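/- Let $\mathbb F$ be a field of characteristic $0$ and let $\mathcal V$ be a unital commutative associative differential superalgebra over $\mathbb F$ with parity $p$ and even derivation $\partial$, finitely generated as a differential algebra (finitely many elements together with all their derivatives generate $\mathcal V$). Let $\Pi\mathcal V$ be $\mathcal V$ with the reversed parity $\bar p=p+\bar 1$. **Spaces.** For $k\ge -1$ let $\tilde W^{\partial}_k(\Pi\mathcal V)$ (resp. $W^{\partial}_k(\Pi\mathcal V)$) be the superspace of linear maps $X:(\Pi\mathcal V)^{\otimes(k+1)}\to \mathbb F[\lambda_0,\dots,\lambda_k]\otimes\Pi\mathcal V$ (resp. to the quotient $\mathbb F_-[\lambda_0,\dots,\lambda_k]\otimes_{\mathbb F[\partial]}\Pi\mathcal V$ of this space by the image of $\lambda_0+\dots+\lambda_k+\partial$) which are sesquilinear, $X_{\lambda_0,\dots,\lambda_k}(\dots,\partial v_i,\dots)=-\lambda_iX_{\lambda_0,\dots,\lambda_k}(\dots,v_i,\dots)$, and symmetric, $X_{\lambda_0,\dots,\lambda_k}(v_0,\dots,v_k)=\epsilon_v(i_0,\dots,i_k)X_{\lambda_{i_0},\dots,\lambda_{i_k}}(v_{i_0},\dots,v_{i_k})$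 for all permutations, where $\epsilon_v$ is the Koszul sign for the parity $\bar p$. Let $\int$ denote the quotient map of values. Put $(\partial X)_{\lambda_0,\dots,\lambda_k}=(\lambda_0+\dots+\lambda_k+\partial)X_{\lambda_0,\dots,\lambda_k}$ on $\tilde W^\partial_k(\Pi\mathcal V)$. For $X$ with $h+1$ arguments and $Y$ with $k-h+1$ arguments let $$(X\Box_{\theta}Y)(v_0,\dots,v_k)=\sum_{\substack{i_0<\dots<i_{k-h}\\ i_{k-h+1}<\dots<i_k}}\epsilon_v(i_0,\dots,i_k)\,X_{\theta,\lambda_{i_{k-h+1}},\dots,\lambda_{i_k}}\big(Y_{\lambda_{i_0},\dots,\lambda_{i_{k-h}}}(v_{i_0},\dots,v_{i_{k-h}}),v_{i_{k-h+1}},\dots,v_{i_k}\big),$$ with $\partial$ moved to the left. This is denoted $X\Box_\lambda Y$ for $\theta=-\lambda-\lambda_{i_{k-h+1}}-\dots-\lambda_{i_k}-\partial$, $X\Box^LY$ for $\theta=-\lambda_{i_{k-h+1}}-\dots-\lambda_{i_k}-\partial$, and $X\Box Y$, also written $X\Box^R Y$, for $\theta=\lambda_{i_0}+\dots+\lambda_{i_{k-h}}$.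 Define * the $\lambda$-bracket of $X,Y\in\tilde W^\partial(\Pi\mathcal V)$: $[X_\lambda Y]=X\Box_\lambda Y-(-1)^{\bar p(X)\bar p(Y)}Y\Box_{-\lambda-\partial}X$, where $-\lambda-\partial$ stands for the substitution of $-\lambda-\lambda_0-\dots-\lambda_k-\partial$ in the values; * the bracket of $X,Y\in W^\partial(\Pi\mathcal V)$: $[X,Y]=X\Box Y-(-1)^{\bar p(X)\bar p(Y)}Y\Box X$; * the action of $X\in W^\partial(\Pi\mathcal V)$ on $\tilde Y\in\tilde W^\partial(\Pi\mathcal V)$: $[X,\tilde Y]=X\Box^L\tilde Y-(-1)^{\bar p(X)\bar p(\tilde Y)}\tilde Y\Box^RX$ (the last two are computed with representatives of the values of elements of $W^\partial(\Pi\mathcal V)$ and do not depend on their choice). Let $\mathrm{RCder}(\mathcal V)\subset\tilde W^\partial_0(\Pi\mathcal V)$ be the space of $X$ with $X_\lambda(uv)=X_{\lambda+\partial}(u)_\to v+(-1)^{p(u)p(v)}X_{\lambda+\partial}(v)_\to u$, where the arrow means that $\partial$ acts on the factor to the right. Let $\tilde W^{\partial,\mathrm{as}}(\Pi\mathcal V)=\bigoplus_{k\ge-1}\tilde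 W^{\partial,\mathrm{as}}_k(\Pi\mathcal V)$ be its full prolongation: $\tilde W^{\partial,\mathrm{as}}_{-1}=\Pi\mathcal V$, $\tilde W^{\partial,\mathrm{as}}_0=\mathrm{RCder}(\mathcal V)$, and for $k\ge1$, $\tilde W^{\partial,\mathrm{as}}_k$ consists of the $X\in\tilde W^\partial_k(\Pi\mathcal V)$ such that all coefficients in $\lambda$ of $[X_\lambda w]$, $w\in\Pi\mathcal V$, lie in $\tilde W^{\partial,\mathrm{as}}_{k-1}$. Let $W^{\partial,\mathrm{as}}(\Pi\mathcal V)=\bigoplus_{k\ge-1}W_k^{\partial,\mathrm{as}}(\Pi\mathcal V)$, where $W_k^{\partial,\mathrm{as}}(\Pi\mathcal V)$ consists of the $X\in W^\partial_k(\Pi\mathcal V)$ satisfying, for all $i$, the Leibniz rule $$X_{\lambda_0,\dots,\lambda_k}(a_0,\dots,b_ic_i,\dots,a_k)=(-1)^{p(c_i)\bar s_i}X_{\dots,\lambda_i+\partial,\dots}(a_0,\dots,b_i,\dots,a_k)_\to c_i+(-1)^{p(b_i)(p(c_i)+\bar s_i)}X_{\dots,\lambda_i+\partial,\dots}(a_0,\dots,c_i,\dots,a_k)_\to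 b_i,$$ with $\bar s_i=\bar p(a_{i+1})+\dots+\bar p(a_k)$. Let $\tilde{\mathcal G}(\mathcal V)=\bigoplus_{k\ge0}\tilde{\mathcal G}_k(\mathcal V)$, $\tilde{\mathcal G}_k(\mathcal V)=\Pi\tilde W^{\partial,\mathrm{as}}_{k-1}(\Pi\mathcal V)$, with parity $p=\bar p+\bar1$, and for $X\in\tilde{\mathcal G}_h(\mathcal V)$, $Y\in\tilde{\mathcal G}_{k-h}(\mathcal V)$ define the concatenation product $$(X\wedge Y)_{\lambda_1,\dots,\lambda_k}(a_1,\dots,a_k)=\sum_{\substack{i_1<\dots<i_h\\ i_{h+1}<\dots<i_k}}\epsilon_a(i_1,\dots,i_k)(-1)^{p(Y)(\bar p(a_{i_1})+\dots+\bar p(a_{i_h}))}X_{\lambda_{i_1},\dots,\lambda_{i_h}}(a_{i_1},\dots,a_{i_h})\,Y_{\lambda_{i_{h+1}},\dots,\lambda_{i_k}}(a_{i_{h+1}},\dots,a_{i_k}).$$ A *Lie conformal superalgebra* is an $\mathbb F[\partial]$-supermodule $R$ ($\partial$ even) with a parity preserving $\lambda$-bracket $R\otimes R\to\mathbb F[\lambda]\otimes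 R$ satisfying $[\partial a_\lambda b]=-\lambda[a_\lambda b]$, $[a_\lambda\partial b]=(\lambda+\partial)[a_\lambda b]$, $[b_\lambda a]=-(-1)^{p(a)p(b)}[a_{-\lambda-\partial}b]$ and $[a_\lambda[b_\mu c]]-(-1)^{p(a)p(b)}[b_\mu[a_\lambda c]]=[[a_\lambda b]_{\lambda+\mu}c]$. An *odd Poisson vertex superalgebra* is a unital commutative associative differential superalgebra $\mathcal P$ with a $\lambda$-bracket making $\Pi\mathcal P$ a Lie conformal superalgebra and satisfying $[a_\lambda bc]=[a_\lambda b]c+(-1)^{(p(a)+\bar1)p(b)}b[a_\lambda c]$. **Proposition.** All the operations above are well defined on $\tilde{\mathcal G}(\mathcal V)$ and $W^{\partial,\mathrm{as}}(\Pi\mathcal V)$ (in particular the $\lambda$-bracket is polynomial in $\lambda$ on $\tilde W^{\partial,\mathrm{as}}(\Pi\mathcal V)$, and $W^{\partial,\mathrm{as}}(\Pi\mathcal V)$ is a Lie superalgebra), and: (a) $\tilde{\mathcal G}(\mathcal V)$, with parity $p$, the derivation $\partial$, the concatenation product $\wedge:\tilde{\mathcal G}_h(\mathcal V)\times\tilde{\mathcal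 G}_{k-h}(\mathcal V)\to\tilde{\mathcal G}_k(\mathcal V)$, and the $\lambda$-bracket on $\Pi\tilde{\mathcal G}(\mathcal V)=\tilde W^{\partial,\mathrm{as}}(\Pi\mathcal V)$ (which maps $\tilde W_h^{\partial,\mathrm{as}}\times\tilde W^{\partial,\mathrm{as}}_{k-h}$ to $\mathbb F[\lambda]\otimes\tilde W_k^{\partial,\mathrm{as}}$), is a $\mathbb Z_+$-graded odd Poisson vertex superalgebra. (b) The formula for $[X,\tilde Y]$ defines a representation of the Lie superalgebra $W^{\partial,\mathrm{as}}(\Pi\mathcal V)$ on $\tilde W^{\partial,\mathrm{as}}(\Pi\mathcal V)$, compatible with parity and grading, commuting with $\partial$, and acting by derivations of both the concatenation product and the $\lambda$-bracket: $[X,\tilde Y\wedge\tilde Z]=[X,\tilde Y]\wedge\tilde Z+(-1)^{\bar p(X)p(\tilde Y)}\tilde Y\wedge[X,\tilde Z]$ and $[X,[\tilde Y_\lambda\tilde Z]]=[[X,\tilde Y]_\lambda\tilde Z]+(-1)^{\bar p(X)\bar p(\tilde Y)}[\tilde Y_\lambda[X,\tilde Z]]$. (c) The map $\int$ restricts to a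 parity and degree preserving map $\int:\tilde W^{\partial,\mathrm{as}}(\Pi\mathcal V)\to W^{\partial,\mathrm{as}}(\Pi\mathcal V)$, which is a homomorphism of representations of $W^{\partial,\mathrm{as}}(\Pi\mathcal V)$, $\int[X,\tilde Y]=[X,\int\tilde Y]$. It induces an injective homomorphism of Lie superalgebras $\tilde W^{\partial,\mathrm{as}}(\Pi\mathcal V)/\partial\tilde W^{\partial,\mathrm{as}}(\Pi\mathcal V)\to W^{\partial,\mathrm{as}}(\Pi\mathcal V)$, where the Lie bracket on the quotient is induced by $[X_\lambda Y]|_{\lambda=0}$. -/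

import Mathlib

open scoped TensorProduct

namespace UniversalPVA

/-! ### Superspaces

A vector superspace is a vector space `U` with a family `𝒰 : ZMod 2 → Submodule F U` such that
`U = 𝒰 0 ⊕ 𝒰 1`; an element of `𝒰 α` has parity `α`. -/

section General

variable (F : Type*) [Field F] {U : Type*} [AddCommGroup U] [Module F U]

/-- The superspace `ΠU`: the same vector space with reversed parity. -/
def parityShift {F : Type*} [Field F] {U : Type*} [AddCommGroup U] [Module F U]
    (𝒰 : ZMod 2 → Submodule F U) : ZMod 2 → Submodule F U :=
  fun α => 𝒰 (α + 1)

/-! ### Polynomials with coefficients in a vector space -/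

/-- `F[λ_s : s ∈ σ] ⊗ U`. -/
abbrev Pol (σ : Type*) (F : Type*) [Field F] (U : Type*) [AddCommGroup U] [Module F U] : Type _ :=
  MvPolynomial σ F ⊗[F] U

variable {F}

/-- The elements of `F[λ] ⊗ U` of parity `γ`, that is, `F[λ] ⊗ 𝒰 γ`. -/
noncomputable def polyPar (σ : Type*) (𝒰 : ZMod 2 → Submodule F U) (γ : ZMod 2) : Submodule F (Pol σ F U) :=
  LinearMap.range (LinearMap.lTensor (MvPolynomial σ F) (𝒰 γ).subtype)

/-- Renaming of the variables, `λ_s ↦ λ_{f s}`. -/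
noncomputable def renameVars {σ τ : Type*} (f : σ → τ) : Pol σ F U →ₗ[F] Pol τ F U :=
  LinearMap.rTensor U (MvPolynomial.rename f).toLinearMap

/-- The `F[λ]`-linear extension `F[λ] ⊗ U → F[λ] ⊗ U'` of a map `U → F[λ] ⊗ U'`. -/
noncomputable def extend {σ : Type*} {U' : Type*} [AddCommGroup U'] [Module F U']
    (f : U →ₗ[F] Pol σ F U') : Pol σ F U →ₗ[F] Pol σ F U' :=
  (LinearMap.liftBaseChange (MvPolynomial σ F) f).restrictScalars F

/-- The action on `F[λ] ⊗ U` of a polynomial in `λ` and `∂`, where `∂` is the variable of the outer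
polynomial ring and acts through the operator `d` on `U`. -/
noncomputable def opAction {σ : Type*} (d : U →ₗ[F] U) (q : Polynomial (MvPolynomial σ F)) :
    Pol σ F U →ₗ[MvPolynomial σ F] Pol σ F U :=
  Polynomial.aeval (R := MvPolynomial σ F)
    (d.baseChange (MvPolynomial σ F) : Module.End (MvPolynomial σ F) (Pol σ F U)) q

/-- Substitution `λ_s ↦ θ_s(λ', ∂)` in a polynomial with coefficients in `U`, with `∂` moved to the
left, i.e. acting on the coefficients. -/
noncomputable def subst {σ τ : Type*} (d : U →ₗ[F] U)
    (θ : σ → Polynomial (MvPolynomial τ F)) : Pol σ F U →ₗ[F] Pol τ F U :=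
  TensorProduct.lift <| LinearMap.mk₂ F
    (fun (p : MvPolynomial σ F) (u : U) =>
      opAction d (MvPolynomial.aeval θ p) ((1 : MvPolynomial τ F) ⊗ₜ[F] u))
    (fun p q u => by simp [opAction])
    (fun c p u => by
      simp only [opAction, map_smul]
      rw [← algebraMap_smul (MvPolynomial τ F) c (MvPolynomial.aeval θ p), map_smul,
        algebraMap_smul]
      rfl)
    (fun p u w => by simp [TensorProduct.tmul_add])
    (fun c p u => by
      rw [TensorProduct.tmul_smul, ← algebraMap_smul (MvPolynomial τ F) c, map_smul,
        algebraMap_smul])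

/-- The variable `λ_t` in the ring of polynomials in `λ` and `∂`. -/
noncomputable def lam {τ : Type*} (t : τ) : Polynomial (MvPolynomial τ F) :=
  Polynomial.C (MvPolynomial.X t)

/-- The variable `∂` in the ring of polynomials in `λ` and `∂`. -/
noncomputable def del {τ : Type*} : Polynomial (MvPolynomial τ F) := Polynomial.X

/-- The operator `λ_0 + ⋯ + λ_k + ∂` on `F[λ_0, …, λ_k] ⊗ U`. -/
noncomputable def totalD {σ : Type*} [Fintype σ] (d : U →ₗ[F] U) :
    Pol σ F U →ₗ[MvPolynomial σ F] Pol σ F U :=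
  opAction d ((∑ s, lam s) + del)

/-- `F₋[λ_0, …, λ_k] ⊗_{F[∂]} U`, i.e. the quotient of `F[λ_0, …, λ_k] ⊗ U` by the image of
`λ_0 + ⋯ + λ_k + ∂`. -/
abbrev PolyQ (m : ℕ) (d : U →ₗ[F] U) : Type _ :=
  Pol (Fin m) F U ⧸ LinearMap.range (totalD (σ := Fin m) d)

/-- The quotient map `∫ : F[λ_0, …, λ_k] ⊗ U → F₋[λ_0, …, λ_k] ⊗_{F[∂]} U`. -/
noncomputable def toQ {m : ℕ} (d : U →ₗ[F] U) : Pol (Fin m) F U →ₗ[F] PolyQ m d :=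
  (LinearMap.range (totalD (σ := Fin m) d)).mkQ.restrictScalars F

/-! ### Signs -/

/-- `ε_v(i_0, …, i_k)` for the permutation `i` and vectors `v_j` of parity `β j`: each interchange
of the indices of two odd vectors contributes `-1`. -/
def permSign {m : ℕ} (β : Fin m → ZMod 2) (i : Equiv.Perm (Fin m)) : ℤˣ :=
  ∏ a, ∏ b, if a < b ∧ i b < i a then (-1 : ℤˣ) ^ (β (i a) * β (i b)) else 1

/-- `ε_v` for the shuffle listing first the elements of `S` and then those of the complement of
`S`, both in increasing order. -/
def shuffleSign {m : ℕ} (β : Fin m → ZMod 2) (S : Finset (Fin m)) : ℤˣ :=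
  ∏ s ∈ S, ∏ t ∈ Sᶜ, if t < s then (-1 : ℤˣ) ^ (β s * β t) else 1

/-- The increasing enumeration of `S`. -/
def pick {m : ℕ} (S : Finset (Fin m)) : Fin S.card → Fin m :=
  S.orderEmbOfFin rfl

/-! ### The spaces of the universal Lie conformal superalgebra and of the Lie superalgebra

Everything is indexed by the number `m = k + 1` of arguments. -/

variable (F U) in
/-- Multilinear maps `U^m → F[λ_0, …, λ_{m-1}] ⊗ U`. -/
abbrev Cochain (m : ℕ) : Type _ := MultilinearMap F (fun _ : Fin m => U) (Pol (Fin m) F U)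

noncomputable instance {m : ℕ} (R : Submodule F (Cochain F U m)) : AddCommGroup R :=
  Module.addCommMonoidToAddCommGroup F

/-- Multilinear maps `U^m → F₋[λ_0, …, λ_{m-1}] ⊗_{F[∂]} U`. -/
abbrev CochainQ (m : ℕ) (d : U →ₗ[F] U) : Type _ :=
  MultilinearMap F (fun _ : Fin m => U) (PolyQ m d)

noncomputable instance {m : ℕ} {d : U →ₗ[F] U} (R : Submodule F (CochainQ m d)) :
    AddCommGroup R :=
  Module.addCommMonoidToAddCommGroup F

/-- `W̃^∂_{m-1}(U)`: the sesquilinear and (super)symmetric maps. -/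
noncomputable def Wt (d : U →ₗ[F] U) (𝒰 : ZMod 2 → Submodule F U) (m : ℕ) :
    Submodule F (Cochain F U m) where
  carrier := {X |
    (∀ (v : Fin m → U) (i : Fin m),
      X (Function.update v i (d (v i))) = -((MvPolynomial.X i : MvPolynomial (Fin m) F) • X v)) ∧
    (∀ (i : Equiv.Perm (Fin m)) (β : Fin m → ZMod 2) (v : Fin m → U), (∀ j, v j ∈ 𝒰 (β j)) →
      X v = permSign β i • renameVars i (X (v ∘ i)))}
  add_mem' := by
    rintro X Y ⟨hX, hX'⟩ ⟨hY, hY'⟩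
    refine ⟨fun v i => ?_, fun i β v hv => ?_⟩
    · simp only [add_apply, hX v i, hY v i, smul_add, neg_add]
    · simp only [add_apply, map_add, smul_add, ← hX' i β v hv, ← hY' i β v hv]
  zero_mem' := by
    refine ⟨fun v i => ?_, fun i β v hv => ?_⟩ <;> simp
  smul_mem' := by
    rintro c X ⟨hX, hX'⟩
    refine ⟨fun v i => ?_, fun i β v hv => ?_⟩
    · simp only [smul_apply, hX v i, smul_neg, smul_comm c]
    · simp only [smul_apply, map_smul, smul_comm _ c, ← hX' i β v hv]

/-- `W^∂_{m-1}(U)`: the sesquilinear and (super)symmetric maps. In the symmetry condition `P` is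
a representative of `X(v_{i_0}, …, v_{i_k})`; the condition does not depend on its choice. -/
noncomputable def WQ (d : U →ₗ[F] U) (𝒰 : ZMod 2 → Submodule F U) (m : ℕ) :
    Submodule F (CochainQ m d) where
  carrier := {X |
    (∀ (v : Fin m → U) (i : Fin m),
      X (Function.update v i (d (v i))) = -((MvPolynomial.X i : MvPolynomial (Fin m) F) • X v)) ∧
    (∀ (i : Equiv.Perm (Fin m)) (β : Fin m → ZMod 2) (v : Fin m → U), (∀ j, v j ∈ 𝒰 (β j)) →
      ∃ P : Pol (Fin m) F U, toQ d P = X (v ∘ i) ∧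
        X v = toQ d (permSign β i • renameVars i P))}
  add_mem' := by
    rintro X Y ⟨hX, hX'⟩ ⟨hY, hY'⟩
    refine ⟨fun v i => ?_, fun i β v hv => ?_⟩
    · simp only [add_apply, hX v i, hY v i, smul_add, neg_add]
    · obtain ⟨P, hP, hP'⟩ := hX' i β v hv
      obtain ⟨Q, hQ, hQ'⟩ := hY' i β v hv
      exact ⟨P + Q, by simp [hP, hQ], by simp [hP', hQ']⟩
  zero_mem' := by
    refine ⟨fun v i => by simp, fun i β v hv => ⟨0, by simp, by simp⟩⟩
  smul_mem' := by
    rintro c X ⟨hX, hX'⟩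
    refine ⟨fun v i => ?_, fun i β v hv => ?_⟩
    · simp only [smul_apply, hX v i, smul_neg, smul_comm c]
    · obtain ⟨P, hP, hP'⟩ := hX' i β v hv
      refine ⟨c • P, by simp [hP], ?_⟩
      simp only [smul_apply, hP', map_smul, smul_comm _ c]

/-- The maps of parity `α`. -/
noncomputable def Cochain.par (𝒰 : ZMod 2 → Submodule F U) (m : ℕ) (α : ZMod 2) :
    Submodule F (Cochain F U m) where
  carrier := {X | ∀ (β : Fin m → ZMod 2) (v : Fin m → U), (∀ j, v j ∈ 𝒰 (β j)) →
    X v ∈ polyPar (Fin m) 𝒰 (α + ∑ j, β j)}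
  add_mem' hX hY := fun β v hv => add_mem (hX β v hv) (hY β v hv)
  zero_mem' := fun _ _ _ => zero_mem _
  smul_mem' c _ hX := fun β v hv => Submodule.smul_mem _ c (hX β v hv)

/-- The maps of parity `α`. -/
noncomputable def CochainQ.par (d : U →ₗ[F] U) (𝒰 : ZMod 2 → Submodule F U) (m : ℕ) (α : ZMod 2) :
    Submodule F (CochainQ m d) where
  carrier := {X | ∀ (β : Fin m → ZMod 2) (v : Fin m → U), (∀ j, v j ∈ 𝒰 (β j)) →
    X v ∈ (polyPar (Fin m) 𝒰 (α + ∑ j, β j)).map (toQ d)}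
  add_mem' hX hY := fun β v hv => add_mem (hX β v hv) (hY β v hv)
  zero_mem' := fun _ _ _ => zero_mem _
  smul_mem' c _ hX := fun β v hv => Submodule.smul_mem _ c (hX β v hv)

/-! ### Box products -/

/-- The linear map `w ↦ X(w, v_1, …, v_n)`. -/
noncomputable def plugFirst {n : ℕ} (X : Cochain F U (n + 1)) (v : Fin n → U) :
    U →ₗ[F] Pol (Fin (n + 1)) F U where
  toFun w := X (Fin.cons w v)
  map_add' := X.cons_add v
  map_smul' c w := X.cons_smul v c w

/-- The common form of the box products: for `v_j` of parity `β j`,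
`∑ ε_v(i_0, …, i_k) X_{θ, λ_{i_{k-h+1}}, …, λ_{i_k}}
  (Y_{λ_{i_0}, …, λ_{i_{k-h}}}(v_{i_0}, …, v_{i_{k-h}}), v_{i_{k-h+1}}, …, v_{i_k})`
over all shuffles `i_0 < ⋯ < i_{k-h}`, `i_{k-h+1} < ⋯ < i_k`. Here `S = {i_0, …, i_{k-h}}`, the
variable `λ_j` is called `ν j`, and `θ = first S` is the polynomial in `λ` and `∂` to be
substituted for the first variable of `X` (with `∂` moved to the left). The arguments `X`, `Y` are
families with one component for each number of arguments. -/
noncomputable def boxSum (d : U →ₗ[F] U) {m : ℕ} {τ : Type*} (ν : Fin m → τ)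
    (first : Finset (Fin m) → Polynomial (MvPolynomial τ F)) (X Y : ∀ n, Cochain F U n)
    (β : Fin m → ZMod 2) (v : Fin m → U) : Pol τ F U :=
  ∑ S : Finset (Fin m), shuffleSign β S •
    extend
      (subst d (Fin.cons (first S) fun j => lam (ν (pick Sᶜ j))) ∘ₗ
        plugFirst (X (Sᶜ.card + 1)) (v ∘ pick Sᶜ))
      (renameVars (ν ∘ pick S) (Y S.card (v ∘ pick S)))

/-- `(X □_λ Y)_{λ_0, …, λ_k}(v_0, …, v_k)`, with `λ` the variable `none`: the first variable of
`X` becomes `-λ - λ_{i_{k-h+1}} - ⋯ - λ_{i_k} - ∂`. -/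
noncomputable def boxLambda (d : U →ₗ[F] U) {m : ℕ} (X Y : ∀ n, Cochain F U n)
    (β : Fin m → ZMod 2) (v : Fin m → U) : Pol (Option (Fin m)) F U :=
  boxSum d some (fun S => -lam none - (∑ j ∈ Sᶜ, lam (some j)) - del) X Y β v

/-- `[X_λ Y]_{λ_0, …, λ_k}(v_0, …, v_k)` for `X`, `Y` of parities `a`, `b` and `v_j` of parity
`β j`. -/
noncomputable def lambdaBracket (d : U →ₗ[F] U) {m : ℕ} (a b : ZMod 2) (X Y : ∀ n, Cochain F U n)
    (β : Fin m → ZMod 2) (v : Fin m → U) : Pol (Option (Fin m)) F U :=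
  boxLambda d X Y β v - (-1 : ℤˣ) ^ (a * b) •
    subst d
      (fun t : Option (Fin m) =>
        t.elim (-lam none - (∑ j, lam (some j)) - del) (fun j => lam (some j)))
      (boxLambda d Y X β v)

/-- `(X □^L Y)_{λ_0, …, λ_k}(v_0, …, v_k)`: the first variable of `X` becomes
`-λ_{i_{k-h+1}} - ⋯ - λ_{i_k} - ∂`. -/
noncomputable def boxLeft (d : U →ₗ[F] U) {m : ℕ} (X Y : ∀ n, Cochain F U n)
    (β : Fin m → ZMod 2) (v : Fin m → U) : Pol (Fin m) F U :=
  boxSum d id (fun S => -(∑ j ∈ Sᶜ, lam j) - del) X Y β v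

/-- `(X □ Y)_{λ_0, …, λ_k}(v_0, …, v_k)`: the first variable of `X` becomes
`λ_{i_0} + ⋯ + λ_{i_{k-h}}`. -/
noncomputable def boxPlain (d : U →ₗ[F] U) {m : ℕ} (X Y : ∀ n, Cochain F U n)
    (β : Fin m → ZMod 2) (v : Fin m → U) : Pol (Fin m) F U :=
  boxSum d id (fun S => ∑ j ∈ S, lam j) X Y β v

/-! ### Full prolongations -/

/-- `[X_λ w]_{λ_1, …, λ_k}(v_1, …, v_k) = X_{-λ-λ_1-⋯-λ_k-∂, λ_1, …, λ_k}(w, v_1, …, v_k)`, the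
`λ`-bracket of `X` with an element `w` of `U = W̃^∂_{-1}(U)`. -/
noncomputable def bracketVec (d : U →ₗ[F] U) {n : ℕ} (w : U) (v : Fin n → U) :
    Cochain F U (n + 1) →ₗ[F] Pol (Option (Fin n)) F U where
  toFun X := subst d
    (Fin.cons (-lam none - (∑ j, lam (some j)) - del) fun j => lam (some j)) (X (Fin.cons w v))
  map_add' X Y := by simp
  map_smul' c X := by simp

/-- The coefficient of `λ^r` (with `λ` the variable `none`). -/
noncomputable def lambdaCoeff {n : ℕ} (r : ℕ) :
    Pol (Option (Fin n)) F U →ₗ[F] Pol (Fin n) F U :=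
  LinearMap.rTensor U
    (((Polynomial.lcoeff (MvPolynomial (Fin n) F) r).restrictScalars F) ∘ₗ
      (MvPolynomial.optionEquivLeft F (Fin n)).toLinearMap)

/-- `{X ∈ W̃^∂_n(U) | [X_λ U] ⊆ F[[λ]] ⊗ R}` for a subspace `R` of `W̃^∂_{n-1}(U)`. -/
noncomputable def prolong (d : U →ₗ[F] U) (𝒰 : ZMod 2 → Submodule F U) {n : ℕ}
    (R : Submodule F (Cochain F U n)) : Submodule F (Cochain F U (n + 1)) where
  carrier := {X | X ∈ Wt d 𝒰 (n + 1) ∧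
    ∀ (w : U) (r : ℕ), ∃ Z ∈ R, ∀ v, Z v = lambdaCoeff r (bracketVec d w v X)}
  add_mem' := by
    rintro X Y ⟨hX, hX'⟩ ⟨hY, hY'⟩
    refine ⟨add_mem hX hY, fun w r => ?_⟩
    obtain ⟨Z, hZ, hZ'⟩ := hX' w r
    obtain ⟨Z₁, hZ₁, hZ₁'⟩ := hY' w r
    exact ⟨Z + Z₁, add_mem hZ hZ₁, fun v => by simp [hZ', hZ₁']⟩
  zero_mem' := ⟨zero_mem _, fun w r => ⟨0, zero_mem _, fun v => by simp⟩⟩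
  smul_mem' := by
    rintro c X ⟨hX, hX'⟩
    refine ⟨Submodule.smul_mem _ c hX, fun w r => ?_⟩
    obtain ⟨Z, hZ, hZ'⟩ := hX' w r
    exact ⟨c • Z, Submodule.smul_mem _ c hZ, fun v => by simp [hZ']⟩

/-- The full prolongation of `R₀ ⊆ W̃^∂_0(U)`, indexed by the number of arguments. -/
noncomputable def fullProlongation (d : U →ₗ[F] U) (𝒰 : ZMod 2 → Submodule F U)
    (R₀ : Submodule F (Cochain F U 1)) : ∀ m, Submodule F (Cochain F U m)
  | 0 => Wt d 𝒰 0
  | 1 => R₀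
  | m + 2 => prolong d 𝒰 (fullProlongation d 𝒰 R₀ (m + 1))

/-! ### Abstract structures -/

/-- A Lie superalgebra structure on the superspace `L = par 0 ⊕ par 1`. -/
structure IsLieSuperalgebra {L : Type*} [AddCommGroup L] [Module F L]
    (par : ZMod 2 → Submodule F L) (br : L →ₗ[F] L →ₗ[F] L) : Prop where
  isInternal : DirectSum.IsInternal par
  mem : ∀ {α β a b}, a ∈ par α → b ∈ par β → br a b ∈ par (α + β)
  skew : ∀ {α β a b}, a ∈ par α → b ∈ par β → br b a = -((-1 : ℤˣ) ^ (α * β) • br a b)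
  jacobi : ∀ {α β γ a b c}, a ∈ par α → b ∈ par β → c ∈ par γ →
    br a (br b c) - (-1 : ℤˣ) ^ (α * β) • br b (br a c) = br (br a b) c

/-- A Lie conformal superalgebra structure on the `F[∂]`-module `R` with `∂ = D`, with
`λ`-bracket `br a b = [a_λ b] ∈ F[λ] ⊗ R`. In the Jacobi identity, an equality in
`F[λ, μ] ⊗ R`, `λ` and `μ` are the variables `0` and `1`. -/
structure IsLieConformalSuperalgebra {R : Type*} [AddCommGroup R] [Module F R]
    (par : ZMod 2 → Submodule F R) (D : R →ₗ[F] R) (br : R →ₗ[F] R →ₗ[F] Pol (Fin 1) F R) :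
    Prop where
  isInternal : DirectSum.IsInternal par
  D_mem : ∀ {α a}, a ∈ par α → D a ∈ par α
  mem : ∀ {α β a b}, a ∈ par α → b ∈ par β → br a b ∈ polyPar (Fin 1) par (α + β)
  sesq_left : ∀ a b, br (D a) b = -((MvPolynomial.X 0 : MvPolynomial (Fin 1) F) • br a b)
  sesq_right : ∀ a b, br a (D b) = opAction D (lam 0 + del) (br a b)
  skew : ∀ {α β a b}, a ∈ par α → b ∈ par β →
    br b a = -((-1 : ℤˣ) ^ (α * β) • subst D (fun _ => -lam 0 - del) (br a b))
  jacobi : ∀ {α β γ a b c}, a ∈ par α → b ∈ par β → c ∈ par γ →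
    extend (subst D (fun _ => lam (0 : Fin 2)) ∘ₗ br a)
        (subst D (fun _ => lam (1 : Fin 2)) (br b c)) -
      (-1 : ℤˣ) ^ (α * β) •
        extend (subst D (fun _ => lam (1 : Fin 2)) ∘ₗ br b)
          (subst D (fun _ => lam (0 : Fin 2)) (br a c)) =
    extend (subst D (fun _ => lam (0 : Fin 2) + lam 1) ∘ₗ br.flip c)
      (subst D (fun _ => lam (0 : Fin 2)) (br a b))

/-- An odd Poisson vertex superalgebra structure on the superspace `P` with parity `par`: a unital
commutative associative differential superalgebra with product `mul` and derivation `D`, and a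
`λ`-bracket making `ΠP` a Lie conformal superalgebra and satisfying the odd Leibniz rule. -/
structure IsOddPVA {P : Type*} [AddCommGroup P] [Module F P]
    (par : ZMod 2 → Submodule F P) (D : P →ₗ[F] P) (mul : P →ₗ[F] P →ₗ[F] P)
    (br : P →ₗ[F] P →ₗ[F] Pol (Fin 1) F P) : Prop where
  isInternal : DirectSum.IsInternal par
  mul_mem : ∀ {α β a b}, a ∈ par α → b ∈ par β → mul a b ∈ par (α + β)
  mul_comm : ∀ {α β a b}, a ∈ par α → b ∈ par β → mul b a = (-1 : ℤˣ) ^ (α * β) • mul a b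
  mul_assoc : ∀ a b c, mul (mul a b) c = mul a (mul b c)
  unital : ∃ e ∈ par 0, ∀ a, mul e a = a ∧ mul a e = a
  D_mem : ∀ {α a}, a ∈ par α → D a ∈ par α
  D_mul : ∀ a b, D (mul a b) = mul (D a) b + mul a (D b)
  lieConformal : IsLieConformalSuperalgebra (parityShift par) D br
  leibniz : ∀ {α β a b}, a ∈ par α → b ∈ par β → ∀ c,
    br a (mul b c) = extend (TensorProduct.mk F _ P 1 ∘ₗ mul.flip c) (br a b) +
      (-1 : ℤˣ) ^ ((α + 1) * β) • extend (TensorProduct.mk F _ P 1 ∘ₗ mul b) (br a c)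

/-- The compatibility of an odd Poisson vertex superalgebra structure with a `ℤ₊`-grading of the
superspace: `∂` has degree `0`, the product has degree `0`, and the `λ`-bracket has degree `-1`
(i.e. it has degree `0` when the degree of `Π(deg k)` is taken to be `k - 1`). -/
structure IsZPlusGraded {P : Type*} [AddCommGroup P] [Module F P]
    (par : ZMod 2 → Submodule F P) (deg : ℕ → Submodule F P) (D : P →ₗ[F] P)
    (mul : P →ₗ[F] P →ₗ[F] P) (br : P →ₗ[F] P →ₗ[F] Pol (Fin 1) F P) : Prop where
  isInternal : DirectSum.IsInternal deg
  isInternal_par : DirectSum.IsInternal fun i : ℕ × ZMod 2 => deg i.1 ⊓ par i.2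
  D_mem : ∀ {k a}, a ∈ deg k → D a ∈ deg k
  mul_mem : ∀ {k l a b}, a ∈ deg k → b ∈ deg l → mul a b ∈ deg (k + l)
  br_mem : ∀ {k l n a b}, k + l = n + 1 → a ∈ deg k → b ∈ deg l →
    br a b ∈ LinearMap.range (LinearMap.lTensor (MvPolynomial (Fin 1) F) (deg n).subtype)
  br_zero : ∀ {a b}, a ∈ deg 0 → b ∈ deg 0 → br a b = 0

/-- The value at `λ = 0` of an element of `F[λ] ⊗ U`. -/
noncomputable def atZero : Pol (Fin 1) F U →ₗ[F] U :=
  (TensorProduct.lid F U).toLinearMap ∘ₗ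
    LinearMap.rTensor U (MvPolynomial.aeval fun _ : Fin 1 => (0 : F)).toLinearMap

end General

/-! ### The case of a differential superalgebra -/

section Differential

variable {F : Type*} [Field F] {V : Type*} [Ring V] [Algebra F V]

/-- The axioms of a commutative associative differential superalgebra, on top of those of a
`ℤ/2`-graded unital associative algebra: supercommutativity, and `d` is an even derivation. -/
structure IsDifferentialSuperalgebra (𝒱 : ZMod 2 → Submodule F V) (d : V →ₗ[F] V) : Prop where
  comm : ∀ {α β a b}, a ∈ 𝒱 α → b ∈ 𝒱 β → b * a = (-1 : ℤˣ) ^ (α * β) • (a * b)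
  d_mem : ∀ {α a}, a ∈ 𝒱 α → d a ∈ 𝒱 α
  d_mul : ∀ a b, d (a * b) = d a * b + a * d b

/-- Finite generation as a differential algebra: finitely many elements generate the algebra
together with all their derivatives. -/
def IsFinitelyGenerated (d : V →ₗ[F] V) : Prop :=
  ∃ s : Finset V, Algebra.adjoin F {a : V | ∃ g ∈ s, ∃ n : ℕ, a = (d ^ n) g} = ⊤

/-- `P_{…, λ_i + ∂, …}(⋯)_→ c` for `P = P_{λ_0, …}(⋯) ∈ F[λ_0, …] ⊗ V`: in `∑ λ^n ⊗ x_n`, the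
monomial `λ^n` becomes `λ_0^{n_0} ⋯ (λ_i + ∂)^{n_i} ⋯`, with `∂` acting on `c` only, and the result
is multiplied by `x_n` on the left. -/
noncomputable def arrow (d : V →ₗ[F] V) {m : ℕ} (i : Fin m) (c : V) :
    Pol (Fin m) F V →ₗ[F] Pol (Fin m) F V :=
  TensorProduct.lift <| LinearMap.mk₂ F
    (fun (p : MvPolynomial (Fin m) F) (x : V) =>
      (LinearMap.mulLeft F x).lTensor (MvPolynomial (Fin m) F)
        (subst d (fun j => if j = i then lam j + del else lam j) (p ⊗ₜ[F] c)))
    (fun p q x => by simp [TensorProduct.add_tmul])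
    (fun r p x => by simp only [← TensorProduct.smul_tmul', map_smul])
    (fun p x y => by
      rw [show LinearMap.mulLeft F (x + y) = LinearMap.mulLeft F x + LinearMap.mulLeft F y from
        (LinearMap.mul F V).map_add x y, LinearMap.lTensor_add, LinearMap.add_apply])
    (fun r p x => by
      rw [show LinearMap.mulLeft F (r • x) = r • LinearMap.mulLeft F x from
        (LinearMap.mul F V).map_smul r x, LinearMap.lTensor_smul, LinearMap.smul_apply])

/-- The right conformal derivations of `V`, as a subspace of `RCend(V) = W̃^∂_0(ΠV)`. -/
noncomputable def RCder (𝒱 : ZMod 2 → Submodule F V) (d : V →ₗ[F] V) :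
    Submodule F (Cochain F V 1) where
  carrier := {X | X ∈ Wt d (parityShift 𝒱) 1 ∧
    ∀ (γ δ : ZMod 2) (b c : V), b ∈ 𝒱 γ → c ∈ 𝒱 δ →
      X ![b * c] = arrow d 0 c (X ![b]) + (-1 : ℤˣ) ^ (γ * δ) • arrow d 0 b (X ![c])}
  add_mem' := by
    rintro X Y ⟨hX, hX'⟩ ⟨hY, hY'⟩
    refine ⟨add_mem hX hY, fun γ δ b c hb hc => ?_⟩
    simp only [add_apply, hX' γ δ b c hb hc, hY' γ δ b c hb hc, map_add, smul_add]
    abel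
  zero_mem' := ⟨zero_mem _, fun γ δ b c hb hc => by simp⟩
  smul_mem' := by
    rintro r X ⟨hX, hX'⟩
    refine ⟨Submodule.smul_mem _ r hX, fun γ δ b c hb hc => ?_⟩
    simp only [smul_apply, hX' γ δ b c hb hc, map_smul, smul_add, smul_comm r]

/-- `W̃^{∂,as}_{m-1}(ΠV)`: the full prolongation of `RCder(V)` in `W̃^∂(ΠV)`. -/
noncomputable def WtAs (𝒱 : ZMod 2 → Submodule F V) (d : V →ₗ[F] V) (m : ℕ) :
    Submodule F (Cochain F V m) :=
  fullProlongation d (parityShift 𝒱) (RCder 𝒱 d) m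

/-- `W^{∂,as}_{m-1}(ΠV)`: the elements of `W^∂_{m-1}(ΠV)` satisfying the Leibniz rule in each
argument. Here `β j` is the parity of `a_j` in `ΠV`, and `P`, `Q` are representatives of
`X(a_0, …, b, …, a_k)` and `X(a_0, …, c, …, a_k)`; the condition does not depend on their
choice. -/
noncomputable def WQAs (𝒱 : ZMod 2 → Submodule F V) (d : V →ₗ[F] V) (m : ℕ) :
    Submodule F (CochainQ m d) where
  carrier := {X | X ∈ WQ d (parityShift 𝒱) m ∧
    ∀ (i : Fin m) (β : Fin m → ZMod 2) (a : Fin m → V), (∀ j, a j ∈ parityShift 𝒱 (β j)) →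
      ∀ (γ δ : ZMod 2) (b c : V), b ∈ 𝒱 γ → c ∈ 𝒱 δ →
        ∃ P Q : Pol (Fin m) F V,
          toQ d P = X (Function.update a i b) ∧ toQ d Q = X (Function.update a i c) ∧
          X (Function.update a i (b * c)) =
            toQ d ((-1 : ℤˣ) ^ (δ * ∑ j ∈ Finset.Ioi i, β j) • arrow d i c P +
              (-1 : ℤˣ) ^ (γ * (δ + ∑ j ∈ Finset.Ioi i, β j)) • arrow d i b Q)}
  add_mem' := by
    rintro X Y ⟨hX, hX'⟩ ⟨hY, hY'⟩
    refine ⟨add_mem hX hY, fun i β a ha γ δ b c hb hc => ?_⟩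
    obtain ⟨P, Q, hP, hQ, h⟩ := hX' i β a ha γ δ b c hb hc
    obtain ⟨P', Q', hP', hQ', h'⟩ := hY' i β a ha γ δ b c hb hc
    refine ⟨P + P', Q + Q', by simp [hP, hP'], by simp [hQ, hQ'], ?_⟩
    simp only [add_apply, h, h']
    rw [← map_add, map_add (arrow d i c), map_add (arrow d i b), smul_add, smul_add,
      add_add_add_comm]
  zero_mem' := ⟨zero_mem _, fun i β a ha γ δ b c hb hc => ⟨0, 0, by simp, by simp, by simp⟩⟩
  smul_mem' := by
    rintro r X ⟨hX, hX'⟩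
    refine ⟨Submodule.smul_mem _ r hX, fun i β a ha γ δ b c hb hc => ?_⟩
    obtain ⟨P, Q, hP, hQ, h⟩ := hX' i β a ha γ δ b c hb hc
    refine ⟨r • P, r • Q, by simp [hP], by simp [hQ], ?_⟩
    simp only [smul_apply, h, ← map_smul, smul_add, smul_comm r]

/-- The space `W̃^{∂,as}(ΠV) = ⨁ₖ W̃^{∂,as}_{k-1}(ΠV)`, which is also the space
`G(V) = ⨁ₖ G_k(V)`, `G_k(V) = Π W̃^{∂,as}_{k-1}(ΠV)`. -/
abbrev G (𝒱 : ZMod 2 → Submodule F V) (d : V →ₗ[F] V) : Type _ :=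
  DirectSum ℕ fun m => WtAs 𝒱 d m

/-- The space `W^{∂,as}(ΠV) = ⨁ₖ W^{∂,as}_{k-1}(ΠV)`. -/
abbrev W (𝒱 : ZMod 2 → Submodule F V) (d : V →ₗ[F] V) : Type _ :=
  DirectSum ℕ fun m => WQAs 𝒱 d m

variable {𝒱 : ZMod 2 → Submodule F V} {d : V →ₗ[F] V}

/-- The components of an element of `W̃^{∂,as}(ΠV)`. -/
noncomputable def G.comp (X : G 𝒱 d) (m : ℕ) : Cochain F V m := (X m : Cochain F V m)

/-- The components of an element of `W^{∂,as}(ΠV)`. -/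
noncomputable def W.comp (X : W 𝒱 d) (m : ℕ) : CochainQ m d := (X m : CochainQ m d)

variable (𝒱 d)

/-- The parity `p̄` of `W̃^{∂,as}(ΠV)`. -/
noncomputable def G.barPar (α : ZMod 2) : Submodule F (G 𝒱 d) where
  carrier := {X | ∀ m, X.comp m ∈ Cochain.par (parityShift 𝒱) m α}
  add_mem' hX hY m := add_mem (hX m) (hY m)
  zero_mem' _ := zero_mem _
  smul_mem' c _ hX m := Submodule.smul_mem _ c (hX m)

/-- The parity `p` of `G(V) = Π W̃^{∂,as}(ΠV)`. -/
noncomputable def G.par : ZMod 2 → Submodule F (G 𝒱 d) := parityShift (G.barPar 𝒱 d)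

/-- The component `G_k(V)`. -/
noncomputable def G.deg (k : ℕ) : Submodule F (G 𝒱 d) :=
  LinearMap.range (DirectSum.lof F ℕ (fun m => WtAs 𝒱 d m) k)

/-- The parity `p̄` of `W^{∂,as}(ΠV)`. -/
noncomputable def W.par (α : ZMod 2) : Submodule F (W 𝒱 d) where
  carrier := {X | ∀ m, X.comp m ∈ CochainQ.par d (parityShift 𝒱) m α}
  add_mem' hX hY m := add_mem (hX m) (hY m)
  zero_mem' _ := zero_mem _
  smul_mem' c _ hX m := Submodule.smul_mem _ c (hX m)

/-- The component `W^{∂,as}_{k-1}(ΠV)`. -/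
noncomputable def W.deg (k : ℕ) : Submodule F (W 𝒱 d) :=
  LinearMap.range (DirectSum.lof F ℕ (fun m => WQAs 𝒱 d m) k)

variable {𝒱 d}

/-- The linear map `Z ↦ Z_{λ_0, …}(v_0, …)`. -/
noncomputable def G.value {m : ℕ} (v : Fin m → V) : G 𝒱 d →ₗ[F] Pol (Fin m) F V where
  toFun Z := Z.comp m v
  map_add' _ _ := rfl
  map_smul' _ _ := rfl

/-- The value `z_{λ_0, …}(v_0, …) ∈ F[λ, λ_0, …] ⊗ V` of an element `z ∈ F[λ] ⊗ W̃^{∂,as}(ΠV)`;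
the variable `λ` is called `none` in the value. -/
noncomputable def G.polyValue {m : ℕ} (v : Fin m → V) (z : Pol (Fin 1) F (G 𝒱 d)) :
    Pol (Option (Fin m)) F V :=
  extend (renameVars some ∘ₗ G.value v) (renameVars (fun _ => none) z)

/-! ### The operations on `G(V)` and `W^{∂,as}(ΠV)`

The following predicates say that a given operation is the one defined by the respective
formula. By bilinearity it suffices to describe them on homogeneous elements. -/

/-- `(∂X)_{λ_0, …, λ_k}(v_0, …, v_k) = (λ_0 + ⋯ + λ_k + ∂) X_{λ_0, …, λ_k}(v_0, …, v_k)`. -/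
def IsTranslation (D : G 𝒱 d →ₗ[F] G 𝒱 d) : Prop :=
  ∀ (X : G 𝒱 d) (m : ℕ) (v : Fin m → V), (D X).comp m v = totalD d (X.comp m v)

/-- Multiplication `(F[λ] ⊗ V) × (F[λ] ⊗ V) → F[λ] ⊗ V` of polynomials with coefficients in `V`. -/
noncomputable def polyMul {σ : Type*} (P Q : Pol σ F V) : Pol σ F V := P * Q

/-- `mul` is the concatenation product: for `Y` of parity `p(Y) = b` and `a_j ∈ ΠV` of parity
`p̄(a_j) = β j`,
`(X ∧ Y)(a_1, …, a_k) = ∑ ε_a(i_1, …, i_k) (-1)^{p(Y)(p̄(a_{i_1}) + ⋯ + p̄(a_{i_h}))}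
  X_{λ_{i_1}, …, λ_{i_h}}(a_{i_1}, …, a_{i_h}) Y_{λ_{i_{h+1}}, …}(a_{i_{h+1}}, …, a_{i_k})`,
the sum being over the subsets `S = {i_1 < ⋯ < i_h}`. -/
def IsConcatenation (mul : G 𝒱 d →ₗ[F] G 𝒱 d →ₗ[F] G 𝒱 d) : Prop :=
  ∀ (b : ZMod 2) (X Y : G 𝒱 d), Y ∈ G.par 𝒱 d b →
    ∀ (m : ℕ) (β : Fin m → ZMod 2) (a : Fin m → V), (∀ j, a j ∈ parityShift 𝒱 (β j)) →
      (mul X Y).comp m a = ∑ S : Finset (Fin m),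
        (shuffleSign β S * (-1 : ℤˣ) ^ (b * ∑ j ∈ S, β j)) •
          polyMul (renameVars (pick S) (X.comp S.card (a ∘ pick S)))
            (renameVars (pick Sᶜ) (Y.comp Sᶜ.card (a ∘ pick Sᶜ)))

/-- `br` is the `λ`-bracket of the (generalized) Lie conformal superalgebra `W̃^∂(ΠV)`. -/
def IsLambdaBracket (br : G 𝒱 d →ₗ[F] G 𝒱 d →ₗ[F] Pol (Fin 1) F (G 𝒱 d)) : Prop :=
  ∀ (a b : ZMod 2) (X Y : G 𝒱 d), X ∈ G.barPar 𝒱 d a → Y ∈ G.barPar 𝒱 d b →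
    ∀ (m : ℕ) (β : Fin m → ZMod 2) (v : Fin m → V), (∀ j, v j ∈ parityShift 𝒱 (β j)) →
      G.polyValue v (br X Y) = lambdaBracket d a b X.comp Y.comp β v

/-- `X'` is a family of representatives of the values of `X`. -/
def IsLift (X : W 𝒱 d) (X' : ∀ m, Cochain F V m) : Prop :=
  ∀ (m : ℕ) (v : Fin m → V), toQ d (X' m v) = X.comp m v

/-- `br` is the Lie bracket `[X, Y] = X □ Y - (-1)^{p̄(X)p̄(Y)} Y □ X` of `W^∂(ΠV)`, computed
with any representatives. -/
def IsLieBracket (br : W 𝒱 d →ₗ[F] W 𝒱 d →ₗ[F] W 𝒱 d) : Prop :=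
  ∀ (a b : ZMod 2) (X Y : W 𝒱 d), X ∈ W.par 𝒱 d a → Y ∈ W.par 𝒱 d b →
    ∀ X' Y' : ∀ m, Cochain F V m, IsLift X X' → IsLift Y Y' →
      ∀ (m : ℕ) (β : Fin m → ZMod 2) (v : Fin m → V), (∀ j, v j ∈ parityShift 𝒱 (β j)) →
        (br X Y).comp m v =
          toQ d (boxPlain d X' Y' β v - (-1 : ℤˣ) ^ (a * b) • boxPlain d Y' X' β v)

/-- `act` is the action `[X, Y] = X □^L Y - (-1)^{p̄(X)p̄(Y)} Y □^R X` of `X ∈ W^∂(ΠV)` on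
`Y ∈ W̃^∂(ΠV)`, computed with any representatives of the values of `X`. -/
def IsAction (act : W 𝒱 d →ₗ[F] G 𝒱 d →ₗ[F] G 𝒱 d) : Prop :=
  ∀ (a b : ZMod 2) (X : W 𝒱 d) (Y : G 𝒱 d), X ∈ W.par 𝒱 d a → Y ∈ G.barPar 𝒱 d b →
    ∀ X' : ∀ m, Cochain F V m, IsLift X X' →
      ∀ (m : ℕ) (β : Fin m → ZMod 2) (v : Fin m → V), (∀ j, v j ∈ parityShift 𝒱 (β j)) →
        (act X Y).comp m v =
          boxLeft d X' Y.comp β v - (-1 : ℤˣ) ^ (a * b) • boxPlain d Y.comp X' β v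

/-- `int` is the map `∫` induced by the quotient maps
`F[λ_0, …, λ_k] ⊗ V → F₋[λ_0, …, λ_k] ⊗_{F[∂]} V`. -/
def IsIntegral (int : G 𝒱 d →ₗ[F] W 𝒱 d) : Prop :=
  ∀ (X : G 𝒱 d) (m : ℕ) (v : Fin m → V), (int X).comp m v = toQ d (X.comp m v)

end Differential

end UniversalPVA

set_option linter.all false
set_option autoImplicit false

namespace UniversalPVA

/-! ### Signs -/

/-- The sign `(-1)^{ab}` as an integer. -/
def sgn (a b : ZMod 2) : ℤ := ((-1 : ℤˣ) ^ (a * b) : ℤˣ)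

theorem sgn_add_left (a b c : ZMod 2) : sgn (a + b) c = sgn a c * sgn b c := by
  simp [sgn, add_mul, uzpow_add]

theorem sgn_comm (a b : ZMod 2) : sgn a b = sgn b a := by simp [sgn, mul_comm]

theorem sgn_add_right (a b c : ZMod 2) : sgn c (a + b) = sgn c a * sgn c b := by
  rw [sgn_comm, sgn_add_left, sgn_comm a, sgn_comm b]

theorem sgn_mul_self (a b : ZMod 2) : sgn a b * sgn a b = 1 := by
  rw [sgn, ← Units.val_mul, Int.units_mul_self, Units.val_one]

@[simp] theorem sgn_zero_left (a : ZMod 2) : sgn 0 a = 1 := by simp [sgn]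

@[simp] theorem sgn_zero_right (a : ZMod 2) : sgn a 0 = 1 := by simp [sgn]

theorem sgn_smul {M : Type*} [AddCommGroup M] (a b : ZMod 2) (x : M) :
    (-1 : ℤˣ) ^ (a * b) • x = sgn a b • x := rfl

theorem sgn_smul_sgn_smul {M : Type*} [AddCommGroup M] (a b : ZMod 2) (x : M) :
    sgn a b • sgn a b • x = x := by rw [smul_smul, sgn_mul_self, one_smul]

/-! ### Series: functions of lists of arguments with momenta -/

/-- An argument `v` of parity `par` and momentum `mom`; the momentum `⊤` is a formal one. -/
structure Arg (F V : Type*) where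
  /-- the momentum -/
  mom : WithTop F
  /-- the parity -/
  par : ZMod 2
  /-- the vector -/
  vec : V

section Series

variable {F : Type*} [Field F] {V : Type*} [AddCommGroup V] [Module F V]
  {B : Type*} [AddCommGroup B] {𝒰 : ZMod 2 → Submodule F V} {d : V →ₗ[F] V} {n : ℕ}
variable {T ν ν' νX νY νZ : WithTop F} {X X' Y Z f : List (Arg F V) → V} {a b c : ZMod 2}
  {l : List (Arg F V)} {e w : Arg F V}

/-- The total momentum. -/
def momSum (l : List (Arg F V)) : WithTop F := (l.map Arg.mom).sum

/-- The total parity. -/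
def parSum (l : List (Arg F V)) : ZMod 2 := (l.map Arg.par).sum

@[simp] theorem momSum_nil : momSum ([] : List (Arg F V)) = 0 := rfl
@[simp] theorem momSum_cons (e : Arg F V) (l : List (Arg F V)) :
    momSum (e :: l) = e.mom + momSum l := by simp [momSum]
@[simp] theorem momSum_append (l l' : List (Arg F V)) :
    momSum (l ++ l') = momSum l + momSum l' := by simp [momSum]
@[simp] theorem parSum_nil : parSum ([] : List (Arg F V)) = 0 := rfl
@[simp] theorem parSum_cons (e : Arg F V) (l : List (Arg F V)) :
    parSum (e :: l) = e.par + parSum l := by simp [parSum]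
@[simp] theorem parSum_append (l l' : List (Arg F V)) :
    parSum (l ++ l') = parSum l + parSum l' := by simp [parSum]

/-- All arguments are homogeneous of the indicated parity. -/
def Hom (𝒰 : ZMod 2 → Submodule F V) (l : List (Arg F V)) : Prop := ∀ e ∈ l, e.vec ∈ 𝒰 e.par

@[simp] theorem hom_nil : Hom 𝒰 [] := by simp [Hom]
@[simp] theorem hom_cons : Hom 𝒰 (e :: l) ↔ e.vec ∈ 𝒰 e.par ∧ Hom 𝒰 l := by simp [Hom]
@[simp] theorem hom_append {l' : List (Arg F V)} : Hom 𝒰 (l ++ l') ↔ Hom 𝒰 l ∧ Hom 𝒰 l' := by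
  simp [Hom, or_imp, forall_and]

/-- The sum over all shuffles of `Z(⟨ν + ⋯, a + ⋯, X(p)⟩, q)`. -/
def ins : List (Arg F V) → WithTop F → ZMod 2 → (List (Arg F V) → V) → (List (Arg F V) → B) → B
  | [], ν, a, X, Z => Z [⟨ν, a, X []⟩]
  | w :: l, ν, a, X, Z => ins l (ν + w.mom) (a + w.par) (fun p => X (w :: p)) Z +
      sgn w.par a • ins l ν a X (fun q => Z (w :: q))

/-- Multilinearity of a series. -/
structure IsLin [Module F B] (Z : List (Arg F V) → B) : Prop where
  map_add : ∀ l₁ μ β x y l₂, Z (l₁ ++ ⟨μ, β, x + y⟩ :: l₂) =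
    Z (l₁ ++ ⟨μ, β, x⟩ :: l₂) + Z (l₁ ++ ⟨μ, β, y⟩ :: l₂)
  map_smul : ∀ l₁ μ β (c : F) x l₂, Z (l₁ ++ ⟨μ, β, c • x⟩ :: l₂) =
    c • Z (l₁ ++ ⟨μ, β, x⟩ :: l₂)

/-- The series `f` takes homogeneous arguments of total parity `γ` to vectors of parity `a + γ`. -/
def HasPar (𝒰 : ZMod 2 → Submodule F V) (a : ZMod 2) (f : List (Arg F V) → V) : Prop :=
  ∀ l, Hom 𝒰 l → f l ∈ 𝒰 (a + parSum l)

/-- A multilinear, symmetric and sesquilinear series of total momentum `ν`. -/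
structure IsSeries (𝒰 : ZMod 2 → Submodule F V) (d : V →ₗ[F] V) (ν : WithTop F)
    (f : List (Arg F V) → V) : Prop extends IsLin f where
  swap : ∀ l₁ e e' l₂, Hom 𝒰 (l₁ ++ e :: e' :: l₂) → ν + momSum (l₁ ++ e :: e' :: l₂) = ⊤ →
    f (l₁ ++ e :: e' :: l₂) = sgn e.par e'.par • f (l₁ ++ e' :: e :: l₂)
  sesq : ∀ l₁ (μ : F) β v l₂, ν + momSum (l₁ ++ l₂) = ⊤ →
    f (l₁ ++ ⟨μ, β, d v⟩ :: l₂) = -(μ • f (l₁ ++ ⟨μ, β, v⟩ :: l₂))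
  sesqT : ∀ l₁ β v l₂ (T : F), ν + momSum (l₁ ++ l₂) = (T : WithTop F) →
    f (l₁ ++ ⟨⊤, β, d v⟩ :: l₂) = d (f (l₁ ++ ⟨⊤, β, v⟩ :: l₂)) + T • f (l₁ ++ ⟨⊤, β, v⟩ :: l₂)
  val : ∀ l₁ (μ : F) β v l₂ (T : F), ν + momSum (l₁ ++ ⟨μ, β, v⟩ :: l₂) = (T : WithTop F) →
    ∃ u, f (l₁ ++ ⟨μ, β, v⟩ :: l₂) - f (l₁ ++ ⟨⊤, β, v⟩ :: l₂) = d u + T • u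

theorem IsLin.cons [Module F B] {Z : List (Arg F V) → B} (h : IsLin Z) (w : Arg F V) :
    IsLin fun l => Z (w :: l) :=
  ⟨fun l₁ => h.map_add (w :: l₁), fun l₁ => h.map_smul (w :: l₁)⟩

theorem IsSeries.cons (h : IsSeries 𝒰 d ν f) (hw : w.vec ∈ 𝒰 w.par) :
    IsSeries 𝒰 d (ν + w.mom) fun l => f (w :: l) where
  toIsLin := h.toIsLin.cons w
  swap l₁ e e' l₂ hl hs := h.swap (w :: l₁) e e' l₂ (by simpa [hw] using hl)
    (by simpa [add_assoc] using hs)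
  sesq l₁ μ β v l₂ hs := h.sesq (w :: l₁) μ β v l₂ (by simpa [add_assoc] using hs)
  sesqT l₁ β v l₂ T hs := h.sesqT (w :: l₁) β v l₂ T (by simpa [add_assoc] using hs)
  val l₁ μ β v l₂ T hs := h.val (w :: l₁) μ β v l₂ T (by simpa [add_assoc] using hs)

theorem HasPar.cons (h : HasPar 𝒰 a f) (hw : w.vec ∈ 𝒰 w.par) :
    HasPar 𝒰 (a + w.par) fun l => f (w :: l) :=
  fun l hl => by simpa [add_assoc] using h (w :: l) (by simp [hw, hl])

theorem ins_add_right (l : List (Arg F V)) (ν : WithTop F) (a : ZMod 2) (X : List (Arg F V) → V)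
    (Z Z' : List (Arg F V) → B) :
    ins l ν a X (fun q => Z q + Z' q) = ins l ν a X Z + ins l ν a X Z' := by
  induction l generalizing ν a X Z Z' with
  | nil => simp [ins]
  | cons w l ih => simp only [ins, ih, smul_add]; abel

theorem ins_zsmul_right (l : List (Arg F V)) (ν : WithTop F) (a : ZMod 2) (X : List (Arg F V) → V)
    (c : ℤ) (Z : List (Arg F V) → B) :
    ins l ν a X (fun q => c • Z q) = c • ins l ν a X Z := by
  induction l generalizing ν a X Z with
  | nil => simp [ins]
  | cons w l ih => simp only [ins, ih, smul_add, smul_comm c]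

theorem ins_smul_right [Module F B] (l : List (Arg F V)) (ν : WithTop F) (a : ZMod 2)
    (X : List (Arg F V) → V) (c : F) (Z : List (Arg F V) → B) :
    ins l ν a X (fun q => c • Z q) = c • ins l ν a X Z := by
  induction l generalizing ν a X Z with
  | nil => simp [ins]
  | cons w l ih => simp only [ins, ih, smul_add, smul_comm c]

theorem ins_sub_right (l : List (Arg F V)) (ν : WithTop F) (a : ZMod 2) (X : List (Arg F V) → V)
    (Z Z' : List (Arg F V) → B) :
    ins l ν a X (fun q => Z q - Z' q) = ins l ν a X Z - ins l ν a X Z' := by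
  induction l generalizing ν a X Z Z' with
  | nil => simp [ins]
  | cons w l ih => simp only [ins, ih, smul_sub]; abel

theorem ins_add_left [Module F B] (l : List (Arg F V)) (ν : WithTop F) (a : ZMod 2)
    (X X' : List (Arg F V) → V) {Z : List (Arg F V) → B} (hZ : IsLin Z) :
    ins l ν a (fun q => X q + X' q) Z = ins l ν a X Z + ins l ν a X' Z := by
  induction l generalizing ν a X X' Z with
  | nil => simpa [ins] using hZ.map_add [] ν a (X []) (X' []) []
  | cons w l ih => simp only [ins, ih _ _ _ _ hZ, ih _ _ _ _ (hZ.cons w), smul_add]; abel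

theorem ins_smul_left [Module F B] (l : List (Arg F V)) (ν : WithTop F) (a : ZMod 2)
    (c : F) (X : List (Arg F V) → V) {Z : List (Arg F V) → B} (hZ : IsLin Z) :
    ins l ν a (fun q => c • X q) Z = c • ins l ν a X Z := by
  induction l generalizing ν a X Z with
  | nil => simpa [ins] using hZ.map_smul [] ν a c (X []) []
  | cons w l ih => simp only [ins, ih _ _ _ hZ, ih _ _ _ (hZ.cons w), smul_add, smul_comm c]

theorem ins_zsmul_left [Module F B] (l : List (Arg F V)) (ν : WithTop F) (a : ZMod 2)
    (c : ℤ) (X : List (Arg F V) → V) {Z : List (Arg F V) → B} (hZ : IsLin Z) :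
    ins l ν a (fun q => c • X q) Z = c • ins l ν a X Z := by
  simpa only [Int.cast_smul_eq_zsmul] using ins_smul_left l ν a (c : F) X hZ

theorem ins_sub_left [Module F B] (l : List (Arg F V)) (ν : WithTop F) (a : ZMod 2)
    (X X' : List (Arg F V) → V) {Z : List (Arg F V) → B} (hZ : IsLin Z) :
    ins l ν a (fun q => X q - X' q) Z = ins l ν a X Z - ins l ν a X' Z := by
  have := ins_add_left l ν a X (fun q => (-1 : ℤ) • X' q) hZ
  rw [ins_zsmul_left _ _ _ _ _ hZ] at this
  simpa [sub_eq_add_neg] using this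

/-- A series all of whose values are trivial, in the sense in which values of a series of total
momentum `ν` are defined. -/
def IsNull (𝒰 : ZMod 2 → Submodule F V) (d : V →ₗ[F] V) (ν : WithTop F)
    (X : List (Arg F V) → V) : Prop :=
  ∀ p, Hom 𝒰 p → (ν + momSum p = ⊤ → X p = 0) ∧
    ∀ T : F, ν + momSum p = (T : WithTop F) → ∃ u, X p = d u + T • u

theorem IsNull.cons (h : IsNull 𝒰 d ν X) (hw : w.vec ∈ 𝒰 w.par) :
    IsNull 𝒰 d (ν + w.mom) fun l => X (w :: l) := by
  intro p hp
  have := h (w :: p) (by simp [hw, hp])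
  rwa [momSum_cons, ← add_assoc] at this

theorem ins_eq_zero (hX : IsNull 𝒰 d ν X) (hZ : IsSeries 𝒰 d ν' Z) (l : List (Arg F V)) (a : ZMod 2)
    (hl : Hom 𝒰 l) (h : ν + ν' + momSum l = ⊤) : ins l ν a X Z = 0 := by
  induction l generalizing ν ν' a X Z with
  | nil =>
    simp only [ins]
    induction ν with
    | top =>
      rw [(hX [] hl).1 (by simp)]
      simpa using hZ.map_smul [] ⊤ a 0 0 []
    | coe T =>
      obtain ⟨u, hu⟩ := (hX [] hl).2 T (by simp)
      rw [hu]
      have h' : ν' = ⊤ := by simpa using h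
      have h1 := hZ.map_add [] T a (d u) (T • u) []
      have h2 := hZ.map_smul [] T a T u []
      have h3 := hZ.sesq [] T a u [] (by simp [h'])
      simp only [List.nil_append] at h1 h2 h3
      rw [h1, h2, h3, neg_add_cancel]
  | cons w l ih =>
    simp only [hom_cons] at hl
    simp only [momSum_cons] at h
    rw [ins, ih (hX.cons hl.1) hZ _ hl.2 (by rw [← h]; abel),
      ih hX (hZ.cons hl.1) _ hl.2 (by rw [← h]; abel), smul_zero, add_zero]

theorem ins_congr_left (hX : IsNull 𝒰 d ν fun p => X p - X' p) (hZ : IsSeries 𝒰 d ν' Z)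
    (l : List (Arg F V)) (a : ZMod 2) (hl : Hom 𝒰 l) (h : ν + ν' + momSum l = ⊤) : ins l ν a X Z =
    ins l ν a X' Z := by
  rw [← sub_eq_zero, ← ins_sub_left _ _ _ _ _ hZ.toIsLin]
  exact ins_eq_zero hX hZ l a hl h

theorem ins_congr_right {Z Z' : List (Arg F V) → B} (hX : HasPar 𝒰 a X)
    (hZ : ∀ q, Hom 𝒰 q → ν' + momSum q = ⊤ → Z q = Z' q) (l : List (Arg F V)) (hl : Hom 𝒰 l)
    (h : ν + ν' + momSum l = ⊤) : ins l ν a X Z = ins l ν a X Z' := by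
  induction l generalizing ν ν' a X Z Z' with
  | nil =>
    refine hZ _ ?_ ?_
    · simpa using hX [] hl
    · rw [← h]; simp [add_comm]
  | cons w l ih =>
    simp only [hom_cons] at hl
    simp only [momSum_cons] at h
    rw [ins, ih (hX.cons hl.1) hZ hl.2 (by rw [← h]; abel), ins]
    congr 2
    refine ih (ν' := ν' + w.mom) hX (fun q hq hq' => hZ _ (by simp [hl.1, hq]) ?_) hl.2
      (by rw [← h]; abel)
    rw [← hq']; simp [add_assoc]

theorem HasPar.ins (hX : HasPar 𝒰 a X) (hZ : HasPar 𝒰 b Z) : HasPar 𝒰 (a + b) fun l => ins l ν a X Z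
    := by
  intro l hl
  induction l generalizing ν a b X Z with
  | nil => simpa [UniversalPVA.ins, add_comm] using hZ [⟨ν, a, X []⟩] (by simpa using hX [] hl)
  | cons w l ih =>
    simp only [hom_cons] at hl
    refine add_mem ?_ (zsmul_mem ?_ _)
    · have := ih (ν := ν + w.mom) (hX.cons hl.1) hZ hl.2
      convert this using 2
      simp only [parSum_cons]; abel
    · have := ih (ν := ν) hX (hZ.cons hl.1) hl.2
      convert this using 2
      simp only [parSum_cons]; abel

theorem IsSeries.swap_isNull (hX : IsSeries 𝒰 d ν X) {e' : Arg F V} (he : e.vec ∈ 𝒰 e.par)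
    (he' : e'.vec ∈ 𝒰 e'.par) : IsNull 𝒰 d (ν + e.mom + e'.mom) fun p => X (e :: e' :: p) -
    sgn e.par e'.par • X (e' :: e :: p) := by
  intro p hp
  refine ⟨fun h => sub_eq_zero.2 (hX.swap [] e e' p (by simp [he, he', hp]) ?_), fun T h => ?_⟩
  · rw [← h]; simp [add_assoc]
  obtain ⟨μ, β, v⟩ := e
  obtain ⟨μ', β', v'⟩ := e'
  induction μ with
  | top => simp at h
  | coe μ =>
  induction μ' with
  | top => simp at h
  | coe μ' =>
  have h' : ν + momSum ([⟨μ, β, v⟩] ++ ⟨μ', β', v'⟩ :: p) = (T : WithTop F) := by rw [← h]; simp [add_assoc]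
  have h'' : ν + momSum ([] ++ ⟨μ', β', v'⟩ :: ⟨μ, β, v⟩ :: p) = (T : WithTop F) := by
    rw [← h]; simp; abel
  obtain ⟨u, hu⟩ := hX.val [⟨μ, β, v⟩] μ' β' v' p T h'
  obtain ⟨u', hu'⟩ := hX.val [] μ' β' v' (⟨μ, β, v⟩ :: p) T h''
  have hs := hX.swap [] ⟨μ, β, v⟩ ⟨⊤, β', v'⟩ p (by simpa using ⟨he, he', hp⟩) (by simp)
  simp only [List.cons_append, List.nil_append] at hu hu' hs
  refine ⟨u - sgn β β' • u', ?_⟩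
  rw [map_sub, map_zsmul, smul_sub, smul_comm T]
  exact add_sub_add_comm_aux hu hu' hs
where
  add_sub_add_comm_aux {A B A' B' u Tu u' Tu' : V} {s : ℤ} (h : A - B = u + Tu)
      (h' : A' - B' = u' + Tu') (hs : B = s • B') : A - s • A' = u - s • u' + (Tu - s • Tu') := by
    rw [sub_eq_iff_eq_add] at h h'
    rw [h, h', hs, smul_add, smul_add]; abel

theorem ins_swap (hX : IsSeries 𝒰 d ν X) (hX' : HasPar 𝒰 a X) (hZ : IsSeries 𝒰 d ν' Z)
    (l₁ : List (Arg F V)) (e e' : Arg F V) (l₂ : List (Arg F V)) (hl : Hom 𝒰 (l₁ ++ e :: e' :: l₂))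
    (h : ν + ν' + momSum (l₁ ++ e :: e' :: l₂) = ⊤) : ins (l₁ ++ e :: e' :: l₂) ν a X Z =
    sgn e.par e'.par • ins (l₁ ++ e' :: e :: l₂) ν a X Z := by
  induction l₁ generalizing ν ν' a X Z with
  | nil =>
    simp only [List.nil_append, hom_cons, momSum_cons] at hl h
    obtain ⟨he, he', hl⟩ := hl
    simp only [List.nil_append, ins]
    have h1 := ins_congr_left (hX.swap_isNull he he') hZ l₂ (a + e.par + e'.par) hl
      (by rw [← h]; abel)
    rw [ins_zsmul_left _ _ _ _ _ hZ.toIsLin] at h1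
    have h2 : ins l₂ ν a X (fun q => Z (e :: e' :: q)) =
        ins l₂ ν a X (fun q => sgn e.par e'.par • Z (e' :: e :: q)) := by
      refine ins_congr_right (ν' := ν' + e.mom + e'.mom) hX' (fun q hq hq' => ?_) l₂ hl
        (by rw [← h]; abel)
      exact hZ.swap [] e e' q (by simp [he, he', hq]) (by rw [← hq']; simp [add_assoc])
    rw [ins_zsmul_right] at h2
    rw [h1, h2, add_right_comm ν e'.mom, add_right_comm a e'.par]
    simp only [smul_add, smul_smul, sgn_add_right]
    match_scalars <;> grind [sgn_mul_self, sgn_comm]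
  | cons w l ih =>
    simp only [List.cons_append, hom_cons, momSum_cons] at hl h
    simp only [List.cons_append, ins]
    rw [ih (hX.cons hl.1) (hX'.cons hl.1) hZ hl.2 (by rw [← h]; abel),
      ih hX hX' (hZ.cons hl.1) hl.2 (by rw [← h]; abel), smul_add, smul_comm (sgn w.par a)]

theorem IsSeries.sesq_isNull (hX : IsSeries 𝒰 d ν X) (μ : F) (β : ZMod 2) (v : V) :
    IsNull 𝒰 d (ν + μ) fun p => X (⟨μ, β, d v⟩ :: p) - -(μ • X (⟨μ, β, v⟩ :: p)) := by
  intro p hp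
  refine ⟨fun h => sub_eq_zero.2 (hX.sesq [] μ β v p ?_), fun T h => ?_⟩
  · induction ν with
    | top => simp
    | coe ν =>
      simpa using h
  · cases p with
    | nil =>
      induction ν with
      | top => simp at h
      | coe ν =>
      have hT : T = ν + μ := by simpa [← WithTop.coe_add] using h.symm
      obtain ⟨u, hu⟩ := hX.val [] μ β (d v) [] T (by simpa using h)
      obtain ⟨u', hu'⟩ := hX.val [] μ β v [] T (by simpa using h)
      have hs := hX.sesqT [] β v [] ν (by simp)
      simp only [List.nil_append] at hu hu' hs
      refine ⟨u + μ • u' + X [⟨⊤, β, v⟩], ?_⟩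
      rw [sub_eq_iff_eq_add] at hu hu'
      beta_reduce
      rw [hu, hu', hs, hT]
      simp only [map_add, map_smul]
      module
    | cons w p =>
      obtain ⟨μ', β', v'⟩ := w
      induction μ' with
      | top => simp at h
      | coe μ' =>
      have h' : ∀ v : V, ν + momSum ([⟨μ, β, v⟩] ++ ⟨μ', β', v'⟩ :: p) = (T : WithTop F) := by
        intro v; rw [← h]; simp [add_assoc]
      obtain ⟨u, hu⟩ := hX.val [⟨μ, β, d v⟩] μ' β' v' p T (h' _)
      obtain ⟨u', hu'⟩ := hX.val [⟨μ, β, v⟩] μ' β' v' p T (h' _)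
      have hs := hX.sesq [] μ β v (⟨⊤, β', v'⟩ :: p) (by simp)
      simp only [List.cons_append, List.nil_append] at hu hu' hs
      refine ⟨u + μ • u', ?_⟩
      rw [sub_eq_iff_eq_add] at hu hu'
      beta_reduce
      rw [hu, hu', hs]
      simp only [map_add, map_smul]
      module

theorem ins_neg_smul_left {c : F} (hZ : IsLin Z) : ins l ν a (fun q => -(c • X q)) Z =
    -(c • ins l ν a X Z) := by
  simpa only [neg_smul] using ins_smul_left l ν a (-c) X hZ

theorem ins_neg_smul_right {c : F} : ins l ν a X (fun q => -(c • Z q)) = -(c • ins l ν a X Z) := by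
  simpa only [neg_smul] using ins_smul_right l ν a X (-c) Z

/-- Symmetry of a series of momentum `ν` on lists of total momentum `T`. -/
def IsSwap (𝒰 : ZMod 2 → Submodule F V) (ν T : WithTop F) (f : List (Arg F V) → B) : Prop :=
  ∀ l₁ e e' l₂, Hom 𝒰 (l₁ ++ e :: e' :: l₂) → ν + momSum (l₁ ++ e :: e' :: l₂) = T →
    f (l₁ ++ e :: e' :: l₂) = sgn e.par e'.par • f (l₁ ++ e' :: e :: l₂)

theorem IsSeries.isSwap (h : IsSeries 𝒰 d ν f) : IsSwap 𝒰 ν ⊤ f := h.swap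

theorem IsSwap.cons {f : List (Arg F V) → B} (h : IsSwap 𝒰 ν T f) (hw : w.vec ∈ 𝒰 w.par) :
    IsSwap 𝒰 (ν + w.mom) T fun l => f (w :: l) :=
  fun l₁ e e' l₂ hl hs => h (w :: l₁) e e' l₂ (by simpa [hw] using hl)
    (by simpa [add_assoc] using hs)

theorem IsSwap.move_last {f : List (Arg F V) → B} (h : IsSwap 𝒰 ν T f) (l₁ : List (Arg F V))
    (e : Arg F V) (l₂ : List (Arg F V)) (hl : Hom 𝒰 (l₁ ++ e :: l₂))
    (hs : ν + momSum (l₁ ++ e :: l₂) = T) : f (l₁ ++ e :: l₂) =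
    sgn e.par (parSum l₂) • f (l₁ ++ l₂ ++ [e]) := by
  induction l₂ generalizing l₁ with
  | nil => simp
  | cons w l ih =>
    have := ih (l₁ ++ [w]) (by simp at hl ⊢; tauto) (by rw [← hs]; simp; abel)
    simp only [List.append_assoc, List.cons_append, List.nil_append] at this
    rw [h l₁ e w l hl hs, this, smul_smul, parSum_cons, sgn_add_right]
    simp

theorem ins_ins [Module F B] {Z : List (Arg F V) → B} (hX : HasPar 𝒰 a X) (hY : HasPar 𝒰 b Y)
    (hZ : IsSwap 𝒰 νZ T Z) (hZ' : IsLin Z) (l : List (Arg F V)) (hl : Hom 𝒰 l)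
    (h : νX + νY + νZ + momSum l = T) : ins l νX a X (fun q => ins q νY b Y Z) -
    sgn a b • ins l νY b Y (fun q => ins q νX a X Z) = ins l (νX + νY) (a + b)
    (fun p => ins p νX a X Y) Z - sgn a b • ins l (νX + νY) (a + b) (fun p => ins p νY b Y X) Z
    := by
  induction l generalizing νX νY νZ a b X Y Z with
  | nil =>
    have := hZ [] ⟨νX, a, X []⟩ ⟨νY, b, Y []⟩ [] (by have h1 := hX [] hl; have h2 := hY [] hl; simp at h1 h2; simpa using ⟨h1, h2⟩)
      (by rw [← h]; simp; abel)
    simp only [List.nil_append] at this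
    simp only [ins, this, add_comm νY, add_comm b, smul_add, smul_smul, sgn_comm b,
      sgn_mul_self, one_smul]
    abel
  | cons w l ih =>
    simp only [hom_cons] at hl
    simp only [momSum_cons] at h
    have h1 := ih (νX := νX + w.mom) (νY := νY) (hX.cons hl.1) hY hZ hZ' hl.2 (by rw [← h]; abel)
    have h2 := ih (νX := νX) (νY := νY + w.mom) hX (hY.cons hl.1) hZ hZ' hl.2 (by rw [← h]; abel)
    have h3 := ih (νX := νX) (νY := νY) hX hY (hZ.cons hl.1) (hZ'.cons w) hl.2 (by rw [← h]; abel)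
    simp only [ins, ins_add_right, ins_zsmul_right, ins_add_left _ _ _ _ _ hZ',
      ins_zsmul_left _ _ _ _ _ hZ']
    rw [add_right_comm, add_right_comm a] at h1
    rw [← add_assoc, ← add_assoc a] at h2
    simp only [sgn_add_left, sgn_add_right] at h1 h2 h3 ⊢
    rw [sub_eq_iff_eq_add] at h1 h2 h3
    rw [h1, h2, h3]
    simp only [smul_add, smul_sub, smul_smul]
    match_scalars <;> grind [sgn_mul_self, sgn_comm]

/-- The bracket of two series of momenta `νX`, `νY` and parities `a`, `b`. -/
def bracket (νX : WithTop F) (a : ZMod 2) (X : List (Arg F V) → V) (νY : WithTop F) (b : ZMod 2)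
    (Y : List (Arg F V) → V) (l : List (Arg F V)) : V :=
  ins l νY b Y X - sgn a b • ins l νX a X Y

theorem bracket_cons (νX νY : WithTop F) (a b : ZMod 2) (X Y : List (Arg F V) → V)
    (w : Arg F V) (l : List (Arg F V)) :
    bracket νX a X νY b Y (w :: l) =
      bracket νX a X (νY + w.mom) (b + w.par) (fun q => Y (w :: q)) l +
        sgn w.par b • bracket (νX + w.mom) (a + w.par) (fun q => X (w :: q)) νY b Y l := by
  simp only [bracket, ins, sgn_add_left, sgn_add_right, smul_add, smul_sub, smul_smul]
  match_scalars <;> grind [sgn_mul_self, sgn_comm]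

theorem bracket_skew (νX νY : WithTop F) (a b : ZMod 2) (X Y : List (Arg F V) → V)
    (l : List (Arg F V)) :
    bracket νY b Y νX a X l = -(sgn a b • bracket νX a X νY b Y l) := by
  simp only [bracket, smul_sub, smul_smul, sgn_mul_self, sgn_comm b a, one_smul]; abel

theorem HasPar.bracket (hX : HasPar 𝒰 a X) (hY : HasPar 𝒰 b Y) :
    HasPar 𝒰 (a + b) (bracket νX a X νY b Y) := fun l hl =>
  sub_mem (by simpa only [add_comm b a] using hY.ins hX l hl)
    (zsmul_mem (hX.ins hY l hl) _)

/-- The Jacobi identity for series. -/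
theorem bracket_jacobi (hX : HasPar 𝒰 a X) (hY : HasPar 𝒰 b Y) (hZ : HasPar 𝒰 c Z)
    (hX' : IsSeries 𝒰 d νX X) (hY' : IsSeries 𝒰 d νY Y) (hZ' : IsSeries 𝒰 d νZ Z)
    (l : List (Arg F V)) (hl : Hom 𝒰 l) (h : νX + νY + νZ + momSum l = ⊤) :
    bracket νX a X (νY + νZ) (b + c) (bracket νY b Y νZ c Z) l -
    sgn a b • bracket νY b Y (νX + νZ) (a + c) (bracket νX a X νZ c Z) l =
    bracket (νX + νY) (a + b) (bracket νX a X νY b Y) νZ c Z l := by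
  have h1 := ins_ins (νX := νX) (νY := νY) hX hY hZ'.isSwap hZ'.toIsLin l hl h
  have h2 := ins_ins (νX := νX) (νY := νZ) hX hZ hY'.isSwap hY'.toIsLin l hl (by rw [← h]; abel)
  have h3 := ins_ins (νX := νY) (νY := νZ) hY hZ hX'.isSwap hX'.toIsLin l hl (by rw [← h]; abel)
  unfold bracket
  simp only [ins_sub_right, ins_zsmul_right, ins_sub_left _ _ _ _ _ hZ'.toIsLin,
    ins_zsmul_left _ _ _ _ _ hZ'.toIsLin, ins_sub_left _ _ _ _ _ hY'.toIsLin,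
    ins_zsmul_left _ _ _ _ _ hY'.toIsLin, ins_sub_left _ _ _ _ _ hX'.toIsLin,
    ins_zsmul_left _ _ _ _ _ hX'.toIsLin]
  rw [sub_eq_iff_eq_add] at h1 h2 h3
  rw [h1, h2, h3]
  simp only [sgn_add_left, sgn_add_right, smul_add, smul_sub, smul_smul]
  match_scalars <;> grind [sgn_mul_self, sgn_comm]

theorem bracket_congr_left (hX : IsNull 𝒰 d νX fun p => X p - X' p) (hY : HasPar 𝒰 b Y)
    (hY' : IsSeries 𝒰 d νY Y) (l : List (Arg F V)) (hl : Hom 𝒰 l) (h : νX + νY + momSum l = ⊤) :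
    bracket νX a X νY b Y l = bracket νX a X' νY b Y l := by
  unfold bracket
  rw [ins_congr_left hX hY' l a hl h, ins_congr_right (ν' := νX) hY (fun q hq hq' => sub_eq_zero.1 ((hX q hq).1 hq'))
    l hl (by rw [← h]; abel)]

theorem bracket_congr_right {Y' : List (Arg F V) → V} (hY : IsNull 𝒰 d νY fun p => Y p - Y' p)
    (hX : HasPar 𝒰 a X) (hX' : IsSeries 𝒰 d νX X) (l : List (Arg F V)) (hl : Hom 𝒰 l)
    (h : νX + νY + momSum l = ⊤) : bracket νX a X νY b Y l = bracket νX a X νY b Y' l := by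
  rw [bracket_skew νY νX b a Y X l, bracket_skew νY νX b a Y' X l,
    bracket_congr_left hY hX hX' l hl (by rw [← h]; abel)]

theorem ins_map {B B' : Type*} [AddCommGroup B] [AddCommGroup B'] (q : B →+ B')
    (l : List (Arg F V)) (ν : WithTop F) (a : ZMod 2) (X : List (Arg F V) → V)
    (Z : List (Arg F V) → B) : q (ins l ν a X Z) = ins l ν a X (fun p => q (Z p)) := by
  induction l generalizing ν a X Z with
  | nil => rfl
  | cons w l ih => simp only [ins, map_add, map_zsmul, ih]

theorem IsSeries.isSwap_mod (h : IsSeries 𝒰 d ν f) (T : F) :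
    IsSwap 𝒰 ν T fun l => (LinearMap.range (d + T • LinearMap.id)).mkQ (f l) := by
  intro l₁ e e' l₂ hl hs
  induction l₁ generalizing ν f with
  | nil =>
    simp only [List.nil_append, hom_cons, momSum_cons] at hl hs
    obtain ⟨u, hu⟩ := (h.swap_isNull hl.1 hl.2.1 l₂ hl.2.2).2 T (by rw [← hs]; abel)
    rw [← map_zsmul, ← sub_eq_zero, ← map_sub, Submodule.mkQ_apply,
      Submodule.Quotient.mk_eq_zero]
    exact ⟨u, by simpa using hu.symm⟩
  | cons w l ih =>
    simp only [List.cons_append, hom_cons, momSum_cons] at hl hs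
    exact ih (h.cons hl.1) hl.2 (by rw [← hs]; abel)

theorem IsLin.comp_linear {B : Type*} [AddCommGroup B] [Module F B] (h : IsLin f) (q : V →ₗ[F] B) :
    IsLin fun l => q (f l) :=
  ⟨fun _ _ _ _ _ _ => (congrArg q (h.map_add _ _ _ _ _ _)).trans (q.map_add _ _),
    fun _ _ _ _ _ _ => (congrArg q (h.map_smul _ _ _ _ _ _)).trans (q.map_smul _ _)⟩

/-- The Jacobi identity for series, including the values that are only defined modulo
`d + T`. -/
theorem bracket_jacobi_isNull (hX : HasPar 𝒰 a X) (hY : HasPar 𝒰 b Y) (hZ : HasPar 𝒰 c Z)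
    (hX' : IsSeries 𝒰 d νX X) (hY' : IsSeries 𝒰 d νY Y) (hZ' : IsSeries 𝒰 d νZ Z) :
    IsNull 𝒰 d (νX + νY + νZ) fun l => bracket νX a X (νY + νZ) (b + c) (bracket νY b Y νZ c Z) l -
    sgn a b • bracket νY b Y (νX + νZ) (a + c) (bracket νX a X νZ c Z) l -
    bracket (νX + νY) (a + b) (bracket νX a X νY b Y) νZ c Z l := by
  intro l hl
  refine ⟨fun h => sub_eq_zero.2 (bracket_jacobi hX hY hZ hX' hY' hZ' l hl h), fun T h => ?_⟩
  have h1 := ins_ins (νX := νX) (νY := νY) hX hY (hZ'.isSwap_mod T) (hZ'.toIsLin.comp_linear _) l hl h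
  have h2 := ins_ins (νX := νX) (νY := νZ) hX hZ (hY'.isSwap_mod T) (hY'.toIsLin.comp_linear _) l hl
    (by rw [← h]; abel)
  have h3 := ins_ins (νX := νY) (νY := νZ) hY hZ (hX'.isSwap_mod T) (hX'.toIsLin.comp_linear _) l hl
    (by rw [← h]; abel)
  have key : ∀ v : V, (LinearMap.range (d + T • LinearMap.id)).mkQ v = 0 → ∃ u, v = d u + T • u := by
    intro v hv
    rw [Submodule.mkQ_apply, Submodule.Quotient.mk_eq_zero] at hv
    obtain ⟨u, hu⟩ := hv
    exact ⟨u, by simpa using hu.symm⟩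
  apply key
  have hm : ∀ (l : List (Arg F V)) ν a X (Z : List (Arg F V) → V),
      (LinearMap.range (d + T • LinearMap.id)).mkQ (ins l ν a X Z) =
        ins l ν a X fun p => (LinearMap.range (d + T • LinearMap.id)).mkQ (Z p) :=
    fun l ν a X Z => ins_map (LinearMap.range (d + T • LinearMap.id)).mkQ.toAddMonoidHom l ν a X Z
  beta_reduce
  unfold bracket
  have hZm := hZ'.toIsLin.comp_linear (LinearMap.range (d + T • LinearMap.id)).mkQ
  have hYm := hY'.toIsLin.comp_linear (LinearMap.range (d + T • LinearMap.id)).mkQ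
  have hXm := hX'.toIsLin.comp_linear (LinearMap.range (d + T • LinearMap.id)).mkQ
  simp only [map_sub, map_zsmul, hm, ins_sub_right, ins_zsmul_right,
    ins_sub_left _ _ _ _ _ hZm, ins_zsmul_left _ _ _ _ _ hZm, ins_sub_left _ _ _ _ _ hYm,
    ins_zsmul_left _ _ _ _ _ hYm, ins_sub_left _ _ _ _ _ hXm, ins_zsmul_left _ _ _ _ _ hXm]
  rw [sub_eq_iff_eq_add] at h1 h2 h3
  rw [h1, h2, h3]
  simp only [sgn_add_left, sgn_add_right, smul_add, smul_sub, smul_smul]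
  match_scalars <;> grind [sgn_mul_self, sgn_comm]

theorem bracket_swap (hX : IsSeries 𝒰 d νX X) (hX' : HasPar 𝒰 a X) (hY : IsSeries 𝒰 d νY Y)
    (hY' : HasPar 𝒰 b Y) : IsSwap 𝒰 (νX + νY) ⊤ (bracket νX a X νY b Y) := by
  intro l₁ e e' l₂ hl h
  unfold bracket
  rw [ins_swap hX hX' hY l₁ e e' l₂ hl h, ins_swap hY hY' hX l₁ e e' l₂ hl (by rw [← h]; abel),
    smul_sub, smul_comm (sgn a b)]

theorem bracket_sesqT {νX νY : F} (hX : IsSeries 𝒰 d νX X) (hY : IsSeries 𝒰 d νY Y)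
    (l : List (Arg F V)) (β : ZMod 2) (v : V) (T : F) (hl : Hom 𝒰 l)
    (h : (νX + νY : WithTop F) + momSum l = T) : bracket νX a X νY b Y (l ++ [⟨⊤, β, d v⟩]) =
    d (bracket νX a X νY b Y (l ++ [⟨⊤, β, v⟩])) + T • bracket νX a X νY b Y (l ++ [⟨⊤, β, v⟩])
    := by
  induction l generalizing νX νY a b X Y with
  | nil =>
    have hT : T = νX + νY := by simpa [← WithTop.coe_add] using h.symm
    have key : ∀ {νX νY : F} {X Y : List (Arg F V) → V} (a b : ZMod 2), IsSeries 𝒰 d νX X →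
        IsSeries 𝒰 d νY Y → ins [⟨⊤, β, d v⟩] νX a X Y = d (ins [⟨⊤, β, v⟩] νX a X Y) +
          (νX + νY) • ins [⟨⊤, β, v⟩] νX a X Y := by
      intro νX νY X Y a b hX hY
      have h1 := hX.sesqT [] β v [] νX (by simp)
      have h2 := hY.sesqT [] (a + β) (X [⟨⊤, β, v⟩]) [] νY (by simp)
      have h3 := hY.map_add [] ⊤ (a + β) (d (X [⟨⊤, β, v⟩])) (νX • X [⟨⊤, β, v⟩]) []
      have h4 := hY.map_smul [] ⊤ (a + β) νX (X [⟨⊤, β, v⟩]) []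
      have h5 := hY.sesqT [] β v [⟨νX, a, X []⟩] (νX + νY) (by simp [add_comm])
      simp only [List.nil_append] at h1 h2 h3 h4 h5
      simp only [ins, WithTop.add_top, h1, h2, h3, h4, h5, map_add, map_zsmul]
      module
    simp only [bracket, List.nil_append]
    rw [key a b hX hY, key b a hY hX, hT]
    simp only [map_sub, map_zsmul]
    module
  | cons w l ih =>
    simp only [hom_cons, momSum_cons] at hl h
    obtain ⟨μ, γ, w⟩ := w
    induction μ with
    | top => simp at h
    | coe μ =>
    have hX' := hX.cons hl.1
    have hY' := hY.cons hl.1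
    simp only [← WithTop.coe_add] at hX' hY'
    simp only [List.cons_append, bracket_cons, ← WithTop.coe_add]
    rw [ih hX hY' hl.2 (by rw [← h]; push_cast; abel), ih hX' hY hl.2 (by rw [← h]; push_cast; abel)]
    simp only [map_add, map_zsmul]
    module

/-- The sum of the finite momenta. -/
def finSum (l : List (Arg F V)) : F := (l.map fun e => e.mom.untopD 0).sum

@[simp] theorem finSum_nil : finSum ([] : List (Arg F V)) = 0 := rfl
@[simp] theorem finSum_cons (e : Arg F V) (l : List (Arg F V)) :
    finSum (e :: l) = e.mom.untopD 0 + finSum l := by simp [finSum]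
@[simp] theorem finSum_append (l l' : List (Arg F V)) :
    finSum (l ++ l') = finSum l + finSum l' := by simp [finSum]

/-- The operator `d + c + Λ` on series, where `Λ` is the sum of the momenta of the arguments. -/
def shiftD (d : V →ₗ[F] V) (c : F) (Y : List (Arg F V) → V) (l : List (Arg F V)) : V :=
  d (Y l) + (c + finSum l) • Y l

theorem shiftD_cons (c : F) (Y : List (Arg F V) → V) (w : Arg F V) (l : List (Arg F V)) :
    shiftD d c Y (w :: l) = shiftD d (c + w.mom.untopD 0) (fun q => Y (w :: q)) l := by
  simp only [shiftD, finSum_cons, add_assoc]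

theorem ins_shiftD_right (l : List (Arg F V)) (c ν : F) (a : ZMod 2) (X Y : List (Arg F V) → V)
    (h : momSum l ≠ ⊤) :
    ins l ν a X (shiftD d c Y) = shiftD d (c + ν) (fun q => ins q ν a X Y) l := by
  induction l generalizing c ν a X Y with
  | nil => simp [ins, shiftD]
  | cons w l ih =>
    simp only [momSum_cons, ne_eq, WithTop.add_eq_top, not_or] at h
    obtain ⟨μ, β, v⟩ := w
    lift μ to F using h.1
    simp only [ins, ← WithTop.coe_add, shiftD_cons]
    rw [ih _ _ _ _ _ h.2, ih _ _ _ _ _ h.2]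
    simp only [shiftD, map_add, map_zsmul, WithTop.untopD_coe, WithTop.coe_add,
      add_assoc, add_comm ν μ]
    module

theorem ins_shiftD_left {ν c : F} (hX : IsSeries 𝒰 d ν X) (l : List (Arg F V)) (b : ZMod 2)
    (hl : Hom 𝒰 l) (h : momSum l ≠ ⊤) : ins l ⊤ b (shiftD d c Y) X =
    shiftD d (c + ν) (fun q => ins q ⊤ b Y X) l := by
  induction l generalizing c ν b X Y with
  | nil =>
    have h1 := hX.map_add [] ⊤ b (d (Y [])) (c • Y []) []
    have h2 := hX.map_smul [] ⊤ b c (Y []) []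
    have h3 := hX.sesqT [] b (Y []) [] ν (by simp)
    simp only [List.nil_append] at h1 h2 h3
    simp only [ins, shiftD, finSum_nil, add_zero, h1, h2, h3]
    module
  | cons w l ih =>
    simp only [hom_cons] at hl
    simp only [momSum_cons, ne_eq, WithTop.add_eq_top, not_or] at h
    obtain ⟨μ, β, v⟩ := w
    lift μ to F using h.1
    have hXc := hX.cons hl.1
    simp only [← WithTop.coe_add] at hXc
    simp only [ins, shiftD_cons, WithTop.top_add]
    rw [ih hX _ hl.2 h.2, ih hXc _ hl.2 h.2]
    simp only [shiftD, map_add, map_zsmul, WithTop.untopD_coe, add_assoc, add_comm ν μ]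
    module

/-- The bracket with a series of total momentum `ν` commutes with translation up to `ν`. -/
theorem bracket_shiftD {ν : F} (hX : IsSeries 𝒰 d ν X) (l : List (Arg F V)) (hl : Hom 𝒰 l)
    (h : momSum l ≠ ⊤) : bracket ν a X ⊤ b (shiftD d 0 Y) l = shiftD d ν (bracket ν a X ⊤ b Y) l
    := by
  rw [bracket, ins_shiftD_left hX l b hl h, ins_shiftD_right l _ _ _ _ _ h]
  simp only [shiftD, bracket, map_sub, map_zsmul, zero_add]
  module

end Series

section Derivations

variable {F : Type*} [Field F] {V : Type*} [Ring V] [Algebra F V]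
  {𝒱 : ZMod 2 → Submodule F V} [GradedAlgebra 𝒱] {d : V →ₗ[F] V} {n : ℕ} {B : Type*} [Ring B]
  [Algebra F B]
variable {X Y Z : List (Arg F V) → V} {a b c γ : ZMod 2}

/-- The Leibniz rule of a series in the last argument, taken with the formal momentum. -/
def IsDer (𝒱 : ZMod 2 → Submodule F V) (ν : WithTop F) (f : List (Arg F V) → V) : Prop :=
  ∀ (l : List (Arg F V)) (γ δ : ZMod 2) (b c : V) (T : F), Hom (parityShift 𝒱) l → b ∈ 𝒱 γ →
    c ∈ 𝒱 δ → ν + momSum l = (T : WithTop F) →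
    f (l ++ [⟨⊤, γ + δ + 1, b * c⟩]) = f (l ++ [⟨⊤, γ + 1, b⟩]) * c +
      sgn γ δ • (f (l ++ [⟨⊤, δ + 1, c⟩]) * b)

theorem IsDer.cons {ν : WithTop F} {f : List (Arg F V) → V} (h : IsDer 𝒱 ν f)
    {w : Arg F V} (hw : w.vec ∈ parityShift 𝒱 w.par) : IsDer 𝒱 (ν + w.mom) fun l => f (w :: l) :=
  fun l γ δ b c T hl hb hc hs => h (w :: l) γ δ b c T (by simp [hw, hl]) hb hc
    (by simpa [add_assoc] using hs)

theorem mem_parityShift {b : V} : b ∈ parityShift 𝒱 (γ + 1) ↔ b ∈ 𝒱 γ := by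
  simp only [parityShift, add_assoc]
  rw [show (1 + 1 : ZMod 2) = 0 from rfl, add_zero]

theorem IsDifferentialSuperalgebra.comm' (hV : IsDifferentialSuperalgebra 𝒱 d) {α β : ZMod 2}
    {a b : V} (ha : a ∈ 𝒱 α) (hb : b ∈ 𝒱 β) : b * a = sgn α β • (a * b) := hV.comm ha hb

theorem mem_of_hasPar (hX : HasPar (parityShift 𝒱) a X) {μ : WithTop F} {b : V} (hb : b ∈ 𝒱 γ) :
    X [⟨μ, γ + 1, b⟩] ∈ 𝒱 (a + γ) := by
  have := hX [⟨μ, γ + 1, b⟩] (by simpa [mem_parityShift] using hb)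
  rw [parSum_cons, parSum_nil, add_zero, ← add_assoc, mem_parityShift] at this
  exact this

theorem bracket_isDer (hV : IsDifferentialSuperalgebra 𝒱 d) {νX νY : F}
    (hX : IsSeries (parityShift 𝒱) d νX X) (hX' : HasPar (parityShift 𝒱) a X) (hX'' : IsDer 𝒱 νX X)
    (hY : IsSeries (parityShift 𝒱) d νY Y) (hY' : HasPar (parityShift 𝒱) b Y)
    (hY'' : IsDer 𝒱 νY Y) : IsDer 𝒱 (νX + νY) (bracket νX a X νY b Y) := by
  intro l γ δ e c T hl he hc h
  induction l generalizing νX νY a b X Y with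
  | nil =>
    have key : ∀ {νX νY : F} {X Y : List (Arg F V) → V} {a b : ZMod 2},
        IsSeries (parityShift 𝒱) d νX X → HasPar (parityShift 𝒱) a X → IsDer 𝒱 νX X →
        HasPar (parityShift 𝒱) b Y → IsSeries (parityShift 𝒱) d νY Y → IsDer 𝒱 νY Y →
        ins [⟨⊤, γ + δ + 1, e * c⟩] νX a X Y = ins [⟨⊤, γ + 1, e⟩] νX a X Y * c +
          sgn γ δ • (ins [⟨⊤, δ + 1, c⟩] νX a X Y * e) +
          (sgn (a + γ) δ • (Y [⟨⊤, δ + 1, c⟩] * X [⟨⊤, γ + 1, e⟩]) +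
          sgn γ δ • sgn (a + δ) γ • (Y [⟨⊤, γ + 1, e⟩] * X [⟨⊤, δ + 1, c⟩])) := by
      intro νX νY X Y a b hX hX' hX'' hY' hY hY''
      have hx : X [] ∈ parityShift 𝒱 a := by simpa using hX' [] (by simp)
      have hsw : ∀ {γ : ZMod 2} {e : V}, e ∈ 𝒱 γ → Y [⟨⊤, γ + 1, e⟩, ⟨νX, a, X []⟩] =
          sgn (γ + 1) a • Y [⟨νX, a, X []⟩, ⟨⊤, γ + 1, e⟩] := fun {γ e} he =>
        hY.swap [] ⟨⊤, γ + 1, e⟩ ⟨νX, a, X []⟩ [] (by simpa [mem_parityShift] using ⟨he, hx⟩)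
          (by simp)
      have h1 := hX'' [] γ δ e c νX (by simp) he hc (by simp)
      have h2 := hY.map_add [] ⊤ (a + (γ + δ + 1)) (X [⟨⊤, γ + 1, e⟩] * c)
        (sgn γ δ • (X [⟨⊤, δ + 1, c⟩] * e)) []
      have h3 := hY.map_smul [] ⊤ (a + (γ + δ + 1)) (sgn γ δ : F) (X [⟨⊤, δ + 1, c⟩] * e) []
      have h4 := hY'' [] (a + γ) δ (X [⟨⊤, γ + 1, e⟩]) c νY (by simp) (mem_of_hasPar hX' he) hc (by simp)
      have h5 := hY'' [] (a + δ) γ (X [⟨⊤, δ + 1, c⟩]) e νY (by simp) (mem_of_hasPar hX' hc) he (by simp)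
      have h6 := hY'' [⟨νX, a, X []⟩] γ δ e c (νY + νX) (by simpa using hx) he hc (by simp)
      simp only [List.nil_append, List.cons_append, Int.cast_smul_eq_zsmul] at h1 h2 h3 h4 h5 h6
      rw [show a + γ + δ + 1 = a + (γ + δ + 1) by abel, show a + γ + 1 = a + (γ + 1) by abel] at h4
      rw [show a + δ + γ + 1 = a + (γ + δ + 1) by abel, show a + δ + 1 = a + (δ + 1) by abel] at h5
      have h7 := hsw (SetLike.mul_mem_graded he hc)
      simp only [ins, WithTop.add_top, h1, h2, h3, h4, h5, h7, hsw he, hsw hc, h6]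
      simp only [smul_add, smul_smul, sgn_add_right, sgn_add_left, add_mul, smul_mul_assoc]
      match_scalars <;> grind [sgn_mul_self, sgn_comm]
    simp only [bracket, List.nil_append]
    rw [key hX hX' hX'' hY' hY hY'', key hY hY' hY'' hX' hX hX'',
      hV.comm' (mem_of_hasPar hX' hc) (mem_of_hasPar hY' he),
      hV.comm' (mem_of_hasPar hX' he) (mem_of_hasPar hY' hc)]
    simp only [smul_add, smul_smul, sgn_add_right, sgn_add_left, sub_mul, smul_sub, smul_mul_assoc]
    match_scalars <;> grind [sgn_mul_self, sgn_comm]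
  | cons w l ih =>
    simp only [hom_cons, momSum_cons] at hl h
    obtain ⟨μ, ε, w⟩ := w
    induction μ with
    | top => simp at h
    | coe μ =>
    have hXc := hX.cons hl.1
    have hYc := hY.cons hl.1
    have hXd := hX''.cons hl.1
    have hYd := hY''.cons hl.1
    simp only [← WithTop.coe_add] at hXc hYc hXd hYd
    simp only [List.cons_append, bracket_cons, ← WithTop.coe_add]
    rw [ih hX hX' hX'' hYc (hY'.cons hl.1) hYd hl.2 (by rw [← h]; push_cast; abel),
      ih hXc (hX'.cons hl.1) hXd hY hY' hY'' hl.2 (by rw [← h]; push_cast; abel)]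
    simp only [smul_add, add_mul, smul_mul_assoc, smul_smul]
    match_scalars <;> ring

/-- The concatenation product of two series, the second one of parity `c`. -/
def conv : List (Arg F V) → ZMod 2 → (List (Arg F V) → B) → (List (Arg F V) → B) → B
  | [], _, Y, Z => Y [] * Z []
  | w :: l, c, Y, Z => conv l (c + w.par) Y (fun q => Z (w :: q)) +
      sgn c w.par • conv l c (fun q => Y (w :: q)) Z

theorem conv_add_left (l : List (Arg F V)) (c : ZMod 2) (Y Y' Z : List (Arg F V) → B) :
    conv l c (fun q => Y q + Y' q) Z = conv l c Y Z + conv l c Y' Z := by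
  induction l generalizing c Y Y' Z with
  | nil => simp [conv, add_mul]
  | cons w l ih => simp only [conv, ih, smul_add]; abel

theorem conv_smul_left (l : List (Arg F V)) (c : ZMod 2) (r : F) (Y Z : List (Arg F V) → B) :
    conv l c (fun q => r • Y q) Z = r • conv l c Y Z := by
  induction l generalizing c Y Z with
  | nil => simp [conv]
  | cons w l ih => simp only [conv, ih, smul_add, smul_comm r]

theorem conv_add_right (l : List (Arg F V)) (c : ZMod 2) (Y Z Z' : List (Arg F V) → B) :
    conv l c Y (fun q => Z q + Z' q) = conv l c Y Z + conv l c Y Z' := by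
  induction l generalizing c Y Z Z' with
  | nil => simp [conv, mul_add]
  | cons w l ih => simp only [conv, ih, smul_add]; abel

theorem conv_smul_right (l : List (Arg F V)) (c : ZMod 2) (r : F) (Y Z : List (Arg F V) → B) :
    conv l c Y (fun q => r • Z q) = r • conv l c Y Z := by
  induction l generalizing c Y Z with
  | nil => simp [conv]
  | cons w l ih => simp only [conv, ih, smul_add, smul_comm r]

theorem conv_zsmul_left (l : List (Arg F V)) (c : ZMod 2) (r : ℤ) (Y Z : List (Arg F V) → B) :
    conv l c (fun q => r • Y q) Z = r • conv l c Y Z := by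
  simpa only [Int.cast_smul_eq_zsmul] using conv_smul_left l c (r : F) Y Z

theorem conv_zsmul_right (l : List (Arg F V)) (c : ZMod 2) (r : ℤ) (Y Z : List (Arg F V) → B) :
    conv l c Y (fun q => r • Z q) = r • conv l c Y Z := by
  simpa only [Int.cast_smul_eq_zsmul] using conv_smul_right l c (r : F) Y Z

theorem conv_assoc (l : List (Arg F V)) (b c : ZMod 2) (X Y Z : List (Arg F V) → V) :
    conv l c (fun q => conv q b X Y) Z = conv l (b + c) X (fun q => conv q c Y Z) := by
  induction l generalizing b c X Y Z with
  | nil => simp [conv, mul_assoc]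
  | cons w l ih =>
    simp only [conv, conv_add_left, conv_add_right, conv_zsmul_left, conv_zsmul_right, ih]
    rw [← add_assoc b c, add_right_comm b w.par]
    simp only [sgn_add_left, smul_add, smul_smul]
    match_scalars <;> ring

theorem conv_comm (hV : IsDifferentialSuperalgebra 𝒱 d) (hX : HasPar (parityShift 𝒱) (a + 1) X)
    (hY : HasPar (parityShift 𝒱) (b + 1) Y) (l : List (Arg F V)) (hl : Hom (parityShift 𝒱) l) :
    conv l a Y X = sgn a b • conv l b X Y := by
  induction l generalizing a b X Y with
  | nil =>
    refine hV.comm' ?_ ?_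
    · simpa [mem_parityShift] using hX [] hl
    · simpa [mem_parityShift] using hY [] hl
  | cons w l ih =>
    simp only [hom_cons] at hl
    have hX' := hX.cons hl.1
    have hY' := hY.cons hl.1
    rw [add_right_comm] at hX' hY'
    simp only [conv, ih hX' hY hl.2, ih hX hY' hl.2, sgn_add_left, sgn_add_right, smul_add,
      smul_smul]
    match_scalars <;> grind [sgn_mul_self, sgn_comm]

theorem HasPar.conv (hY : HasPar (parityShift 𝒱) (b + 1) Y)
    (hZ : HasPar (parityShift 𝒱) (c + 1) Z) : HasPar (parityShift 𝒱) (b + c + 1) fun l => conv l c Y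
    Z := by
  intro l hl
  induction l generalizing b c Y Z with
  | nil =>
    have h1 : Y [] ∈ 𝒱 b := by simpa [mem_parityShift] using hY [] hl
    have h2 : Z [] ∈ 𝒱 c := by simpa [mem_parityShift] using hZ [] hl
    simpa [mem_parityShift, UniversalPVA.conv] using SetLike.mul_mem_graded h1 h2
  | cons w l ih =>
    simp only [hom_cons] at hl
    have hY' := hY.cons hl.1
    have hZ' := hZ.cons hl.1
    rw [add_right_comm] at hY' hZ'
    simp only [UniversalPVA.conv, parSum_cons]
    refine add_mem ?_ (zsmul_mem ?_ _)
    · convert ih hY hZ' hl.2 using 2; abel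
    · convert ih hY' hZ hl.2 using 2; abel

theorem conv_congr {Y Y' Z Z' : List (Arg F V) → B} {l : List (Arg F V)}
    (hl : Hom (parityShift 𝒱) l) (hY : ∀ l, Hom (parityShift 𝒱) l → Y l = Y' l)
    (hZ : ∀ l, Hom (parityShift 𝒱) l → Z l = Z' l) : conv l c Y Z = conv l c Y' Z' := by
  induction l generalizing c Y Y' Z Z' with
  | nil => rw [conv, conv, hY [] hl, hZ [] hl]
  | cons w l ih =>
    simp only [hom_cons] at hl
    rw [conv, conv, ih hl.2 hY fun q hq => hZ _ (by simp [hl.1, hq]),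
      ih hl.2 (fun q hq => hY _ (by simp [hl.1, hq])) hZ]

theorem conv_swap {Y Z : List (Arg F V) → B} (hY : IsSwap (parityShift 𝒱) ⊤ ⊤ Y)
    (hZ : IsSwap (parityShift 𝒱) ⊤ ⊤ Z) : IsSwap (parityShift 𝒱) ⊤ ⊤ fun l => conv l c Y Z := by
  intro l₁ e e' l₂ hl h
  induction l₁ generalizing c Y Z with
  | nil =>
    simp only [List.nil_append, hom_cons] at hl
    simp only [List.nil_append, conv]
    rw [conv_congr hl.2.2 (Y := fun q => Y (e :: e' :: q))
      (fun q hq => hY [] e e' q (by simp [hl.1, hl.2.1, hq]) (by simp)) (fun _ _ => rfl),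
      conv_congr hl.2.2 (Z := fun q => Z (e :: e' :: q)) (fun _ _ => rfl)
      (fun q hq => hZ [] e e' q (by simp [hl.1, hl.2.1, hq]) (by simp))]
    simp only [List.nil_append, conv_zsmul_left, conv_zsmul_right, smul_add, smul_smul,
      sgn_add_left, add_right_comm c e'.par]
    match_scalars <;> grind [sgn_mul_self, sgn_comm]
  | cons w l ih =>
    simp only [List.cons_append, hom_cons] at hl
    simp only [List.cons_append, conv]
    have hY' := hY.cons hl.1
    have hZ' := hZ.cons hl.1
    simp only [WithTop.top_add] at hY' hZ'
    have e1 := ih (c := c + w.par) hY hZ' hl.2 (by simp)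
    have e2 := ih (c := c) hY' hZ hl.2 (by simp)
    beta_reduce at e1 e2
    rw [e1, e2, smul_add, smul_comm (sgn c w.par)]

theorem ins_conv (l : List (Arg F V)) (ν : WithTop F) (a c : ZMod 2) (X Y Z : List (Arg F V) → V) :
    ins l ν a X (fun q => conv q c Y Z) = conv l (c + a) Y (fun q => ins q ν a X Z) +
      sgn c a • conv l c (fun q => ins q ν a X Y) Z := by
  induction l generalizing ν a c X Y Z with
  | nil => simp [ins, conv]
  | cons w l ih =>
    simp only [ins, conv, ins_add_right, ins_zsmul_right, conv_add_left, conv_add_right,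
      conv_zsmul_left, conv_zsmul_right, ih, ← add_assoc, add_right_comm c w.par a]
    simp only [sgn_add_left, sgn_add_right, smul_add, smul_smul]
    match_scalars <;> grind [sgn_mul_self, sgn_comm]

/-- A series whose formal slot is a derivation acts on concatenation products by derivations. -/
theorem ins_conv_left (hV : IsDifferentialSuperalgebra 𝒱 d) {ν : F}
    (hX : IsSeries (parityShift 𝒱) d ν X) (hX' : IsDer 𝒱 ν X) (hXp : HasPar (parityShift 𝒱) a X)
    (hY : HasPar (parityShift 𝒱) (b + 1) Y) (hZ : HasPar (parityShift 𝒱) (c + 1) Z)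
    (l : List (Arg F V)) (hl : Hom (parityShift 𝒱) l) (h : momSum l ≠ ⊤) :
    ins l ⊤ (b + c + 1) (fun q => conv q c Y Z) X = conv l c (fun q => ins q ⊤ (b + 1) Y X) Z +
    sgn a b • conv l (c + a) Y (fun q => ins q ⊤ (c + 1) Z X) := by
  induction l generalizing ν a b c X Y Z with
  | nil =>
    have h1 : Y [] ∈ 𝒱 b := by simpa [mem_parityShift] using hY [] hl
    have h2 : Z [] ∈ 𝒱 c := by simpa [mem_parityShift] using hZ [] hl
    have h3 := hX' [] b c (Y []) (Z []) ν (by simp) h1 h2 (by simp)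
    simp only [List.nil_append] at h3
    simp only [ins, conv, h3]
    rw [hV.comm' h1 (mem_of_hasPar hXp h2), smul_smul, sgn_add_right]
    congr 2
    grind [sgn_mul_self, sgn_comm]
  | cons w l ih =>
    simp only [hom_cons] at hl
    simp only [momSum_cons, ne_eq, WithTop.add_eq_top, not_or] at h
    obtain ⟨μ, ε, w⟩ := w
    lift μ to F using h.1
    have hY' := hY.cons hl.1
    have hZ' := hZ.cons hl.1
    have hXc := hX.cons hl.1
    have hXd := hX'.cons hl.1
    have hXe := hXp.cons hl.1
    simp only [← WithTop.coe_add] at hXc hXd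
    rw [add_right_comm] at hY' hZ'
    simp only [conv, ins, ins_add_left _ _ _ _ _ hX.toIsLin, ins_zsmul_left _ _ _ _ _ hX.toIsLin,
      conv_add_left, conv_add_right, conv_zsmul_left, conv_zsmul_right]
    rw [ih hXc hXd hXe hY hZ hl.2 h.2]
    have e1 := ih hX hX' hXp hY' hZ hl.2 h.2
    have e2 := ih hX hX' hXp hY hZ' hl.2 h.2
    rw [show b + ε + c + 1 = b + c + 1 + ε by abel, show b + ε + 1 = b + 1 + ε by abel] at e1
    rw [show b + (c + ε) + 1 = b + c + 1 + ε by abel, show c + ε + 1 = c + 1 + ε by abel,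
      show c + ε + a = c + a + ε by abel] at e2
    simp only [WithTop.top_add, e1, e2, ← add_assoc]
    simp only [sgn_add_left, sgn_add_right, smul_add, smul_smul]
    match_scalars <;> grind [sgn_mul_self, sgn_comm]

theorem conv_shiftD (hd : ∀ a b, d (a * b) = d a * b + a * d b) (l : List (Arg F V))
    (c c' : F) (b : ZMod 2) (Y Z : List (Arg F V) → V) :
    shiftD d (c + c') (fun q => conv q b Y Z) l =
      conv l b (shiftD d c Y) Z + conv l b Y (shiftD d c' Z) := by
  induction l generalizing c c' b Y Z with
  | nil =>
    simp only [conv, shiftD, finSum_nil, add_zero, hd, add_mul, mul_add, smul_mul_assoc,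
      mul_smul_comm]
    module
  | cons w l ih =>
    have e : ∀ c Y, (fun q => shiftD d c Y (w :: q)) =
        shiftD d (c + w.mom.untopD 0) (fun q => Y (w :: q)) :=
      fun c Y => funext fun q => shiftD_cons c Y w q
    have hs : ∀ c Y, shiftD d c Y l = d (Y l) + (c + finSum l) • Y l := fun _ _ => rfl
    rw [shiftD_cons]
    simp only [conv, e]
    have h1 := ih c (c' + w.mom.untopD 0) (b + w.par) Y (fun q => Z (w :: q))
    have h2 := ih (c + w.mom.untopD 0) c' b (fun q => Y (w :: q)) Z
    rw [← add_assoc] at h1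
    rw [add_right_comm] at h2
    simp only [hs, map_add, map_zsmul] at h1 h2 ⊢
    linear_combination (norm := module) h1 + sgn b w.par • h2

theorem conv_unit_left (l : List (Arg F V)) (c : ZMod 2) (Y Z : List (Arg F V) → V)
    (hY : ∀ w q, Y (w :: q) = 0) : conv l c Y Z = Y [] * Z l := by
  induction l generalizing c Z with
  | nil => rfl
  | cons w l ih =>
    have h : conv l c (fun q => Y (w :: q)) Z = 0 := by
      simp only [hY]
      simpa using conv_smul_left l c (0 : F) (fun _ => 0) Z
    rw [conv, ih, h, smul_zero, add_zero]

theorem conv_unit_right (l : List (Arg F V)) (Y Z : List (Arg F V) → V)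
    (hZ : ∀ w q, Z (w :: q) = 0) : conv l 0 Y Z = Y l * Z [] := by
  induction l generalizing Y with
  | nil => rfl
  | cons w l ih =>
    have h : ∀ c, conv l c Y (fun q => Z (w :: q)) = 0 := fun c => by
      simp only [hZ]
      simpa using conv_smul_right l c (0 : F) Y (fun _ => 0)
    rw [conv, ih, h, sgn_zero_left, one_smul, zero_add]

end Derivations

section Evaluation

variable {F : Type*} [Field F] {U : Type*} [AddCommGroup U] [Module F U] {d : U →ₗ[F] U}
  {n : ℕ} {σ σ' : Type*}
variable {ν : F} {P : Pol (Fin n) F U}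

theorem aeval_apply_comm (q : Polynomial F) (u : U) :
    Polynomial.aeval (R := F) (d : Module.End F U) q (d u) =
      d (Polynomial.aeval (R := F) (d : Module.End F U) q u) := by
  have h : Polynomial.aeval (R := F) (d : Module.End F U) (q * Polynomial.X) =
    Polynomial.aeval (R := F) (d : Module.End F U) (Polynomial.X * q) := by rw [mul_comm]
  rw [map_mul, map_mul, Polynomial.aeval_X] at h
  exact LinearMap.congr_fun h u

/-- The value of an element of `F[λ] ⊗ U` at a point `τ` whose coordinates are polynomials in the
operator `d`. -/
noncomputable def evP (d : U →ₗ[F] U) (τ : σ → Polynomial F) : Pol σ F U →ₗ[F] U :=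
  TensorProduct.lift ((Polynomial.aeval (R := F) (d : Module.End F U)).toLinearMap ∘ₗ
    (MvPolynomial.aeval τ).toLinearMap)

@[simp] theorem evP_tmul (τ : σ → Polynomial F) (p : MvPolynomial σ F) (u : U) :
    evP d τ (p ⊗ₜ[F] u) =
      Polynomial.aeval (R := F) (d : Module.End F U) (MvPolynomial.aeval τ p) u := rfl

theorem evP_smul (τ : σ → Polynomial F) (p : MvPolynomial σ F) (P : Pol σ F U) :
    evP d τ (p • P) =
      Polynomial.aeval (R := F) (d : Module.End F U) (MvPolynomial.aeval τ p) (evP d τ P) := by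
  induction P using TensorProduct.induction_on with
  | zero => simp
  | tmul q u => simp [TensorProduct.smul_tmul']
  | add P Q hP hQ => simp only [smul_add, map_add, hP, hQ]

/-- The substitution of a point in a polynomial in `λ` and `∂`. -/
noncomputable def bindP (τ : σ → Polynomial F) :
    Polynomial (MvPolynomial σ F) →ₐ[F] Polynomial F :=
  { Polynomial.eval₂RingHom (MvPolynomial.aeval τ : MvPolynomial σ F →ₐ[F] Polynomial F).toRingHom
      Polynomial.X with
    commutes' := fun r => by
      simp [IsScalarTower.algebraMap_apply F (MvPolynomial σ F) (Polynomial (MvPolynomial σ F))] }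

@[simp] theorem bindP_C (τ : σ → Polynomial F) (p : MvPolynomial σ F) :
    bindP τ (Polynomial.C p) = MvPolynomial.aeval τ p := by
  simp [bindP]

@[simp] theorem bindP_lam (τ : σ → Polynomial F) (s : σ) : bindP τ (lam s) = τ s := by
  simp [bindP, lam]

@[simp] theorem bindP_del (τ : σ → Polynomial F) : bindP τ del = Polynomial.X := by
  simp [bindP, del]

theorem evP_opAction (τ : σ → Polynomial F) (q : Polynomial (MvPolynomial σ F)) (P : Pol σ F U) :
    evP d τ (opAction d q P) =
      Polynomial.aeval (R := F) (d : Module.End F U) (bindP τ q) (evP d τ P) := by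
  have hX : ∀ P : Pol σ F U, evP d τ (d.baseChange (MvPolynomial σ F) P) = d (evP d τ P) := by
    intro P
    induction P using TensorProduct.induction_on with
    | zero => simp
    | tmul q u =>
      simp only [LinearMap.baseChange_tmul, evP_tmul]
      exact aeval_apply_comm _ u
    | add P Q hP hQ => simp only [map_add, hP, hQ]
  induction q using Polynomial.induction_on generalizing P with
  | C p => simp [opAction, Polynomial.aeval_C, evP_smul, Module.algebraMap_end_apply]
  | add p q hp hq =>
    have : opAction d (p + q) P = opAction d p P + opAction d q P := by simp [opAction]
    simp only [this, map_add, hp, hq, LinearMap.add_apply]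
  | monomial n p h =>
    have : opAction d (Polynomial.C p * Polynomial.X ^ (n + 1)) P =
        opAction d (Polynomial.C p * Polynomial.X ^ n) (d.baseChange (MvPolynomial σ F) P) := by
      simp only [opAction, pow_succ, ← mul_assoc, map_mul, Polynomial.aeval_X, Module.End.mul_apply]
    rw [this, h, hX, pow_succ, ← mul_assoc, map_mul (bindP τ) (_ * _)]
    simp only [map_mul, Module.End.mul_apply]
    congr 1
    rw [show bindP τ Polynomial.X = Polynomial.X from bindP_del τ, Polynomial.aeval_X]

theorem subst_tmul (θ : σ → Polynomial (MvPolynomial σ' F)) (p : MvPolynomial σ F) (u : U) :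
    subst d θ (p ⊗ₜ[F] u) =
      opAction d (MvPolynomial.aeval θ p) ((1 : MvPolynomial σ' F) ⊗ₜ[F] u) := rfl

theorem evP_subst (τ : σ' → Polynomial F) (θ : σ → Polynomial (MvPolynomial σ' F))
    (P : Pol σ F U) : evP d τ (subst d θ P) = evP d (fun s => bindP τ (θ s)) P := by
  induction P using TensorProduct.induction_on with
  | zero => simp
  | tmul p u =>
    rw [subst_tmul, evP_opAction, evP_tmul, evP_tmul, map_one, map_one, Module.End.one_apply]
    have : (bindP τ).comp (MvPolynomial.aeval θ) = MvPolynomial.aeval fun s => bindP τ (θ s) := by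
      ext; simp
    rw [← this]; rfl
  | add P Q hP hQ => simp only [map_add, hP, hQ]

theorem evP_renameVars (τ : σ' → Polynomial F) (f : σ → σ') (P : Pol σ F U) :
    evP d τ (renameVars f P) = evP d (fun s => τ (f s)) P := by
  induction P using TensorProduct.induction_on with
  | zero => simp
  | tmul p u => simp [renameVars, MvPolynomial.aeval_rename, Function.comp_def]
  | add P Q hP hQ => simp only [map_add, hP, hQ]

theorem extend_tmul {U' : Type*} [AddCommGroup U'] [Module F U'] (f : U →ₗ[F] Pol σ F U')
    (p : MvPolynomial σ F) (u : U) : extend f (p ⊗ₜ[F] u) = p • f u := by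
  simp [extend]

theorem evP_extend {U' : Type*} [AddCommGroup U'] [Module F U'] {d' : U' →ₗ[F] U'}
    (f : U →ₗ[F] Pol σ F U') (τ τ' : σ → Polynomial F)
    (h : ∀ s u, evP d' τ (f (Polynomial.aeval (R := F) (d : Module.End F U) (τ' s) u)) =
      Polynomial.aeval (R := F) (d' : Module.End F U') (τ s) (evP d' τ (f u))) (P : Pol σ F U) :
    evP d' τ (extend f P) = evP d' τ (f (evP d τ' P)) := by
  induction P using TensorProduct.induction_on with
  | zero => simp
  | tmul p u =>
    rw [extend_tmul, evP_smul, evP_tmul]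
    induction p using MvPolynomial.induction_on generalizing u with
    | C r => simp [Polynomial.aeval_C, Module.algebraMap_end_apply]
    | add p q hp hq => simp only [map_add, LinearMap.add_apply, hp, hq]
    | mul_X p s hp =>
      simp only [map_mul, MvPolynomial.aeval_X, Module.End.mul_apply]
      rw [← hp, h]
  | add P Q hP hQ => simp only [map_add, hP, hQ]

theorem aeval_C_apply (c : F) (u : U) :
    Polynomial.aeval (R := F) (d : Module.End F U) (Polynomial.C c) u = c • u := by
  simp [Polynomial.aeval_C, Module.algebraMap_end_apply]

/-- The extension of a linear map evaluated at a point of the base field. -/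
theorem evP_extend_C {U' : Type*} [AddCommGroup U'] [Module F U'] {d' : U' →ₗ[F] U'}
    (f : U →ₗ[F] Pol σ F U') (τ : σ → F) (P : Pol σ F U) :
    evP d' (fun s => Polynomial.C (τ s)) (extend f P) =
      evP d' (fun s => Polynomial.C (τ s)) (f (evP d (fun s => Polynomial.C (τ s)) P)) :=
  evP_extend f _ _ (fun s u => by simp only [aeval_C_apply, map_smul]) P

theorem evP_totalD [Fintype σ] (τ : σ → Polynomial F) (P : Pol σ F U) :
    evP d τ (totalD d P) = Polynomial.aeval (R := F) (d : Module.End F U)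
      (∑ s, τ s + Polynomial.X) (evP d τ P) := by
  simp [totalD, evP_opAction]

/-- Over an infinite field an element of `F[λ] ⊗ U` is determined by its values. -/
theorem eq_zero_of_evP [Infinite F] {P : Pol σ F U}
    (h : ∀ τ : σ → F, evP d (fun s => Polynomial.C (τ s)) P = 0) : P = 0 := by
  classical
  let b := Module.Basis.ofVectorSpace F U
  refine (TensorProduct.equivFinsuppOfBasisRight b).injective ?_
  rw [map_zero]
  ext1 j
  refine MvPolynomial.funext fun x => ?_
  have key : ∀ P : Pol σ F U, MvPolynomial.eval x (TensorProduct.equivFinsuppOfBasisRight b P j) =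
      b.coord j (evP d (fun s => Polynomial.C (x s)) P) := by
    intro P
    induction P using TensorProduct.induction_on with
    | zero => simp
    | tmul p u =>
      rw [TensorProduct.equivFinsuppOfBasisRight_apply_tmul, evP_tmul]
      have : MvPolynomial.aeval (fun s => Polynomial.C (x s)) p =
          Polynomial.C (MvPolynomial.eval x p) := by
        have := (MvPolynomial.comp_aeval_apply (R := F) x (Polynomial.CAlgHom (R := F) (A := F)) p)
        simpa [MvPolynomial.aeval_eq_eval] using this.symm
      rw [this, aeval_C_apply]
      simp [mul_comm, MvPolynomial.smul_eval]
    | add P Q hP hQ => simp only [map_add, Finsupp.add_apply, hP, hQ]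
  rw [key, h, map_zero]; simp

theorem aeval_sub_mem {R : Type*} [CommRing R] [Algebra F R] {I : Ideal R} {θ θ' : σ → R}
    (h : ∀ s, θ s - θ' s ∈ I) (p : MvPolynomial σ F) :
    MvPolynomial.aeval θ p - MvPolynomial.aeval θ' p ∈ I := by
  rw [← Ideal.Quotient.eq]
  have : (Ideal.Quotient.mkₐ F I).comp (MvPolynomial.aeval θ) =
      (Ideal.Quotient.mkₐ F I).comp (MvPolynomial.aeval θ') := by
    ext s
    simpa using Ideal.Quotient.eq.2 (h s)
  exact DFunLike.congr_fun this p

theorem evP_sub_eq {τ τ' : σ → Polynomial F} {q : Polynomial F}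
    (h : ∀ s, τ s - τ' s ∈ Ideal.span {q}) (P : Pol σ F U) :
    ∃ u, evP d τ P - evP d τ' P = Polynomial.aeval (R := F) (d : Module.End F U) q u := by
  induction P using TensorProduct.induction_on with
  | zero => exact ⟨0, by simp⟩
  | tmul p u =>
    obtain ⟨r, hr⟩ := Ideal.mem_span_singleton'.1 (aeval_sub_mem h p)
    refine ⟨Polynomial.aeval (R := F) (d : Module.End F U) r u, ?_⟩
    rw [evP_tmul, evP_tmul, ← Module.End.mul_apply, ← map_mul, mul_comm q, hr, map_sub,
      LinearMap.sub_apply]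
  | add P Q hP hQ =>
    obtain ⟨u, hu⟩ := hP
    obtain ⟨v, hv⟩ := hQ
    exact ⟨u + v, by rw [map_add, map_add, map_add, ← hu, ← hv]; abel⟩

theorem subst_sub_mem {θ θ' : σ → Polynomial (MvPolynomial σ' F)}
    {q : Polynomial (MvPolynomial σ' F)} (h : ∀ s, θ s - θ' s ∈ Ideal.span {q}) (P : Pol σ F U) :
    subst d θ P - subst d θ' P ∈ LinearMap.range (opAction d q) := by
  induction P using TensorProduct.induction_on with
  | zero => simp
  | tmul p u =>
    obtain ⟨r, hr⟩ := Ideal.mem_span_singleton'.1 (aeval_sub_mem h p)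
    refine ⟨opAction d r (1 ⊗ₜ u), ?_⟩
    rw [subst_tmul, subst_tmul]
    simp only [opAction]
    rw [← Module.End.mul_apply, ← map_mul, mul_comm q, hr, map_sub, LinearMap.sub_apply]
  | add P Q hP hQ =>
    rw [map_add, map_add, add_sub_add_comm]
    exact add_mem hP hQ

theorem subst_lam (P : Pol σ F U) : subst d lam P = P := by
  induction P using TensorProduct.induction_on with
  | zero => simp
  | tmul p u =>
    rw [subst_tmul]
    have : (MvPolynomial.aeval lam : MvPolynomial σ F →ₐ[F] Polynomial (MvPolynomial σ F)) p =
        Polynomial.C p := by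
      induction p using MvPolynomial.induction_on with
      | C r =>
        rw [← MvPolynomial.algebraMap_eq, AlgHom.commutes, MvPolynomial.algebraMap_eq]
        simp [IsScalarTower.algebraMap_apply F (MvPolynomial σ F) (Polynomial (MvPolynomial σ F))]
      | add p q hp hq => simp [hp, hq]
      | mul_X p s hp => simp [hp, lam]
    rw [this, opAction, Polynomial.aeval_C, Module.algebraMap_end_apply]
    simp [TensorProduct.smul_tmul']
  | add P Q hP hQ => simp only [map_add, hP, hQ]

/-- The values considered trivial for maps of total momentum `ν`. -/
noncomputable def nullPol (d : U →ₗ[F] U) (n : ℕ) : WithTop F → Submodule F (Pol (Fin n) F U)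
  | none => ⊥
  | some ν => LinearMap.range
      ((totalD (σ := Fin n) d).restrictScalars F + ν • LinearMap.id : Pol (Fin n) F U →ₗ[F] _)

theorem mem_nullPol_top {n : ℕ} {P : Pol (Fin n) F U} : P ∈ nullPol d n ⊤ ↔ P = 0 := Iff.rfl

theorem mem_nullPol_coe {n : ℕ} {P : Pol (Fin n) F U} : P ∈ nullPol d n ν ↔ ∃ Q, totalD d Q +
    ν • Q = P := Iff.rfl

theorem mem_nullPol_zero {n : ℕ} {P : Pol (Fin n) F U} :
    P ∈ nullPol d n ((0 : F) : WithTop F) ↔ toQ d P = 0 := by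
  rw [mem_nullPol_coe, toQ]
  simp [Submodule.Quotient.mk_eq_zero]

theorem evP_of_mem_nullPol {n : ℕ} {P : Pol (Fin n) F U} (hP : P ∈ nullPol d n ν)
    {τ : Fin n → Polynomial F} (hτ : ∑ s, τ s + Polynomial.X = -Polynomial.C ν) : evP d τ P = 0
    := by
  obtain ⟨Q, rfl⟩ := mem_nullPol_coe.1 hP
  rw [map_add, evP_totalD, hτ, map_smul, map_neg, LinearMap.neg_apply, aeval_C_apply,
    neg_add_cancel]

theorem evP_C_of_mem_nullPol {n : ℕ} {P : Pol (Fin n) F U} (hP : P ∈ nullPol d n ν)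
    (x : Fin n → F) : ∃ u, evP d (fun s => Polynomial.C (x s)) P = d u + (ν + ∑ s, x s) • u := by
  obtain ⟨Q, rfl⟩ := mem_nullPol_coe.1 hP
  refine ⟨evP d (fun s => Polynomial.C (x s)) Q, ?_⟩
  rw [map_add, evP_totalD, ← map_sum, map_add, LinearMap.add_apply, aeval_C_apply,
    Polynomial.aeval_X, map_smul]
  module

theorem mem_nullPol_of_evP [Infinite F] {n : ℕ} {P : Pol (Fin n) F U} (i : Fin n)
    (h : ∀ τ : Fin n → Polynomial F, (∀ j, j ≠ i → ∃ x, τ j = Polynomial.C x) → ∑ s, τ s +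
    Polynomial.X = -Polynomial.C ν → evP d τ P = 0) : P ∈ nullPol d n ν := by
  let θ : Fin n → Polynomial (MvPolynomial (Fin n) F) :=
    Function.update lam i (-algebraMap F _ ν - ∑ j ∈ Finset.univ.erase i, lam j - del)
  have hθ : ∀ j ∈ Finset.univ.erase i, θ j = lam j := fun j hj =>
    Function.update_of_ne (Finset.ne_of_mem_erase hj) _ _
  have hi : θ i = -algebraMap F _ ν - ∑ j ∈ Finset.univ.erase i, lam j - del :=
    Function.update_self _ _ _
  have h0 : subst d θ P = 0 := by
    refine eq_zero_of_evP (d := d) fun x => ?_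
    rw [evP_subst]
    refine h _ (fun j hj => ⟨x j, by simp [θ, Function.update_of_ne hj]⟩) ?_
    have e : ∀ j ∈ Finset.univ.erase i, bindP (fun s => Polynomial.C (x s)) (θ j) =
      Polynomial.C (x j) := fun j hj => by rw [hθ j hj, bindP_lam]
    rw [← Finset.add_sum_erase _ _ (Finset.mem_univ i), hi, Finset.sum_congr rfl e]
    simp only [map_sub, map_neg, map_sum, bindP_lam, bindP_del,
      AlgHom.commutes, Polynomial.algebraMap_eq]
    abel
  have h1 := subst_sub_mem (d := d) (θ := lam) (θ' := θ)
    (q := (∑ s, lam s + del) + algebraMap F _ ν) (fun s => ?_) P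
  · rw [h0, sub_zero, subst_lam] at h1
    obtain ⟨Q, hQ⟩ := h1
    refine mem_nullPol_coe.2 ⟨Q, ?_⟩
    rw [← hQ, totalD, opAction, opAction, map_add _ _ (algebraMap F _ ν), LinearMap.add_apply,
      IsScalarTower.algebraMap_apply F (MvPolynomial (Fin n) F)
      (Polynomial (MvPolynomial (Fin n) F)), Polynomial.algebraMap_eq, Polynomial.aeval_C,
      Module.algebraMap_end_apply, algebraMap_smul]
  · by_cases hs : s = i
    · subst hs
      refine Ideal.mem_span_singleton'.2 ⟨1, ?_⟩
      rw [hi, ← Finset.add_sum_erase _ _ (Finset.mem_univ s)]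
      ring
    · rw [hθ s (by simp [hs]), sub_self]
      exact zero_mem _

/-- A value that is trivial for every total momentum vanishes. -/
theorem eq_zero_of_mem_nullPol [Infinite F] {n : ℕ} {P : Pol (Fin (n + 1)) F U}
    (h : ∀ ν : F, ν ≠ 0 → P ∈ nullPol d (n + 1) ν) : P = 0 := by
  let θ : Fin (n + 1) → Polynomial (MvPolynomial (Fin (n + 1)) F) :=
    Fin.snoc (fun i : Fin n => lam i.castSucc) (-lam (Fin.last n) - del)
  let q : MvPolynomial (Fin (n + 1)) F :=
    MvPolynomial.X (Fin.last n) - ∑ i : Fin n, MvPolynomial.X i.castSucc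
  have hq : q ≠ 0 := fun hq => by
    have := congrArg (MvPolynomial.eval (Fin.snoc (fun _ => 0) 1 : Fin (n + 1) → F)) hq
    simp [q] at this
  have h0 : q • subst d θ P = 0 := by
    refine eq_zero_of_evP (d := d) fun x => ?_
    rw [evP_smul, evP_subst]
    by_cases hx : x (Fin.last n) - ∑ i : Fin n, x i.castSucc = 0
    · have : MvPolynomial.aeval (fun s => Polynomial.C (x s)) q = 0 := by
        simp only [q, map_sub, map_sum, MvPolynomial.aeval_X]
        rw [← map_sum, ← map_sub, hx, map_zero]
      rw [this, map_zero, LinearMap.zero_apply]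
    · rw [evP_of_mem_nullPol (h _ hx), map_zero]
      rw [Fin.sum_univ_castSucc]
      simp only [θ, Fin.snoc_castSucc, Fin.snoc_last, map_sub, map_neg, map_sum, bindP_lam, bindP_del]
      abel
  have h0 := (smul_eq_zero.1 h0).resolve_left hq
  refine eq_zero_of_evP (d := d) fun x => ?_
  have h1 := congrArg (evP d (Fin.snoc (fun i : Fin n => Polynomial.C (x i.castSucc))
    (-Polynomial.C (x (Fin.last n)) - Polynomial.X) : Fin (n + 1) → Polynomial F)) h0
  rw [evP_subst, map_zero] at h1
  rw [← h1]
  congr 2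
  funext s
  refine Fin.lastCases ?_ (fun i => ?_) s <;> simp [θ]

theorem totalD_injective [Infinite F] {n : ℕ} : Function.Injective (totalD d : Pol (Fin (n + 1)) F U →ₗ[_] _) := by
  refine (injective_iff_map_eq_zero _).2 fun P hP => eq_zero_of_mem_nullPol (d := d) fun ν hν =>
    mem_nullPol_coe.2 ⟨ν⁻¹ • P, ?_⟩
  rw [smul_smul, mul_inv_cancel₀ hν, one_smul]
  have : totalD d (ν⁻¹ • P) = ν⁻¹ • totalD d P := map_smul ((totalD d).restrictScalars F) _ _
  rw [this, hP, smul_zero, zero_add]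

end Evaluation

section Tuples

variable {α : Type*}

/-! ### Lists and tuples -/

theorem exists_ofFn_update (l₁ : List α) (a₀ : α) (l₂ : List α) : ∃ (n : ℕ) (e : Fin n → α)
    (i : Fin n), i.val = l₁.length ∧ n = l₁.length + l₂.length + 1 ∧
      ∀ a, l₁ ++ a :: l₂ = List.ofFn (Function.update e i a) := by
  refine ⟨l₁.length + l₂.length + 1, fun k => (l₁ ++ a₀ :: l₂)[k.val]'(by simp; omega),
    ⟨l₁.length, by omega⟩, rfl, rfl, fun a => ?_⟩
  refine List.ext_getElem (by simp; omega) fun k h1 h2 => ?_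
  simp only [List.getElem_ofFn, Function.update_apply, Fin.mk.injEq]
  split_ifs with h
  · subst h; simp
  · rcases lt_or_gt_of_ne h with h | h
    · rw [List.getElem_append_left h, List.getElem_append_left h]
    · rw [List.getElem_append_right h.le, List.getElem_append_right h.le]
      obtain ⟨m, hm⟩ : ∃ m, k - l₁.length = m + 1 := ⟨k - l₁.length - 1, by omega⟩
      simp only [hm, List.getElem_cons_succ]

theorem exists_ofFn_swap (l₁ : List α) (a b : α) (l₂ : List α) : ∃ (n : ℕ) (e : Fin n → α)
    (i j : Fin n), j.val = i.val + 1 ∧ e i = a ∧ e j = b ∧ l₁ ++ a :: b :: l₂ = List.ofFn e ∧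
      l₁ ++ b :: a :: l₂ = List.ofFn (e ∘ Equiv.swap i j) := by
  let e : Fin (l₁.length + l₂.length + 2) → α :=
    fun k => (l₁ ++ a :: b :: l₂)[k.val]'(by simp; omega)
  refine ⟨_, e, ⟨l₁.length, by omega⟩, ⟨l₁.length + 1, by omega⟩, rfl, ?_, ?_, ?_, ?_⟩
  · simp [e]
  · simp [e, List.getElem_append_right]
  · exact List.ext_getElem (by simp; omega) fun k h1 h2 => by
      simp only [List.getElem_ofFn, e]
  · refine List.ext_getElem (by simp; omega) fun k h1 h2 => ?_
    simp only [List.getElem_ofFn, Function.comp, Equiv.swap_apply_def, Fin.mk.injEq, e]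
    split_ifs with h h'
    · subst h; simp [List.getElem_append_right]
    · subst h'; simp [List.getElem_append_right]
    · rcases lt_or_ge k l₁.length with h2 | h2
      · rw [List.getElem_append_left h2, List.getElem_append_left h2]
      · rw [List.getElem_append_right h2, List.getElem_append_right h2]
        obtain ⟨m, hm⟩ : ∃ m, k - l₁.length = m + 2 := ⟨k - l₁.length - 2, by omega⟩
        simp only [hm, List.getElem_cons_succ]

theorem permSign_swap {n : ℕ} (β : Fin n → ZMod 2) (i j : Fin n) (h : j.val = i.val + 1) :
    permSign β (Equiv.swap i j) = (-1) ^ (β i * β j) := by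
  have hij : i ≠ j := fun e => by rw [e] at h; omega
  rw [permSign, Finset.prod_eq_single i, Finset.prod_eq_single j]
  · rw [if_pos]
    · rw [Equiv.swap_apply_left, Equiv.swap_apply_right, mul_comm]
    · rw [Equiv.swap_apply_left, Equiv.swap_apply_right]; exact ⟨by omega, by omega⟩
  · intro b _ hb
    rw [if_neg]
    rintro ⟨h1, h2⟩
    rw [Equiv.swap_apply_left, Equiv.swap_apply_of_ne_of_ne (by omega) hb] at h2
    omega
  · simp
  · intro a _ ha
    refine Finset.prod_eq_one fun b _ => if_neg ?_
    rintro ⟨h1, h2⟩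
    simp only [Equiv.swap_apply_def] at h2
    split_ifs at h2 <;> omega
  · simp

end Tuples

section Momenta

variable {F : Type*} [Field F]
variable {ν : WithTop F}

/-- `1` for the formal momentum and `0` for the others. -/
noncomputable def topCount : WithTop F → ℕ
  | none => 1
  | some _ => 0

@[simp] theorem topCount_top : topCount (⊤ : WithTop F) = 1 := rfl
@[simp] theorem topCount_coe (μ : F) : topCount (μ : WithTop F) = 0 := rfl

theorem topCount_eq_zero {μ : WithTop F} : topCount μ = 0 ↔ μ ≠ ⊤ := by
  induction μ with
  | top => simp
  | coe μ => simp

/-- The value of the variable of an argument of momentum `μ`, the sum of the finite momenta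
being `N`. -/
noncomputable def tau (N : F) : WithTop F → Polynomial F
  | none => -Polynomial.C N - Polynomial.X
  | some μ => Polynomial.C μ

@[simp] theorem tau_top (N : F) : tau N ⊤ = -Polynomial.C N - Polynomial.X := rfl
@[simp] theorem tau_coe (N μ : F) : tau N (μ : WithTop F) = Polynomial.C μ := rfl

theorem tau_eq (N : F) (μ : WithTop F) :
    tau N μ = Polynomial.C (μ.untopD 0) + topCount μ • (-Polynomial.C N - Polynomial.X) := by
  induction μ with
  | top => simp
  | coe μ => simp

theorem sum_tau {ι : Type*} (s : Finset ι) (N : F) (m : ι → WithTop F) :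
    ∑ j ∈ s, tau N (m j) = Polynomial.C (∑ j ∈ s, (m j).untopD 0) +
      (∑ j ∈ s, topCount (m j)) • (-Polynomial.C N - Polynomial.X) := by
  simp only [tau_eq, Finset.sum_add_distrib, map_sum, Finset.sum_smul]

theorem topCount_add_eq_zero {ι : Type*} {s : Finset ι} {m : ι → WithTop F} {T : F}
    (h : ν + ∑ j ∈ s, m j = T) : topCount ν + ∑ j ∈ s, topCount (m j) = 0 ∧ ν.untopD 0 + ∑ j ∈ s,
    (m j).untopD 0 = T := by
  have h1 : ν ≠ ⊤ := by rintro rfl; simp at h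
  have h2 : ∀ j ∈ s, m j ≠ ⊤ := by
    intro j hj e
    rw [WithTop.sum_eq_top.2 ⟨j, hj, e⟩] at h
    simp at h
  refine ⟨?_, ?_⟩
  · rw [topCount_eq_zero.2 h1, Finset.sum_eq_zero fun j hj => topCount_eq_zero.2 (h2 j hj), add_zero]
  · have h3 : ∀ j ∈ s, m j = ((m j).untopD 0 : F) := fun j hj => by
      lift m j to F using h2 j hj with x; rfl
    rw [Finset.sum_congr rfl h3, ← WithTop.coe_sum] at h
    lift ν to F using h1
    rw [← WithTop.coe_add, WithTop.coe_inj] at h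
    simpa using h

theorem one_le_topCount_add {ι : Type*} {s : Finset ι} {m : ι → WithTop F}
    (h : ν + ∑ j ∈ s, m j = ⊤) : 1 ≤ topCount ν + ∑ j ∈ s, topCount (m j) := by
  by_contra! hc
  have h0 : topCount ν = 0 ∧ ∑ j ∈ s, topCount (m j) = 0 := by omega
  rw [WithTop.add_eq_top, WithTop.sum_eq_top] at h
  rcases h with h | ⟨j, hj, h⟩
  · exact topCount_eq_zero.1 h0.1 h
  · exact topCount_eq_zero.1 (Finset.sum_eq_zero_iff.1 h0.2 j hj) h

end Momenta

section Values

variable {F : Type*} [Field F] {V : Type*} [AddCommGroup V] [Module F V]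
  {d : V →ₗ[F] V} {n : ℕ}

/-- The value of a map of total momentum `ν` on arguments with momenta, at most one of which is
formal. -/
noncomputable def evC (d : V →ₗ[F] V) (ν : WithTop F) (X : Cochain F V n) (e : Fin n → Arg F V) :
    V :=
  if topCount ν + ∑ j, topCount (e j).mom ≤ 1 then
    evP d (fun i => tau (ν.untopD 0 + ∑ j, (e j).mom.untopD 0) (e i).mom) (X fun i => (e i).vec)
  else 0

/-- The series of a family of maps, taken with total momentum `ν`. -/
noncomputable def ser (d : V →ₗ[F] V) (ν : WithTop F) (X : ∀ n, Cochain F V n)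
    (l : List (Arg F V)) : V :=
  evC d ν (X l.length) l.get

theorem ser_ofFn (ν : WithTop F) (X : ∀ n, Cochain F V n) (e : Fin n → Arg F V) :
    ser d ν X (List.ofFn e) = evC d ν (X n) e := by
  have : ∀ (l : List (Arg F V)) (n : ℕ) (e : Fin n → Arg F V), l = List.ofFn e →
      ser d ν X l = evC d ν (X n) e := by
    intro l n e h
    have hn : l.length = n := by simp [h]
    subst hn
    have : l.get = e := List.ofFn_injective ((List.ofFn_get l).trans h)
    rw [ser, this]
  exact this _ _ _ rfl

theorem momSum_ofFn (e : Fin n → Arg F V) : momSum (List.ofFn e) = ∑ i, (e i).mom := by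
  simp [momSum, List.map_ofFn, List.sum_ofFn]

theorem parSum_ofFn (e : Fin n → Arg F V) : parSum (List.ofFn e) = ∑ i, (e i).par := by
  simp [parSum, List.map_ofFn, List.sum_ofFn]

theorem hom_ofFn {𝒰 : ZMod 2 → Submodule F V} {e : Fin n → Arg F V} :
    Hom 𝒰 (List.ofFn e) ↔ ∀ i, (e i).vec ∈ 𝒰 (e i).par := by
  simp [Hom, List.forall_mem_ofFn_iff]

theorem mom_update (e : Fin n → Arg F V) (i : Fin n) (a : Arg F V) :
    (fun j => (Function.update e i a j).mom) = Function.update (fun k => (e k).mom) i a.mom :=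
  funext fun j => Function.apply_update (fun _ => Arg.mom) e i a j

theorem vec_update (e : Fin n → Arg F V) (i : Fin n) (a : Arg F V) :
    (fun j => (Function.update e i a j).vec) = Function.update (fun k => (e k).vec) i a.vec :=
  funext fun j => Function.apply_update (fun _ => Arg.vec) e i a j

theorem evC_update (ν : WithTop F) (X : Cochain F V n) (e : Fin n → Arg F V) (i : Fin n)
    (μ : WithTop F) (β : ZMod 2) (x : V) :
    evC d ν X (Function.update e i ⟨μ, β, x⟩) =
      if topCount ν + ∑ j, topCount (Function.update (fun k => (e k).mom) i μ j) ≤ 1 then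
        evP d (fun j => tau (ν.untopD 0 +
          ∑ j, (Function.update (fun k => (e k).mom) i μ j).untopD 0)
            (Function.update (fun k => (e k).mom) i μ j))
          (X (Function.update (fun k => (e k).vec) i x))
      else 0 := by
  have h := mom_update e i ⟨μ, β, x⟩
  have h' := vec_update e i ⟨μ, β, x⟩
  simp only at h h'
  rw [evC, h', ← h]

theorem isLin_ser (ν : WithTop F) (X : ∀ n, Cochain F V n) : IsLin (ser d ν X) where
  map_add l₁ μ β x y l₂ := by
    obtain ⟨n, e, i, -, -, h⟩ := exists_ofFn_update l₁ ⟨μ, β, x⟩ l₂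
    simp only [h, ser_ofFn, evC_update, MultilinearMap.map_update_add, map_add]
    split_ifs <;> simp
  map_smul l₁ μ β c x l₂ := by
    obtain ⟨n, e, i, -, -, h⟩ := exists_ofFn_update l₁ ⟨μ, β, x⟩ l₂
    simp only [h, ser_ofFn, evC_update, MultilinearMap.map_update_smul, map_smul]
    split_ifs <;> simp

theorem evP_tau_of_mem {ν : WithTop F} {P : Pol (Fin n) F V} (hP : P ∈ nullPol d n ν)
    {m : Fin n → WithTop F} (h : topCount ν + ∑ j, topCount (m j) = 1) :
    evP d (fun i => tau (ν.untopD 0 + ∑ j, (m j).untopD 0) (m i)) P = 0 := by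
  induction ν with
  | top => rw [mem_nullPol_top.1 hP, map_zero]
  | coe ν =>
    refine evP_of_mem_nullPol hP ?_
    rw [topCount_coe, zero_add] at h
    rw [sum_tau, h]
    simp only [WithTop.untopD_coe, one_smul, map_add]
    abel

end Values

section Permutations

variable {n : ℕ}

/-- The product of a symmetric function over unordered pairs does not depend on the order. -/
theorem prod_pairs_comp (σ : Equiv.Perm (Fin n)) (h : Fin n → Fin n → ℤˣ)
    (hh : ∀ x y, h x y = h y x) : ∏ a, ∏ b ∈ Finset.Ioi a, h (σ a) (σ b) = ∏ a, ∏ b ∈ Finset.Ioi a,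
    h a b := by
  let ε : Fin n → Fin n → ℤ := fun x y => if x < y then 1 else if y < x then -1 else 0
  have hε : ∀ x y, ε x y = -ε y x := fun x y => by
    simp only [ε]; split_ifs <;> first | rfl | omega
  have h1 := Equiv.Perm.prod_Ioi_comp_eq_sign_mul_prod σ (f := ε) hε
  have h2 := Equiv.Perm.prod_Ioi_comp_eq_sign_mul_prod σ (f := fun x y => (h x y : ℤ) * ε x y)
    fun x y => by rw [hh, hε]; ring
  have h3 : ∏ a, ∏ b ∈ Finset.Ioi a, ε a b = 1 :=
    Finset.prod_eq_one fun a _ => Finset.prod_eq_one fun b hb => if_pos (Finset.mem_Ioi.1 hb)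
  simp only [Finset.prod_mul_distrib, h3, h1, mul_one] at h2
  rw [mul_comm] at h2
  have h4 := mul_left_cancel₀ (Units.ne_zero (Equiv.Perm.sign σ)) h2
  refine Units.ext ?_
  push_cast
  exact h4

theorem permSign_eq (β : Fin n → ZMod 2) (σ : Equiv.Perm (Fin n)) : permSign β σ = ∏ a, ∏ b ∈
    Finset.Ioi a, if σ b < σ a then (-1 : ℤˣ) ^ (β (σ a) * β (σ b)) else 1 := by
  refine Finset.prod_congr rfl fun a _ => ?_
  rw [← Finset.prod_filter_mul_prod_filter_not Finset.univ (a < ·)]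
  have : ∏ b with ¬a < b, (if a < b ∧ σ b < σ a then (-1 : ℤˣ) ^ (β (σ a) * β (σ b)) else 1) = 1 :=
    Finset.prod_eq_one fun b hb => if_neg fun h => (Finset.mem_filter.1 hb).2 h.1
  rw [this, mul_one]
  refine Finset.prod_congr (by ext; simp) fun b hb => ?_
  simp [Finset.mem_Ioi.1 hb]

theorem permSign_mul (β : Fin n → ZMod 2) (σ ρ : Equiv.Perm (Fin n)) : permSign β (σ * ρ) =
    permSign β σ * permSign (β ∘ σ) ρ := by
  let h : Fin n → Fin n → ℤˣ := fun x y =>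
    (if σ y < σ x then (-1 : ℤˣ) ^ (β (σ x) * β (σ y)) else 1) *
      if y < x then (-1 : ℤˣ) ^ (β (σ x) * β (σ y)) else 1
  have hs : ∀ x y, h x y = h y x := fun x y => by
    rcases eq_or_ne x y with rfl | hxy
    · rfl
    have hxy' : σ x ≠ σ y := σ.injective.ne hxy
    simp only [h, mul_comm (β (σ y))]
    rcases lt_or_gt_of_ne hxy with h1 | h1 <;> rcases lt_or_gt_of_ne hxy' with h2 | h2 <;>
      simp [h1, h2, h1.not_gt, h2.not_gt]
  have h1 := prod_pairs_comp ρ h hs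
  have h2 : ∏ a, ∏ b ∈ Finset.Ioi a, h a b = permSign β σ := by
    rw [permSign_eq]
    refine Finset.prod_congr rfl fun a _ => Finset.prod_congr rfl fun b hb => ?_
    simp only [h, if_neg (Finset.mem_Ioi.1 hb).not_gt, mul_one]
  have h3 : ∏ a, ∏ b ∈ Finset.Ioi a, h (ρ a) (ρ b) = permSign β (σ * ρ) * permSign (β ∘ σ) ρ := by
    rw [permSign_eq, permSign_eq, ← Finset.prod_mul_distrib]
    simp only [← Finset.prod_mul_distrib]
    rfl
  rw [← h2, ← h1, h3, mul_assoc, Int.units_mul_self, mul_one]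

theorem permSign_one (β : Fin n → ZMod 2) : permSign β 1 = 1 := by
  rw [permSign_eq]
  exact Finset.prod_eq_one fun a _ => Finset.prod_eq_one fun b hb =>
    if_neg (Finset.mem_Ioi.1 hb).not_gt

theorem exists_list_swap {α : Type*} (e : Fin (n + 1) → α) (i : Fin n) : ∃ l₁ l₂, List.ofFn e =
    l₁ ++ e i.castSucc :: e i.succ :: l₂ ∧ List.ofFn (e ∘ Equiv.swap i.castSucc i.succ) =
    l₁ ++ e i.succ :: e i.castSucc :: l₂ := by
  induction n with
  | zero => exact i.elim0
  | succ n ih =>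
    refine Fin.cases ?_ (fun j => ?_) i
    · refine ⟨[], List.ofFn fun k : Fin n => e k.succ.succ, ?_, ?_⟩
      · rw [List.ofFn_succ, List.ofFn_succ]; rfl
      · rw [List.ofFn_succ, List.ofFn_succ]
        simp only [Function.comp, Fin.castSucc_zero, List.nil_append, Equiv.swap_apply_left,
          Equiv.swap_apply_right]
        congr 3
    · obtain ⟨l₁, l₂, h1, h2⟩ := ih (fun k => e k.succ) j
      refine ⟨e 0 :: l₁, l₂, ?_, ?_⟩
      · rw [List.ofFn_succ, h1]; rfl
      · rw [List.ofFn_succ]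
        refine congrArg₂ List.cons (congrArg e ?_) (Eq.trans ?_ h2)
        · rw [← Fin.succ_castSucc]
          exact Equiv.swap_apply_of_ne_of_ne (Fin.succ_ne_zero _).symm (Fin.succ_ne_zero _).symm
        · refine congrArg List.ofFn (funext fun k => congrArg e ?_)
          rw [← Fin.succ_castSucc]
          simp only [Equiv.swap_apply_def, Fin.succ_inj]
          split_ifs <;> rfl

theorem exists_list_update {F V : Type*} [Field F] (e : Fin n → Arg F V) (i : Fin n) : ∃ l₁ l₂,
    (∀ a, List.ofFn (Function.update e i a) = l₁ ++ a :: l₂) ∧ parSum l₂ = ∑ j ∈ Finset.Ioi i,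
    (e j).par := by
  induction n with
  | zero => exact i.elim0
  | succ n ih =>
    refine Fin.cases ?_ (fun j => ?_) i
    · refine ⟨[], List.ofFn fun k : Fin n => e k.succ, fun a => ?_, ?_⟩
      · rw [List.ofFn_succ, Function.update_self]
        congr 2
      · simp [parSum, List.map_ofFn, List.sum_ofFn]
    · obtain ⟨l₁, l₂, h1, h2⟩ := ih (fun k => e k.succ) j
      refine ⟨e 0 :: l₁, l₂, fun a => ?_, ?_⟩
      · rw [List.ofFn_succ, List.cons_append, ← h1]
        refine congrArg₂ List.cons ?_ (congrArg List.ofFn (funext fun k => ?_))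
        · exact Function.update_of_ne (Fin.succ_ne_zero _).symm _ _
        · simp [Function.update_apply]
      · rw [h2]
        simp [Fin.sum_Ioi_succ]

end Permutations

section Coefficients

variable {F : Type*} [Field F] {U : Type*} [AddCommGroup U] [Module F U] {d : U →ₗ[F] U}
  {n : ℕ}

theorem lambdaCoeff_tmul (r : ℕ) (p : MvPolynomial (Option (Fin n)) F) (u : U) :
    lambdaCoeff r (p ⊗ₜ[F] u) = (MvPolynomial.optionEquivLeft F (Fin n) p).coeff r ⊗ₜ[F] u := rfl

theorem aeval_option_elim (t : F) (τ : Fin n → Polynomial F) (p : MvPolynomial (Option (Fin n)) F) :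
    MvPolynomial.aeval (fun s : Option (Fin n) => s.elim (Polynomial.C t) τ) p =
      Polynomial.eval₂ (MvPolynomial.aeval τ : MvPolynomial (Fin n) F →ₐ[F] Polynomial F).toRingHom
        (Polynomial.C t) (MvPolynomial.optionEquivLeft F (Fin n) p) := by
  induction p using MvPolynomial.induction_on with
  | C r => simp [MvPolynomial.optionEquivLeft_C]
  | add p q hp hq => simp only [map_add, hp, hq, Polynomial.eval₂_add]
  | mul_X p s hp =>
    rw [map_mul, map_mul, hp, Polynomial.eval₂_mul, MvPolynomial.aeval_X]
    cases s <;> simp [MvPolynomial.optionEquivLeft_X_some, MvPolynomial.optionEquivLeft_X_none]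

theorem exists_evP_lambdaCoeff (t : F) (τ : Fin n → Polynomial F) (P : Pol (Option (Fin n)) F U) :
    ∃ R₀, ∀ R, R₀ ≤ R → ∑ r ∈ Finset.range R, t ^ r • evP d τ (lambdaCoeff r P) =
      evP d (fun s : Option (Fin n) => s.elim (Polynomial.C t) τ) P := by
  induction P using TensorProduct.induction_on with
  | zero => exact ⟨0, fun R _ => by simp⟩
  | tmul p u =>
    refine ⟨(MvPolynomial.optionEquivLeft F (Fin n) p).natDegree + 1, fun R hR => ?_⟩
    rw [evP_tmul, aeval_option_elim, Polynomial.eval₂_eq_sum_range' _ hR, map_sum,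
      LinearMap.sum_apply]
    refine Finset.sum_congr rfl fun r _ => ?_
    rw [lambdaCoeff_tmul, evP_tmul, mul_comm, map_mul, Module.End.mul_apply, ← map_pow,
      aeval_C_apply]
    rfl
  | add P Q hP hQ =>
    obtain ⟨R₁, h₁⟩ := hP
    obtain ⟨R₂, h₂⟩ := hQ
    refine ⟨max R₁ R₂, fun R hR => ?_⟩
    simp only [map_add, smul_add, Finset.sum_add_distrib]
    rw [h₁ R (le_trans (le_max_left _ _) hR), h₂ R (le_trans (le_max_right _ _) hR)]

theorem exists_lambdaCoeff_eq_zero (P : Pol (Option (Fin n)) F U) :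
    ∃ R₀, ∀ r, R₀ ≤ r → lambdaCoeff r P = 0 := by
  induction P using TensorProduct.induction_on with
  | zero => exact ⟨0, fun R _ => by simp⟩
  | tmul p u =>
    refine ⟨(MvPolynomial.optionEquivLeft F (Fin n) p).natDegree + 1, fun r hr => ?_⟩
    rw [lambdaCoeff_tmul, Polynomial.coeff_eq_zero_of_natDegree_lt hr, TensorProduct.zero_tmul]
  | add P Q hP hQ =>
    obtain ⟨R₁, h₁⟩ := hP
    obtain ⟨R₂, h₂⟩ := hQ
    refine ⟨max R₁ R₂, fun r hr => ?_⟩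
    rw [map_add, h₁ r (le_trans (le_max_left _ _) hr), h₂ r (le_trans (le_max_right _ _) hr),
      add_zero]

/-- The value at `λ = t` in terms of the coefficients in `λ`. -/
theorem sum_evP_lambdaCoeff (t : F) (τ : Fin n → Polynomial F) (P : Pol (Option (Fin n)) F U)
    {R : ℕ} (hR : ∀ r, R ≤ r → lambdaCoeff r P = 0) :
    ∑ r ∈ Finset.range R, t ^ r • evP d τ (lambdaCoeff r P) =
      evP d (fun s : Option (Fin n) => s.elim (Polynomial.C t) τ) P := by
  obtain ⟨R₀, h⟩ := exists_evP_lambdaCoeff (d := d) t τ P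
  rw [← h (max R R₀) (le_max_right _ _)]
  refine Finset.sum_subset (Finset.range_mono (le_max_left _ _)) fun r _ hr => ?_
  rw [hR r (by simpa using hr), map_zero, smul_zero]

theorem evP_extend_rename {σ σ' : Type*} {U' : Type*} [AddCommGroup U'] [Module F U']
    {d' : U' →ₗ[F] U'} (f : U →ₗ[F] Pol σ' F U') (g : σ → σ') (τ : σ' → Polynomial F)
    (τ' : σ → Polynomial F)
    (h : ∀ s u, evP d' τ (f (Polynomial.aeval (R := F) (d : Module.End F U) (τ' s) u)) =
      Polynomial.aeval (R := F) (d' : Module.End F U') (τ (g s)) (evP d' τ (f u)))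
    (P : Pol σ F U) :
    evP d' τ (extend f (renameVars g P)) = evP d' τ (f (evP d τ' P)) := by
  induction P using TensorProduct.induction_on with
  | zero => simp
  | tmul p u =>
    rw [renameVars, LinearMap.rTensor_tmul, extend_tmul, evP_smul, evP_tmul]
    simp only [AlgHom.toLinearMap_apply]
    induction p using MvPolynomial.induction_on generalizing u with
    | C r => simp [Polynomial.aeval_C, Module.algebraMap_end_apply]
    | add p q hp hq => simp only [map_add, LinearMap.add_apply, hp, hq]
    | mul_X p s hp =>
      simp only [map_mul, MvPolynomial.aeval_X, MvPolynomial.rename_X, Module.End.mul_apply]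
      rw [← hp, h]
  | add P Q hP hQ => simp only [map_add, hP, hQ]

theorem topCount_add_le {ι : Type*} (s : Finset ι) (ν : WithTop F) (m : ι → WithTop F) :
    topCount (ν + ∑ j ∈ s, m j) ≤ topCount ν + ∑ j ∈ s, topCount (m j) := by
  by_cases h : ν + ∑ j ∈ s, m j = ⊤
  · rw [h, topCount_top]; exact one_le_topCount_add h
  · rw [topCount_eq_zero.2 h]; exact Nat.zero_le _

theorem topCount_add_eq_zero_iff {ι : Type*} {s : Finset ι} {ν : WithTop F} {m : ι → WithTop F}
    (h : topCount ν + ∑ j ∈ s, topCount (m j) = 0) : ∃ T : F, ν + ∑ j ∈ s, m j = T ∧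
      ν.untopD 0 + ∑ j ∈ s, (m j).untopD 0 = T := by
  have h1 := topCount_add_le s ν m
  rw [h, Nat.le_zero, topCount_eq_zero] at h1
  obtain ⟨T, hT⟩ := WithTop.ne_top_iff_exists.1 h1
  exact ⟨T, hT.symm, (topCount_add_eq_zero hT.symm).2⟩

end Coefficients

section Shuffles

variable {F : Type*} [Field F] {V : Type*} [AddCommGroup V] [Module F V]
  {B : Type*} [AddCommGroup B] {𝒰 : ZMod 2 → Submodule F V} {d : V →ₗ[F] V} {n : ℕ}
variable {ν : WithTop F} {l l' : List (Arg F V)} {m : ℕ} {x : V} {X : ∀ n, Cochain F V n}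

/-- The signed sum of `Φ(p, q)` over the splittings of a list into complementary sublists. -/
def shuf : List (Arg F V) → (List (Arg F V) → List (Arg F V) → B) → B
  | [], Φ => Φ [] []
  | w :: l, Φ => shuf l (fun p q => Φ (w :: p) q) +
      shuf l (fun p q => sgn w.par (parSum p) • Φ p (w :: q))

theorem shuf_congr {Φ Φ' : List (Arg F V) → List (Arg F V) → B}
    (h : ∀ p q, (p ++ q).Perm l → Φ p q = Φ' p q) : shuf l Φ = shuf l Φ' := by
  induction l generalizing Φ Φ' with
  | nil => exact h [] [] (by simp)
  | cons w l ih =>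
    rw [shuf, shuf]
    congr 1
    · exact ih fun p q hs => h _ _ (hs.cons w)
    · exact ih fun p q hs => by rw [h _ _ (List.perm_middle.trans (hs.cons w))]

theorem Hom.of_perm (hl : Hom 𝒰 l) (h : l'.Perm l) : Hom 𝒰 l' :=
  fun e he => hl e (h.mem_iff.1 he)

theorem momSum_of_perm (h : l'.Perm l) : momSum l' = momSum l :=
  (h.map _).sum_eq

theorem shuf_zsmul (l : List (Arg F V)) (c : ℤ) (Φ : List (Arg F V) → List (Arg F V) → B) :
    shuf l (fun p q => c • Φ p q) = c • shuf l Φ := by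
  induction l generalizing Φ with
  | nil => rfl
  | cons w l ih => simp only [shuf, smul_comm _ c, ih, smul_add]

theorem ins_eq_shuf {ν' T : WithTop F} {a : ZMod 2} {X : List (Arg F V) → V}
    {Z : List (Arg F V) → B} (hX : HasPar 𝒰 a X) (hZ : IsSwap 𝒰 ν' T Z) (l : List (Arg F V))
    (hl : Hom 𝒰 l) (h : ν + ν' + momSum l = T) : ins l ν a X Z =
    shuf l fun p q => Z (⟨ν + momSum p, a + parSum p, X p⟩ :: q) := by
  induction l generalizing ν ν' a X Z with
  | nil => simp [ins, shuf]
  | cons w l ih =>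
    obtain ⟨hw, hl⟩ := hom_cons.1 hl
    rw [momSum_cons] at h
    rw [ins, shuf, ih (hX.cons hw) hZ hl (by rw [← h]; abel),
      ih hX (hZ.cons hw) hl (by rw [← h]; abel), ← shuf_zsmul]
    congr 1
    · simp only [momSum_cons, parSum_cons, add_assoc]
    · refine shuf_congr fun p q hpq => ?_
      obtain ⟨hp, hq⟩ := hom_append.1 (hl.of_perm hpq)
      have hs := momSum_of_perm hpq
      rw [momSum_append] at hs
      have key := hZ [] w ⟨ν + momSum p, a + parSum p, X p⟩ q
        (by simp only [List.nil_append, hom_cons]; exact ⟨hw, hX p hp, hq⟩)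
        (by simp only [List.nil_append, momSum_cons]; rw [← h, ← hs]; abel)
      simp only [List.nil_append] at key
      rw [key, smul_smul]
      congr 1
      rw [sgn_add_right]
      grind [sgn_mul_self, sgn_comm]

theorem pick_list (S : Finset (Fin m)) : List.ofFn (pick S) = (List.finRange m).filter (· ∈ S) := by
  rw [List.ofFn_eq_map]
  have : (List.finRange S.card).map (pick S) = S.sort := S.listMap_orderEmbOfFin_finRange rfl
  rw [this]
  refine List.Perm.eq_of_sortedLE (Finset.sortedLT_sort S).sortedLE ?_ ?_
  · exact ((List.sortedLT_finRange m).pairwise.filter _).sortedLT.sortedLE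
  · rw [List.perm_ext_iff_of_nodup (Finset.sort_nodup _ _) ((List.nodup_finRange m).filter _)]
    intro a; simp

theorem ofFn_comp_pick {α : Type*} (e : Fin m → α) (S : Finset (Fin m)) : List.ofFn (e ∘ pick S) =
    ((List.finRange m).filter (· ∈ S)).map e := by
  rw [← pick_list, List.map_ofFn]

theorem shuffleSign_eq (β : Fin m → ZMod 2) (S : Finset (Fin m)) : shuffleSign β S = ∏ s, ∏ t,
    if s ∈ S ∧ t ∉ S ∧ t < s then (-1 : ℤˣ) ^ (β s * β t) else 1 := by
  rw [shuffleSign, ← Finset.prod_filter_mul_prod_filter_not Finset.univ (· ∈ S)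
    (fun s => ∏ t, if s ∈ S ∧ t ∉ S ∧ t < s then (-1 : ℤˣ) ^ (β s * β t) else 1)]
  rw [Finset.filter_mem_eq_inter, Finset.univ_inter,
    Finset.prod_eq_one (s := Finset.univ.filter (· ∉ S))
    fun s hs => Finset.prod_eq_one fun t _ => by rw [if_neg]; simp at hs; tauto, mul_one]
  refine Finset.prod_congr rfl fun s hs => ?_
  rw [← Finset.prod_filter_mul_prod_filter_not Finset.univ (· ∈ Sᶜ)]
  rw [Finset.filter_mem_eq_inter, Finset.univ_inter,
    Finset.prod_eq_one (s := Finset.univ.filter (· ∉ Sᶜ))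
    fun t ht => by rw [if_neg]; simp at ht; tauto, mul_one]
  refine Finset.prod_congr rfl fun t ht => ?_
  simp only [Finset.mem_compl] at ht
  simp [hs, ht]

theorem sum_finset_succ (f : Finset (Fin (m + 1)) → B) : ∑ S, f S =
    (∑ S : Finset (Fin m), f (insert 0 (S.map (Fin.succEmb m)))) + ∑ S : Finset (Fin m),
    f (S.map (Fin.succEmb m)) := by
  have h : (Finset.univ : Finset (Fin (m + 1))) = insert 0 (Finset.univ.map (Fin.succEmb m)) := by
    ext i; refine Fin.cases ?_ (fun j => ?_) i <;> simp
  have h1 : (Finset.univ.map (Fin.succEmb m)).powerset =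
      Finset.univ.map (Finset.mapEmbedding (Fin.succEmb m)).toEmbedding := by
    ext S
    simp only [Finset.mem_powerset, Finset.mem_map, Finset.mem_univ, true_and, RelEmbedding.coe_toEmbedding,
      Finset.mapEmbedding_apply]
    rw [Finset.subset_map_iff]
    simp [eq_comm]
  rw [← Finset.powerset_univ, h, Finset.sum_powerset_insert (by simp), h1, Finset.sum_map,
    Finset.sum_map, add_comm]
  rfl

theorem uzpow_sum_eq {ι : Type*} (s : Finset ι) (f : ι → ZMod 2) :
    (-1 : ℤˣ) ^ (∑ i ∈ s, f i) = ∏ i ∈ s, (-1 : ℤˣ) ^ f i := by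
  classical
  induction s using Finset.induction_on with
  | empty => simp
  | insert i s hi ih => rw [Finset.sum_insert hi, Finset.prod_insert hi, uzpow_add, ih]

theorem sum_shuffleSign (e : Fin m → Arg F V) (Φ : List (Arg F V) → List (Arg F V) → B) : ∑ S :
    Finset (Fin m), shuffleSign (fun i => (e i).par) S • Φ (List.ofFn (e ∘ pick S))
    (List.ofFn (e ∘ pick Sᶜ)) = shuf (List.ofFn e) Φ := by
  induction m generalizing Φ with
  | zero =>
    simp [shuf, Finset.univ_unique, shuffleSign_eq, ofFn_comp_pick]
  | succ m ih =>
    rw [sum_finset_succ, List.ofFn_succ, shuf, ← ih (fun i => e i.succ),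
      ← ih (fun i => e i.succ)]
    simp only [ofFn_comp_pick, List.finRange_succ, Finset.mem_compl]
    congr 1
    · refine Finset.sum_congr rfl fun S _ => ?_
      congr 1
      · simp only [shuffleSign_eq, Fin.prod_univ_succ]
        simp [Fin.succ_ne_zero]
      · simp [List.filter_cons, List.filter_map, Function.comp_def, Fin.succ_ne_zero]
    · refine Finset.sum_congr rfl fun S _ => ?_
      have h1 : shuffleSign (fun i => (e i).par) (S.map (Fin.succEmb m)) =
          (-1 : ℤˣ) ^ ((e 0).par * parSum (List.ofFn ((fun i => e i.succ) ∘ pick S))) *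
            shuffleSign (fun i => (e i.succ).par) S := by
        have h2 : parSum (List.ofFn ((fun i => e i.succ) ∘ pick S)) = ∑ s ∈ S, (e s.succ).par := by
          rw [parSum_ofFn]
          conv_rhs => rw [← S.map_orderEmbOfFin_univ rfl, Finset.sum_map]
          rfl
        simp only [shuffleSign_eq, Fin.prod_univ_succ]
        rw [h2, Finset.mul_sum, uzpow_sum_eq]
        simp only [Finset.mem_map, Fin.coe_succEmb, Fin.succ_ne_zero, and_false, exists_false,
          false_and, if_false, Finset.prod_const_one, one_mul, Fin.succ_inj, exists_eq_right,
          not_false_eq_true, Fin.succ_pos, true_and, and_true, Fin.succ_lt_succ_iff]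
        rw [← Finset.univ_inter S, ← Finset.prod_ite_mem, ← Finset.prod_mul_distrib]
        refine Finset.prod_congr rfl fun x _ => ?_
        rw [Finset.univ_inter, mul_comm (e x.succ).par]
      rw [h1, mul_comm, mul_smul, sgn_smul]
      congr 1
      congr 1
      · rw [ofFn_comp_pick]
      · simp [List.filter_cons, List.filter_map, Function.comp_def]

/-- The values that vanish at total momentum `T`. -/
noncomputable def nullVec (d : V →ₗ[F] V) : WithTop F → Submodule F V
  | none => ⊥
  | some T => LinearMap.range (d + T • LinearMap.id)

theorem mem_nullVec_top : x ∈ nullVec d ⊤ ↔ x = 0 := Submodule.mem_bot F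

theorem mem_nullVec_coe {T : F} : x ∈ nullVec d T ↔ ∃ u, d u + T • u = x := Iff.rfl

theorem isNull_iff {𝒰 : ZMod 2 → Submodule F V} {X : List (Arg F V) → V} : IsNull 𝒰 d ν X ↔ ∀ l,
    Hom 𝒰 l → X l ∈ nullVec d (ν + momSum l) := by
  refine forall₂_congr fun l _ => ?_
  generalize ν + momSum l = T
  induction T using WithTop.recTopCoe with
  | top => simp [mem_nullVec_top]
  | coe T =>
    simp only [WithTop.coe_ne_top, WithTop.top_ne_coe, false_imp_iff, true_and, WithTop.coe_inj, forall_eq',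
      mem_nullVec_coe, eq_comm]

/-- The number of formal momenta. -/
noncomputable def topSum (l : List (Arg F V)) : ℕ := (l.map fun e => topCount e.mom).sum

theorem topSum_cons (e : Arg F V) (l : List (Arg F V)) :
    topSum (e :: l) = topCount e.mom + topSum l := by simp [topSum]

theorem topSum_append (l l' : List (Arg F V)) : topSum (l ++ l') = topSum l + topSum l' := by
  simp [topSum]

theorem topSum_of_perm (h : l'.Perm l) : topSum l' = topSum l :=
  (h.map _).sum_eq

theorem topSum_ofFn {n : ℕ} (e : Fin n → Arg F V) :
    topSum (List.ofFn e) = ∑ j, topCount (e j).mom := by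
  simp [topSum, List.map_ofFn, List.sum_ofFn]

theorem exists_ofFn {α : Type*} (l : List α) : ∃ (n : ℕ) (e : Fin n → α), l = List.ofFn e :=
  ⟨l.length, l.get, (List.ofFn_get l).symm⟩

theorem ser_eq_zero (h : 2 ≤ topCount ν + topSum l) : ser d ν X l = 0 := by
  obtain ⟨n, e, rfl⟩ := exists_ofFn l
  rw [ser_ofFn, evC, if_neg (by rw [topSum_ofFn] at h; omega)]

theorem momSum_eq_top (h : 1 ≤ topCount ν + topSum l) : ν + momSum l = ⊤ := by
  by_contra h'
  obtain ⟨n, e, rfl⟩ := exists_ofFn l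
  obtain ⟨T, hT⟩ := WithTop.ne_top_iff_exists.1 h'
  rw [momSum_ofFn] at hT
  rw [topSum_ofFn] at h
  have := (topCount_add_eq_zero hT.symm).1
  omega

theorem topCount_add_topSum {T : F} (h : ν + momSum l = T) : topCount ν + topSum l = 0 := by
  by_contra h'
  rw [momSum_eq_top (by omega)] at h
  exact WithTop.top_ne_coe h

theorem one_le_topSum (h : ν + momSum l = ⊤) : 1 ≤ topCount ν + topSum l := by
  obtain ⟨n, e, rfl⟩ := exists_ofFn l
  rw [momSum_ofFn] at h
  rw [topSum_ofFn]
  exact one_le_topCount_add h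

theorem shuf_zero {B : Type*} [AddCommGroup B] (l : List (Arg F V)) :
    shuf l (fun _ _ => (0 : B)) = 0 := by
  have := shuf_zsmul l 0 (fun _ _ => (0 : B))
  simpa using this

theorem shuf_map {B B' : Type*} [AddCommGroup B] [AddCommGroup B'] (f : B →+ B')
    (l : List (Arg F V)) (Φ : List (Arg F V) → List (Arg F V) → B) :
    f (shuf l Φ) = shuf l fun p q => f (Φ p q) := by
  induction l generalizing Φ with
  | nil => rfl
  | cons w l ih => simp only [shuf, map_add, ih, map_zsmul]

/-- The insertion of `Y` into the first slot of `X`, as a sum over splittings. -/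
noncomputable def insShuf (d : V →ₗ[F] V) (νX νY : WithTop F) (b : ZMod 2)
    (X Y : ∀ n, Cochain F V n) (l : List (Arg F V)) : V :=
  shuf l fun p q => ser d νX X (⟨νY + momSum p, b + parSum p, ser d νY Y p⟩ :: q)

theorem isLin_ser_head (μ : WithTop F) (β : ZMod 2) (q : List (Arg F V)) :
    ser d ν X (⟨μ, β, 0⟩ :: q) = 0 := by
  have := (isLin_ser (d := d) ν X).map_smul [] μ β 0 0 q
  simpa using this

theorem insShuf_eq_zero {νX νY : WithTop F} {b : ZMod 2} {Y : ∀ n, Cochain F V n}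
    (h : 2 ≤ topCount νX + topCount νY + topSum l) : insShuf d νX νY b X Y l = 0 := by
  rw [insShuf, ← shuf_zero l]
  refine shuf_congr fun p q hpq => ?_
  have h1 := topSum_of_perm hpq
  rw [topSum_append] at h1
  by_cases h2 : 2 ≤ topCount νY + topSum p
  · rw [ser_eq_zero h2, isLin_ser_head]
  · refine ser_eq_zero ?_
    rw [topSum_cons]
    dsimp only
    by_cases h3 : 1 ≤ topCount νY + topSum p
    · rw [momSum_eq_top h3, topCount_top]; omega
    · omega

end Shuffles

section Structure

variable {F : Type*} [Field F] {V : Type*} [Ring V] [Algebra F V]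
  {𝒱 : ZMod 2 → Submodule F V} [GradedAlgebra 𝒱] {d : V →ₗ[F] V} {n : ℕ}
variable {T ν νX νY : WithTop F} {g : List (Arg F V) → V} {a b α β γ δ : ZMod 2}
  {l l₁ l₂ : List (Arg F V)} {R : ℕ} {N t x y : F} {c : V} {X Y : ∀ n, Cochain F V n}
  {e : Fin n → Arg F V} {P : Pol (Fin n) F V} {v : Fin n → V} {m : Fin n → WithTop F} {i : Fin n}

/-- The value on `p ⊗ c` of the substitution used in the definition of `arrow`. -/
noncomputable def arrowSubst (d : V →ₗ[F] V) (i : Fin n) (c : V) (p : MvPolynomial (Fin n) F) :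
    Pol (Fin n) F V :=
  subst d (fun j => if j = i then lam j + del else lam j) (p ⊗ₜ[F] c)

theorem arrow_tmul (i : Fin n) (c : V) (p : MvPolynomial (Fin n) F) (x : V) :
    arrow d i c (p ⊗ₜ x) = (LinearMap.mulLeft F x).lTensor _ (arrowSubst d i c p) := rfl

theorem arrowSubst_mul_X (i : Fin n) (c : V) (p : MvPolynomial (Fin n) F) (j : Fin n) :
    arrowSubst d i c (p * MvPolynomial.X j) = (MvPolynomial.X j : MvPolynomial (Fin n) F) •
      arrowSubst d i c p + if j = i then d.lTensor _ (arrowSubst d i c p) else 0 := by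
  rw [arrowSubst, arrowSubst, subst_tmul, subst_tmul, map_mul, MvPolynomial.aeval_X, opAction,
    mul_comm, map_mul, Module.End.mul_apply]
  split_ifs
  · rw [map_add, LinearMap.add_apply, lam, Polynomial.aeval_C, Module.algebraMap_end_apply, del,
      Polynomial.aeval_X]
    rfl
  · rw [lam, Polynomial.aeval_C, Module.algebraMap_end_apply, add_zero]
    rfl

theorem arrowSubst_C (i : Fin n) (c : V) (r : F) :
    arrowSubst d i c (MvPolynomial.C r) = r • ((1 : MvPolynomial (Fin n) F) ⊗ₜ[F] c) := by
  rw [arrowSubst, subst_tmul, MvPolynomial.aeval_C,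
    IsScalarTower.algebraMap_apply F (MvPolynomial (Fin n) F) (Polynomial (MvPolynomial (Fin n) F)),
    Polynomial.algebraMap_eq, opAction, Polynomial.aeval_C, Module.algebraMap_end_apply,
    algebraMap_smul]

theorem arrowSubst_add (i : Fin n) (c : V) (p q : MvPolynomial (Fin n) F) :
    arrowSubst d i c (p + q) = arrowSubst d i c p + arrowSubst d i c q := by
  rw [arrowSubst, TensorProduct.add_tmul, map_add]; rfl

theorem lTensor_mulLeft_smul (x : V) (q : MvPolynomial (Fin n) F) (S : Pol (Fin n) F V) :
    (LinearMap.mulLeft F x).lTensor _ (q • S) = q • (LinearMap.mulLeft F x).lTensor _ S := by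
  induction S using TensorProduct.induction_on with
  | zero => simp
  | tmul p u => simp [TensorProduct.smul_tmul']
  | add P Q hP hQ => simp only [smul_add, map_add, hP, hQ]

theorem lTensor_mulLeft_d (hd : ∀ a b, d (a * b) = d a * b + a * d b) (x : V)
    (S : Pol (Fin n) F V) :
    (LinearMap.mulLeft F (d x)).lTensor _ S + (LinearMap.mulLeft F x).lTensor _ (d.lTensor _ S) =
      d.lTensor _ ((LinearMap.mulLeft F x).lTensor _ S) := by
  induction S using TensorProduct.induction_on with
  | zero => simp
  | tmul p u => simp [hd, TensorProduct.tmul_add]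
  | add P Q hP hQ => simp only [map_add, ← hP, ← hQ]; abel

theorem evP_lTensor_d (τ : Fin n → Polynomial F) (P : Pol (Fin n) F V) :
    evP d τ (d.lTensor _ P) = d (evP d τ P) := by
  have := evP_opAction (d := d) τ Polynomial.X P
  rw [opAction, Polynomial.aeval_X] at this
  rw [show bindP τ Polynomial.X = Polynomial.X from bindP_del τ, Polynomial.aeval_X] at this
  exact this

/-- Evaluation of `P_→ c` at a point where the arrowed momentum is formal. -/
theorem evP_arrow (hd : ∀ a b, d (a * b) = d a * b + a * d b) (i : Fin n) (c : V)
    {τ : Fin n → Polynomial F} (hi : τ i = -Polynomial.C N - Polynomial.X)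
    (hτ : ∀ j, j ≠ i → ∃ x, τ j = Polynomial.C x) (P : Pol (Fin n) F V) : evP d τ (arrow d i c P) =
    evP d τ P * c := by
  induction P using TensorProduct.induction_on with
  | zero => simp
  | tmul p x =>
    rw [arrow_tmul, evP_tmul]
    induction p using MvPolynomial.induction_on generalizing x with
    | C r =>
      rw [arrowSubst_C, map_smul, map_smul, LinearMap.lTensor_tmul, evP_tmul]
      simp [Polynomial.aeval_C, Module.algebraMap_end_apply]
    | add p q hp hq => rw [arrowSubst_add, map_add, map_add, hp, hq]; simp [add_mul]
    | mul_X p j hp =>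
      rw [arrowSubst_mul_X, map_add, lTensor_mulLeft_smul, map_add, evP_smul, MvPolynomial.aeval_X,
        map_mul, MvPolynomial.aeval_X, map_mul, Module.End.mul_apply]
      by_cases hj : j = i
      · subst hj
        rw [if_pos rfl, hi, hp]
        have h1 := congrArg (evP d τ) (lTensor_mulLeft_d hd x (arrowSubst d j c p))
        rw [map_add, hp, evP_lTensor_d, hp] at h1
        have h2 : ∀ u : V, Polynomial.aeval (R := F) (d : Module.End F V)
            (-Polynomial.C N - Polynomial.X) u = -(N • u) - d u := fun u => by
          rw [map_sub, map_neg, LinearMap.sub_apply, LinearMap.neg_apply, aeval_C_apply,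
            Polynomial.aeval_X]
        rw [h2, h2, map_sub, map_neg, map_smul, sub_mul, neg_mul, smul_mul_assoc, ← h1]
        abel
      · obtain ⟨y, hy⟩ := hτ j hj
        rw [if_neg hj, map_zero, map_zero, add_zero, hp, hy, aeval_C_apply, aeval_C_apply, map_smul,
          smul_mul_assoc]
  | add P Q hP hQ => simp only [map_add, hP, hQ, add_mul]

theorem totalD_apply (P : Pol (Fin n) F V) :
    totalD d P = (∑ j, MvPolynomial.X j : MvPolynomial (Fin n) F) • P + d.lTensor _ P := by
  rw [totalD, opAction, map_add, LinearMap.add_apply, del, Polynomial.aeval_X]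
  congr 1
  rw [show (∑ s, lam s : Polynomial (MvPolynomial (Fin n) F)) =
    Polynomial.C (∑ j, MvPolynomial.X j) by simp [lam], Polynomial.aeval_C,
    Module.algebraMap_end_apply]

theorem arrow_smul_X (i : Fin n) (c : V) (j : Fin n) (p : MvPolynomial (Fin n) F) (x : V) :
    arrow d i c ((MvPolynomial.X j : MvPolynomial (Fin n) F) • (p ⊗ₜ[F] x)) =
      (MvPolynomial.X j : MvPolynomial (Fin n) F) • arrow d i c (p ⊗ₜ[F] x) +
      if j = i then (LinearMap.mulLeft F x).lTensor _ (d.lTensor _ (arrowSubst d i c p)) else 0 := by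
  rw [TensorProduct.smul_tmul', smul_eq_mul, mul_comm, arrow_tmul, arrow_tmul, arrowSubst_mul_X,
    map_add, lTensor_mulLeft_smul]
  split_ifs <;> simp

theorem arrow_totalD (hd : ∀ a b, d (a * b) = d a * b + a * d b) (i : Fin n) (c : V)
    (P : Pol (Fin n) F V) : arrow d i c (totalD d P) = totalD d (arrow d i c P) := by
  induction P using TensorProduct.induction_on with
  | zero => simp
  | tmul p x =>
    rw [totalD_apply, totalD_apply, map_add, Finset.sum_smul, map_sum, Finset.sum_smul]
    simp only [arrow_smul_X, Finset.sum_add_distrib, Finset.sum_ite_eq', Finset.mem_univ, if_true]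
    rw [LinearMap.lTensor_tmul, arrow_tmul, arrow_tmul, ← lTensor_mulLeft_d hd, add_assoc]
    congr 1
    abel
  | add P Q hP hQ => simp only [map_add, hP, hQ]

theorem arrow_mem_nullPol (hd : ∀ a b, d (a * b) = d a * b + a * d b) (i : Fin n) (c : V)
    (hP : P ∈ nullPol d n ν) : arrow d i c P ∈ nullPol d n ν := by
  induction ν with
  | top => rw [mem_nullPol_top] at hP ⊢; rw [hP, map_zero]
  | coe ν =>
    obtain ⟨Q, rfl⟩ := mem_nullPol_coe.1 hP
    exact mem_nullPol_coe.2 ⟨arrow d i c Q, by rw [map_add, arrow_totalD hd, map_smul]⟩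

/-- Sesquilinearity and symmetry of a map of total momentum `ν`. -/
structure IsCoch (𝒱 : ZMod 2 → Submodule F V) (d : V →ₗ[F] V) (ν : WithTop F)
    (X : Cochain F V n) : Prop where
  sesq : ∀ (v : Fin n → V) (i : Fin n), X (Function.update v i (d (v i))) +
    (MvPolynomial.X i : MvPolynomial (Fin n) F) • X v ∈ nullPol d n ν
  sym : ∀ (i : Equiv.Perm (Fin n)) (β : Fin n → ZMod 2) (v : Fin n → V),
    (∀ j, v j ∈ parityShift 𝒱 (β j)) →
      X v - permSign β i • renameVars i (X (v ∘ i)) ∈ nullPol d n ν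

/-- Sesquilinearity, symmetry and the Leibniz rules of a map of total momentum `ν`. -/
structure IsAs (𝒱 : ZMod 2 → Submodule F V) (d : V →ₗ[F] V) (ν : WithTop F)
    (X : Cochain F V n) : Prop extends IsCoch 𝒱 d ν X where
  leib : ∀ (i : Fin n) (β : Fin n → ZMod 2) (a : Fin n → V), (∀ j, a j ∈ parityShift 𝒱 (β j)) →
    ∀ (γ δ : ZMod 2) (b c : V), b ∈ 𝒱 γ → c ∈ 𝒱 δ →
      X (Function.update a i (b * c)) -
        ((-1 : ℤˣ) ^ (δ * ∑ j ∈ Finset.Ioi i, β j) • arrow d i c (X (Function.update a i b)) +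
          (-1 : ℤˣ) ^ (γ * (δ + ∑ j ∈ Finset.Ioi i, β j)) •
            arrow d i b (X (Function.update a i c))) ∈ nullPol d n ν

theorem map_sgn_smul {M N : Type*} [AddCommGroup M] [AddCommGroup N] [Module F M] [Module F N]
    (f : M →ₗ[F] N) (ε : ℤˣ) (x : M) : f (ε • x) = ε • f x := map_zsmul f (ε : ℤ) x

theorem evC_of_mem {X : Cochain F V n} (hX : X (fun i => (e i).vec) ∈ nullPol d n ν)
    (h : 1 ≤ topCount ν + ∑ j, topCount (e j).mom) : evC d ν X e = 0 := by
  rw [evC]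
  split_ifs with h'
  · exact evP_tau_of_mem hX (le_antisymm h' h)
  · rfl

theorem evC_swap {X : Cochain F V n} (hX : IsCoch 𝒱 d ν X) (e : Fin n → Arg F V)
    (he : ∀ i, (e i).vec ∈ parityShift 𝒱 (e i).par) (h : ν + ∑ j, (e j).mom = ⊤)
    (σ : Equiv.Perm (Fin n)) : evC d ν X e = permSign (fun i => (e i).par) σ • evC d ν X (e ∘ σ)
    := by
  have h1 : ∀ f : WithTop F → ℕ, ∑ j, f ((e ∘ σ) j).mom = ∑ j, f (e j).mom :=
    fun f => Equiv.sum_comp σ fun j => f (e j).mom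
  have h2 : ∀ f : WithTop F → F, ∑ j, f ((e ∘ σ) j).mom = ∑ j, f (e j).mom :=
    fun f => Equiv.sum_comp σ fun j => f (e j).mom
  rw [evC, evC, h1, h2 fun x => x.untopD 0]
  split_ifs with h'
  · have := evP_tau_of_mem (hX.sym σ (fun i => (e i).par) (fun i => (e i).vec) he)
      (le_antisymm h' (one_le_topCount_add h))
    rw [map_sub, map_sgn_smul, evP_renameVars, sub_eq_zero] at this
    rw [this]; rfl
  · rw [smul_zero]

theorem isSeries_ser (hX : ∀ n, IsCoch 𝒱 d ν (X n)) : IsSeries (parityShift 𝒱) d ν (ser d ν X) where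
  toIsLin := isLin_ser ν X
  swap l₁ e e' l₂ hl h := by
    obtain ⟨n, f, i, j, hij, rfl, rfl, h1, h2⟩ := exists_ofFn_swap l₁ e e' l₂
    rw [h1] at hl h
    rw [h1, h2, ser_ofFn, ser_ofFn, evC_swap (hX n) f (hom_ofFn.1 hl) (by rwa [← momSum_ofFn])
      (Equiv.swap i j), permSign_swap _ _ _ hij]
    rfl
  sesq l₁ μ β v l₂ h := by
    obtain ⟨n, e, i, -, -, hl⟩ := exists_ofFn_update l₁ ⟨μ, β, v⟩ l₂
    simp only [hl, ser_ofFn, evC_update]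
    split_ifs with h'
    · have h1 : ν + ∑ j, Function.update (fun k => (e k).mom) i (μ : WithTop F) j = ⊤ := by
        have := momSum_ofFn (Function.update e i ⟨μ, β, v⟩)
        rw [← hl, mom_update] at this
        rw [← this, momSum_append, momSum_cons]
        rw [momSum_append] at h
        rw [add_left_comm (momSum l₁), add_left_comm ν, h]; rfl
      have h2 := evP_tau_of_mem ((hX n).sesq (Function.update (fun k => (e k).vec) i v) i)
        (le_antisymm h' (one_le_topCount_add h1))
      rw [Function.update_idem, Function.update_self, map_add, evP_smul, MvPolynomial.aeval_X,
        Function.update_self, tau_coe, aeval_C_apply] at h2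
      exact eq_neg_of_add_eq_zero_left h2
    · simp
  sesqT l₁ β v l₂ T h := by
    obtain ⟨n, e, i, -, -, hl⟩ := exists_ofFn_update l₁ ⟨⊤, β, v⟩ l₂
    simp only [hl, ser_ofFn, evC_update]
    have h1 := momSum_ofFn (Function.update e i ⟨((0 : F) : WithTop F), β, v⟩)
    rw [← hl, mom_update] at h1
    simp only [momSum_append, momSum_cons] at h1 h
    rw [WithTop.coe_zero, zero_add] at h1
    rw [h1] at h
    obtain ⟨h2, h3⟩ := topCount_add_eq_zero h
    have h4 : topCount ν + ∑ j, topCount (Function.update (fun k => (e k).mom) i ⊤ j) = 1 := by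
      rw [← Finset.add_sum_erase _ _ (Finset.mem_univ i)] at h2 ⊢
      rw [Function.update_self] at h2 ⊢
      rw [Finset.sum_congr rfl fun j hj => by rw [Function.update_of_ne (Finset.ne_of_mem_erase hj)]]
      rw [Finset.sum_congr rfl fun j hj => by rw [Function.update_of_ne (Finset.ne_of_mem_erase hj)]]
        at h2
      rw [topCount_top]
      omega
    have h5 : ν.untopD 0 + ∑ j, (Function.update (fun k => (e k).mom) i ⊤ j).untopD 0 = T := by
      rw [← h3]
      congr 1
      refine Finset.sum_congr rfl fun j _ => ?_
      rw [Function.update_apply, Function.update_apply]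
      split_ifs <;> rfl
    rw [if_pos h4.le, if_pos h4.le]
    have h6 := evP_tau_of_mem ((hX n).sesq (Function.update (fun k => (e k).vec) i v) i) h4
    rw [Function.update_idem, Function.update_self, map_add, evP_smul, MvPolynomial.aeval_X,
      Function.update_self, h5, tau_top, map_sub, map_neg, LinearMap.sub_apply,
      LinearMap.neg_apply, aeval_C_apply, Polynomial.aeval_X, add_eq_zero_iff_eq_neg] at h6
    rw [h5, h6]
    abel
  val l₁ μ β v l₂ T h := by
    obtain ⟨n, e, i, -, -, hl⟩ := exists_ofFn_update l₁ ⟨μ, β, v⟩ l₂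
    rw [hl, momSum_ofFn, mom_update] at h
    dsimp only at h
    simp only [hl, ser_ofFn, evC_update]
    obtain ⟨h2, h3⟩ := topCount_add_eq_zero h
    rw [← Finset.add_sum_erase _ _ (Finset.mem_univ i), Function.update_self] at h2 h3
    have e1 : ∀ (m : WithTop F), ∑ j ∈ Finset.univ.erase i,
        topCount (Function.update (fun k => (e k).mom) i m j) =
        ∑ j ∈ Finset.univ.erase i, topCount (e j).mom := fun m =>
      Finset.sum_congr rfl fun j hj => by rw [Function.update_of_ne (Finset.ne_of_mem_erase hj)]
    have e2 : ∀ (m : WithTop F), ∑ j ∈ Finset.univ.erase i,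
        (Function.update (fun k => (e k).mom) i m j).untopD 0 =
        ∑ j ∈ Finset.univ.erase i, (e j).mom.untopD 0 := fun m =>
      Finset.sum_congr rfl fun j hj => by rw [Function.update_of_ne (Finset.ne_of_mem_erase hj)]
    rw [e1] at h2
    rw [e2] at h3
    simp only [← Finset.add_sum_erase _ _ (Finset.mem_univ i), Function.update_self, e1, e2]
    rw [if_pos (by omega), if_pos (by rw [topCount_top]; omega)]
    have := evP_sub_eq (d := d)
      (τ := fun j => tau (ν.untopD 0 + ((μ : WithTop F).untopD 0 +
        ∑ j ∈ Finset.univ.erase i, (e j).mom.untopD 0))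
          (Function.update (fun k => (e k).mom) i (μ : WithTop F) j))
      (τ' := fun j => tau (ν.untopD 0 + ((⊤ : WithTop F).untopD 0 +
        ∑ j ∈ Finset.univ.erase i, (e j).mom.untopD 0))
          (Function.update (fun k => (e k).mom) i ⊤ j)) (q := Polynomial.C T + Polynomial.X)
      (fun s => ?_) (X n (Function.update (fun k => (e k).vec) i v))
    · obtain ⟨u, hu⟩ := this
      refine ⟨u, ?_⟩
      rw [hu, map_add, LinearMap.add_apply, aeval_C_apply, Polynomial.aeval_X, add_comm]
    · by_cases hs : s = i
      · subst hs
        refine Ideal.mem_span_singleton'.2 ⟨1, ?_⟩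
        rw [Function.update_self, Function.update_self, tau_top, tau_coe, ← h3]
        simp only [WithTop.untopD_coe, WithTop.untopD_top, map_add, map_zero]
        ring
      · rw [Function.update_of_ne hs, Function.update_of_ne hs]
        have : topCount (e s).mom = 0 := by
          refine Nat.eq_zero_of_le_zero (le_trans (Finset.single_le_sum (f := fun j => topCount (e j).mom)
            (fun _ _ => Nat.zero_le _) (Finset.mem_erase.2 ⟨hs, Finset.mem_univ s⟩)) ?_)
          omega
        obtain ⟨x, hx⟩ := WithTop.ne_top_iff_exists.1 (topCount_eq_zero.1 this)
        rw [← hx]; simp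

/-- The sum of the momenta other than the `i`-th one. -/
theorem momSum_ofFn_update {a : Arg F V} : momSum (List.ofFn (Function.update e i a)) = a.mom +
    ∑ j ∈ Finset.univ.erase i, (e j).mom := by
  rw [momSum_ofFn, mom_update, ← Finset.add_sum_erase _ _ (Finset.mem_univ i),
    Function.update_self,
    Finset.sum_congr rfl fun j hj => by rw [Function.update_of_ne (Finset.ne_of_mem_erase hj)]]

theorem formal_sums {T : F} (h : ν + ∑ j ∈ Finset.univ.erase i, m j = (T : WithTop F)) :
    topCount ν + ∑ j, topCount (Function.update m i ⊤ j) = 1 ∧ ν.untopD 0 + ∑ j,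
    (Function.update m i ⊤ j).untopD 0 = T := by
  obtain ⟨h1, h2⟩ := topCount_add_eq_zero h
  have e1 : ∑ j ∈ Finset.univ.erase i, topCount (Function.update m i ⊤ j) =
      ∑ j ∈ Finset.univ.erase i, topCount (m j) :=
    Finset.sum_congr rfl fun j hj => by rw [Function.update_of_ne (Finset.ne_of_mem_erase hj)]
  have e2 : ∑ j ∈ Finset.univ.erase i, (Function.update m i ⊤ j).untopD 0 =
      ∑ j ∈ Finset.univ.erase i, (m j).untopD 0 :=
    Finset.sum_congr rfl fun j hj => by rw [Function.update_of_ne (Finset.ne_of_mem_erase hj)]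
  rw [← Finset.add_sum_erase _ _ (Finset.mem_univ i),
    ← Finset.add_sum_erase _ _ (Finset.mem_univ i), e1, e2, Function.update_self, topCount_top,
    WithTop.untopD_top, zero_add, h2]
  exact ⟨by omega, rfl⟩

theorem evC_formal {T : F} {X : Cochain F V n} (h : ν + ∑ j ∈ Finset.univ.erase i, (e j).mom =
    (T : WithTop F)) (β : ZMod 2) (x : V) : evC d ν X (Function.update e i ⟨⊤, β, x⟩) =
    evP d (fun j => tau T (Function.update (fun k => (e k).mom) i ⊤ j))
    (X (Function.update (fun k => (e k).vec) i x)) := by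
  obtain ⟨h1, h2⟩ := formal_sums h
  rw [evC_update, if_pos h1.le, h2]

theorem evC_comp (ν : WithTop F) (X : Cochain F V n) (e : Fin n → Arg F V)
    (σ : Equiv.Perm (Fin n)) : evC d ν X (e ∘ σ) =
      if topCount ν + ∑ j, topCount (e j).mom ≤ 1 then
        evP d (fun i => tau (ν.untopD 0 + ∑ j, (e j).mom.untopD 0) (e i).mom)
          (renameVars σ (X ((fun i => (e i).vec) ∘ σ))) else 0 := by
  have h1 : ∀ f : WithTop F → ℕ, ∑ j, f ((e ∘ σ) j).mom = ∑ j, f (e j).mom :=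
    fun f => Equiv.sum_comp σ fun j => f (e j).mom
  have h2 : ∀ f : WithTop F → F, ∑ j, f ((e ∘ σ) j).mom = ∑ j, f (e j).mom :=
    fun f => Equiv.sum_comp σ fun j => f (e j).mom
  rw [evC, h1, h2 fun x => x.untopD 0, evP_renameVars]
  rfl

theorem sum_tau_formal {ν : F} {T : F} (h : ν + ∑ j ∈ Finset.univ.erase i, m j = (T : WithTop F)) :
    ∑ j, tau T (Function.update m i ⊤ j) + Polynomial.X = -Polynomial.C ν := by
  obtain ⟨h1, h2⟩ := topCount_add_eq_zero h
  rw [← Finset.add_sum_erase _ _ (Finset.mem_univ i), Function.update_self,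
    Finset.sum_congr rfl fun j hj => by rw [Function.update_of_ne (Finset.ne_of_mem_erase hj)],
    sum_tau, show ∑ j ∈ Finset.univ.erase i, topCount (m j) = 0 by omega, ← h2, tau_top]
  simp only [WithTop.untopD_coe, zero_smul, map_add]
  abel

/-- Every point whose only nonconstant coordinate is the `i`-th one comes from momenta. -/
theorem exists_momenta {ν : F} {τ : Fin n → Polynomial F} (h : ∀ j, j ≠ i → ∃ x, τ j =
    Polynomial.C x) (hs : ∑ s, τ s + Polynomial.X = -Polynomial.C ν) : ∃ (m : Fin n → WithTop F)
    (T : F), ν + ∑ j ∈ Finset.univ.erase i, m j = (T : WithTop F) ∧ τ =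
    fun j => tau T (Function.update m i ⊤ j) := by
  choose! x hx using h
  refine ⟨fun j => x j, ν + ∑ j ∈ Finset.univ.erase i, x j, by push_cast; rfl, ?_⟩
  funext j
  by_cases hj : j = i
  · subst hj
    rw [← Finset.add_sum_erase _ _ (Finset.mem_univ j),
      Finset.sum_congr rfl fun k hk => hx k (Finset.ne_of_mem_erase hk)] at hs
    rw [Function.update_self, tau_top, map_add, map_sum]
    rw [add_assoc, ← eq_sub_iff_add_eq] at hs
    rw [hs]; abel
  · rw [Function.update_of_ne hj, hx j hj]; rfl

theorem evP_sesq_defect {T : F} (X : Cochain F V n)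
    (h : ν + ∑ j ∈ Finset.univ.erase i, (e j).mom = (T : WithTop F)) (β : ZMod 2) (x : V) :
    evP d (fun j => tau T (Function.update (fun k => (e k).mom) i ⊤ j))
    (X (Function.update (fun k => (e k).vec) i (d x)) +
    (MvPolynomial.X i : MvPolynomial (Fin n) F) • X (Function.update (fun k => (e k).vec) i x)) =
    evC d ν X (Function.update e i ⟨⊤, β, d x⟩) -
    (d (evC d ν X (Function.update e i ⟨⊤, β, x⟩)) + T • evC d ν X (Function.update e i ⟨⊤, β, x⟩))
    := by
  rw [evC_formal h, evC_formal h, map_add, evP_smul, MvPolynomial.aeval_X, Function.update_self,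
    tau_top, map_sub, map_neg, LinearMap.sub_apply, LinearMap.neg_apply, aeval_C_apply,
    Polynomial.aeval_X]
  abel

theorem evP_leib_defect (hd : ∀ a b, d (a * b) = d a * b + a * d b) {T : F} (X : Cochain F V n)
    (h : ν + ∑ j ∈ Finset.univ.erase i, (e j).mom = (T : WithTop F)) (γ δ ε : ZMod 2) (b c : V) :
    evP d (fun j => tau T (Function.update (fun k => (e k).mom) i ⊤ j))
    (X (Function.update (fun k => (e k).vec) i (b * c)) -
    ((-1 : ℤˣ) ^ (δ * ε) • arrow d i c (X (Function.update (fun k => (e k).vec) i b)) +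
    (-1 : ℤˣ) ^ (γ * (δ + ε)) • arrow d i b (X (Function.update (fun k => (e k).vec) i c)))) =
    evC d ν X (Function.update e i ⟨⊤, γ + δ + 1, b * c⟩) -
    (sgn δ ε • (evC d ν X (Function.update e i ⟨⊤, γ + 1, b⟩) * c) +
    sgn γ (δ + ε) • (evC d ν X (Function.update e i ⟨⊤, δ + 1, c⟩) * b)) := by
  have ha : ∀ (c : V) (P : Pol (Fin n) F V),
      evP d (fun j => tau T (Function.update (fun k => (e k).mom) i ⊤ j)) (arrow d i c P) =
      evP d (fun j => tau T (Function.update (fun k => (e k).mom) i ⊤ j)) P * c := fun c P => by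
    refine evP_arrow hd i c (by rw [Function.update_self]; exact tau_top _) (fun j hj => ?_) P
    have h1 : (e j).mom ≠ ⊤ := fun e' => by
      rw [WithTop.sum_eq_top.2 ⟨j, by simp [hj], e'⟩] at h
      simp at h
    obtain ⟨x, hx⟩ := WithTop.ne_top_iff_exists.1 h1
    exact ⟨x, by rw [Function.update_of_ne hj, ← hx]; rfl⟩
  rw [evC_formal h, evC_formal h, evC_formal h, map_sub, map_add, sgn_smul, sgn_smul, map_zsmul,
    map_zsmul, ha, ha]

/-- The parity components of a vector. -/
theorem exists_sum_homogeneous (v : V) : ∃ w : ZMod 2 → V, (∀ β, w β ∈ parityShift 𝒱 β) ∧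
    v = ∑ β, w β := by
  classical
  refine ⟨fun β => DirectSum.decompose 𝒱 v (β + 1), fun β => SetLike.coe_mem _, ?_⟩
  conv_lhs => rw [← DirectSum.sum_support_decompose 𝒱 v]
  refine Eq.trans ?_ (Fintype.sum_equiv (Equiv.addRight (1 : ZMod 2)) _
    (fun β => ((DirectSum.decompose 𝒱 v β : 𝒱 β) : V)) (fun _ => rfl)).symm
  refine Finset.sum_subset (Finset.subset_univ _) fun β _ h => ?_
  simpa using h

/-- A multilinear map that vanishes on homogeneous arguments vanishes. -/
theorem eq_zero_of_homogeneous {B : Type*} [AddCommGroup B] [Module F B]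
    (A : MultilinearMap F (fun _ : Fin n => V) B)
    (h : ∀ (β : Fin n → ZMod 2) (v : Fin n → V), (∀ j, v j ∈ parityShift 𝒱 (β j)) → A v = 0)
    (v : Fin n → V) : A v = 0 := by
  choose w hw hw' using fun j => exists_sum_homogeneous (𝒱 := 𝒱) (v j)
  rw [show v = fun j => ∑ β, w j β from funext hw', MultilinearMap.map_sum]
  exact Finset.sum_eq_zero fun r _ => h r _ fun j => hw j (r j)

theorem IsSwap.perm {B : Type*} [AddCommGroup B] {g : List (Arg F V) → B}
    (hg : IsSwap (parityShift 𝒱) ν T g) (σ : Equiv.Perm (Fin n)) (e : Fin n → Arg F V)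
    (he : ∀ i, (e i).vec ∈ parityShift 𝒱 (e i).par) (h : ν + ∑ j, (e j).mom = T) : g (List.ofFn e) =
    permSign (fun i => (e i).par) σ • g (List.ofFn (e ∘ σ)) := by
  cases n with
  | zero => rw [Subsingleton.elim σ 1, permSign_one]; simp
  | succ n =>
  have hσ : σ ∈ Submonoid.closure
      (Set.range fun i : Fin n => Equiv.swap i.castSucc i.succ) := by
    rw [Equiv.Perm.mclosure_swap_castSucc_succ]; trivial
  induction hσ using Submonoid.closure_induction_right with
  | one => rw [permSign_one, one_smul]; rfl
  | mul_right x hx y hy ih =>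
    obtain ⟨i, rfl⟩ := hy
    obtain ⟨l₁, l₂, h1, h2⟩ := exists_list_swap (e ∘ x) i
    have h3 := hg l₁ _ _ l₂ (by rw [← h1, hom_ofFn]; exact fun j => he (x j)) (by
      rw [← h1, momSum_ofFn, ← h]
      exact congrArg _ (Equiv.sum_comp x fun j => (e j).mom))
    rw [ih, permSign_mul, mul_smul, permSign_swap _ _ _ rfl, h1, h3, ← h2]
    rfl

/-- The Leibniz rule of a series in an arbitrary argument. -/
theorem IsDer.of_swap {ν : F} (hg : IsSwap (parityShift 𝒱) ν ⊤ g) (hg' : IsDer 𝒱 ν g)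
    (hl₁ : Hom (parityShift 𝒱) l₁) (hl₂ : Hom (parityShift 𝒱) l₂) {b : V} {T : F} (hb : b ∈ 𝒱 γ)
    (hc : c ∈ 𝒱 δ) (hs : ν + momSum (l₁ ++ l₂) = (T : WithTop F)) :
    g (l₁ ++ ⟨⊤, γ + δ + 1, b * c⟩ :: l₂) = sgn δ (parSum l₂) • (g (l₁ ++ ⟨⊤, γ + 1, b⟩ :: l₂) * c)
    + sgn γ (δ + parSum l₂) • (g (l₁ ++ ⟨⊤, δ + 1, c⟩ :: l₂) * b) := by
  have key : ∀ {γ : ZMod 2} {b : V}, b ∈ 𝒱 γ → g (l₁ ++ ⟨⊤, γ + 1, b⟩ :: l₂) =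
      sgn (γ + 1) (parSum l₂) • g (l₁ ++ l₂ ++ [⟨⊤, γ + 1, b⟩]) := fun hb =>
    hg.move_last l₁ ⟨⊤, _, _⟩ l₂ (by simpa [hl₁, hl₂, mem_parityShift] using hb) (by simp)
  rw [key hb, key hc, key (SetLike.mul_mem_graded hb hc),
    hg' (l₁ ++ l₂) γ δ b c T (by simp [hl₁, hl₂]) hb hc hs]
  simp only [sgn_add_left, sgn_add_right, smul_add, smul_smul, smul_mul_assoc]
  match_scalars <;> grind [sgn_mul_self, sgn_comm]

theorem sesqT_of_swap {ν : F} (hg : IsSwap (parityShift 𝒱) ν ⊤ g)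
    (hd : ∀ {α : ZMod 2} {a : V}, a ∈ 𝒱 α → d a ∈ 𝒱 α) (hg' : ∀ (l : List (Arg F V)) (β : ZMod 2)
    (v : V) (T : F), Hom (parityShift 𝒱) l → v ∈ parityShift 𝒱 β → ν + momSum l = (T : WithTop F) →
    g (l ++ [⟨⊤, β, d v⟩]) = d (g (l ++ [⟨⊤, β, v⟩])) + T • g (l ++ [⟨⊤, β, v⟩]))
    (hl₁ : Hom (parityShift 𝒱) l₁) (hl₂ : Hom (parityShift 𝒱) l₂) {v : V} {T : F}
    (hv : v ∈ parityShift 𝒱 β) (hs : ν + momSum (l₁ ++ l₂) = (T : WithTop F)) :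
    g (l₁ ++ ⟨⊤, β, d v⟩ :: l₂) = d (g (l₁ ++ ⟨⊤, β, v⟩ :: l₂)) + T • g (l₁ ++ ⟨⊤, β, v⟩ :: l₂)
    := by
  have key : ∀ {v : V}, v ∈ parityShift 𝒱 β → g (l₁ ++ ⟨⊤, β, v⟩ :: l₂) =
      sgn β (parSum l₂) • g (l₁ ++ l₂ ++ [⟨⊤, β, v⟩]) := fun hv =>
    hg.move_last l₁ ⟨⊤, _, _⟩ l₂ (by simpa [hl₁, hl₂] using hv) (by simp)
  rw [key hv, key (hd hv), hg' (l₁ ++ l₂) β v T (by simp [hl₁, hl₂]) hv hs, map_zsmul, smul_add,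
    smul_comm T]

theorem coeff_eq_zero [Infinite F] {B : Type*} [AddCommGroup B] [Module F B] {A : ℕ → B}
    (h : ∀ t : F, ∑ r ∈ Finset.range R, t ^ r • A r = 0) {r : ℕ} (hr : r < R) : A r = 0 := by
  rw [← Module.forall_dual_apply_eq_zero_iff F]
  intro φ
  have hp : (∑ r ∈ Finset.range R, Polynomial.monomial r (φ (A r)) : Polynomial F) = 0 := by
    refine Polynomial.funext fun t => ?_
    rw [Polynomial.eval_finset_sum, Polynomial.eval_zero, ← map_zero φ, ← h t, map_sum]
    exact Finset.sum_congr rfl fun r _ => by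
      rw [Polynomial.eval_monomial, map_smul, smul_eq_mul, mul_comm]
  have := congrArg (Polynomial.coeff · r) hp
  simp only [Polynomial.finset_sum_coeff, Polynomial.coeff_monomial, Finset.sum_ite_eq',
    Finset.mem_range, hr, if_true, Polynomial.coeff_zero] at this
  exact this

/-- The Leibniz rule in the last argument of the series of a family of maps. -/
theorem isDer_ser (hd : ∀ a b, d (a * b) = d a * b + a * d b) {ν : F} (hX : ∀ n, IsAs 𝒱 d ν (X n)) :
    IsDer 𝒱 ν (ser d ν X) := by
  intro l γ δ b c T hl hb hc h
  obtain ⟨n, e, i, hi, hn, hu⟩ := exists_ofFn_update l ⟨⊤, γ + 1, b⟩ []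
  have hI : Finset.Ioi i = ∅ := by
    ext j; simp only [Finset.mem_Ioi, Finset.notMem_empty, iff_false]; intro h'
    have := j.2; simp at hn; omega
  have hm : ν + ∑ j ∈ Finset.univ.erase i, (e j).mom = (T : WithTop F) := by
    have := momSum_ofFn_update (e := e) (i := i) (a := ⟨((0 : F) : WithTop F), γ + 1, b⟩)
    rw [← hu] at this
    rw [← h]
    congr 1
    simpa using this.symm
  have hh : Hom (parityShift 𝒱) (List.ofFn (Function.update e i ⟨⊤, γ + 1, b⟩)) := by
    rw [← hu]; simpa [hl, mem_parityShift] using hb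
  have h1 := evP_of_mem_nullPol ((hX n).leib i
    (fun j => (Function.update e i ⟨⊤, γ + 1, b⟩ j).par) _ (hom_ofFn.1 hh) γ δ b c hb hc)
    (sum_tau_formal hm)
  rw [hI, Finset.sum_empty, vec_update, Function.update_idem, Function.update_idem,
    Function.update_idem, evP_leib_defect hd (X n) hm, sub_eq_zero] at h1
  rw [hu, hu, hu, ser_ofFn, ser_ofFn, ser_ofFn, h1]
  simp

/-- A family of maps is sesquilinear, symmetric and satisfies the Leibniz rules if its generating
functions do. -/
theorem isAs_of_series [Infinite F] (hV : IsDifferentialSuperalgebra 𝒱 d) {ν : F}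
    {Z : ℕ → Cochain F V n} (hZ : ∀ v, ∃ R, ∀ r, R ≤ r → Z r v = 0) {g : F → List (Arg F V) → V}
    (hg : ∀ (t : F) (e : Fin n → Arg F V) (R : ℕ), Hom (parityShift 𝒱) (List.ofFn e) →
      ν + momSum (List.ofFn e) = ⊤ → (∀ r, R ≤ r → Z r (fun i => (e i).vec) = 0) →
      ∑ r ∈ Finset.range R, t ^ r • evC d ν (Z r) e = g t (List.ofFn e))
    (hsw : ∀ t, IsSwap (parityShift 𝒱) ν ⊤ (g t))
    (hsq : ∀ (t : F) (l : List (Arg F V)) (β : ZMod 2) (v : V) (T : F), Hom (parityShift 𝒱) l →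
      v ∈ parityShift 𝒱 β → ν + momSum l = (T : WithTop F) →
      g t (l ++ [⟨⊤, β, d v⟩]) = d (g t (l ++ [⟨⊤, β, v⟩])) + T • g t (l ++ [⟨⊤, β, v⟩]))
    (hder : ∀ t, IsDer 𝒱 ν (g t)) (r : ℕ) : IsAs 𝒱 d ν (Z r) := by
  choose R hR using hZ
  refine ⟨⟨fun v i => ?_, fun σ β v hv => ?_⟩, fun i β a ha γ δ b c hb hc => ?_⟩
  · refine mem_nullPol_of_evP i fun τ h1 h2 => ?_
    obtain ⟨m, T, hm, rfl⟩ := exists_momenta h1 h2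
    let A : ℕ → MultilinearMap F (fun _ : Fin n => V) V := fun r =>
      (evP d fun j => tau T (Function.update m i ⊤ j)).compMultilinearMap
        ((Z r).compLinearMap (fun j => if j = i then d else LinearMap.id) +
          (DistribSMul.toLinearMap F (Pol (Fin n) F V)
            (MvPolynomial.X i : MvPolynomial (Fin n) F)).compMultilinearMap (Z r))
    have hA : ∀ r v, A r v = evP d (fun j => tau T (Function.update m i ⊤ j))
        (Z r (Function.update v i (d (v i))) + (MvPolynomial.X i : MvPolynomial (Fin n) F) • Z r v) := by
      intro r v
      have : (fun j => (if j = i then d else LinearMap.id : V →ₗ[F] V) (v j)) =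
          Function.update v i (d (v i)) := by
        funext j
        by_cases hj : j = i
        · subst hj; simp
        · simp [hj]
      simp only [A, LinearMap.compMultilinearMap_apply, add_apply,
        MultilinearMap.compLinearMap_apply, this]
      rfl
    rw [← hA]
    refine eq_zero_of_homogeneous (𝒱 := 𝒱) (A r) (fun β a ha => ?_) v
    let e : Fin n → Arg F V := fun j => ⟨m j, β j, a j⟩
    obtain ⟨l₁, l₂, hl, hl'⟩ := exists_list_update e i
    have hh : Hom (parityShift 𝒱) (l₁ ++ e i :: l₂) := by
      rw [← hl, Function.update_eq_self, hom_ofFn]; exact ha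
    simp only [hom_append, hom_cons] at hh
    have hs : (ν : WithTop F) + momSum (l₁ ++ l₂) = T := by
      have := momSum_ofFn_update (e := e) (i := i) (a := ⟨((0 : F) : WithTop F), 0, 0⟩)
      rw [hl] at this
      rw [← hm]
      congr 1
      simpa using this
    have key : ∀ (t : F) (x : V), x ∈ parityShift 𝒱 (β i) → ∀ N,
        R (Function.update a i x) ≤ N →
        ∑ r ∈ Finset.range N, t ^ r • evC d ν (Z r) (Function.update e i ⟨⊤, β i, x⟩) =
          g t (l₁ ++ ⟨⊤, β i, x⟩ :: l₂) := by
      intro t x hx N hN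
      rw [← hl]
      refine hg t _ N ?_ ?_ fun r hr => ?_
      · rw [hl]; simp [hh, hx]
      · rw [hl]; simp
      · rw [vec_update]; exact hR _ r (hN.trans hr)
    refine coeff_eq_zero (F := F) (R := R (Function.update a i (d (a i))) + R (Function.update a i (a i)) +
      r + 1) (A := fun r => A r a) (fun t => ?_) (by omega)
    have h3 := fun r => evP_sesq_defect (d := d) (Z r) (e := e) hm (β i) (a i)
    simp only [e, Function.update_eq_self] at h3
    simp only [hA, h3, smul_sub, smul_add, Finset.sum_sub_distrib, Finset.sum_add_distrib]
    simp only [smul_comm (_ ^ _ : F) T, ← Finset.smul_sum, ← map_smul, ← map_sum]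
    have ha' := ha i
    rw [sub_eq_zero, key t _ (hV.d_mem ha') _ (by omega), key t _ ha' _ (by omega),
      sesqT_of_swap (hsw t) (fun h => hV.d_mem h) (hsq t) hh.1 hh.2.2 ha' hs]
  · cases n with
    | zero =>
      rw [Subsingleton.elim σ 1, permSign_one, one_smul, renameVars]
      simp
    | succ n =>
    refine mem_nullPol_of_evP 0 fun τ h1 h2 => ?_
    obtain ⟨m, T, hm, rfl⟩ := exists_momenta h1 h2
    let e : Fin (n + 1) → Arg F V := fun j => ⟨Function.update m 0 ⊤ j, β j, v j⟩
    obtain ⟨h3, h4⟩ := formal_sums hm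
    have h5 : ∀ r, evP d (fun j => tau T (Function.update m 0 ⊤ j))
        (Z r v - permSign β σ • renameVars σ (Z r (v ∘ σ))) =
        evC d ν (Z r) e - permSign β σ • evC d ν (Z r) (e ∘ σ) := by
      intro r
      rw [evC_comp, if_pos h3.le, evC, if_pos h3.le, h4, map_sub, map_sgn_smul]
    have hs : ν + ∑ j, (e j).mom = ⊤ := by
      rw [WithTop.sum_eq_top.2 ⟨0, Finset.mem_univ _, Function.update_self _ _ _⟩]; rfl
    have hs' : ν + ∑ j, ((e ∘ σ) j).mom = ⊤ := by
      rw [← hs]; exact congrArg _ (Equiv.sum_comp σ fun j => (e j).mom)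
    refine coeff_eq_zero (F := F) (R := R v + R (v ∘ σ) + r + 1) (A := fun r => evP d _ (Z r v -
      permSign β σ • renameVars σ (Z r (v ∘ σ)))) (fun t => ?_) (by omega)
    simp only [h5, smul_sub, Finset.sum_sub_distrib]
    simp only [smul_comm (_ ^ _ : F) (permSign β σ), ← Finset.smul_sum]
    rw [hg t e _ (hom_ofFn.2 hv) (by rwa [momSum_ofFn]) fun r hr => hR v r (by omega),
      hg t (e ∘ σ) _ (hom_ofFn.2 fun j => hv (σ j)) (by rwa [momSum_ofFn])
        fun r hr => hR (v ∘ σ) r (by omega), sub_eq_zero]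
    exact (hsw t).perm σ e hv hs
  · refine mem_nullPol_of_evP i fun τ h1 h2 => ?_
    obtain ⟨m, T, hm, rfl⟩ := exists_momenta h1 h2
    let e : Fin n → Arg F V := fun j => ⟨m j, β j, a j⟩
    obtain ⟨l₁, l₂, hl, hl'⟩ := exists_list_update e i
    have hh : Hom (parityShift 𝒱) (l₁ ++ e i :: l₂) := by
      rw [← hl, Function.update_eq_self, hom_ofFn]; exact ha
    simp only [hom_append, hom_cons] at hh
    have hs : (ν : WithTop F) + momSum (l₁ ++ l₂) = T := by
      have := momSum_ofFn_update (e := e) (i := i) (a := ⟨((0 : F) : WithTop F), γ + 1, b⟩)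
      rw [hl] at this
      rw [← hm]
      congr 1
      simpa using this
    have key : ∀ (t : F) (ε : ZMod 2) (x : V), x ∈ parityShift 𝒱 ε → ∀ N, 
        R (Function.update a i x) ≤ N →
        ∑ r ∈ Finset.range N, t ^ r • evC d ν (Z r) (Function.update e i ⟨⊤, ε, x⟩) = 
          g t (l₁ ++ ⟨⊤, ε, x⟩ :: l₂) := by
      intro t ε x hx N hN
      rw [← hl]
      refine hg t _ N ?_ ?_ fun r hr => ?_
      · rw [hl]; simp [hh, hx]
      · rw [hl]; simp
      · rw [vec_update]; exact hR _ r (hN.trans hr)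
    refine coeff_eq_zero (F := F) (R := R (Function.update a i (b * c)) + R (Function.update a i b) + 
      R (Function.update a i c) + r + 1) (A := fun r => evP d _ (Z r (Function.update a i (b * c)) -
        ((-1 : ℤˣ) ^ (δ * ∑ j ∈ Finset.Ioi i, β j) • arrow d i c (Z r (Function.update a i b)) +
          (-1 : ℤˣ) ^ (γ * (δ + ∑ j ∈ Finset.Ioi i, β j)) •
            arrow d i b (Z r (Function.update a i c))))) (fun t => ?_) (by omega)
    have h3 := fun r => evP_leib_defect hV.d_mul (Z r) (e := e) hm γ δ (∑ j ∈ Finset.Ioi i, β j) b c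
    beta_reduce
    simp only [e] at h3
    simp only [h3, smul_sub, smul_add, Finset.sum_sub_distrib, Finset.sum_add_distrib]
    simp only [smul_comm (_ ^ _ : F) (sgn _ _), ← Finset.smul_sum, ← smul_mul_assoc, 
      ← Finset.sum_mul]
    rw [sub_eq_zero]
    rw [key t _ _ (mem_parityShift.2 (SetLike.mul_mem_graded hb hc)) _ (by omega),
      key t _ _ (mem_parityShift.2 hb) _ (by omega), key t _ _ (mem_parityShift.2 hc) _ (by omega),
      IsDer.of_swap (hsw t) (hder t) hh.1 hh.2.2 hb hc hs, hl', smul_mul_assoc, smul_mul_assoc]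

theorem isAs_zero (X : Cochain F V 0) : IsAs 𝒱 d ν X where
  sesq _ i := i.elim0
  sym σ β v _ := by
    have h1 : renameVars (F := F) (U := V) ⇑σ = LinearMap.id := by
      rw [renameVars, Subsingleton.elim (⇑σ) id, MvPolynomial.rename_id]
      exact LinearMap.rTensor_id _ _
    rw [h1, Subsingleton.elim (v ∘ σ) v, LinearMap.id_apply]
    simp [permSign]
  leib i := i.elim0

/-- The conditions for all total momenta together are the conditions without identifications. -/
theorem isAs_top [Infinite F] {X : Cochain F V n} (h : ∀ ν : F, IsAs 𝒱 d ν X) : IsAs 𝒱 d ⊤ X := by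
  cases n with
  | zero =>
    exact isAs_zero _
  | succ n =>
    exact ⟨⟨fun v i => eq_zero_of_mem_nullPol fun ν _ => (h ν).sesq v i,
      fun σ β v hv => eq_zero_of_mem_nullPol fun ν _ => (h ν).sym σ β v hv⟩,
      fun i β a ha γ δ b c hb hc =>
        eq_zero_of_mem_nullPol fun ν _ => (h ν).leib i β a ha γ δ b c hb hc⟩

theorem IsCoch.of_top {X : Cochain F V n} (h : IsCoch 𝒱 d ⊤ X) (ν : WithTop F) :
    IsCoch 𝒱 d ν X :=
  ⟨fun v i => by rw [mem_nullPol_top.1 (h.sesq v i)]; exact zero_mem _,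
    fun σ β v hv => by rw [mem_nullPol_top.1 (h.sym σ β v hv)]; exact zero_mem _⟩

theorem IsAs.of_top {X : Cochain F V n} (h : IsAs 𝒱 d ⊤ X) (ν : WithTop F) : IsAs 𝒱 d ν X :=
  ⟨h.toIsCoch.of_top ν, fun i β a ha γ δ b c hb hc => by
      rw [mem_nullPol_top.1 (h.leib i β a ha γ δ b c hb hc)]; exact zero_mem _⟩

/-- The coefficient of `λ^r` of `[X_λ w]`. -/
noncomputable def bracketCoeff (d : V →ₗ[F] V) (X : Cochain F V (n + 1)) (r : ℕ) :
    V →ₗ[F] Cochain F V n where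
  toFun w := (lambdaCoeff r ∘ₗ subst d
    (Fin.cons (-lam none - (∑ j, lam (some j)) - del) fun j => lam (some j))).compMultilinearMap
      (X.curryLeft w)
  map_add' w w' := by ext v; simp
  map_smul' c w := by ext v; simp

theorem bracketCoeff_apply (X : Cochain F V (n + 1)) (r : ℕ) (w : V) (v : Fin n → V) :
    bracketCoeff d X r w v = lambdaCoeff r (bracketVec d w v X) := rfl

theorem evC_cons_eq_sum (X : Cochain F V (n + 1)) (t ν : F) (ω : ZMod 2) (w : V)
    (e : Fin n → Arg F V) (he : ν + momSum (List.ofFn e) = ⊤)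
    (hR : ∀ r, R ≤ r → bracketCoeff d X r w (fun i => (e i).vec) = 0) : ∑ r ∈ Finset.range R,
    t ^ r • evC d ν (bracketCoeff d X r w) e = evC d t X
    (Fin.cons ⟨((ν - t : F) : WithTop F), ω, w⟩ e) := by
  rw [momSum_ofFn] at he
  have h1 := one_le_topCount_add he
  simp only [evC, Fin.sum_univ_succ, Fin.cons_zero, Fin.cons_succ, topCount_coe, zero_add] at h1 ⊢
  split_ifs with h2
  · have h3 : (fun i : Fin (n + 1) => (Fin.cons ⟨((ν - t : F) : WithTop F), ω, w⟩ e : Fin (n + 1) → Arg F V) i |>.vec) =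
        Fin.cons w fun i => (e i).vec := by
      funext i; refine Fin.cases rfl (fun _ => rfl) i
    simp only [bracketCoeff_apply] at hR ⊢
    rw [sum_evP_lambdaCoeff _ _ _ hR, h3]
    simp only [bracketVec, LinearMap.coe_mk, AddHom.coe_mk, evP_subst]
    congr 2
    funext i
    have hN : WithTop.untopD 0 (ν : WithTop F) + ∑ j, (e j).mom.untopD 0 =
        WithTop.untopD 0 (t : WithTop F) + (WithTop.untopD 0 ((ν - t : F) : WithTop F) + ∑ j, (e j).mom.untopD 0) := by
      simp only [WithTop.untopD_coe]; ring
    refine Fin.cases ?_ (fun j => ?_) i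
    · simp only [Fin.cons_zero, map_sub, map_neg, map_sum, bindP_lam, bindP_del, Option.elim_none,
        Option.elim_some]
      rw [sum_tau, le_antisymm h2 h1, tau_coe]
      simp only [WithTop.untopD_coe, map_add, map_sub, one_smul]
      ring
    · simp only [Fin.cons_succ, bindP_lam, Option.elim_some, hN]
  · simp

theorem IsAs.zero (ν : WithTop F) : IsAs 𝒱 d ν (0 : Cochain F V n) :=
  ⟨⟨fun v i => by simp, fun i β v _ => by simp⟩, fun i β a _ γ δ b c _ _ => by simp⟩

theorem IsAs.add {X Y : Cochain F V n} (hX : IsAs 𝒱 d ν X) (hY : IsAs 𝒱 d ν Y) : IsAs 𝒱 d ν (X + Y)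
    := by
  refine ⟨⟨fun v i => ?_, fun i β v h => ?_⟩, fun i β a h γ δ b c hb hc => ?_⟩
  · convert add_mem (hX.sesq v i) (hY.sesq v i) using 1
    simp only [add_apply, smul_add]; abel
  · convert add_mem (hX.sym i β v h) (hY.sym i β v h) using 1
    simp only [add_apply, smul_add, map_add]; abel
  · convert add_mem (hX.leib i β a h γ δ b c hb hc) (hY.leib i β a h γ δ b c hb hc) using 1
    simp only [add_apply, smul_add, map_add]; abel

theorem IsAs.sum {ι : Type*} {s : Finset ι} {X : ι → Cochain F V n}
    (hX : ∀ i ∈ s, IsAs 𝒱 d ν (X i)) : IsAs 𝒱 d ν (∑ i ∈ s, X i) := by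
  classical
  induction s using Finset.induction_on with
  | empty => simpa using IsAs.zero ν
  | insert i s hi ih =>
    rw [Finset.sum_insert hi]
    exact (hX i (by simp)).add (ih fun j hj => hX j (by simp [hj]))

theorem IsAs.single {X : Cochain F V n} (hX : IsAs 𝒱 d ν X) (k : ℕ) :
    IsAs 𝒱 d ν ((Pi.single n X : ∀ k, Cochain F V k) k) := by
  by_cases h : k = n
  · subst h; simpa using hX
  · rw [Pi.single_eq_of_ne h]; exact IsAs.zero ν

theorem IsCoch.single {X : Cochain F V n} (hX : IsCoch 𝒱 d ν X) (k : ℕ) :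
    IsCoch 𝒱 d ν ((Pi.single n X : ∀ k, Cochain F V k) k) := by
  by_cases h : k = n
  · subst h; simpa using hX
  · rw [Pi.single_eq_of_ne h]; exact (IsAs.zero ν).toIsCoch

theorem evC_zero (ν : WithTop F) (e : Fin n → Arg F V) : evC d ν (0 : Cochain F V n) e = 0 := by
  simp [evC]

theorem ser_single_of_ne {X : Cochain F V n} (h : l.length ≠ n) : ser d ν (Pi.single n X) l = 0
    := by
  rw [ser, Pi.single_eq_of_ne h, evC_zero]

theorem exists_ser_single_cons (X : Cochain F V (n + 1)) (ν μ : F) (ω : ZMod 2) (w : V)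
    (q : List (Arg F V)) (h : ((ν + μ : F) : WithTop F) + momSum q = ⊤) :
    ∃ R₀, ∀ R, R₀ ≤ R → ∑ r ∈ Finset.range R,
      ν ^ r • ser d ((ν + μ : F) : WithTop F) (Pi.single n (bracketCoeff d X r w)) q =
        ser d ν (Pi.single (n + 1) X) (⟨(μ : WithTop F), ω, w⟩ :: q) := by
  by_cases hq : q.length = n
  · obtain ⟨e, rfl⟩ : ∃ e : Fin n → Arg F V, q = List.ofFn e := by
      subst hq; exact ⟨q.get, (List.ofFn_get q).symm⟩
    obtain ⟨R₀, hR₀⟩ := exists_lambdaCoeff_eq_zero (bracketVec d w (fun i => (e i).vec) X)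
    refine ⟨R₀, fun R hR => ?_⟩
    have h1 : (⟨(μ : WithTop F), ω, w⟩ :: List.ofFn e) =
        List.ofFn (Fin.cons ⟨(((ν + μ) - ν : F) : WithTop F), ω, w⟩ e : Fin (n + 1) → Arg F V) := by
      rw [List.ofFn_succ]; simp
    rw [h1]
    simp only [ser_ofFn, Pi.single_eq_same]
    exact evC_cons_eq_sum X ν (ν + μ) ω w e h fun r hr => hR₀ r (hR.trans hr)
  · refine ⟨0, fun R _ => ?_⟩
    rw [ser_single_of_ne (by simpa using hq)]
    exact Finset.sum_eq_zero fun r _ => by rw [ser_single_of_ne hq, smul_zero]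

theorem mem_Wt_iff {X : Cochain F V n} : X ∈ Wt d (parityShift 𝒱) n ↔ IsCoch 𝒱 d ⊤ X := by
  constructor
  · rintro ⟨h1, h2⟩
    refine ⟨fun v i => ?_, fun i β v hv => ?_⟩
    · rw [mem_nullPol_top, h1]; simp
    · rw [mem_nullPol_top, sub_eq_zero]; exact h2 i β v hv
  · intro h
    exact ⟨fun v i => eq_neg_of_add_eq_zero_left (mem_nullPol_top.1 (h.sesq v i)),
      fun i β v hv => sub_eq_zero.1 (mem_nullPol_top.1 (h.sym i β v hv))⟩

theorem IsAs.bracketCoeff [Infinite F] (hV : IsDifferentialSuperalgebra 𝒱 d)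
    {X : Cochain F V (n + 1)} (hX : IsAs 𝒱 d ⊤ X) (r : ℕ) (w : V) :
    IsAs 𝒱 d ⊤ (bracketCoeff d X r w) := by
  suffices H : ∀ ω, ∀ w ∈ parityShift 𝒱 ω, IsAs 𝒱 d ⊤ (UniversalPVA.bracketCoeff d X r w) by
    obtain ⟨w', hw', rfl⟩ := exists_sum_homogeneous (𝒱 := 𝒱) w
    rw [map_sum]
    exact IsAs.sum fun β _ => H β _ (hw' β)
  intro ω w hw
  refine isAs_top fun ν => ?_
  let g : F → List (Arg F V) → V := fun t l =>
    ser d t (Pi.single (n + 1) X) (⟨((ν - t : F) : WithTop F), ω, w⟩ :: l)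
  have hs : ∀ t : F, IsSeries (parityShift 𝒱) d (ν : WithTop F) (g t) := fun t => by
    have := (isSeries_ser fun k => ((hX.of_top t).single k).toIsCoch).cons
      (w := ⟨((ν - t : F) : WithTop F), ω, w⟩) hw
    dsimp only at this
    rwa [← WithTop.coe_add, add_sub_cancel] at this
  have hder : ∀ t : F, IsDer 𝒱 (ν : WithTop F) (g t) := fun t => by
    have := (isDer_ser hV.d_mul fun k => (hX.of_top t).single k).cons
      (w := ⟨((ν - t : F) : WithTop F), ω, w⟩) hw
    dsimp only at this
    rwa [← WithTop.coe_add, add_sub_cancel] at this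
  refine isAs_of_series (ν := ν) (Z := fun r => UniversalPVA.bracketCoeff d X r w) hV
    (fun v => ?_) (g := g) (fun t e R _ he hR => ?_) (fun t => (hs t).isSwap)
    (fun t l β v T _ _ hT => ?_) hder r
  · exact exists_lambdaCoeff_eq_zero (bracketVec d w v X)
  · rw [evC_cons_eq_sum X t ν ω w e he hR]
    have h1 : (⟨((ν - t : F) : WithTop F), ω, w⟩ :: List.ofFn e) =
        List.ofFn (Fin.cons ⟨((ν - t : F) : WithTop F), ω, w⟩ e : Fin (n + 1) → Arg F V) := by
      rw [List.ofFn_succ]; simp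
    simp only [g]
    rw [h1, ser_ofFn, Pi.single_eq_same]
  · exact (hs t).sesqT l β v [] T (by simpa using hT)

theorem isAs_of_bracketCoeff [Infinite F] (hV : IsDifferentialSuperalgebra 𝒱 d)
    {X : Cochain F V (n + 2)} (hX : IsCoch 𝒱 d ⊤ X)
    (hX' : ∀ w r, IsAs 𝒱 d ⊤ (bracketCoeff d X r w)) : IsAs 𝒱 d ⊤ X := by
  refine isAs_top fun ν => ?_
  let g : List (Arg F V) → V := ser d ν (Pi.single (n + 2) X)
  have hs : IsSeries (parityShift 𝒱) d (ν : WithTop F) g := isSeries_ser (hX.of_top ν).single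
  have hder : IsDer 𝒱 (ν : WithTop F) g := by
    intro l γ δ b c T hl hb hc hT
    cases l with
    | nil => simp only [g]; simp only [List.nil_append, ser_single_of_ne (d := d) (n := n + 2)
        (l := [_]) (by simp : ([_] : List (Arg F V)).length ≠ n + 2)]; simp
    | cons w q =>
      obtain ⟨m, ω, w⟩ := w
      have hm : m ≠ ⊤ := by rintro rfl; simp at hT
      lift m to F using hm with μ
      have key : ∀ (ρ : ZMod 2) (x : V), ∃ R₀, ∀ R, R₀ ≤ R → ∑ r ∈ Finset.range R,
          ν ^ r • ser d ((ν + μ : F) : WithTop F) (Pi.single (n + 1) (bracketCoeff d X r w))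
            (q ++ [⟨⊤, ρ, x⟩]) = g (⟨(μ : WithTop F), ω, w⟩ :: (q ++ [⟨⊤, ρ, x⟩])) :=
        fun ρ x => exists_ser_single_cons X ν μ ω w _ (by simp)
      obtain ⟨R₁, h₁⟩ := key (γ + δ + 1) (b * c)
      obtain ⟨R₂, h₂⟩ := key (γ + 1) b
      obtain ⟨R₃, h₃⟩ := key (δ + 1) c
      simp only [List.cons_append]
      rw [← h₁ (R₁ + R₂ + R₃) (by omega), ← h₂ (R₁ + R₂ + R₃) (by omega),
        ← h₃ (R₁ + R₂ + R₃) (by omega), Finset.sum_mul, Finset.sum_mul, Finset.smul_sum,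
        ← Finset.sum_add_distrib]
      refine Finset.sum_congr rfl fun r _ => ?_
      have h4 := isDer_ser hV.d_mul (fun k => ((hX' w r).of_top ((ν + μ : F) : WithTop F)).single k)
      rw [h4 q γ δ b c T (hom_cons.1 hl).2 hb hc (by rw [← hT]; simp [add_assoc]), smul_add,
        smul_mul_assoc, smul_mul_assoc, smul_comm (sgn γ δ)]
  refine isAs_of_series (ν := ν) (Z := fun r => if r = 0 then X else 0) hV
    (fun v => ⟨1, fun r hr => by simp [show r ≠ 0 by omega]⟩) (g := fun _ => g)
    (fun t e R _ _ hR => ?_) (fun t => hs.isSwap)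
    (fun t l β v T _ _ hT => hs.sesqT l β v [] T (by simpa using hT)) (fun _ => hder) 0
  simp only [g, ser_ofFn, Pi.single_eq_same]
  cases R with
  | zero =>
    have := hR 0 le_rfl
    simp only [if_true] at this
    simp [evC, this]
  | succ R =>
    rw [Finset.sum_range_succ']
    simp [evC_zero]

theorem mem_WtAs_iff [Infinite F] (hV : IsDifferentialSuperalgebra 𝒱 d) {n : ℕ}
    {X : Cochain F V n} : X ∈ WtAs 𝒱 d n ↔ IsAs 𝒱 d ⊤ X := by
  induction n using Nat.twoStepInduction with
  | zero =>
    change X ∈ Wt d (parityShift 𝒱) 0 ↔ _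
    rw [mem_Wt_iff]
    exact ⟨fun h => ⟨h, fun i => i.elim0⟩, fun h => h.toIsCoch⟩
  | one =>
    change X ∈ RCder 𝒱 d ↔ _
    have h0 : ∀ a : Fin 1 → V, ∀ b, Function.update a 0 b = ![b] := fun a b => by
      funext i; rw [Subsingleton.elim i 0]; simp
    have h1 : ∀ i : Fin 1, Finset.Ioi i = ∅ := by decide
    refine ⟨fun h => ⟨mem_Wt_iff.1 h.1, fun i β a ha γ δ b c hb hc => ?_⟩,
      fun h => ⟨mem_Wt_iff.2 h.toIsCoch, fun γ δ b c hb hc => ?_⟩⟩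
    · obtain rfl := Subsingleton.elim i 0
      rw [mem_nullPol_top, h0, h0, h0, h1, h.2 γ δ b c hb hc]
      simp
    · have := h.leib 0 0 0 (fun _ => zero_mem _) γ δ b c hb hc
      rw [mem_nullPol_top, h0, h0, h0, h1] at this
      simpa [sub_eq_zero] using this
  | more n _ ih =>
    change X ∈ prolong d (parityShift 𝒱) (WtAs 𝒱 d (n + 1)) ↔ _
    constructor
    · rintro ⟨h1, h2⟩
      refine isAs_of_bracketCoeff hV (mem_Wt_iff.1 h1) fun w r => ?_
      obtain ⟨Z, hZ, hZ'⟩ := h2 w r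
      rw [← ih]
      convert hZ
      ext v : 1
      rw [hZ', bracketCoeff_apply]
    · intro h
      exact ⟨mem_Wt_iff.2 h.toIsCoch, fun w r => ⟨bracketCoeff d X r w, ih.2 (h.bracketCoeff hV r w),
        fun v => rfl⟩⟩

theorem toQ_smul_poly (p : MvPolynomial (Fin n) F) (P : Pol (Fin n) F V) :
    toQ d (p • P) = p • toQ d P := (LinearMap.range (totalD (σ := Fin n) d)).mkQ.map_smul p P

theorem toQ_surjective : Function.Surjective (toQ (m := n) d) :=
  (LinearMap.range (totalD (σ := Fin n) d)).mkQ_surjective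

theorem toQ_eq_iff {Q : Pol (Fin n) F V} : toQ d P = toQ d Q ↔ P - Q ∈
    nullPol d n ((0 : F) : WithTop F) := by
  rw [mem_nullPol_zero, map_sub, sub_eq_zero]

theorem renameVars_totalD (σ : Equiv.Perm (Fin n)) (P : Pol (Fin n) F V) :
    renameVars σ (totalD d P) = totalD d (renameVars σ P) := by
  induction P using TensorProduct.induction_on with
  | zero => simp
  | add P Q hP hQ => simp only [map_add, hP, hQ]
  | tmul p u =>
    simp only [totalD_apply, map_add, renameVars, LinearMap.rTensor_tmul, LinearMap.lTensor_tmul,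
      TensorProduct.smul_tmul', smul_eq_mul, AlgHom.toLinearMap_apply, map_mul, map_sum,
      MvPolynomial.rename_X]
    rw [Equiv.sum_comp σ fun j => (MvPolynomial.X j : MvPolynomial (Fin n) F)]

theorem renameVars_mem_nullPol (h : P ∈ nullPol d n ν) (σ : Equiv.Perm (Fin n)) : renameVars σ P ∈
    nullPol d n ν := by
  induction ν using WithTop.recTopCoe with
  | top => rw [mem_nullPol_top] at *; simp [h]
  | coe ν =>
    rw [mem_nullPol_coe] at *
    obtain ⟨Q, rfl⟩ := h
    exact ⟨renameVars σ Q, by rw [map_add, renameVars_totalD, map_smul]⟩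

theorem sgn_smul_mem {M : Type*} [AddCommGroup M] [Module F M] {S : Submodule F M} {x : M}
    (ε : ℤˣ) (h : x ∈ S) : ε • x ∈ S := by
  rcases Int.units_eq_one_or ε with rfl | rfl
  · simpa using h
  · simpa using h

theorem mem_WQAs_iff (hV : IsDifferentialSuperalgebra 𝒱 d) {X : CochainQ n d}
    {X' : Cochain F V n} (h : ∀ v, toQ d (X' v) = X v) :
    X ∈ WQAs 𝒱 d n ↔ IsAs 𝒱 d ((0 : F) : WithTop F) X' := by
  constructor
  · rintro ⟨⟨h1, h2⟩, h3⟩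
    refine ⟨⟨fun v i => ?_, fun i β v hv => ?_⟩, fun i β a ha γ δ b c hb hc => ?_⟩
    · rw [mem_nullPol_zero, map_add, h, h1, toQ_smul_poly, h]; simp
    · obtain ⟨P, hP, hP'⟩ := h2 i β v hv
      rw [← h, toQ_eq_iff] at hP'
      rw [← h, toQ_eq_iff] at hP
      convert add_mem hP' (sgn_smul_mem (permSign β i) (renameVars_mem_nullPol hP i)) using 1
      rw [map_sub, smul_sub]; abel
    · obtain ⟨P, Q, hP, hQ, h4⟩ := h3 i β a ha γ δ b c hb hc
      rw [← h, toQ_eq_iff] at hP hQ h4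
      convert add_mem h4 (add_mem
        (sgn_smul_mem ((-1 : ℤˣ) ^ (δ * ∑ j ∈ Finset.Ioi i, β j)) (arrow_mem_nullPol hV.d_mul i c hP))
        (sgn_smul_mem ((-1 : ℤˣ) ^ (γ * (δ + ∑ j ∈ Finset.Ioi i, β j)))
          (arrow_mem_nullPol hV.d_mul i b hQ))) using 1
      rw [map_sub, smul_sub, map_sub, smul_sub]; abel
  · intro hX
    refine ⟨⟨fun v i => ?_, fun i β v hv => ⟨X' (v ∘ i), h _, ?_⟩⟩,
      fun i β a ha γ δ b c hb hc => ⟨_, _, h _, h _, ?_⟩⟩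
    · rw [← h, ← h, ← toQ_smul_poly, ← map_neg, toQ_eq_iff, sub_neg_eq_add]
      exact hX.sesq v i
    · rw [← h, toQ_eq_iff]; exact hX.sym i β v hv
    · rw [← h, toQ_eq_iff]; exact hX.leib i β a ha γ δ b c hb hc

theorem ser_cons_ofFn {n : ℕ} (ν : WithTop F) (X : ∀ n, Cochain F V n) (a : Arg F V)
    (q : Fin n → Arg F V) :
    ser d ν X (a :: List.ofFn q) = evC d ν (X (n + 1)) (Fin.cons a q) := by
  rw [← ser_ofFn, List.ofFn_succ]; simp

theorem evP_box_term {σ : Type*} {k n : ℕ} {A : Cochain F V k} {X : ∀ n, Cochain F V n}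
    (hX : ∀ n, IsCoch 𝒱 d νX (X n)) {p : Fin k → Arg F V} {q : Fin n → Arg F V}
    (hc : topCount νX + (topCount νY + ∑ j, topCount (p j).mom) + ∑ j, topCount (q j).mom ≤ 1)
    (hN : N = νX.untopD 0 + (νY.untopD 0 + ∑ j, (p j).mom.untopD 0) + ∑ j, (q j).mom.untopD 0)
    {ν₁ : Fin k → σ} {ν₂ : Fin n → σ} {τ : σ → Polynomial F} (hτ₁ : ∀ j, τ (ν₁ j) = tau N (p j).mom)
    (hτ₂ : ∀ j, τ (ν₂ j) = tau N (q j).mom) {φ : Polynomial (MvPolynomial σ F)}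
    (hφ : bindP τ φ = tau (νX.untopD 0 + (νY + ∑ j, (p j).mom).untopD 0 + ∑ j, (q j).mom.untopD 0)
    (νY + ∑ j, (p j).mom)) (β : ZMod 2) : evP d τ
    (extend (subst d (Fin.cons φ fun j => lam (ν₂ j)) ∘ₗ plugFirst (X (n + 1)) fun i => (q i).vec)
    (renameVars ν₁ (A fun i => (p i).vec))) = evC d νX (X (n + 1))
    (Fin.cons ⟨νY + ∑ j, (p j).mom, β, evC d νY A p⟩ q) := by
  have hle := topCount_add_le Finset.univ νY fun j => (p j).mom
  have claim : ∀ u, evP d τ ((subst d (Fin.cons φ fun j => lam (ν₂ j)) ∘ₗ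
        plugFirst (X (n + 1)) fun i => (q i).vec) u) =
      evC d νX (X (n + 1)) (Fin.cons ⟨νY + ∑ j, (p j).mom, β, u⟩ q) := by
    intro u
    have h3 : (fun i : Fin (n + 1) => ((Fin.cons ⟨νY + ∑ j, (p j).mom, β, u⟩ q :
        Fin (n + 1) → Arg F V) i).vec) = Fin.cons u fun i => (q i).vec := by
      funext i; refine Fin.cases rfl (fun _ => rfl) i
    rw [LinearMap.comp_apply, evP_subst, evC, if_pos (by
      simp only [Fin.sum_univ_succ, Fin.cons_zero, Fin.cons_succ]; omega), h3]
    simp only [Fin.sum_univ_succ, Fin.cons_zero, Fin.cons_succ, plugFirst, LinearMap.coe_mk,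
      AddHom.coe_mk]
    congr 2
    funext i
    refine Fin.cases ?_ (fun j => ?_) i
    · simp only [Fin.cons_zero, hφ, add_assoc]
    · simp only [Fin.cons_succ, bindP_lam, hτ₂]
      rcases h : (q j).mom with _ | μ
      · have h4 : 1 ≤ ∑ j, topCount (q j).mom := by
          have := Finset.single_le_sum (f := fun j => topCount (q j).mom) (fun _ _ => Nat.zero_le _)
            (Finset.mem_univ j)
          simp only [h] at this
          exact this
        obtain ⟨T, hT, hT'⟩ := topCount_add_eq_zero_iff (s := Finset.univ) (ν := νY)
          (m := fun j => (p j).mom) (by omega)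
        rw [hN, hT', hT, WithTop.untopD_coe, add_assoc]
      · rfl
  rw [evP_extend_rename (d := d) _ ν₁ τ (fun i => tau (νY.untopD 0 + ∑ j, (p j).mom.untopD 0) (p i).mom),
    claim]
  · have h7 : evC d νY A p = evP d (fun i => tau (νY.untopD 0 + ∑ j, (p j).mom.untopD 0) (p i).mom)
        (A fun i => (p i).vec) := by rw [evC, if_pos (by omega)]
    rw [h7]
  · intro s u
    induction h : (p s).mom using WithTop.recTopCoe with
    | top =>
    · have h4 : 1 ≤ ∑ j, topCount (p j).mom := by
        have := Finset.single_le_sum (f := fun j => topCount (p j).mom) (fun _ _ => Nat.zero_le _)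
          (Finset.mem_univ s)
        simp only [h] at this
        exact this
      have h5 : νY + ∑ j, (p j).mom = ⊤ := by
        rw [WithTop.sum_eq_top.2 ⟨s, Finset.mem_univ _, h⟩]; simp
      obtain ⟨T, hT, hT'⟩ := topCount_add_eq_zero_iff (s := Finset.univ) (ν := νX)
        (m := fun j => (q j).mom) (by omega)
      simp only [hτ₁, h, tau_top]
      simp only [map_sub, map_neg, LinearMap.sub_apply, LinearMap.neg_apply, aeval_C_apply,
        Polynomial.aeval_X, map_smul]
      rw [claim, claim, h5]
      have h6 := (isSeries_ser hX).sesqT [] β u (List.ofFn q) T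
        (by rw [List.nil_append, momSum_ofFn]; exact hT)
      simp only [List.nil_append, ser_cons_ofFn] at h6
      rw [h6, hN, ← hT']
      module
    | coe μ =>
      simp only [hτ₁, h, tau_coe]
      rw [aeval_C_apply, aeval_C_apply, map_smul, map_smul]

theorem sum_pick {M : Type*} [AddCommMonoid M] {m : ℕ} (S : Finset (Fin m)) (f : Fin m → M) :
    ∑ j, f (pick S j) = ∑ j ∈ S, f j := by
  conv_rhs => rw [← S.map_orderEmbOfFin_univ rfl, Finset.sum_map]
  rfl

theorem evP_boxSum {σ : Type*} {m : ℕ} (hX : ∀ n, IsCoch 𝒱 d νX (X n)) (e : Fin m → Arg F V)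
    (hc : topCount νX + topCount νY + ∑ j, topCount (e j).mom ≤ 1) {ν : Fin m → σ}
    {τ : σ → Polynomial F} (hτ : ∀ j, τ (ν j) =
    tau (νX.untopD 0 + νY.untopD 0 + ∑ j, (e j).mom.untopD 0) (e j).mom)
    {first : Finset (Fin m) → Polynomial (MvPolynomial σ F)}
    (hfirst : ∀ S : Finset (Fin m), bindP τ (first S) =
    tau (νX.untopD 0 + (νY + ∑ j ∈ S, (e j).mom).untopD 0 + ∑ j ∈ Sᶜ, (e j).mom.untopD 0)
    (νY + ∑ j ∈ S, (e j).mom)) (b : ZMod 2) : evP d τ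
    (boxSum d ν first X Y (fun i => (e i).par) fun i => (e i).vec) =
    shuf (List.ofFn e) fun p q => ser d νX X (⟨νY + momSum p, b + parSum p, ser d νY Y p⟩ :: q)
    := by
  rw [← sum_shuffleSign, boxSum, map_sum]
  refine Finset.sum_congr rfl fun S _ => ?_
  rw [map_sgn_smul]
  congr 1
  rw [ser_cons_ofFn, ser_ofFn, momSum_ofFn]
  have h1 := Finset.sum_add_sum_compl S fun j => topCount (e j).mom
  have h2 := Finset.sum_add_sum_compl S fun j => (e j).mom.untopD 0
  refine evP_box_term hX (p := e ∘ pick S) (q := e ∘ pick Sᶜ) (ν₂ := ν ∘ pick Sᶜ)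
    (N := νX.untopD 0 + νY.untopD 0 + ∑ j, (e j).mom.untopD 0) ?_ ?_
    (fun j => hτ _) (fun j => hτ _) ?_ _
  · simp only [Function.comp_apply]
    rw [sum_pick S fun j => topCount (e j).mom, sum_pick Sᶜ fun j => topCount (e j).mom]
    omega
  · simp only [Function.comp_apply]
    rw [sum_pick S fun j => (e j).mom.untopD 0, sum_pick Sᶜ fun j => (e j).mom.untopD 0, ← h2]
    ring
  · simp only [Function.comp_apply]
    rw [sum_pick S fun j => (e j).mom, sum_pick Sᶜ fun j => (e j).mom.untopD 0, hfirst]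

theorem first_plain {m : ℕ} (e : Fin m → Arg F V) (hc : topCount νX + ∑ j, topCount (e j).mom ≤ 1)
    (S : Finset (Fin m)) : Polynomial.C y + ∑ j ∈ S,
    tau (νX.untopD 0 + y + ∑ j, (e j).mom.untopD 0) (e j).mom =
    tau (νX.untopD 0 + (y + ∑ j ∈ S, (e j).mom).untopD 0 + ∑ j ∈ Sᶜ, (e j).mom.untopD 0) (y + ∑ j ∈
    S, (e j).mom) := by
  have h1 := Finset.sum_add_sum_compl S fun j => topCount (e j).mom
  have h2 := Finset.sum_add_sum_compl S fun j => (e j).mom.untopD 0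
  rw [sum_tau]
  by_cases h : (y : WithTop F) + ∑ j ∈ S, (e j).mom = ⊤
  · have h3 := one_le_topCount_add h
    rw [topCount_coe, zero_add] at h3
    have h4 : ∑ j ∈ S, topCount (e j).mom = 1 := by omega
    rw [h, h4, tau_top, WithTop.untopD_top, one_smul, ← h2]
    simp only [map_add, map_zero]
    ring
  · obtain ⟨T, hT⟩ := WithTop.ne_top_iff_exists.1 h
    obtain ⟨h3, h4⟩ := topCount_add_eq_zero hT.symm
    rw [topCount_coe, zero_add] at h3
    rw [← hT, h3, tau_coe, zero_smul, add_zero, ← h4, WithTop.untopD_coe, map_add]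

theorem first_left {m : ℕ} (e : Fin m → Arg F V) (hc : topCount νY + ∑ j, topCount (e j).mom = 1)
    (S : Finset (Fin m)) : -Polynomial.C x - ∑ j ∈ Sᶜ,
    tau (x + νY.untopD 0 + ∑ j, (e j).mom.untopD 0) (e j).mom - Polynomial.X =
    tau (x + (νY + ∑ j ∈ S, (e j).mom).untopD 0 + ∑ j ∈ Sᶜ, (e j).mom.untopD 0) (νY + ∑ j ∈ S,
    (e j).mom) := by
  have h1 := Finset.sum_add_sum_compl S fun j => topCount (e j).mom
  have h2 := Finset.sum_add_sum_compl S fun j => (e j).mom.untopD 0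
  rw [sum_tau]
  by_cases h : νY + ∑ j ∈ S, (e j).mom = ⊤
  · have h3 := one_le_topCount_add h
    have h4 : ∑ j ∈ Sᶜ, topCount (e j).mom = 0 := by omega
    rw [h, h4, tau_top, WithTop.untopD_top]
    simp only [map_add, map_zero, zero_smul]
    ring
  · obtain ⟨T, hT⟩ := WithTop.ne_top_iff_exists.1 h
    obtain ⟨h3, h4⟩ := topCount_add_eq_zero hT.symm
    have h5 : ∑ j ∈ Sᶜ, topCount (e j).mom = 1 := by omega
    rw [← hT, h5, tau_coe, one_smul, ← h4, ← h2]
    simp only [map_add]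
    ring

theorem ins_sub_insShuf_mem (hX : ∀ n, IsCoch 𝒱 d νX (X n))
    (hY : HasPar (parityShift 𝒱) b (ser d νY Y)) (hl : Hom (parityShift 𝒱) l) :
    insShuf d νX νY b X Y l - ins l νY b (ser d νY Y) (ser d νX X) ∈ nullVec d (νX + νY + momSum l)
    := by
  generalize hT : νX + νY + momSum l = T
  induction T using WithTop.recTopCoe with
  | top =>
    rw [mem_nullVec_top, sub_eq_zero, insShuf,
      ins_eq_shuf (ν := νY) hY (isSeries_ser hX).isSwap l hl (by rw [← hT, add_comm νX])]
  | coe T =>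
    have h1 := ins_eq_shuf (ν := νY) hY ((isSeries_ser hX).isSwap_mod T) l hl (by rw [← hT, add_comm νX])
    have h2 := ins_map (LinearMap.range (d + T • LinearMap.id)).mkQ.toAddMonoidHom l νY b
      (ser d νY Y) (ser d νX X)
    have h3 := shuf_map (LinearMap.range (d + T • LinearMap.id)).mkQ.toAddMonoidHom l
      fun p q => ser d νX X (⟨νY + momSum p, b + parSum p, ser d νY Y p⟩ :: q)
    change insShuf d νX νY b X Y l - _ ∈ LinearMap.range (d + T • LinearMap.id)
    rw [← Submodule.ker_mkQ (LinearMap.range (d + T • LinearMap.id)), LinearMap.mem_ker, map_sub,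
      sub_eq_zero]
    exact h3.trans (h1.symm.trans h2.symm)

theorem evP_boxSum_plain {σ : Type*} {m : ℕ} (hX : ∀ n, IsCoch 𝒱 d νX (X n)) (e : Fin m → Arg F V)
    (hc : topCount νX + ∑ j, topCount (e j).mom ≤ 1) {ν : Fin m → σ} {τ : σ → Polynomial F}
    (hτ : ∀ j, τ (ν j) = tau (νX.untopD 0 + y + ∑ j, (e j).mom.untopD 0) (e j).mom)
    {first : Finset (Fin m) → Polynomial (MvPolynomial σ F)}
    (hfirst : ∀ S : Finset (Fin m), bindP τ (first S) = Polynomial.C y + ∑ j ∈ S, τ (ν j))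
    (b : ZMod 2) : evP d τ (boxSum d ν first X Y (fun i => (e i).par) fun i => (e i).vec) =
    insShuf d νX y b X Y (List.ofFn e) := by
  rw [insShuf]
  refine evP_boxSum (νY := (y : WithTop F)) hX e ?_ ?_ (fun S => ?_) b
  · rwa [topCount_coe, add_zero]
  · exact hτ
  · rw [hfirst]
    simp only [hτ]
    exact first_plain e hc S

theorem evP_boxSum_left {σ : Type*} {m : ℕ} (hX : ∀ n, IsCoch 𝒱 d x (X n)) (e : Fin m → Arg F V)
    (hc : topCount νY + ∑ j, topCount (e j).mom ≤ 1) {ν : Fin m → σ} {τ : σ → Polynomial F}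
    (hτ : ∀ j, τ (ν j) = tau (x + νY.untopD 0 + ∑ j, (e j).mom.untopD 0) (e j).mom)
    {first : Finset (Fin m) → Polynomial (MvPolynomial σ F)}
    (hfirst : ∀ S : Finset (Fin m), bindP τ (first S) = -Polynomial.C x - ∑ j ∈ Sᶜ, τ (ν j) -
    Polynomial.X) (b : ZMod 2) : evP d τ (boxSum d ν first X Y (fun i => (e i).par) fun i =>
    (e i).vec) - insShuf d x νY b X Y (List.ofFn e) ∈ nullVec d (x + νY + momSum (List.ofFn e))
    := by
  rcases hc.lt_or_eq with hc | hc
  · obtain ⟨T, hT, hT'⟩ := topCount_add_eq_zero_iff (s := Finset.univ) (ν := νY)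
      (m := fun j => (e j).mom) (by omega)
    have h0 : ∀ j, topCount (e j).mom = 0 := fun j => by
      have : topCount (e j).mom ≤ ∑ j, topCount (e j).mom := Finset.single_le_sum
        (f := fun j => topCount (e j).mom) (fun _ _ => Nat.zero_le _) (Finset.mem_univ j)
      omega
    have h1 : ∀ S : Finset (Fin m), νY.untopD 0 + ∑ j ∈ S, (e j).mom.untopD 0 =
        (νY + ∑ j ∈ S, (e j).mom).untopD 0 ∧ topCount (νY + ∑ j ∈ S, (e j).mom) = 0 := fun S => by
      obtain ⟨T, h, h'⟩ := topCount_add_eq_zero_iff (s := S) (ν := νY)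
        (m := fun j => (e j).mom) (by simp only [h0, Finset.sum_const_zero]; omega)
      rw [h, h']; simp
    rw [momSum_ofFn, add_assoc, hT, ← WithTop.coe_add]
    let first' : Finset (Fin m) → Polynomial (MvPolynomial σ F) := fun S =>
      algebraMap F _ ((νY + ∑ j ∈ S, (e j).mom).untopD 0)
    rw [insShuf, ← evP_boxSum (νY := νY) (τ := τ) (ν := ν) (first := first') hX e
      (by rw [topCount_coe]; omega) (by simpa using hτ) (fun S => by
        simp only [first', AlgHom.commutes]
        rw [tau_eq, (h1 S).2, zero_smul, add_zero]; rfl) b]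
    rw [boxSum, boxSum, ← map_sub, ← Finset.sum_sub_distrib, map_sum]
    refine Submodule.sum_mem _ fun S _ => ?_
    rw [map_sub, map_sgn_smul, map_sgn_smul, ← smul_sub]
    refine sgn_smul_mem _ ?_
    have hco : ∀ j, τ (ν j) = Polynomial.C ((e j).mom.untopD 0) := fun j => by
      rw [hτ, tau_eq, h0, zero_smul, add_zero]
    rw [evP_extend_rename (d := d) _ (ν ∘ pick S) τ (fun j => Polynomial.C ((e (pick S j)).mom.untopD 0))
        (fun s u => by
          simp only [Function.comp_apply, hco, aeval_C_apply, map_smul]),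
      evP_extend_rename (d := d) _ (ν ∘ pick S) τ (fun j => Polynomial.C ((e (pick S j)).mom.untopD 0))
        (fun s u => by
          simp only [Function.comp_apply, hco, aeval_C_apply, map_smul])]
    simp only [LinearMap.comp_apply, evP_subst]
    obtain ⟨u, hu⟩ := evP_sub_eq (d := d) (q := Polynomial.X + Polynomial.C (x + T)) (τ := fun s => bindP τ ((Fin.cons (first S) fun j => lam (ν (pick Sᶜ j)) :
        Fin (Sᶜ.card + 1) → Polynomial (MvPolynomial σ F)) s))
      (τ' := fun s => bindP τ ((Fin.cons (first' S) fun j => lam (ν (pick Sᶜ j)) :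
        Fin (Sᶜ.card + 1) → Polynomial (MvPolynomial σ F)) s))
      (fun s => by
        refine Fin.cases ?_ (fun j => ?_) s
        · simp only [Fin.cons_zero, hfirst, first', AlgHom.commutes, ← (h1 S).1, hco]
          rw [← hT', ← Finset.sum_add_sum_compl S, ← map_sum]
          refine Ideal.mem_span_singleton'.2 ⟨-1, ?_⟩
          rw [Polynomial.algebraMap_eq]
          simp only [map_add]
          ring
        · simp) (plugFirst (X (Sᶜ.card + 1)) ((fun i => (e i).vec) ∘ pick Sᶜ)
            (evP d (fun j => Polynomial.C ((e (pick S j)).mom.untopD 0))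
              (Y S.card ((fun i => (e i).vec) ∘ pick S))))
    rw [hu]
    refine mem_nullVec_coe.2 ⟨u, ?_⟩
    rw [map_add, LinearMap.add_apply, Polynomial.aeval_X, aeval_C_apply]
  · rw [add_assoc, momSum_eq_top (ν := νY) (by rw [topSum_ofFn, hc]), WithTop.add_top, mem_nullVec_top, sub_eq_zero]
    rw [insShuf]
    refine evP_boxSum (νX := (x : WithTop F)) hX e ?_ ?_ (fun S => ?_) b
    · rw [topCount_coe]; omega
    · exact hτ
    · rw [hfirst, WithTop.untopD_coe]
      simp only [hτ]
      exact first_left e hc S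

/-- The evaluation of a polynomial at momenta `m`, with total momentum `ν + ∑ m`. -/
noncomputable def evPol (d : V →ₗ[F] V) (ν : WithTop F) (m : Fin n → WithTop F)
    (P : Pol (Fin n) F V) : V :=
  if topCount ν + ∑ j, topCount (m j) ≤ 1 then
    evP d (fun i => tau (ν.untopD 0 + ∑ j, (m j).untopD 0) (m i)) P
  else 0

theorem evC_eq_evPol (ν : WithTop F) (X : Cochain F V n) (e : Fin n → Arg F V) :
    evC d ν X e = evPol d ν (fun i => (e i).mom) (X fun i => (e i).vec) := rfl

/-- The evaluation at `λ = t` and momenta `m`, with total momentum `t + ν + ∑ m`. -/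
noncomputable def evPolLambda (d : V →ₗ[F] V) (t : F) (ν : WithTop F) (m : Fin n → WithTop F)
    (P : Pol (Option (Fin n)) F V) : V :=
  if topCount ν + ∑ j, topCount (m j) ≤ 1 then
    evP d (fun s : Option (Fin n) => s.elim (Polynomial.C t)
      fun i => tau (t + ν.untopD 0 + ∑ j, (m j).untopD 0) (m i)) P
  else 0

theorem evPol_sub_smul (ν : WithTop F) (m : Fin n → WithTop F) (P Q : Pol (Fin n) F V) (ε : ℤˣ) :
    evPol d ν m (P - ε • Q) = evPol d ν m P - ε • evPol d ν m Q := by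
  unfold evPol
  split_ifs
  · rw [map_sub, map_sgn_smul]
  · simp

theorem evPolLambda_sub_smul (t : F) (ν : WithTop F) (m : Fin n → WithTop F)
    (P Q : Pol (Option (Fin n)) F V) (ε : ℤˣ) :
    evPolLambda d t ν m (P - ε • Q) = evPolLambda d t ν m P - ε • evPolLambda d t ν m Q := by
  unfold evPolLambda
  split_ifs
  · rw [map_sub, map_sgn_smul]
  · simp

variable {X Y : ∀ n, Cochain F V n}

theorem evPol_boxPlain (hX : ∀ n, IsCoch 𝒱 d νX (X n)) (e : Fin n → Arg F V) (b : ZMod 2) :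
    evPol d νX (fun i => (e i).mom) (boxPlain d X Y (fun i => (e i).par) fun i => (e i).vec) =
    insShuf d νX ((0 : F) : WithTop F) b X Y (List.ofFn e) := by
  unfold evPol
  beta_reduce
  split_ifs with h
  · exact evP_boxSum_plain hX e h (fun j => by simp) (fun S => by simp) b
  · rw [insShuf_eq_zero (by rw [topCount_coe, topSum_ofFn]; omega)]

theorem evPol_boxLeft_mem (hX : ∀ n, IsCoch 𝒱 d ((0 : F) : WithTop F) (X n)) (e : Fin n → Arg F V)
    (b : ZMod 2) : evPol d νY (fun i => (e i).mom)
    (boxLeft d X Y (fun i => (e i).par) fun i => (e i).vec) -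
    insShuf d ((0 : F) : WithTop F) νY b X Y (List.ofFn e) ∈ nullVec d (νY + momSum (List.ofFn e))
    := by
  unfold evPol
  beta_reduce
  split_ifs with h
  · have := evP_boxSum_left (ν := id) (first := fun S => -(∑ j ∈ Sᶜ, lam j) - del)
      (τ := fun i => tau (νY.untopD 0 + ∑ j, (e j).mom.untopD 0) (e i).mom) (Y := Y) hX e h
      (fun j => by simp) (fun S => by simp) b
    simpa [boxLeft] using this
  · rw [insShuf_eq_zero (by rw [topCount_coe, topSum_ofFn]; omega)]
    simp

theorem evPolLambda_boxLambda_mem (hX : ∀ n, IsCoch 𝒱 d t (X n)) (e : Fin n → Arg F V)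
    (b : ZMod 2) : evPolLambda d t νY (fun i => (e i).mom)
    (boxLambda d X Y (fun i => (e i).par) fun i => (e i).vec) - insShuf d t νY b X Y (List.ofFn e) ∈
    nullVec d (t + νY + momSum (List.ofFn e)) := by
  unfold evPolLambda
  beta_reduce
  split_ifs with h
  · have := evP_boxSum_left (ν := some)
      (first := fun S => -lam none - (∑ j ∈ Sᶜ, lam (some j)) - del)
      (τ := fun s : Option (Fin n) => s.elim (Polynomial.C t)
        fun i => tau (t + νY.untopD 0 + ∑ j, (e j).mom.untopD 0) (e i).mom) (Y := Y) hX e h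
      (fun j => rfl) (fun S => by simp) b
    rw [boxLambda]
    exact this
  · rw [insShuf_eq_zero (by rw [topCount_coe, topSum_ofFn]; omega)]
    simp

theorem evPolLambda_subst_boxLambda (hY : ∀ n, IsCoch 𝒱 d νY (Y n)) (e : Fin n → Arg F V)
    (a : ZMod 2) : evPolLambda d t νY (fun i => (e i).mom)
    (subst d (fun t : Option (Fin n) => t.elim (-lam none - (∑ j, lam (some j)) - del)
    (fun j => lam (some j))) (boxLambda d Y X (fun i => (e i).par) fun i => (e i).vec)) =
    insShuf d νY t a Y X (List.ofFn e) := by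
  unfold evPolLambda
  beta_reduce
  split_ifs with h
  · rw [evP_subst]
    refine evP_boxSum_plain hY e h (fun j => by simp [add_comm]) (fun S => ?_) a
    simp only [map_sub, map_neg, map_sum, bindP_lam, bindP_del, Option.elim_none, Option.elim_some]
    rw [← Finset.sum_add_sum_compl S]
    ring
  · rw [insShuf_eq_zero (by rw [topCount_coe, topSum_ofFn]; omega)]

theorem smul_mem_nullVec {x : V} (ε : ℤ) (h : x ∈ nullVec d T) : ε • x ∈ nullVec d T :=
  zsmul_mem h ε

theorem lie_mem (hX : ∀ n, IsCoch 𝒱 d ((0 : F) : WithTop F) (X n))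
    (hY : ∀ n, IsCoch 𝒱 d ((0 : F) : WithTop F) (Y n))
    (hX' : HasPar (parityShift 𝒱) a (ser d ((0 : F) : WithTop F) X))
    (hY' : HasPar (parityShift 𝒱) b (ser d ((0 : F) : WithTop F) Y)) (e : Fin n → Arg F V)
    (he : Hom (parityShift 𝒱) (List.ofFn e)) :
    evPol d ((0 : F) : WithTop F) (fun i => (e i).mom) (boxPlain d X Y (fun i => (e i).par)
    (fun i => (e i).vec) - (-1 : ℤˣ) ^ (a * b) • boxPlain d Y X (fun i => (e i).par) fun i =>
    (e i).vec) - bracket ((0 : F) : WithTop F) a (ser d ((0 : F) : WithTop F) X)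
    ((0 : F) : WithTop F) b (ser d ((0 : F) : WithTop F) Y) (List.ofFn e) ∈
    nullVec d (((0 : F) : WithTop F) + momSum (List.ofFn e)) := by
  rw [evPol_sub_smul, evPol_boxPlain hX e b, evPol_boxPlain hY e a, bracket, sgn_smul,
    sub_sub_sub_comm, ← smul_sub]
  have h1 := ins_sub_insShuf_mem hX hY' he
  have h2 := ins_sub_insShuf_mem hY hX' he
  rw [← WithTop.coe_add, add_zero] at h1 h2
  exact sub_mem h1 (smul_mem_nullVec _ h2)

theorem act_mem (hX : ∀ n, IsCoch 𝒱 d ((0 : F) : WithTop F) (X n)) (hY : ∀ n, IsCoch 𝒱 d ν (Y n))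
    (hX' : HasPar (parityShift 𝒱) a (ser d ((0 : F) : WithTop F) X))
    (hY' : HasPar (parityShift 𝒱) b (ser d ν Y)) (e : Fin n → Arg F V)
    (he : Hom (parityShift 𝒱) (List.ofFn e)) : evPol d ν (fun i => (e i).mom)
    (boxLeft d X Y (fun i => (e i).par) (fun i => (e i).vec) -
    (-1 : ℤˣ) ^ (a * b) • boxPlain d Y X (fun i => (e i).par) fun i => (e i).vec) -
    bracket ((0 : F) : WithTop F) a (ser d ((0 : F) : WithTop F) X) ν b (ser d ν Y) (List.ofFn e) ∈
    nullVec d (ν + momSum (List.ofFn e)) := by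
  rw [evPol_sub_smul, evPol_boxPlain hY e a, bracket, sgn_smul, sub_sub_sub_comm, ← smul_sub]
  have h0 := evPol_boxLeft_mem (Y := Y) (νY := ν) hX e b
  have h1 := ins_sub_insShuf_mem hX hY' he
  have h2 := ins_sub_insShuf_mem hY hX' he
  rw [WithTop.coe_zero, zero_add] at h1
  rw [WithTop.coe_zero, add_zero] at h2
  rw [WithTop.coe_zero] at h0
  refine sub_mem ?_ (smul_mem_nullVec _ h2)
  simpa using add_mem h0 h1

theorem lambdaBracket_mem (hX : ∀ n, IsCoch 𝒱 d t (X n)) (hY : ∀ n, IsCoch 𝒱 d ν (Y n))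
    (hX' : HasPar (parityShift 𝒱) a (ser d t X)) (hY' : HasPar (parityShift 𝒱) b (ser d ν Y))
    (e : Fin n → Arg F V) (he : Hom (parityShift 𝒱) (List.ofFn e)) :
    evPolLambda d t ν (fun i => (e i).mom) (lambdaBracket d a b X Y (fun i => (e i).par)
    (fun i => (e i).vec)) - bracket t a (ser d t X) ν b (ser d ν Y) (List.ofFn e) ∈
    nullVec d (t + ν + momSum (List.ofFn e)) := by
  rw [lambdaBracket, evPolLambda_sub_smul, evPolLambda_subst_boxLambda hY e a, bracket, sgn_smul,
    sub_sub_sub_comm, ← smul_sub]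
  have h0 := evPolLambda_boxLambda_mem (Y := Y) (νY := ν) hX e b
  have h1 := ins_sub_insShuf_mem hX hY' he
  have h2 := ins_sub_insShuf_mem hY hX' he
  rw [add_comm ν] at h2
  refine sub_mem ?_ (smul_mem_nullVec _ h2)
  simpa using add_mem h0 h1

theorem ser_mem_nullVec {Z : ∀ n, Cochain F V n} (hZ : ∀ n v, Z n v ∈ nullPol d n ν) : ser d ν Z l ∈
    nullVec d (ν + momSum l) := by
  obtain ⟨n, e, rfl⟩ := exists_ofFn l
  rw [ser_ofFn]
  generalize hT : ν + momSum (List.ofFn e) = T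
  induction T using WithTop.recTopCoe with
  | top =>
    rw [mem_nullVec_top]
    refine evC_of_mem (hZ n _) ?_
    rw [← topSum_ofFn]; exact one_le_topSum hT
  | coe T =>
    have h1 := topCount_add_topSum hT
    rw [topSum_ofFn] at h1
    rw [momSum_ofFn] at hT
    obtain ⟨h2, h3⟩ := topCount_add_eq_zero hT
    have hν : ν ≠ ⊤ := topCount_eq_zero.1 (by omega)
    lift ν to F using hν
    obtain ⟨u, hu⟩ := evP_C_of_mem_nullPol (hZ n fun i => (e i).vec) fun i => (e i).mom.untopD 0
    refine mem_nullVec_coe.2 ⟨u, ?_⟩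
    rw [evC, if_pos (by omega)]
    rw [WithTop.untopD_coe] at h3
    rw [← h3, ← hu]
    congr 2
    funext i
    have : topCount (e i).mom ≤ ∑ j, topCount (e j).mom := Finset.single_le_sum
        (f := fun j => topCount (e j).mom) (fun _ _ => Nat.zero_le _) (Finset.mem_univ i)
    rw [tau_eq, show topCount (e i).mom = 0 by omega, zero_smul, add_zero]

theorem shuf_mem {B : Type*} [AddCommGroup B] {Φ : List (Arg F V) → List (Arg F V) → B}
    {S : AddSubgroup B} (h : ∀ p q, (p ++ q).Perm l → Φ p q ∈ S) : shuf l Φ ∈ S := by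
  have h1 := shuf_map (QuotientAddGroup.mk' S) l Φ
  rw [shuf_congr (Φ' := fun _ _ => (0 : B ⧸ S)) fun p q hpq => by
    simpa using h p q hpq, shuf_zero] at h1
  simpa using h1

theorem shuf_sub {B : Type*} [AddCommGroup B] (l : List (Arg F V))
    (Φ Φ' : List (Arg F V) → List (Arg F V) → B) :
    shuf l (fun p q => Φ p q - Φ' p q) = shuf l Φ - shuf l Φ' := by
  induction l generalizing Φ Φ' with
  | nil => rfl
  | cons w l ih => simp only [shuf, smul_sub, ih]; abel

theorem ser_sub (ν : WithTop F) (X X' : ∀ n, Cochain F V n) (l : List (Arg F V)) :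
    ser d ν (X - X') l = ser d ν X l - ser d ν X' l := by
  simp only [ser, evC, Pi.sub_apply, sub_apply, map_sub]
  split_ifs <;> simp

theorem insShuf_congr_left {X' : ∀ n, Cochain F V n} (hX : ∀ n v, X n v - X' n v ∈ nullPol d n νX)
    (b : ZMod 2) (l : List (Arg F V)) : insShuf d νX νY b X Y l - insShuf d νX νY b X' Y l ∈
    nullVec d (νX + νY + momSum l) := by
  rw [insShuf, insShuf, ← shuf_sub]
  refine shuf_mem (S := (nullVec d (νX + νY + momSum l)).toAddSubgroup) fun p q hpq => ?_
  rw [← ser_sub]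
  have h1 := ser_mem_nullVec (Z := X - X') (ν := νX)
    (l := ⟨νY + momSum p, b + parSum p, ser d νY Y p⟩ :: q) hX
  have h2 := momSum_of_perm hpq
  rw [momSum_append] at h2
  rw [← h2]
  simpa [add_assoc] using h1

theorem insShuf_congr_right {Y' : ∀ n, Cochain F V n} (hX : ∀ n, IsCoch 𝒱 d νX (X n))
    (hY : ∀ n v, Y n v - Y' n v ∈ nullPol d n νY) (b : ZMod 2) (hl : Hom (parityShift 𝒱) l) :
    insShuf d νX νY b X Y l - insShuf d νX νY b X Y' l ∈ nullVec d (νX + νY + momSum l) := by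
  rw [insShuf, insShuf, ← shuf_sub]
  refine shuf_mem (S := (nullVec d (νX + νY + momSum l)).toAddSubgroup) fun p q hpq => ?_
  have h1 := ser_mem_nullVec (Z := Y - Y') (ν := νY) (l := p) hY
  have h2 := momSum_of_perm hpq
  have hq := (hom_append.1 (hl.of_perm hpq)).2
  rw [momSum_append] at h2
  rw [ser_sub] at h1
  have h3 : ∀ μ β x y, ser d νX X (⟨μ, β, x⟩ :: q) - ser d νX X (⟨μ, β, y⟩ :: q) =
      ser d νX X (⟨μ, β, x - y⟩ :: q) := fun μ β x y => by
    have h4 := (isLin_ser (d := d) νX X).map_add [] μ β (x - y) y q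
    rw [sub_add_cancel] at h4
    simp only [List.nil_append] at h4
    rw [h4, add_sub_cancel_right]
  rw [h3]
  generalize ser d νY Y p - ser d νY Y' p = x at h1
  change _ ∈ nullVec d _
  rw [← h2, ← add_assoc, add_assoc νX νY]
  generalize νY + momSum p = μ at h1
  induction μ using WithTop.recTopCoe with
  | top => rw [mem_nullVec_top] at h1; rw [h1, isLin_ser_head]; exact zero_mem _
  | coe μ =>
    obtain ⟨u, rfl⟩ := mem_nullVec_coe.1 h1
    have h5 := isNull_iff.1 ((isSeries_ser hX).sesq_isNull μ (b + parSum p) u) q hq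
    have h6 := (isLin_ser (d := d) νX X).map_add [] μ (b + parSum p) (d u) (μ • u) q
    have h7 := (isLin_ser (d := d) νX X).map_smul [] μ (b + parSum p) μ u q
    simp only [List.nil_append] at h6 h7
    rw [h6, h7]
    simpa using h5

variable (𝒱) in
/-- The projection of `ΠV` onto its component of parity `β`. -/
noncomputable def piProj (β : ZMod 2) : V →ₗ[F] V := GradedAlgebra.proj 𝒱 (β + 1)

theorem piProj_mem (β : ZMod 2) (v : V) : piProj 𝒱 β v ∈ parityShift 𝒱 β :=
  SetLike.coe_mem (DirectSum.decompose 𝒱 v (β + 1))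

theorem piProj_of_mem {v : V} (hv : v ∈ parityShift 𝒱 β) : piProj 𝒱 β v = v :=
  DirectSum.decompose_of_mem_same 𝒱 hv

theorem piProj_of_ne {v : V} (hv : v ∈ parityShift 𝒱 β) (h : γ ≠ β) : piProj 𝒱 γ v = 0 :=
  DirectSum.decompose_of_mem_ne 𝒱 hv fun h' => h (add_right_cancel h').symm

theorem sum_piProj (v : V) : ∑ β, piProj 𝒱 β v = v := by
  obtain ⟨w, hw, rfl⟩ := exists_sum_homogeneous (𝒱 := 𝒱) v
  simp only [map_sum]
  rw [Finset.sum_comm]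
  refine Finset.sum_congr rfl fun γ _ => ?_
  rw [Finset.sum_eq_single γ (fun β _ h => piProj_of_ne (hw γ) h) (by simp), piProj_of_mem (hw γ)]

theorem piProj_d (hV : IsDifferentialSuperalgebra 𝒱 d) (β : ZMod 2) (v : V) :
    piProj 𝒱 β (d v) = d (piProj 𝒱 β v) := by
  obtain ⟨w, hw, rfl⟩ := exists_sum_homogeneous (𝒱 := 𝒱) v
  simp only [map_sum]
  refine Finset.sum_congr rfl fun γ _ => ?_
  have h1 : d (w γ) ∈ parityShift 𝒱 γ := hV.d_mem (hw γ)
  by_cases h : β = γ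
  · subst h; rw [piProj_of_mem (hw β), piProj_of_mem h1]
  · rw [piProj_of_ne (hw γ) h, piProj_of_ne h1 h, map_zero]

theorem piProj_mul (hc : c ∈ 𝒱 δ) (x : V) : piProj 𝒱 (β + δ) (x * c) = piProj 𝒱 β x * c := by
  obtain ⟨w, hw, rfl⟩ := exists_sum_homogeneous (𝒱 := 𝒱) x
  simp only [map_sum, Finset.sum_mul]
  refine Finset.sum_congr rfl fun γ _ => ?_
  have h1 : w γ * c ∈ parityShift 𝒱 (γ + δ) := by
    have := SetLike.mul_mem_graded (A := 𝒱) (hw γ) hc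
    rwa [show γ + 1 + δ = γ + δ + 1 by ring] at this
  by_cases h : β = γ
  · subst h; rw [piProj_of_mem (hw β), piProj_of_mem h1]
  · rw [piProj_of_ne (hw γ) h, piProj_of_ne h1 (fun h' => h (add_right_cancel h')), zero_mul]

variable (𝒱) in
/-- The multilinear map given by `A β` on homogeneous arguments of parity `β` in `ΠV`. -/
noncomputable def homExt {M : Type*} [AddCommGroup M] [Module F M] :
    ((Fin n → ZMod 2) → MultilinearMap F (fun _ : Fin n => V) M) →ₗ[F]
      MultilinearMap F (fun _ : Fin n => V) M where
  toFun A := ∑ β, (A β).compLinearMap fun j => piProj 𝒱 (β j)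
  map_add' A B := by
    rw [← Finset.sum_add_distrib]; rfl
  map_smul' c A := by
    rw [RingHom.id_apply, Finset.smul_sum]; rfl

theorem homExt_apply {M : Type*} [AddCommGroup M] [Module F M]
    (A : (Fin n → ZMod 2) → MultilinearMap F (fun _ : Fin n => V) M) {β : Fin n → ZMod 2}
    (hv : ∀ j, v j ∈ parityShift 𝒱 (β j)) : homExt 𝒱 A v = A β v := by
  simp only [homExt, LinearMap.coe_mk, AddHom.coe_mk, MultilinearMap.sum_apply,
    MultilinearMap.compLinearMap_apply]
  rw [Finset.sum_eq_single β]
  · congr 1; funext j; exact piProj_of_mem (hv j)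
  · intro γ _ h
    obtain ⟨j, hj⟩ := Function.ne_iff.1 h
    exact (A γ).map_coord_zero j (piProj_of_ne (hv j) hj)
  · simp

theorem eq_of_homogeneous {M : Type*} [AddCommGroup M] [Module F M]
    {A B : MultilinearMap F (fun _ : Fin n => V) M}
    (h : ∀ (β : Fin n → ZMod 2) (v : Fin n → V), (∀ j, v j ∈ parityShift 𝒱 (β j)) → A v = B v) :
    A = B := by
  ext v
  exact sub_eq_zero.1 (eq_zero_of_homogeneous (𝒱 := 𝒱) (A - B)
    (fun β v hv => sub_eq_zero.2 (h β v hv)) v)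

theorem mem_of_homogeneous {M : Type*} [AddCommGroup M] [Module F M] {S : Submodule F M}
    {A : MultilinearMap F (fun _ : Fin n => V) M}
    (h : ∀ (β : Fin n → ZMod 2) (v : Fin n → V), (∀ j, v j ∈ parityShift 𝒱 (β j)) → A v ∈ S)
    (v : Fin n → V) : A v ∈ S := by
  have := eq_zero_of_homogeneous (𝒱 := 𝒱) (S.mkQ.compMultilinearMap A) (fun β v hv => by
    simpa using h β v hv) v
  simpa using this

/-- The families of multilinear maps with one component for each number of arguments. -/
abbrev Fam (F V : Type*) [Field F] [Ring V] [Algebra F V] : Type _ := ∀ n, Cochain F V n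

variable (𝒱) in
/-- The projection of a family onto its component of parity `α`. -/
noncomputable def parProj (α : ZMod 2) : Fam F V →ₗ[F] Fam F V where
  toFun X n := homExt 𝒱 fun β =>
    ((piProj 𝒱 (α + ∑ j, β j)).lTensor (MvPolynomial (Fin n) F)).compMultilinearMap (X n)
  map_add' X Y := by
    funext n
    change _ = homExt 𝒱 _ + homExt 𝒱 _
    rw [← map_add]
    congr 1; ext β v; simp
  map_smul' c X := by
    funext n
    change _ = c • homExt 𝒱 _
    rw [← map_smul]
    congr 1; ext β v; simp

theorem parProj_apply (α : ZMod 2) (X : Fam F V) {β : Fin n → ZMod 2}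
    (hv : ∀ j, v j ∈ parityShift 𝒱 (β j)) : parProj 𝒱 α X n v =
    (piProj 𝒱 (α + ∑ j, β j)).lTensor _ (X n v) :=
  homExt_apply _ hv

theorem evP_piProj (hV : IsDifferentialSuperalgebra 𝒱 d) {σ : Type*} (τ : σ → Polynomial F)
    (β : ZMod 2) (P : Pol σ F V) :
    evP d τ ((piProj 𝒱 β).lTensor _ P) = piProj 𝒱 β (evP d τ P) := by
  induction P using TensorProduct.induction_on with
  | zero => simp
  | add P Q hP hQ => simp only [map_add, hP, hQ]
  | tmul p u =>
    rw [LinearMap.lTensor_tmul, evP_tmul, evP_tmul]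
    generalize MvPolynomial.aeval τ p = q
    induction q using Polynomial.induction_on generalizing u with
    | C a => simp [aeval_C_apply]
    | add p q hp hq => simp only [map_add, LinearMap.add_apply, hp, hq]
    | monomial n a h =>
      rw [pow_succ, ← mul_assoc, map_mul, Module.End.mul_apply, Module.End.mul_apply,
        Polynomial.aeval_X, ← h, piProj_d hV]

theorem ser_parProj (hV : IsDifferentialSuperalgebra 𝒱 d) (α : ZMod 2) (X : Fam F V)
    (hl : Hom (parityShift 𝒱) l) : ser d ν (parProj 𝒱 α X) l = piProj 𝒱 (α + parSum l) (ser d ν X l)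
    := by
  obtain ⟨n, e, rfl⟩ := exists_ofFn l
  rw [ser_ofFn, ser_ofFn, evC, evC]
  split_ifs
  · rw [parProj_apply α X (hom_ofFn.1 hl), evP_piProj hV, parSum_ofFn]
  · rw [map_zero]

theorem isAs_of_null [Infinite F] (hV : IsDifferentialSuperalgebra 𝒱 d) {ν : F} {Z : Fam F V}
    (hg : ∀ l, Hom (parityShift 𝒱) l → ser d ν Z l - g l ∈ nullVec d (ν + momSum l))
    (hsw : IsSwap (parityShift 𝒱) ν ⊤ g) (hsq : ∀ (l : List (Arg F V)) (β : ZMod 2) (v : V) (T : F),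
    Hom (parityShift 𝒱) l → v ∈ parityShift 𝒱 β → ν + momSum l = (T : WithTop F) →
    g (l ++ [⟨⊤, β, d v⟩]) = d (g (l ++ [⟨⊤, β, v⟩])) + T • g (l ++ [⟨⊤, β, v⟩]))
    (hder : IsDer 𝒱 ν g) (n : ℕ) : IsAs 𝒱 d ν (Z n) := by
  refine isAs_of_series (ν := ν) (Z := fun r => if r = 0 then Z n else 0) hV
    (fun v => ⟨1, fun r hr => by simp [show r ≠ 0 by omega]⟩) (g := fun _ => g)
    (fun t e R he hT hR => ?_) (fun t => hsw) (fun _ => hsq) (fun _ => hder) 0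
  have h1 := hg _ he
  rw [hT, mem_nullVec_top, sub_eq_zero, ser_ofFn] at h1
  rw [← h1]
  cases R with
  | zero =>
    have := hR 0 le_rfl
    simp only [if_true] at this
    simp [evC, this]
  | succ R =>
    rw [Finset.sum_range_succ']
    simp [evC_zero]

theorem parProj_isAs [Infinite F] (hV : IsDifferentialSuperalgebra 𝒱 d) {ν : F} {X : Fam F V}
    (hX : ∀ n, IsAs 𝒱 d ν (X n)) (α : ZMod 2) (n : ℕ) : IsAs 𝒱 d ν (parProj 𝒱 α X n) := by
  have hs := isSeries_ser fun n => (hX n).toIsCoch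
  refine isAs_of_null hV (g := fun l => piProj 𝒱 (α + parSum l) (ser d ν X l))
    (fun l hl => by rw [ser_parProj hV α X hl, sub_self]; exact zero_mem _)
    (fun l₁ e e' l₂ hl hT => ?_) (fun l β v T hl hv hT => ?_)
    (fun l γ δ b c T hl hb hc hT => ?_) n
  · beta_reduce
    rw [hs.isSwap l₁ e e' l₂ hl hT, map_zsmul]
    simp only [parSum_append, parSum_cons, add_left_comm]
  · rw [hs.sesqT l β v [] T (by simpa using hT), map_add, piProj_d hV, map_smul]
    simp
  · beta_reduce
    rw [isDer_ser hV.d_mul hX l γ δ b c T hl hb hc hT, map_add, map_zsmul]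
    simp only [parSum_append, parSum_cons, parSum_nil, add_zero]
    rw [← piProj_mul hc, ← piProj_mul hb]
    congr 2
    · ring_nf
    · ring_nf

theorem parProj_isAs_top [Infinite F] (hV : IsDifferentialSuperalgebra 𝒱 d) {X : Fam F V}
    (hX : ∀ n, IsAs 𝒱 d ⊤ (X n)) (α : ZMod 2) (n : ℕ) : IsAs 𝒱 d ⊤ (parProj 𝒱 α X n) :=
  isAs_top fun ν => parProj_isAs hV (fun n => (hX n).of_top ν) α n

theorem mem_polyPar_iff {σ : Type*} {P : Pol σ F V} : P ∈ polyPar σ (parityShift 𝒱) γ ↔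
    (piProj 𝒱 γ).lTensor _ P = P := by
  constructor
  · rintro ⟨Q, rfl⟩
    rw [← LinearMap.comp_apply, ← LinearMap.lTensor_comp]
    congr 2
    ext x
    exact piProj_of_mem x.2
  · intro h
    refine ⟨((piProj 𝒱 γ).codRestrict (parityShift 𝒱 γ) (piProj_mem γ)).lTensor _ P, ?_⟩
    rw [← LinearMap.comp_apply, ← LinearMap.lTensor_comp, LinearMap.subtype_comp_codRestrict, h]

theorem lTensor_piProj_of_ne {σ : Type*} {P : Pol σ F V} (h : P ∈ polyPar σ (parityShift 𝒱) β)
    (hne : γ ≠ β) : (piProj 𝒱 γ).lTensor _ P = 0 := by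
  rw [← mem_polyPar_iff.1 h, ← LinearMap.comp_apply, ← LinearMap.lTensor_comp]
  have : piProj 𝒱 γ ∘ₗ piProj 𝒱 β = 0 := by
    ext x; exact piProj_of_ne (piProj_mem β x) hne
  rw [this]; simp

theorem lTensor_piProj_piProj {σ : Type*} (γ : ZMod 2) (P : Pol σ F V) :
    (piProj 𝒱 γ).lTensor _ P ∈ polyPar σ (parityShift 𝒱) γ := by
  rw [mem_polyPar_iff, ← LinearMap.comp_apply, ← LinearMap.lTensor_comp]
  congr 2
  ext x; exact piProj_of_mem (piProj_mem γ x)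

theorem sum_lTensor_piProj {σ : Type*} (β : ZMod 2) (P : Pol σ F V) :
    ∑ α, (piProj 𝒱 (α + β)).lTensor _ P = P := by
  refine (Equiv.sum_comp (Equiv.addRight β)
    fun α => (piProj 𝒱 α).lTensor (MvPolynomial σ F) P).trans ?_
  induction P using TensorProduct.induction_on with
  | zero => simp
  | add P Q hP hQ => simp only [map_add, Finset.sum_add_distrib, hP, hQ]
  | tmul p u => simp only [LinearMap.lTensor_tmul, ← TensorProduct.tmul_sum, sum_piProj]

theorem sum_parProj (X : Fam F V) : ∑ α, parProj 𝒱 α X = X := by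
  funext n
  refine eq_of_homogeneous (𝒱 := 𝒱) fun β v hv => ?_
  rw [Finset.sum_apply, MultilinearMap.sum_apply]
  simp only [parProj_apply _ X hv]
  exact sum_lTensor_piProj _ _

variable (𝒱) in
/-- The families of parity `α`. -/
def IsHomFam (α : ZMod 2) (X : Fam F V) : Prop :=
  ∀ n, X n ∈ Cochain.par (parityShift 𝒱) n α

theorem isHomFam_parProj (α : ZMod 2) (X : Fam F V) : IsHomFam 𝒱 α (parProj 𝒱 α X) :=
  fun n β v hv => by rw [parProj_apply α X hv]; exact lTensor_piProj_piProj _ _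

theorem IsHomFam.parProj {X : Fam F V} (hX : IsHomFam 𝒱 α X) : parProj 𝒱 α X = X := by
  funext n
  refine eq_of_homogeneous (𝒱 := 𝒱) fun β v hv => ?_
  rw [parProj_apply _ X hv]
  exact mem_polyPar_iff.1 (hX n β v hv)

theorem IsHomFam.parProj_of_ne {X : Fam F V} (hX : IsHomFam 𝒱 α X) (h : γ ≠ α) :
    UniversalPVA.parProj 𝒱 γ X = 0 := by
  funext n
  refine eq_of_homogeneous (𝒱 := 𝒱) fun β v hv => ?_
  rw [parProj_apply _ X hv]
  exact lTensor_piProj_of_ne (hX n β v hv) fun h' => h (add_right_cancel h')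

theorem IsHomFam.hasPar (hV : IsDifferentialSuperalgebra 𝒱 d) {X : Fam F V} (hX : IsHomFam 𝒱 α X)
    (ν : WithTop F) : HasPar (parityShift 𝒱) α (ser d ν X) := by
  intro l hl
  rw [← hX.parProj, ser_parProj hV α X hl]
  exact piProj_mem _ _

/-- The families that vanish at total momentum `ν`. -/
def NullFam (d : V →ₗ[F] V) (ν : WithTop F) : Submodule F (Fam F V) where
  carrier := {Z | ∀ n v, Z n v ∈ nullPol d n ν}
  add_mem' hX hY n v := add_mem (hX n v) (hY n v)
  zero_mem' n v := zero_mem _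
  smul_mem' c _ hX n v := Submodule.smul_mem _ c (hX n v)

theorem mem_nullFam_top {Z : Fam F V} : Z ∈ NullFam d ⊤ ↔ Z = 0 := by
  constructor
  · intro h
    funext n
    ext v : 1
    exact mem_nullPol_top.1 (h n v)
  · rintro rfl; exact zero_mem _

variable (𝒱) in
theorem mem_nullFam [Infinite F] {Z : Fam F V} (h : ∀ l, Hom (parityShift 𝒱) l → ser d ν Z l ∈
    nullVec d (ν + momSum l)) : Z ∈ NullFam d ν := by
  intro n
  refine mem_of_homogeneous (𝒱 := 𝒱) fun β v hv => ?_
  induction ν using WithTop.recTopCoe with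
  | top =>
    rw [mem_nullPol_top]
    refine eq_zero_of_evP (d := d) fun τ => ?_
    have h1 := h (List.ofFn fun j => ⟨(τ j : WithTop F), β j, v j⟩) (hom_ofFn.2 hv)
    rw [WithTop.top_add, mem_nullVec_top, ser_ofFn, evC, if_pos (by simp)] at h1
    exact h1
  | coe ν =>
    cases n with
    | zero =>
      obtain ⟨u, hu⟩ := mem_nullVec_coe.1 (show ser d ν Z (List.ofFn fun j : Fin 0 =>
        (⟨0, 0, v j⟩ : Arg F V)) ∈ nullVec d ν by
          simpa using h (List.ofFn fun j : Fin 0 => (⟨0, 0, v j⟩ : Arg F V)) (by simp))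
      rw [ser_ofFn, evC, if_pos (by simp)] at hu
      refine mem_nullPol_coe.2 ⟨1 ⊗ₜ u, ?_⟩
      rw [← sub_eq_zero]
      refine eq_zero_of_evP (d := d) fun τ => ?_
      rw [map_sub, map_add, evP_totalD, map_smul, evP_tmul]
      simp only [Finset.univ_eq_empty, Finset.sum_empty, zero_add, Polynomial.aeval_X, map_one,
        Module.End.one_apply]
      rw [hu, sub_eq_zero]
      congr 2
      exact Subsingleton.elim _ _
    | succ n =>
      refine mem_nullPol_of_evP 0 fun τ h1 h2 => ?_
      obtain ⟨m, T, hm, rfl⟩ := exists_momenta h1 h2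
      obtain ⟨h3, h4⟩ := formal_sums hm
      have h5 := h (List.ofFn fun j => ⟨Function.update m 0 ⊤ j, β j, v j⟩) (hom_ofFn.2 hv)
      rw [momSum_eq_top (by rw [topSum_ofFn]; exact h3.ge), mem_nullVec_top, ser_ofFn, evC,
        if_pos h3.le, h4] at h5
      exact h5

end Structure

section NullSeries

variable {F : Type*} [Field F] {V : Type*} [AddCommGroup V] [Module F V]
  {B : Type*} [AddCommGroup B] {𝒰 : ZMod 2 → Submodule F V} {d : V →ₗ[F] V} {n : ℕ}
variable {ν ν' νX νY : WithTop F} {X Y Z : List (Arg F V) → V} {a b : ZMod 2}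

/-- The series that vanish at total momentum `ν`. -/
def NullSer (𝒰 : ZMod 2 → Submodule F V) (d : V →ₗ[F] V) (ν : WithTop F) :
    Submodule F (List (Arg F V) → V) where
  carrier := {f | ∀ l, Hom 𝒰 l → f l ∈ nullVec d (ν + momSum l)}
  add_mem' hX hY l hl := add_mem (hX l hl) (hY l hl)
  zero_mem' _ _ := zero_mem _
  smul_mem' c _ hX l hl := Submodule.smul_mem _ c (hX l hl)

theorem mem_nullSer {f : List (Arg F V) → V} : f ∈ NullSer 𝒰 d ν ↔ IsNull 𝒰 d ν f := isNull_iff.symm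

theorem IsSeries.head_mem (hZ : IsSeries 𝒰 d ν Z) (μ : WithTop F) (β : ZMod 2) {x : V}
    (hx : x ∈ nullVec d μ) {q : List (Arg F V)} (hq : Hom 𝒰 q) : Z (⟨μ, β, x⟩ :: q) ∈
    nullVec d (ν + μ + momSum q) := by
  have h0 := hZ.map_smul [] μ β 0 0 q
  induction μ using WithTop.recTopCoe with
  | top =>
    rw [mem_nullVec_top] at hx
    subst hx
    simp only [List.nil_append, zero_smul] at h0
    rw [h0]; exact zero_mem _
  | coe μ =>
    obtain ⟨u, rfl⟩ := mem_nullVec_coe.1 hx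
    have h5 := isNull_iff.1 (hZ.sesq_isNull μ β u) q hq
    have h6 := hZ.map_add [] μ β (d u) (μ • u) q
    have h7 := hZ.map_smul [] μ β μ u q
    simp only [List.nil_append] at h6 h7
    rw [h6, h7]
    simpa using h5

theorem ins_mem_left (hX : X ∈ NullSer 𝒰 d ν) (hZ : IsSeries 𝒰 d ν' Z) : (fun l => ins l ν a X Z) ∈
    NullSer 𝒰 d (ν' + ν) := by
  intro l hl
  induction l generalizing ν ν' a X Z with
  | nil =>
    have := hZ.head_mem ν a (by simpa using hX [] hom_nil) (q := []) hom_nil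
    simpa [ins] using this
  | cons w l ih =>
    rw [hom_cons] at hl
    have hX' : (fun p => X (w :: p)) ∈ NullSer 𝒰 d (ν + w.mom) :=
      mem_nullSer.2 ((mem_nullSer.1 hX).cons hl.1)
    have h1 := ih hX' hZ (a := a + w.par) hl.2
    have h2 := ih hX (hZ.cons hl.1) (a := a) hl.2
    simp only [ins, momSum_cons]
    refine add_mem ?_ (zsmul_mem ?_ _)
    · convert h1 using 2; abel
    · convert h2 using 2; abel

theorem ins_mem_right (hX : HasPar 𝒰 a X) (hZ : Z ∈ NullSer 𝒰 d ν') : (fun l => ins l ν a X Z) ∈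
    NullSer 𝒰 d (ν + ν') := by
  intro l hl
  induction l generalizing ν ν' a X Z with
  | nil =>
    have := hZ [⟨ν, a, X []⟩] (by simpa using hX [] hom_nil)
    simpa [ins, add_comm] using this
  | cons w l ih =>
    rw [hom_cons] at hl
    have hZ' : (fun p => Z (w :: p)) ∈ NullSer 𝒰 d (ν' + w.mom) :=
      mem_nullSer.2 ((mem_nullSer.1 hZ).cons hl.1)
    have h1 := ih (hX.cons hl.1) hZ (ν := ν + w.mom) hl.2
    have h2 := ih hX hZ' (ν := ν) hl.2
    simp only [ins, momSum_cons]
    refine add_mem ?_ (zsmul_mem ?_ _)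
    · convert h1 using 2; abel
    · convert h2 using 2; abel

theorem bracket_sub_mem_left {X' : List (Arg F V) → V} (hX : X - X' ∈ NullSer 𝒰 d νX)
    (hY : HasPar 𝒰 b Y) (hY' : IsSeries 𝒰 d νY Y) : bracket νX a X νY b Y - bracket νX a X' νY b Y ∈
    NullSer 𝒰 d (νX + νY) := by
  have h1 := ins_mem_left (a := a) hX hY'
  have h2 := ins_mem_right (ν := νY) hY hX
  rw [add_comm] at h1 h2
  have : bracket νX a X νY b Y - bracket νX a X' νY b Y = (fun l => ins l νY b Y (X - X')) -
      sgn a b • fun l => ins l νX a (X - X') Y := by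
    funext l
    have h3 := ins_sub_right l νY b Y X X'
    have h4 := ins_sub_left l νX a X X' hY'.toIsLin
    simp only [bracket, Pi.sub_apply, Pi.smul_apply]
    change _ = ins l νY b Y (fun q => X q - X' q) - sgn a b • ins l νX a (fun q => X q - X' q) Y
    rw [h3, h4, smul_sub]; abel
  rw [this]
  exact sub_mem h2 (zsmul_mem h1 _)

theorem bracket_sub_mem_right {Y' : List (Arg F V) → V} (hY : Y - Y' ∈ NullSer 𝒰 d νY)
    (hX : HasPar 𝒰 a X) (hX' : IsSeries 𝒰 d νX X) : bracket νX a X νY b Y - bracket νX a X νY b Y' ∈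
    NullSer 𝒰 d (νX + νY) := by
  have h := zsmul_mem (bracket_sub_mem_left (a := b) hY hX hX') (-sgn a b)
  rw [add_comm] at h
  convert h using 1
  funext l
  simp only [Pi.sub_apply, Pi.smul_apply]
  rw [bracket_skew νY νX b a Y X, bracket_skew νY νX b a Y' X, sgn_comm a b]
  module

theorem bracket_zero_left (hY : IsLin Y) : bracket νX a 0 νY b Y = 0 := by
  funext l
  have h1 := ins_sub_left l νX a 0 0 hY
  have h2 := ins_sub_right l νY b Y (0 : List (Arg F V) → V) 0
  simp only [sub_self, Pi.zero_apply] at h1 h2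
  simp only [bracket]
  change ins l νY b Y (fun _ => 0) - sgn a b • ins l νX a (fun _ => 0) Y = 0
  rw [h1, h2]; simp

theorem bracket_mem_left (hX : X ∈ NullSer 𝒰 d νX) (hY : HasPar 𝒰 b Y) (hY' : IsSeries 𝒰 d νY Y) :
    bracket νX a X νY b Y ∈ NullSer 𝒰 d (νX + νY) := by
  have := bracket_sub_mem_left (a := a) (X' := 0) (by simpa using hX) hY hY'
  rwa [bracket_zero_left hY'.toIsLin, sub_zero] at this

end NullSeries

section Extend

variable {F : Type*} [Field F] {U U' : Type*} [AddCommGroup U] [Module F U] [AddCommGroup U']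
  [Module F U'] {σ : Type*}

theorem extend_add_left (f g : U →ₗ[F] Pol σ F U') (P : Pol σ F U) :
    extend (f + g) P = extend f P + extend g P := by
  induction P using TensorProduct.induction_on with
  | zero => simp
  | add P Q hP hQ => simp only [map_add, hP, hQ]; abel
  | tmul p u => simp only [extend_tmul, LinearMap.add_apply, smul_add]

theorem extend_smul_left (c : F) (f : U →ₗ[F] Pol σ F U') (P : Pol σ F U) :
    extend (c • f) P = c • extend f P := by
  induction P using TensorProduct.induction_on with
  | zero => simp
  | add P Q hP hQ => simp only [map_add, hP, hQ, smul_add]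
  | tmul p u => simp only [extend_tmul, LinearMap.smul_apply, smul_comm c]

theorem extend_zero_left (P : Pol σ F U) : extend (0 : U →ₗ[F] Pol σ F U') P = 0 := by
  have := extend_smul_left 0 (0 : U →ₗ[F] Pol σ F U') P
  simpa using this

end Extend

theorem linearMap_eq_of_internal {F M N : Type*} [Field F] [AddCommMonoid M] [Module F M]
    [AddCommMonoid N] [Module F N] {S : ZMod 2 → Submodule F M} (hS : DirectSum.IsInternal S)
    {f g : M →ₗ[F] N} (h : ∀ a, ∀ x ∈ S a, f x = g x) : f = g :=
  LinearMap.eqLocus_eq_top.1 (top_le_iff.1 (hS.submodule_iSup_eq_top.ge.trans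
    (iSup_le fun a x hx => h a x hx)))

section Internal

variable {F : Type*} [Field F] {M M' N N' P P' : Type*} [AddCommMonoid M] [Module F M]
  [AddCommMonoid N] [Module F N] [AddCommMonoid P] [Module F P] [AddCommMonoid M'] [Module F M']
  [AddCommMonoid N'] [Module F N'] [AddCommMonoid P'] [Module F P']
  {S : ZMod 2 → Submodule F M} {S' : ZMod 2 → Submodule F N}

theorem bilin_eq_of_internal (hS : DirectSum.IsInternal S) (hS' : DirectSum.IsInternal S')
    {f g : M →ₗ[F] N →ₗ[F] P}
    (h : ∀ a b, ∀ x ∈ S a, ∀ y ∈ S' b, f x y = g x y) (x : M) (y : N) : f x y = g x y :=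
  LinearMap.congr_fun₂ (linearMap_eq_of_internal hS fun a x hx =>
    linearMap_eq_of_internal hS' fun b y hy => h a b x hx y hy) x y

theorem bilin_map_eq_of_internal (hS : DirectSum.IsInternal S) (hS' : DirectSum.IsInternal S')
    {f : M →ₗ[F] N →ₗ[F] P} {g : M' →ₗ[F] N' →ₗ[F] P'} {u : M →ₗ[F] M'} {v : N →ₗ[F] N'}
    {w : P →ₗ[F] P'} (h : ∀ a b, ∀ x ∈ S a, ∀ y ∈ S' b, w (f x y) = g (u x) (v y)) (x : M) (y : N) :
    w (f x y) = g (u x) (v y) :=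
  bilin_eq_of_internal hS hS' (f := f.compr₂ w) (g := g.compl₁₂ u v) h x y

end Internal

section Modules

variable {F : Type*} [Field F] {M : Type*} [AddCommGroup M] [Module F M] {D : M →ₗ[F] M} {N : Submodule F M}

/-- The coefficient of `λ^r`. -/
noncomputable def polyCoeff (r : ℕ) : Pol (Fin 1) F M →ₗ[F] M :=
  Finsupp.lapply (Finsupp.single 0 r) ∘ₗ
    (TensorProduct.equivFinsuppOfBasisLeft (MvPolynomial.basisMonomials (Fin 1) F)).toLinearMap

theorem polyCoeff_tmul (r : ℕ) (p : MvPolynomial (Fin 1) F) (x : M) :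
    polyCoeff r (p ⊗ₜ[F] x) = p.coeff (Finsupp.single 0 r) • x := by
  simp [polyCoeff, MvPolynomial.basisMonomials, MvPolynomial.coeff]

theorem polyCoeff_lTensor {M' : Type*} [AddCommGroup M'] [Module F M'] (f : M →ₗ[F] M') (r : ℕ)
    (z : Pol (Fin 1) F M) : polyCoeff r (f.lTensor _ z) = f (polyCoeff r z) := by
  induction z using TensorProduct.induction_on with
  | zero => simp
  | tmul p x => simp [polyCoeff_tmul]
  | add P Q hP hQ => simp only [map_add, hP, hQ]

theorem eq_zero_of_polyCoeff {z : Pol (Fin 1) F M} (h : ∀ r, polyCoeff r z = 0) : z = 0 := by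
  refine (TensorProduct.equivFinsuppOfBasisLeft
    (MvPolynomial.basisMonomials (Fin 1) F)).injective ?_
  rw [map_zero]
  ext1 m
  rw [Finsupp.unique_single m]
  exact h _

theorem exists_polyCoeff {g : ℕ → M} {R : ℕ} (h : ∀ r, R ≤ r → g r = 0) :
    ∃ z : Pol (Fin 1) F M, ∀ r, polyCoeff r z = g r := by
  classical
  refine ⟨∑ k ∈ Finset.range R, MvPolynomial.monomial (Finsupp.single 0 k) (1 : F) ⊗ₜ g k,
    fun r => ?_⟩
  simp only [map_sum, polyCoeff_tmul, MvPolynomial.coeff_monomial, Finsupp.single_left_inj,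
    (Finsupp.single_injective (0 : Fin 1)).eq_iff, ite_smul, one_smul, zero_smul]
  rw [Finset.sum_ite_eq']
  split_ifs with hr
  · rfl
  · exact (h r (by simpa using hr)).symm

theorem exists_polyCoeff_eq_zero (z : Pol (Fin 1) F M) :
    ∃ R, (∀ r, R ≤ r → polyCoeff r z = 0) ∧ ∀ t : F, ∀ R', R ≤ R' →
      evP D (fun _ => Polynomial.C t) z = ∑ r ∈ Finset.range R', t ^ r • polyCoeff r z := by
  induction z using TensorProduct.induction_on with
  | zero => exact ⟨0, by simp, by simp⟩
  | add P Q hP hQ =>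
    obtain ⟨R, h1, h2⟩ := hP
    obtain ⟨R', h1', h2'⟩ := hQ
    refine ⟨max R R', fun r hr => ?_, fun t S hS => ?_⟩
    · rw [map_add, h1 r (le_trans (le_max_left _ _) hr), h1' r (le_trans (le_max_right _ _) hr),
        add_zero]
    · rw [map_add, h2 t S (le_trans (le_max_left _ _) hS), h2' t S (le_trans (le_max_right _ _) hS),
        ← Finset.sum_add_distrib]
      simp only [map_add, smul_add]
  | tmul p x =>
    induction p using MvPolynomial.induction_on' with
    | monomial u a =>
      classical
      obtain ⟨k, rfl⟩ : ∃ k, u = Finsupp.single 0 k := ⟨_, Finsupp.unique_single u⟩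
      refine ⟨k + 1, fun r hr => ?_, fun t S hS => ?_⟩
      · rw [polyCoeff_tmul, MvPolynomial.coeff_monomial, if_neg, zero_smul]
        exact fun h => by have := Finsupp.single_injective _ h; omega
      · simp only [polyCoeff_tmul, MvPolynomial.coeff_monomial,
          (Finsupp.single_injective (0 : Fin 1)).eq_iff, ite_smul, zero_smul, smul_ite, smul_zero]
        rw [Finset.sum_ite_eq, if_pos (Finset.mem_range.2 (by omega)), evP_tmul,
          MvPolynomial.aeval_monomial]
        simp only [Finsupp.prod_single_index, pow_zero]
        rw [← map_pow, Polynomial.algebraMap_eq, ← map_mul, aeval_C_apply, mul_comm, mul_smul]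
    | add p q hp hq =>
      obtain ⟨R, h1, h2⟩ := hp
      obtain ⟨R', h1', h2'⟩ := hq
      refine ⟨max R R', fun r hr => ?_, fun t S hS => ?_⟩
      · rw [TensorProduct.add_tmul, map_add, h1 r (le_trans (le_max_left _ _) hr),
          h1' r (le_trans (le_max_right _ _) hr), add_zero]
      · rw [TensorProduct.add_tmul, map_add, h2 t S (le_trans (le_max_left _ _) hS),
          h2' t S (le_trans (le_max_right _ _) hS), ← Finset.sum_add_distrib]
        simp only [map_add, smul_add]

theorem mem_range_lTensor {S : Submodule F M} {z : Pol (Fin 1) F M} (h : ∀ r, polyCoeff r z ∈ S) :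
    z ∈ LinearMap.range (LinearMap.lTensor (MvPolynomial (Fin 1) F) S.subtype) := by
  obtain ⟨R, hR, -⟩ := exists_polyCoeff_eq_zero (D := 0) z
  obtain ⟨y, hy⟩ := exists_polyCoeff (F := F) (g := fun r => (⟨polyCoeff r z, h r⟩ : S)) (R := R)
    fun r hr => Subtype.ext (hR r hr)
  refine ⟨y, ?_⟩
  rw [← sub_eq_zero]
  refine eq_zero_of_polyCoeff fun r => ?_
  rw [map_sub, polyCoeff_lTensor, hy, Submodule.subtype_apply, sub_self]

theorem atZero_eq (z : Pol (Fin 1) F M) : atZero z = evP D (fun _ => Polynomial.C 0) z := by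
  induction z using TensorProduct.induction_on with
  | zero => simp
  | add P Q hP hQ => simp only [map_add, hP, hQ]
  | tmul p x =>
    have : (MvPolynomial.aeval fun _ : Fin 1 => Polynomial.C (0 : F)) p =
        algebraMap F (Polynomial F) (MvPolynomial.aeval (fun _ : Fin 1 => (0 : F)) p) := by
      rw [← MvPolynomial.aeval_algebraMap_apply]; rfl
    rw [evP_tmul, this, Polynomial.algebraMap_eq, aeval_C_apply]
    simp [atZero]

theorem exists_bilin {A B C E : Type*} [AddCommMonoid A] [Module F A] [AddCommMonoid B] [Module F B]
    [AddCommMonoid C] [Module F C] [AddCommMonoid E] [Module F E] (f : A →ₗ[F] B →ₗ[F] E)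
    (ι : C →ₗ[F] E) (hι : Function.Injective ι) (h : ∀ a b, ∃ c, ι c = f a b) :
    ∃ g : A →ₗ[F] B →ₗ[F] C, ∀ a b, ι (g a b) = f a b := by
  choose g hg using h
  refine ⟨LinearMap.mk₂ F g (fun _ _ _ => hι ?_) (fun _ _ _ => hι ?_) (fun _ _ _ => hι ?_)
    (fun _ _ _ => hι ?_), hg⟩ <;> simp [hg]

theorem exists_bilin_poly {A B E : Type*} [AddCommMonoid A] [Module F A] [AddCommMonoid B]
    [Module F B] [AddCommMonoid E] [Module F E] (f : ℕ → A →ₗ[F] B →ₗ[F] E) (ι : M →ₗ[F] E)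
    (hι : Function.Injective ι) (h : ∀ r a b, ∃ c, ι c = f r a b)
    (h' : ∀ a b, ∃ R, ∀ r, R ≤ r → f r a b = 0) :
    ∃ g : A →ₗ[F] B →ₗ[F] Pol (Fin 1) F M, ∀ a b r, ι (polyCoeff r (g a b)) = f r a b := by
  obtain ⟨g, hg⟩ := exists_bilin (LinearMap.mk₂ F (fun a b r => f r a b)
    (fun _ _ _ => by funext r; simp) (fun _ _ _ => by funext r; simp)
    (fun _ _ _ => by funext r; simp) (fun _ _ _ => by funext r; simp))
    (LinearMap.pi fun r => ι ∘ₗ polyCoeff r)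
    (fun z z' hz => sub_eq_zero.1 (eq_zero_of_polyCoeff fun r => by
      rw [map_sub, sub_eq_zero]; exact hι (congrFun hz r)))
    fun a b => by
      choose c hc using fun r => h r a b
      obtain ⟨R, hR⟩ := h' a b
      obtain ⟨z, hz⟩ := exists_polyCoeff (F := F) (g := c) (R := R) fun r hr =>
        hι (by rw [hc, hR r hr, map_zero])
      exact ⟨z, funext fun r => (congrArg ι (hz r)).trans (hc r)⟩
  exact ⟨g, fun a b r => congrFun (hg a b) r⟩

/-- A direct sum decomposition given by projections. -/
theorem isInternal_of_proj {ι : Type*} [DecidableEq ι] {S : ι → Submodule F M}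
    (π : ι → M →ₗ[F] M) (h1 : ∀ i x, π i x ∈ S i) (h2 : ∀ i x, x ∈ S i → π i x = x)
    (h3 : ∀ i j x, x ∈ S i → j ≠ i → π j x = 0) (h4 : ∀ x, ∃ s : Finset ι, ∑ i ∈ s, π i x = x) :
    DirectSum.IsInternal S := by
  rw [DirectSum.isInternal_submodule_iff_iSupIndep_and_iSup_eq_top]
  constructor
  · intro i
    rw [Submodule.disjoint_def]
    intro x hx hx'
    have : (⨆ j, ⨆ (_ : j ≠ i), S j) ≤ LinearMap.ker (π i) :=
      iSup₂_le fun j hj y hy => h3 j i y hy hj.symm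
    rw [← h2 i x hx]
    exact this hx'
  · rw [eq_top_iff]
    intro x _
    obtain ⟨s, hs⟩ := h4 x
    rw [← hs]
    exact sum_mem fun i _ => Submodule.mem_iSup_of_mem i (h1 i x)

theorem evP_lTensor {U U' : Type*} [AddCommGroup U] [Module F U] [AddCommGroup U'] [Module F U']
    {σ : Type*} {d : U →ₗ[F] U} {d' : U' →ₗ[F] U'} (f : U →ₗ[F] U') (τ : σ → F) (z : Pol σ F U) :
    evP d' (fun s => Polynomial.C (τ s)) (f.lTensor _ z) =
      f (evP d (fun s => Polynomial.C (τ s)) z) := by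
  induction z using TensorProduct.induction_on with
  | zero => simp
  | add P Q hP hQ => simp only [map_add, hP, hQ]
  | tmul p x =>
    have : MvPolynomial.aeval (fun s => Polynomial.C (τ s)) p =
        Polynomial.C (MvPolynomial.aeval τ p) := MvPolynomial.aeval_algebraMap_apply (Polynomial F) τ p
    rw [LinearMap.lTensor_tmul, evP_tmul, evP_tmul, this, aeval_C_apply, aeval_C_apply, map_smul]

/-- The value at `λ = t` of a `λ`-bracket. -/
noncomputable def brAt {F : Type*} [Field F] {M : Type*} [AddCommGroup M] [Module F M]
    (D : M →ₗ[F] M) (br : M →ₗ[F] M →ₗ[F] Pol (Fin 1) F M) (t : F) : M →ₗ[F] M →ₗ[F] M :=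
  br.compr₂ (evP D fun _ => Polynomial.C t)

theorem sub_mem_of_sub_left {p q r : M} (h1 : p - q ∈ N) (h2 : p - r ∈ N) : r - q ∈ N := by
  simpa using sub_mem h1 h2

theorem sub_mem_of_sub_right {p q r : M} (h1 : p - q ∈ N) (h2 : r - q ∈ N) : p - r ∈ N := by
  simpa using sub_mem h1 h2

theorem sub_zsmul_sub_mem {p p' q q' r r' : M} {k : ℤ} (hp : p - p' ∈ N) (hq : q - q' ∈ N)
    (hr : r - r' ∈ N) (h : p' - k • q' - r' ∈ N) : p - k • q - r ∈ N := by
  convert add_mem h (sub_mem (sub_mem hp (zsmul_mem hq k)) hr) using 1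
  module

theorem ext_evP [Infinite F] {P Q : Pol (Fin 1) F M}
    (h : ∀ t : F, evP D (fun _ => Polynomial.C t) P = evP D (fun _ => Polynomial.C t) Q) : P = Q := by
  rw [← sub_eq_zero]
  refine eq_zero_of_evP (d := D) fun τ => ?_
  rw [show τ = fun _ => τ 0 from funext fun i => by rw [Subsingleton.elim i 0], map_sub, h, sub_self]

theorem exists_rangeSection {N : Type*} [AddCommGroup N] [Module F N] (f : M →ₗ[F] N) :
    ∃ s : N →ₗ[F] M, ∀ y ∈ LinearMap.range f, f (s y) = y := by
  obtain ⟨s, hs⟩ := f.rangeRestrict.exists_rightInverse_of_surjective f.range_rangeRestrict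
  obtain ⟨g, hg⟩ := s.exists_extend
  exact ⟨g, fun y hy => (congrArg f (LinearMap.congr_fun hg ⟨y, hy⟩)).trans
    (congrArg Subtype.val (LinearMap.congr_fun hs ⟨y, hy⟩))⟩

/-- A Lie conformal superalgebra structure from the values of its `λ`-bracket. -/
theorem isLieConformalSuperalgebra_of_values [Infinite F] {S : ZMod 2 → Submodule F M}
    {br : M →ₗ[F] M →ₗ[F] Pol (Fin 1) F M} (hS : DirectSum.IsInternal S)
    (π : ZMod 2 → M →ₗ[F] M) (hπ : ∀ a x, π a x ∈ S a) (hπ' : ∀ a x, x ∈ S a → π a x = x)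
    (D_mem : ∀ {a x}, x ∈ S a → D x ∈ S a)
    (mem : ∀ {a b x y}, x ∈ S a → y ∈ S b → ∀ t, brAt D br t x y ∈ S (a + b))
    (sesq_left : ∀ {a b x y}, x ∈ S a → y ∈ S b → ∀ t, brAt D br t (D x) y = -(t • brAt D br t x y))
    (sesq_right : ∀ {a b x y}, x ∈ S a → y ∈ S b → ∀ t,
      brAt D br t x (D y) = t • brAt D br t x y + D (brAt D br t x y))
    (skew : ∀ {a b x y}, x ∈ S a → y ∈ S b →
      br y x = -((-1 : ℤˣ) ^ (a * b) • subst D (fun _ => -lam 0 - del) (br x y)))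
    (jacobi : ∀ {a b c x y z}, x ∈ S a → y ∈ S b → z ∈ S c → ∀ s t,
      brAt D br s x (brAt D br t y z) - sgn a b • brAt D br t y (brAt D br s x z) =
        brAt D br (s + t) (brAt D br s x y) z) :
    IsLieConformalSuperalgebra S D br where
  isInternal := hS
  D_mem := D_mem
  mem {a b x y} hx hy := mem_range_lTensor fun r => by
    have h1 : (π (a + b)).lTensor _ (br x y) = br x y := ext_evP (D := D) fun t =>
      (evP_lTensor (d := D) (π (a + b)) (fun _ => t) _).trans (hπ' _ _ (mem hx hy t))
    rw [← h1, polyCoeff_lTensor]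
    exact hπ _ _
  sesq_left x y := ext_evP (D := D) fun t => by
    rw [map_neg, evP_smul, MvPolynomial.aeval_X, aeval_C_apply]
    exact bilin_eq_of_internal hS hS (f := brAt D br t ∘ₗ D) (g := -(t • brAt D br t))
      (fun a b x hx y hy => sesq_left hx hy t) x y
  sesq_right x y := ext_evP (D := D) fun t => by
    rw [evP_opAction, map_add, bindP_lam, bindP_del, map_add, LinearMap.add_apply, aeval_C_apply,
      Polynomial.aeval_X]
    exact bilin_eq_of_internal hS hS (f := (brAt D br t).compl₂ D)
      (g := t • brAt D br t + (brAt D br t).compr₂ D) (fun a b x hx y hy => sesq_right hx hy t) x y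
  skew := skew
  jacobi {a b c x y z} hx hy hz := by
    rw [← sub_eq_zero]
    refine eq_zero_of_evP (d := D) fun τ => ?_
    simp only [sgn_smul, map_sub, map_zsmul, evP_extend_C (d := D), LinearMap.comp_apply, evP_subst,
      map_add, bindP_lam, LinearMap.flip_apply]
    rw [← Polynomial.C_add]
    exact sub_eq_zero.2 (jacobi hx hy hz (τ 0) (τ 1))

theorem exists_bilin_quotient {I : Submodule F M} (B : M →ₗ[F] M →ₗ[F] M)
    (hl : ∀ x ∈ I, ∀ y, B x y ∈ I) (hr : ∀ x, ∀ y ∈ I, B x y ∈ I) :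
    ∃ f : (M ⧸ I) →ₗ[F] (M ⧸ I) →ₗ[F] (M ⧸ I), ∀ x y, f (Submodule.Quotient.mk x)
      (Submodule.Quotient.mk y) = Submodule.Quotient.mk (B x y) := by
  obtain ⟨s, hs⟩ := LinearMap.exists_rightInverse_of_surjective I.mkQ I.range_mkQ
  have h1 : ∀ x, s (Submodule.Quotient.mk x) - x ∈ I := fun x =>
    (Submodule.Quotient.eq I).1 (LinearMap.congr_fun hs _)
  refine ⟨(B.compl₁₂ s s).compr₂ I.mkQ, fun x y => (Submodule.Quotient.eq I).2 ?_⟩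
  have := add_mem (hl _ (h1 x) (s (Submodule.Quotient.mk y))) (hr x _ (h1 y))
  rwa [map_sub, map_sub, LinearMap.sub_apply, sub_add_sub_cancel] at this

theorem isInternal_quotient {S : ZMod 2 → Submodule F M} (π : ZMod 2 → M →ₗ[F] M)
    (h1 : ∀ a x, π a x ∈ S a) (h2 : ∀ a x, x ∈ S a → π a x = x)
    (h3 : ∀ a b x, x ∈ S a → b ≠ a → π b x = 0) (h4 : ∀ x, ∑ a, π a x = x)
    {I : Submodule F M} (hI : ∀ a, ∀ x ∈ I, π a x ∈ I) :
    DirectSum.IsInternal fun a => (S a).map I.mkQ := by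
  refine isInternal_of_proj (fun a => I.mapQ I (π a) (hI a)) (fun a x => ?_) ?_ ?_ fun x =>
    ⟨Finset.univ, ?_⟩
  · obtain ⟨x, rfl⟩ := I.mkQ_surjective x
    exact ⟨_, h1 a x, rfl⟩
  · rintro a _ ⟨x, hx, rfl⟩
    exact congrArg I.mkQ (h2 a x hx)
  · rintro a b _ ⟨x, hx, rfl⟩ hb
    exact (congrArg I.mkQ (h3 a b x hx hb)).trans (map_zero _)
  · obtain ⟨x, rfl⟩ := I.mkQ_surjective x
    exact (map_sum I.mkQ _ _).symm.trans (congrArg I.mkQ (h4 x))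

end Modules

section Lift

variable {F : Type*} [Field F]

theorem exists_linear {A C D : Type*} [AddCommMonoid A] [Module F A]
    [AddCommMonoid C] [Module F C] [AddCommMonoid D] [Module F D] (f : A →ₗ[F] D)
    (ι : C →ₗ[F] D) (hι : Function.Injective ι) (h : ∀ a, ∃ c, ι c = f a) :
    ∃ g : A →ₗ[F] C, ∀ a, ι (g a) = f a := by
  choose g hg using h
  exact ⟨⟨⟨g, fun _ _ => hι (by simp [hg])⟩, fun _ _ => hι (by simp [hg])⟩, hg⟩

theorem exists_directSum {M : ℕ → Type*} [∀ n, AddCommMonoid (M n)] [∀ n, Module F (M n)]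
    (S : ∀ n, Submodule F (M n)) {Z : ∀ n, M n} (h : ∀ n, Z n ∈ S n)
    (hZ : ∃ N, ∀ n, N ≤ n → Z n = 0) : ∃ X : DirectSum ℕ fun n => S n, ∀ n, (X n : M n) = Z n := by
  obtain ⟨N, hN⟩ := hZ
  refine ⟨DirectSum.mk (fun n => S n) (Finset.range N) fun k => ⟨Z k, h k⟩, fun n => ?_⟩
  by_cases hn : n ∈ Finset.range N
  · rw [DirectSum.mk_apply_of_mem hn]
  · rw [DirectSum.mk_apply_of_notMem hn, hN n (by simpa using hn)]; rfl

theorem exists_directSum_eq_zero {M : ℕ → Type*} [∀ n, AddCommMonoid (M n)] [∀ n, Module F (M n)]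
    (S : ∀ n, Submodule F (M n)) (X : DirectSum ℕ fun n => S n) :
    ∃ N, ∀ n, N ≤ n → (X n : M n) = 0 := by
  classical
  refine ⟨(DFinsupp.support X).sup id + 1, fun n hn => ?_⟩
  by_contra h
  have : n ∈ DFinsupp.support X := DFinsupp.mem_support_iff.2 fun h' => h (by rw [h']; rfl)
  have := Finset.le_sup (f := id) this
  simp only [id_eq] at this
  omega

theorem mem_range_lof_iff {M : ℕ → Type*} [∀ n, AddCommMonoid (M n)] [∀ n, Module F (M n)]
    (S : ∀ n, Submodule F (M n)) (X : DirectSum ℕ fun n => S n) (k : ℕ) :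
    X ∈ LinearMap.range (DirectSum.lof F ℕ (fun n => S n) k) ↔ ∀ n, n ≠ k → (X n : M n) = 0 := by
  constructor
  · rintro ⟨x, rfl⟩ n hn
    rw [DirectSum.lof_eq_of, DirectSum.of_eq_of_ne _ _ _ hn]; rfl
  · intro h
    refine ⟨X k, ?_⟩
    refine DFinsupp.ext fun n => ?_
    rcases eq_or_ne n k with rfl | hn
    · exact DirectSum.lof_apply F n _
    · exact (DirectSum.of_eq_of_ne _ _ _ hn).trans (Subtype.ext (h n hn).symm)

end Lift

section Families

variable {F : Type*} [Field F] {V : Type*} [Ring V] [Algebra F V]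
  {𝒱 : ZMod 2 → Submodule F V} [GradedAlgebra 𝒱] {d : V →ₗ[F] V} {n : ℕ} {m : ℕ}
  {σ : Type*}
variable {ν : WithTop F} {a b c k δ : ZMod 2} {X X' Y Z Z' : Fam F V} {l : List (Arg F V)} {R : ℕ}
  {z : V} {P : Pol (Fin n) F V} {β : Fin n → ZMod 2} {v : Fin n → V}

theorem plugFirst_update_add {k : ℕ} (X : Cochain F V (k + 1)) [inst : DecidableEq (Fin k)]
    (w : Fin k → V) (j : Fin k) (x y : V) : plugFirst X (Function.update w j (x + y)) =
      plugFirst X (Function.update w j x) + plugFirst X (Function.update w j y) := by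
  obtain rfl := Subsingleton.elim inst (instDecidableEqFin k)
  ext u
  simp [plugFirst, Fin.cons_update]

theorem plugFirst_update_smul {k : ℕ} (X : Cochain F V (k + 1)) [inst : DecidableEq (Fin k)]
    (w : Fin k → V) (j : Fin k) (c : F) (x : V) : plugFirst X (Function.update w j (c • x)) =
      c • plugFirst X (Function.update w j x) := by
  obtain rfl := Subsingleton.elim inst (instDecidableEqFin k)
  ext u
  simp [plugFirst, Fin.cons_update]

theorem pick_injective {m : ℕ} (S : Finset (Fin m)) : Function.Injective (pick S) :=
  (S.orderEmbOfFin rfl).injective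

theorem pick_mem {m : ℕ} (S : Finset (Fin m)) (k : Fin S.card) : pick S k ∈ S :=
  S.orderEmbOfFin_mem rfl k

theorem exists_pick {m : ℕ} {S : Finset (Fin m)} {j : Fin m} (h : j ∈ S) : ∃ k, pick S k = j := by
  have := S.range_orderEmbOfFin rfl
  rw [Set.ext_iff] at this
  exact (this j).2 h

/-- Updating one argument changes exactly one of the two parts of a splitting. -/
theorem update_comp_pick {α : Type*} {m : ℕ} (S : Finset (Fin m)) (j : Fin m) :
    (∃ k, ∀ (v : Fin m → α) x, Function.update v j x ∘ pick S = Function.update (v ∘ pick S) k x ∧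
      Function.update v j x ∘ pick Sᶜ = v ∘ pick Sᶜ) ∨
    (∃ k, ∀ (v : Fin m → α) x, Function.update v j x ∘ pick S = v ∘ pick S ∧
      Function.update v j x ∘ pick Sᶜ = Function.update (v ∘ pick Sᶜ) k x) := by
  by_cases h : j ∈ S
  · obtain ⟨k, rfl⟩ := exists_pick h
    exact .inl ⟨k, fun v x => ⟨Function.update_comp_eq_of_injective v (pick_injective S) k x,
      Function.update_comp_eq_of_forall_ne v x fun k' h' =>
        Finset.mem_compl.1 (pick_mem Sᶜ k') (h' ▸ h)⟩⟩
  · obtain ⟨k, rfl⟩ := exists_pick (Finset.mem_compl.2 h)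
    exact .inr ⟨k, fun v x => ⟨Function.update_comp_eq_of_forall_ne v x fun k' h' =>
      h (h' ▸ pick_mem S k'), Function.update_comp_eq_of_injective v (pick_injective Sᶜ) k x⟩⟩

/-- The box product for fixed parities of the arguments, as a multilinear map. -/
noncomputable def boxMulti (d : V →ₗ[F] V) (ν : Fin m → σ)
    (first : Finset (Fin m) → Polynomial (MvPolynomial σ F)) (X Y : Fam F V)
    (β : Fin m → ZMod 2) : MultilinearMap F (fun _ : Fin m => V) (Pol σ F V) :=
  MultilinearMap.mk' (fun v => boxSum d ν first X Y β v)
    (fun v j x y => by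
      simp only [boxSum]
      rw [← Finset.sum_add_distrib]
      refine Finset.sum_congr rfl fun S _ => ?_
      rw [← smul_add]
      congr 1
      rcases update_comp_pick (α := V) S j with ⟨k, h⟩ | ⟨k, h⟩
      · simp only [(h _ _).1, (h _ _).2, MultilinearMap.map_update_add, map_add]
      · simp only [(h _ _).1, (h _ _).2, plugFirst_update_add, LinearMap.comp_add,
          extend_add_left])
    (fun v j c x => by
      simp only [boxSum]
      rw [Finset.smul_sum]
      refine Finset.sum_congr rfl fun S _ => ?_
      rw [smul_comm c]
      congr 1
      rcases update_comp_pick (α := V) S j with ⟨k, h⟩ | ⟨k, h⟩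
      · simp only [(h _ _).1, (h _ _).2, MultilinearMap.map_update_smul, map_smul]
      · simp only [(h _ _).1, (h _ _).2, plugFirst_update_smul, LinearMap.comp_smul,
          extend_smul_left])

variable (𝒱) in
/-- The box product, bilinear in the two families. -/
noncomputable def boxLin (d : V →ₗ[F] V) (ν : Fin m → σ)
    (first : Finset (Fin m) → Polynomial (MvPolynomial σ F)) :
    Fam F V →ₗ[F] Fam F V →ₗ[F] MultilinearMap F (fun _ : Fin m => V) (Pol σ F V) :=
  LinearMap.mk₂ F (fun X Y => homExt 𝒱 (boxMulti d ν first X Y))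
    (fun X X' Y => by
      rw [← map_add]; congr 1; ext β v
      simp only [boxMulti, boxSum, MultilinearMap.mk'_apply, Pi.add_apply, add_apply]
      rw [← Finset.sum_add_distrib]
      refine Finset.sum_congr rfl fun S _ => ?_
      rw [← smul_add, ← extend_add_left, ← LinearMap.comp_add]; rfl)
    (fun c X Y => by
      rw [← map_smul]; congr 1; ext β v
      simp only [boxMulti, boxSum, MultilinearMap.mk'_apply, Pi.smul_apply, smul_apply]
      rw [Finset.smul_sum]
      refine Finset.sum_congr rfl fun S _ => ?_
      rw [smul_comm c, ← extend_smul_left, ← LinearMap.comp_smul]; rfl)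
    (fun X Y Y' => by
      rw [← map_add]; congr 1; ext β v
      simp only [boxMulti, boxSum, MultilinearMap.mk'_apply, Pi.add_apply, add_apply, map_add,
        smul_add, Finset.sum_add_distrib])
    (fun c X Y => by
      rw [← map_smul]; congr 1; ext β v
      simp only [boxMulti, boxSum, MultilinearMap.mk'_apply, Pi.smul_apply, smul_apply, map_smul,
        smul_comm _ c, Finset.smul_sum])

theorem boxLin_apply (ν : Fin m → σ)
    (first : Finset (Fin m) → Polynomial (MvPolynomial σ F)) (X Y : Fam F V) {β : Fin m → ZMod 2}
    {v : Fin m → V} (hv : ∀ j, v j ∈ parityShift 𝒱 (β j)) :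
    boxLin 𝒱 d ν first X Y v = boxSum d ν first X Y β v :=
  homExt_apply _ hv

theorem boxSum_eq_zero {ν : Fin m → σ} {first : Finset (Fin m) → Polynomial (MvPolynomial σ F)}
    {β : Fin m → ZMod 2} {v : Fin m → V} (h : ∀ k l, k + l = m → Y k = 0 ∨ X (l + 1) = 0) :
    boxSum d ν first X Y β v = 0 := by
  refine Finset.sum_eq_zero fun S _ => ?_
  rcases h _ _ ((Finset.card_add_card_compl S).trans (Fintype.card_fin m)) with h | h
  · rw [h]; simp
  · rw [h]
    have : plugFirst (0 : Cochain F V (Sᶜ.card + 1)) (v ∘ pick Sᶜ) = 0 := by ext; rfl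
    rw [this, LinearMap.comp_zero, extend_zero_left, smul_zero]

variable (𝒱) in
/-- `(X, Y) ↦ L(X, Y) - (-1)^{p̄(X)p̄(Y)} R(Y, X)`. -/
noncomputable def superComm {M : Type*} [AddCommGroup M] [Module F M]
    (L R : Fam F V →ₗ[F] Fam F V →ₗ[F] M) : Fam F V →ₗ[F] Fam F V →ₗ[F] M :=
  ∑ a, ∑ b, (L - sgn a b • R.flip).compl₁₂ (parProj 𝒱 a) (parProj 𝒱 b)

theorem superComm_apply {M : Type*} [AddCommGroup M] [Module F M]
    (L R : Fam F V →ₗ[F] Fam F V →ₗ[F] M) (X Y : Fam F V) : superComm 𝒱 L R X Y =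
      ∑ a, ∑ b, (L (parProj 𝒱 a X) (parProj 𝒱 b Y) -
        sgn a b • R (parProj 𝒱 b Y) (parProj 𝒱 a X)) := by
  simp [superComm, LinearMap.sum_apply]

theorem superComm_of_hom {M : Type*} [AddCommGroup M] [Module F M]
    (L R : Fam F V →ₗ[F] Fam F V →ₗ[F] M) (hX : IsHomFam 𝒱 a X) (hY : IsHomFam 𝒱 b Y) :
    superComm 𝒱 L R X Y = L X Y - sgn a b • R Y X := by
  rw [superComm_apply, Finset.sum_eq_single a, Finset.sum_eq_single b, hX.parProj, hY.parProj]
  · intro c _ hc; rw [hY.parProj_of_ne hc]; simp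
  · simp
  · intro c _ hc; rw [hX.parProj_of_ne hc]; simp
  · simp

/-- A family of bilinear maps as a bilinear map to families. -/
noncomputable def famBilin (f : ∀ n, Fam F V →ₗ[F] Fam F V →ₗ[F] Cochain F V n) :
    Fam F V →ₗ[F] Fam F V →ₗ[F] Fam F V :=
  LinearMap.mk₂ F (fun X Y n => f n X Y) (fun _ _ _ => by funext; simp)
    (fun _ _ _ => by funext; simp) (fun _ _ _ => by funext; simp) (fun _ _ _ => by funext; simp)

theorem famBilin_apply (f : ∀ n, Fam F V →ₗ[F] Fam F V →ₗ[F] Cochain F V n) (X Y : Fam F V) :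
    famBilin f X Y n = f n X Y := rfl

theorem famBilin_sum (f : Fam F V →ₗ[F] Fam F V →ₗ[F] Fam F V) (X Y : Fam F V) :
    f X Y n = ∑ a, ∑ b, f (parProj 𝒱 a X) (parProj 𝒱 b Y) n := by
  conv_lhs => rw [← sum_parProj (𝒱 := 𝒱) X, ← sum_parProj (𝒱 := 𝒱) Y]
  simp only [map_sum, LinearMap.sum_apply, Finset.sum_apply]
  exact Finset.sum_comm

variable (𝒱) in
/-- The bracket of families of representatives for `W^∂(ΠV)`. -/
noncomputable def lieFam (d : V →ₗ[F] V) : Fam F V →ₗ[F] Fam F V →ₗ[F] Fam F V :=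
  famBilin fun n => superComm 𝒱 (M := Cochain F V n)
    (boxLin 𝒱 d id fun S => ∑ j ∈ S, lam j) (boxLin 𝒱 d id fun S => ∑ j ∈ S, lam j)

variable (𝒱) in
/-- The action on `W̃^∂(ΠV)` of families of representatives for `W^∂(ΠV)`. -/
noncomputable def actFam (d : V →ₗ[F] V) : Fam F V →ₗ[F] Fam F V →ₗ[F] Fam F V :=
  famBilin fun n => superComm 𝒱 (M := Cochain F V n)
    (boxLin 𝒱 d id fun S => -(∑ j ∈ Sᶜ, lam j) - del) (boxLin 𝒱 d id fun S => ∑ j ∈ S, lam j)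

variable (𝒱) in
/-- The `λ`-bracket on the components with `n` arguments. -/
noncomputable def lambdaFam (d : V →ₗ[F] V) (n : ℕ) : Fam F V →ₗ[F] Fam F V →ₗ[F]
    MultilinearMap F (fun _ : Fin n => V) (Pol (Option (Fin n)) F V) :=
  superComm 𝒱 (M := MultilinearMap F (fun _ : Fin n => V) (Pol (Option (Fin n)) F V))
    (boxLin 𝒱 d some fun S => -lam none - (∑ j ∈ Sᶜ, lam (some j)) - del)
    ((boxLin 𝒱 d some fun S => -lam none - (∑ j ∈ Sᶜ, lam (some j)) - del).compr₂
      ((subst d (fun t : Option (Fin n) =>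
        t.elim (-lam none - (∑ j, lam (some j)) - del) (fun j => lam (some j)))).compMultilinearMapₗ F))

variable (𝒱) in
/-- The coefficient of `λ^r` in the `λ`-bracket. -/
noncomputable def brCoeff (d : V →ₗ[F] V) (r : ℕ) : Fam F V →ₗ[F] Fam F V →ₗ[F] Fam F V :=
  famBilin fun n => (lambdaFam 𝒱 d n).compr₂ ((lambdaCoeff r).compMultilinearMapₗ F)

variable {a b : ZMod 2} {X Y : Fam F V} {β : Fin n → ZMod 2} {v : Fin n → V}

theorem lieFam_apply (hX : IsHomFam 𝒱 a X) (hY : IsHomFam 𝒱 b Y)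
    (hv : ∀ j, v j ∈ parityShift 𝒱 (β j)) : lieFam 𝒱 d X Y n v =
      boxPlain d X Y β v - (-1 : ℤˣ) ^ (a * b) • boxPlain d Y X β v := by
  rw [lieFam, famBilin_apply, superComm_of_hom _ _ hX hY, MultilinearMap.sub_apply,
    MultilinearMap.smul_apply, boxLin_apply _ _ _ _ hv, boxLin_apply _ _ _ _ hv]
  rfl

theorem actFam_apply (hX : IsHomFam 𝒱 a X) (hY : IsHomFam 𝒱 b Y)
    (hv : ∀ j, v j ∈ parityShift 𝒱 (β j)) : actFam 𝒱 d X Y n v =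
      boxLeft d X Y β v - (-1 : ℤˣ) ^ (a * b) • boxPlain d Y X β v := by
  rw [actFam, famBilin_apply, superComm_of_hom _ _ hX hY, MultilinearMap.sub_apply,
    MultilinearMap.smul_apply, boxLin_apply _ _ _ _ hv, boxLin_apply _ _ _ _ hv]
  rfl

theorem lambdaFam_apply (hX : IsHomFam 𝒱 a X) (hY : IsHomFam 𝒱 b Y)
    (hv : ∀ j, v j ∈ parityShift 𝒱 (β j)) :
    lambdaFam 𝒱 d n X Y v = lambdaBracket d a b X Y β v := by
  rw [lambdaFam, superComm_of_hom _ _ hX hY, MultilinearMap.sub_apply,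
    MultilinearMap.smul_apply, LinearMap.compr₂_apply, LinearMap.compMultilinearMapₗ_apply,
    LinearMap.compMultilinearMap_apply, boxLin_apply _ _ _ _ hv, boxLin_apply _ _ _ _ hv]
  rfl

theorem brCoeff_apply (r : ℕ) (X Y : Fam F V) (v : Fin n → V) :
    brCoeff 𝒱 d r X Y n v = lambdaCoeff r (lambdaFam 𝒱 d n X Y v) := rfl

theorem exists_brCoeff_eq_zero (X Y : Fam F V) (v : Fin n → V) :
    ∃ R, ∀ r, R ≤ r → brCoeff 𝒱 d r X Y n v = 0 :=
  exists_lambdaCoeff_eq_zero _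

theorem ser_lieFam_mem (hV : IsDifferentialSuperalgebra 𝒱 d) (hX : IsHomFam 𝒱 a X)
    (hY : IsHomFam 𝒱 b Y) (hX' : ∀ n, IsCoch 𝒱 d ((0 : F) : WithTop F) (X n))
    (hY' : ∀ n, IsCoch 𝒱 d ((0 : F) : WithTop F) (Y n)) (hl : Hom (parityShift 𝒱) l) :
    ser d ((0 : F) : WithTop F) (lieFam 𝒱 d X Y) l -
    bracket ((0 : F) : WithTop F) a (ser d ((0 : F) : WithTop F) X)
    ((0 : F) : WithTop F) b (ser d ((0 : F) : WithTop F) Y) l ∈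
    nullVec d (((0 : F) : WithTop F) + momSum l) := by
  obtain ⟨n, e, rfl⟩ := exists_ofFn l
  have := lie_mem hX' hY' (hX.hasPar hV _) (hY.hasPar hV _) e hl
  rwa [ser_ofFn, evC_eq_evPol, lieFam_apply hX hY (hom_ofFn.1 hl)]

theorem ser_actFam_mem (hV : IsDifferentialSuperalgebra 𝒱 d) (hX : IsHomFam 𝒱 a X)
    (hY : IsHomFam 𝒱 b Y) (hX' : ∀ n, IsCoch 𝒱 d ((0 : F) : WithTop F) (X n))
    (hY' : ∀ n, IsCoch 𝒱 d ν (Y n)) (hl : Hom (parityShift 𝒱) l) : ser d ν (actFam 𝒱 d X Y) l -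
    bracket ((0 : F) : WithTop F) a (ser d ((0 : F) : WithTop F) X) ν b (ser d ν Y) l ∈
    nullVec d (ν + momSum l) := by
  obtain ⟨n, e, rfl⟩ := exists_ofFn l
  have := act_mem hX' hY' (hX.hasPar hV _) (hY.hasPar hV _) e hl
  rwa [ser_ofFn, evC_eq_evPol, actFam_apply hX hY (hom_ofFn.1 hl)]

theorem sum_evPol_lambdaCoeff (t : F) (ν : WithTop F) (m : Fin n → WithTop F)
    (P : Pol (Option (Fin n)) F V) (hR : ∀ r, R ≤ r → lambdaCoeff r P = 0) : ∑ r ∈ Finset.range R,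
    t ^ r • evPol d ((t : WithTop F) + ν) m (lambdaCoeff r P) = evPolLambda d t ν m P := by
  have h : topCount ((t : WithTop F) + ν) = topCount ν := by
    induction ν using WithTop.recTopCoe with
    | top => simp
    | coe ν => rw [← WithTop.coe_add, topCount_coe, topCount_coe]
  unfold evPol evPolLambda
  simp only [h]
  split_ifs with h1
  · rw [sum_evP_lambdaCoeff _ _ _ hR]
    congr 3
    funext i
    cases i with
    | none => rfl
    | some i => ?_
    simp only [Option.elim_some]
    induction ν using WithTop.recTopCoe with
    | top =>
      have h2 : topCount (m i) ≤ ∑ j, topCount (m j) := Finset.single_le_sum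
        (f := fun j => topCount (m j)) (fun _ _ => Nat.zero_le _) (Finset.mem_univ i)
      rw [topCount_top] at h1
      rw [tau_eq, tau_eq, show topCount (m i) = 0 by omega, zero_smul, zero_smul]
    | coe ν => rw [← WithTop.coe_add]; simp
  · simp

theorem sum_ser_brCoeff_mem (hV : IsDifferentialSuperalgebra 𝒱 d) (hX : IsHomFam 𝒱 a X)
    (hY : IsHomFam 𝒱 b Y) {t : F} (hX' : ∀ n, IsCoch 𝒱 d t (X n)) (hY' : ∀ n, IsCoch 𝒱 d ν (Y n))
    {e : Fin n → Arg F V} (he : Hom (parityShift 𝒱) (List.ofFn e))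
    (hR : ∀ r, R ≤ r → brCoeff 𝒱 d r X Y n (fun i => (e i).vec) = 0) : ∑ r ∈ Finset.range R,
    t ^ r • evC d (t + ν) (brCoeff 𝒱 d r X Y n) e -
    bracket t a (ser d t X) ν b (ser d ν Y) (List.ofFn e) ∈ nullVec d (t + ν + momSum (List.ofFn e))
    := by
  have := lambdaBracket_mem hX' hY' (hX.hasPar hV _) (hY.hasPar hV _) e he
  rw [← lambdaFam_apply hX hY (hom_ofFn.1 he), ← sum_evPol_lambdaCoeff t ν _ _ hR] at this
  exact this

theorem isAs_lieFam [Infinite F] (hV : IsDifferentialSuperalgebra 𝒱 d)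
    (hX : ∀ n, IsAs 𝒱 d ((0 : F) : WithTop F) (X n))
    (hY : ∀ n, IsAs 𝒱 d ((0 : F) : WithTop F) (Y n)) (n : ℕ) :
    IsAs 𝒱 d ((0 : F) : WithTop F) (lieFam 𝒱 d X Y n) := by
  rw [famBilin_sum (𝒱 := 𝒱)]
  refine IsAs.sum fun a _ => IsAs.sum fun b _ => ?_
  have hX₁ := parProj_isAs hV hX a
  have hY₁ := parProj_isAs hV hY b
  have hX₂ := isHomFam_parProj (𝒱 := 𝒱) a X
  have hY₂ := isHomFam_parProj (𝒱 := 𝒱) b Y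
  generalize parProj 𝒱 a X = X at *
  generalize parProj 𝒱 b Y = Y at *
  have hX₃ := isSeries_ser fun n => (hX₁ n).toIsCoch
  have hY₃ := isSeries_ser fun n => (hY₁ n).toIsCoch
  have h0 : ((0 : F) : WithTop F) + ((0 : F) : WithTop F) = ((0 : F) : WithTop F) := by
    rw [← WithTop.coe_add, add_zero]
  refine isAs_of_null hV (fun l hl => ser_lieFam_mem hV hX₂ hY₂ (fun n => (hX₁ n).toIsCoch)
    (fun n => (hY₁ n).toIsCoch) hl) ?_ (fun l β v T hl _ hT => ?_) ?_ n
  · have := bracket_swap hX₃ (hX₂.hasPar hV _) hY₃ (hY₂.hasPar hV _)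
    rwa [h0] at this
  · exact bracket_sesqT hX₃ hY₃ l β v T hl (by rwa [h0])
  · have := bracket_isDer hV hX₃ (hX₂.hasPar hV _) (isDer_ser hV.d_mul hX₁) hY₃ (hY₂.hasPar hV _)
      (isDer_ser hV.d_mul hY₁)
    rwa [h0] at this

theorem isAs_actFam [Infinite F] (hV : IsDifferentialSuperalgebra 𝒱 d)
    (hX : ∀ n, IsAs 𝒱 d ((0 : F) : WithTop F) (X n))
    (hY : ∀ n, IsAs 𝒱 d ⊤ (Y n)) (n : ℕ) : IsAs 𝒱 d ⊤ (actFam 𝒱 d X Y n) := by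
  refine isAs_top fun ν => ?_
  rw [famBilin_sum (𝒱 := 𝒱)]
  refine IsAs.sum fun a _ => IsAs.sum fun b _ => ?_
  have hX₁ := parProj_isAs hV hX a
  have hY₁ := parProj_isAs hV (fun n => (hY n).of_top ν) b
  have hX₂ := isHomFam_parProj (𝒱 := 𝒱) a X
  have hY₂ := isHomFam_parProj (𝒱 := 𝒱) b Y
  generalize parProj 𝒱 a X = X at *
  generalize parProj 𝒱 b Y = Y at *
  have hX₃ := isSeries_ser fun n => (hX₁ n).toIsCoch
  have hY₃ := isSeries_ser fun n => (hY₁ n).toIsCoch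
  have h0 : ((0 : F) : WithTop F) + (ν : WithTop F) = ν := by
    rw [← WithTop.coe_add, zero_add]
  refine isAs_of_null hV (fun l hl => ser_actFam_mem hV hX₂ hY₂ (fun n => (hX₁ n).toIsCoch)
    (fun n => (hY₁ n).toIsCoch) hl) ?_ (fun l β v T hl _ hT => ?_) ?_ n
  · have := bracket_swap hX₃ (hX₂.hasPar hV _) hY₃ (hY₂.hasPar hV _)
    rwa [h0] at this
  · exact bracket_sesqT hX₃ hY₃ l β v T hl (by rwa [h0])
  · have := bracket_isDer hV hX₃ (hX₂.hasPar hV _) (isDer_ser hV.d_mul hX₁) hY₃ (hY₂.hasPar hV _)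
      (isDer_ser hV.d_mul hY₁)
    rwa [h0] at this

theorem isAs_brCoeff [Infinite F] (hV : IsDifferentialSuperalgebra 𝒱 d)
    (hX : ∀ n, IsAs 𝒱 d ⊤ (X n)) (hY : ∀ n, IsAs 𝒱 d ⊤ (Y n)) (r n : ℕ) :
    IsAs 𝒱 d ⊤ (brCoeff 𝒱 d r X Y n) := by
  rw [famBilin_sum (𝒱 := 𝒱)]
  refine IsAs.sum fun a _ => IsAs.sum fun b _ => ?_
  have hX₁ := parProj_isAs_top hV hX a
  have hY₁ := parProj_isAs_top hV hY b
  have hX₂ := isHomFam_parProj (𝒱 := 𝒱) a X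
  have hY₂ := isHomFam_parProj (𝒱 := 𝒱) b Y
  generalize parProj 𝒱 a X = X at *
  generalize parProj 𝒱 b Y = Y at *
  refine isAs_top fun ν => ?_
  have hX₃ := fun t : F => isSeries_ser fun n => ((hX₁ n).of_top t).toIsCoch
  have hY₃ := fun t : F => isSeries_ser fun n => ((hY₁ n).of_top t).toIsCoch
  have h0 : ∀ t : F, (t : WithTop F) + ((ν - t : F) : WithTop F) = ν := fun t => by
    rw [← WithTop.coe_add, add_sub_cancel]
  refine isAs_of_series (ν := ν) (Z := fun r => brCoeff 𝒱 d r X Y n) hV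
    (fun v => exists_brCoeff_eq_zero X Y v)
    (g := fun t => bracket t a (ser d t X) ((ν - t : F) : WithTop F) b
      (ser d ((ν - t : F) : WithTop F) Y)) (fun t e R he hT hR => ?_) (fun t => ?_)
    (fun t l β v T hl _ hT => ?_) (fun t => ?_) r
  · have := sum_ser_brCoeff_mem hV hX₂ hY₂ (fun n => ((hX₁ n).of_top t).toIsCoch)
      (fun n => ((hY₁ n).of_top ((ν - t : F) : WithTop F)).toIsCoch) he hR
    rwa [h0, hT, mem_nullVec_top, sub_eq_zero] at this
  · have := bracket_swap (hX₃ t) (hX₂.hasPar hV _) (hY₃ (ν - t)) (hY₂.hasPar hV _)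
    rwa [h0] at this
  · exact bracket_sesqT (hX₃ t) (hY₃ (ν - t)) l β v T hl (by rwa [h0])
  · have := bracket_isDer hV (hX₃ t) (hX₂.hasPar hV _)
      (isDer_ser hV.d_mul fun n => (hX₁ n).of_top t) (hY₃ (ν - t)) (hY₂.hasPar hV _)
      (isDer_ser hV.d_mul fun n => (hY₁ n).of_top _)
    rwa [h0] at this

/-- A family that agrees with a function of parity `c` at total momentum `ν` is of parity `c`. -/
theorem sub_parProj_mem_nullFam [Infinite F] (hV : IsDifferentialSuperalgebra 𝒱 d)
    {g : List (Arg F V) → V} (hg : HasPar (parityShift 𝒱) c g)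
    (h : ∀ l, Hom (parityShift 𝒱) l → ser d ν Z l - g l ∈ nullVec d (ν + momSum l)) : Z -
    parProj 𝒱 c Z ∈ NullFam d ν := by
  refine mem_nullFam 𝒱 fun l hl => ?_
  rw [ser_sub, ser_parProj hV c Z hl]
  have h1 := h l hl
  have h2 : ∀ {T : WithTop F} {x : V} (γ : ZMod 2), x ∈ nullVec d T →
      piProj 𝒱 γ x ∈ nullVec d T := by
    intro T x γ hx
    induction T using WithTop.recTopCoe with
    | top => rw [mem_nullVec_top] at *; rw [hx, map_zero]
    | coe T =>
      obtain ⟨u, rfl⟩ := mem_nullVec_coe.1 hx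
      exact mem_nullVec_coe.2 ⟨piProj 𝒱 γ u, by rw [map_add, piProj_d hV, map_smul]⟩
  have h3 := sub_mem h1 (h2 (c + parSum l) h1)
  rwa [map_sub, piProj_of_mem (hg l hl), sub_sub_sub_cancel_right] at h3

theorem lTensor_poly_smul {σ U U' : Type*} [AddCommGroup U] [Module F U] [AddCommGroup U']
    [Module F U'] (f : U →ₗ[F] U') (q : MvPolynomial σ F) (P : Pol σ F U) :
    f.lTensor (MvPolynomial σ F) (q • P) = q • f.lTensor (MvPolynomial σ F) P :=
  (f.baseChange (MvPolynomial σ F)).map_smul q P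

/-- The value of the variable of an argument of momentum `μ`; the variable of a formal argument is
kept. -/
noncomputable def slotVar : WithTop F → MvPolynomial (Fin 1) F
  | none => MvPolynomial.X 0
  | some μ => MvPolynomial.C μ

@[simp] theorem slotVar_top : slotVar (⊤ : WithTop F) = MvPolynomial.X 0 := rfl
@[simp] theorem slotVar_coe (μ : F) : slotVar (μ : WithTop F) = MvPolynomial.C μ := rfl

/-- Evaluation of the variables of the arguments with finite momenta. -/
noncomputable def slotEval (m : Fin n → WithTop F) : Pol (Fin n) F V →ₐ[F] Pol (Fin 1) F V :=
  Algebra.TensorProduct.map (MvPolynomial.aeval fun i => slotVar (m i)) (AlgHom.id F V)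

@[simp] theorem slotEval_tmul (m : Fin n → WithTop F) (p : MvPolynomial (Fin n) F) (x : V) :
    slotEval m (p ⊗ₜ[F] x) = MvPolynomial.aeval (fun i => slotVar (m i)) p ⊗ₜ[F] x := rfl

theorem slotEval_smul (m : Fin n → WithTop F) (p : MvPolynomial (Fin n) F) (P : Pol (Fin n) F V) :
    slotEval m (p • P) = MvPolynomial.aeval (fun i => slotVar (m i)) p • slotEval m P := by
  induction P using TensorProduct.induction_on with
  | zero => simp
  | tmul q u => simp [TensorProduct.smul_tmul']
  | add P Q hP hQ => simp only [smul_add, map_add, hP, hQ]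

theorem slotEval_renameVars {k : ℕ} (m : Fin n → WithTop F) (f : Fin k → Fin n)
    (P : Pol (Fin k) F V) : slotEval m (renameVars f P) = slotEval (m ∘ f) P := by
  induction P using TensorProduct.induction_on with
  | zero => simp
  | tmul q u =>
    rw [renameVars, LinearMap.rTensor_tmul, AlgHom.toLinearMap_apply, slotEval_tmul,
      MvPolynomial.aeval_rename]
    rfl
  | add P Q hP hQ => simp only [map_add, hP, hQ]

theorem evP_slotEval (m : Fin n → WithTop F) (T : F) (P : Pol (Fin n) F V) :
    evP d (fun _ => -Polynomial.C T - Polynomial.X) (slotEval m P) =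
      evP d (fun i => tau T (m i)) P := by
  induction P using TensorProduct.induction_on with
  | zero => simp
  | add P Q hP hQ => simp only [map_add, hP, hQ]
  | tmul q u =>
    have h : (MvPolynomial.aeval fun _ : Fin 1 => -Polynomial.C T - Polynomial.X).comp
        (MvPolynomial.aeval fun i => slotVar (m i)) = MvPolynomial.aeval fun i => tau T (m i) := by
      refine MvPolynomial.algHom_ext fun i => ?_
      rw [AlgHom.comp_apply, MvPolynomial.aeval_X, MvPolynomial.aeval_X]
      induction m i using WithTop.recTopCoe with
      | top => simp
      | coe μ => simp [← Polynomial.algebraMap_eq]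
    rw [slotEval_tmul, evP_tmul, evP_tmul, ← h]
    rfl

theorem slotEval_of_ne_top {m : Fin n → WithTop F} (hm : ∀ i, m i ≠ ⊤) (T : F)
    (P : Pol (Fin n) F V) : slotEval m P = 1 ⊗ₜ[F] evP d (fun i => tau T (m i)) P := by
  lift m to Fin n → F using hm
  induction P using TensorProduct.induction_on with
  | zero => simp
  | add P Q hP hQ => simp only [map_add, hP, hQ, TensorProduct.tmul_add]
  | tmul q u =>
    have h1 : (MvPolynomial.aeval fun i => slotVar ((m i : F) : WithTop F)) q =
        algebraMap F (MvPolynomial (Fin 1) F) (MvPolynomial.aeval m q) := by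
      rw [← MvPolynomial.aeval_algebraMap_apply]; rfl
    have h2 : (MvPolynomial.aeval fun i => tau T ((m i : F) : WithTop F)) q =
        algebraMap F (Polynomial F) (MvPolynomial.aeval m q) := by
      rw [← MvPolynomial.aeval_algebraMap_apply]; rfl
    rw [slotEval_tmul, evP_tmul, h1, h2, Polynomial.algebraMap_eq, aeval_C_apply,
      Algebra.algebraMap_eq_smul_one, TensorProduct.smul_tmul]

theorem lTensor_mulLeft_eq (x : V) (P : Pol (Fin n) F V) :
    (LinearMap.mulLeft F x).lTensor _ P = ((1 : MvPolynomial (Fin n) F) ⊗ₜ[F] x) * P := by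
  induction P using TensorProduct.induction_on with
  | zero => simp
  | tmul p u => simp
  | add P Q hP hQ => simp only [map_add, mul_add, hP, hQ]

theorem slotEval_lTensor (m : Fin n → WithTop F) (f : V →ₗ[F] V) (P : Pol (Fin n) F V) :
    slotEval m (f.lTensor _ P) = f.lTensor _ (slotEval m P) := by
  induction P using TensorProduct.induction_on with
  | zero => simp
  | tmul p u => simp
  | add P Q hP hQ => simp only [map_add, hP, hQ]

theorem slotEval_arrow {m : Fin n → WithTop F} {i : Fin n} (hi : m i = ⊤)
    (hm : ∀ j, j ≠ i → m j ≠ ⊤) (c : V) (P : Pol (Fin n) F V) :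
    slotEval m (arrow d i c P) = arrow d 0 c (slotEval m P) := by
  have key : ∀ p : MvPolynomial (Fin n) F, slotEval m (arrowSubst d i c p) =
      arrowSubst d 0 c (MvPolynomial.aeval (fun i => slotVar (m i)) p) := by
    intro p
    induction p using MvPolynomial.induction_on with
    | C a =>
      rw [arrowSubst_C, MvPolynomial.aeval_C, MvPolynomial.algebraMap_eq, arrowSubst_C]
      simp
    | add p q hp hq => rw [arrowSubst_add, map_add, map_add, arrowSubst_add, hp, hq]
    | mul_X p j h =>
      rw [arrowSubst_mul_X, map_add, slotEval_smul, h, map_mul, MvPolynomial.aeval_X]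
      rcases eq_or_ne j i with rfl | hj
      · rw [if_pos rfl, slotEval_lTensor, h, hi, slotVar_top, arrowSubst_mul_X, if_pos rfl]
      · obtain ⟨μ, hμ⟩ := WithTop.ne_top_iff_exists.1 (hm j hj)
        rw [if_neg hj, ← hμ, slotVar_coe, map_zero, add_zero, mul_comm, MvPolynomial.C_mul',
          arrowSubst, arrowSubst, ← TensorProduct.smul_tmul', map_smul,
          ← MvPolynomial.algebraMap_eq, algebraMap_smul]
  induction P using TensorProduct.induction_on with
  | zero => simp
  | tmul p x => rw [arrow_tmul, slotEval_lTensor, key, slotEval_tmul, arrow_tmul]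
  | add P Q hP hQ => simp only [map_add, hP, hQ]

theorem arrow_one_mul (i : Fin n) (c y : V) (P : Pol (Fin n) F V) :
    arrow d i c ((1 : MvPolynomial (Fin n) F) ⊗ₜ[F] y * P) =
      (1 : MvPolynomial (Fin n) F) ⊗ₜ[F] y * arrow d i c P := by
  induction P using TensorProduct.induction_on with
  | zero => simp
  | tmul p x =>
    rw [Algebra.TensorProduct.tmul_mul_tmul, one_mul, arrow_tmul, arrow_tmul, lTensor_mulLeft_eq,
      lTensor_mulLeft_eq, ← mul_assoc, Algebra.TensorProduct.tmul_mul_tmul, one_mul]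
  | add P Q hP hQ => simp only [map_add, mul_add, hP, hQ]

theorem mul_one_tmul_of_mem (hV : IsDifferentialSuperalgebra 𝒱 d) (hz : z ∈ 𝒱 k)
    (hP : P ∈ polyPar (Fin n) 𝒱 δ) : (1 : MvPolynomial (Fin n) F) ⊗ₜ[F] z * P =
    sgn δ k • (P * (1 : MvPolynomial (Fin n) F) ⊗ₜ[F] z) := by
  obtain ⟨Q, rfl⟩ := hP
  induction Q using TensorProduct.induction_on with
  | zero => simp
  | tmul p x =>
    rw [LinearMap.lTensor_tmul, Algebra.TensorProduct.tmul_mul_tmul,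
      Algebra.TensorProduct.tmul_mul_tmul, one_mul, mul_one, Submodule.subtype_apply,
      hV.comm' x.2 hz, TensorProduct.tmul_smul]
  | add P Q hP hQ => simp only [map_add, mul_add, add_mul, smul_add, hP, hQ]

theorem arrowSubst_mem (hV : IsDifferentialSuperalgebra 𝒱 d) (i : Fin n) {c : V} (hc : c ∈ 𝒱 δ)
    (p : MvPolynomial (Fin n) F) : arrowSubst d i c p ∈ polyPar (Fin n) 𝒱 δ := by
  have hs : ∀ (q : MvPolynomial (Fin n) F) {S : Pol (Fin n) F V},
      S ∈ polyPar (Fin n) 𝒱 δ → q • S ∈ polyPar (Fin n) 𝒱 δ := by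
    rintro q _ ⟨S, rfl⟩
    exact ⟨q • S, lTensor_poly_smul _ _ _⟩
  induction p using MvPolynomial.induction_on with
  | C a => rw [arrowSubst_C]; exact Submodule.smul_mem _ _ ⟨1 ⊗ₜ ⟨c, hc⟩, by simp⟩
  | add p q hp hq => rw [arrowSubst_add]; exact add_mem hp hq
  | mul_X p j h =>
    rw [arrowSubst_mul_X]
    refine add_mem (hs _ h) ?_
    split_ifs
    · obtain ⟨S, hS⟩ := h
      rw [← hS]
      refine ⟨(d.restrict (p := 𝒱 δ) (q := 𝒱 δ) fun x hx => hV.d_mem hx).lTensor _ S, ?_⟩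
      rw [← LinearMap.comp_apply, ← LinearMap.comp_apply, ← LinearMap.lTensor_comp,
        ← LinearMap.lTensor_comp]
      rfl
    · exact zero_mem _

theorem arrow_mul_one (hV : IsDifferentialSuperalgebra 𝒱 d) (i : Fin n) {c : V} (hc : c ∈ 𝒱 δ)
    (hz : z ∈ 𝒱 k) (P : Pol (Fin n) F V) : arrow d i c (P * (1 : MvPolynomial (Fin n) F) ⊗ₜ[F] z) =
    sgn δ k • (arrow d i c P * (1 : MvPolynomial (Fin n) F) ⊗ₜ[F] z) := by
  induction P using TensorProduct.induction_on with
  | zero => simp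
  | tmul p x =>
    rw [Algebra.TensorProduct.tmul_mul_tmul, mul_one, arrow_tmul, arrow_tmul, lTensor_mulLeft_eq,
      lTensor_mulLeft_eq, mul_assoc, ← mul_smul_comm,
      ← mul_one_tmul_of_mem hV hz (arrowSubst_mem hV i hc p), ← mul_assoc,
      Algebra.TensorProduct.tmul_mul_tmul, one_mul]
  | add P Q hP hQ => simp only [map_add, add_mul, smul_add, hP, hQ]

/-! ### Series with one formal variable -/

/-- The Leibniz rule in the last argument, taken with the formal momentum. -/
def IsSlotDer (𝒱 : ZMod 2 → Submodule F V) (d : V →ₗ[F] V)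
    (f : List (Arg F V) → Pol (Fin 1) F V) : Prop :=
  ∀ l γ δ b c, Hom (parityShift 𝒱) l → momSum l ≠ ⊤ → b ∈ 𝒱 γ → c ∈ 𝒱 δ →
    f (l ++ [⟨⊤, γ + δ + 1, b * c⟩]) = arrow d 0 c (f (l ++ [⟨⊤, γ + 1, b⟩])) +
      sgn γ δ • arrow d 0 b (f (l ++ [⟨⊤, δ + 1, c⟩]))

/-- Sesquilinearity in the last argument, taken with the formal momentum. -/
def IsSlotSesq (d : V →ₗ[F] V) (f : List (Arg F V) → Pol (Fin 1) F V) : Prop :=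
  ∀ l β v, f (l ++ [⟨⊤, β, d v⟩]) =
    (-MvPolynomial.X 0 : MvPolynomial (Fin 1) F) • f (l ++ [⟨⊤, β, v⟩])

/-- The values without formal arguments are constants of the appropriate parity. -/
def IsSlotConst (𝒰 : ZMod 2 → Submodule F V) (a : ZMod 2)
    (f : List (Arg F V) → Pol (Fin 1) F V) : Prop :=
  ∀ l, Hom 𝒰 l → momSum l ≠ ⊤ → ∃ x ∈ 𝒰 (a + parSum l), f l = 1 ⊗ₜ[F] x

section Cons
variable {f : List (Arg F V) → Pol (Fin 1) F V} {w : Arg F V}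

theorem IsSlotDer.cons (h : IsSlotDer 𝒱 d f) (hw : w.vec ∈ parityShift 𝒱 w.par) (hw' : w.mom ≠ ⊤) :
    IsSlotDer 𝒱 d fun l => f (w :: l) :=
  fun l γ δ b c hl hm => h (w :: l) γ δ b c (by simp [hw, hl]) (by simp [hw', hm])

theorem IsSlotSesq.cons (h : IsSlotSesq d f) : IsSlotSesq d fun l => f (w :: l) :=
  fun l β v => h (w :: l) β v

theorem IsSlotConst.cons {𝒰 : ZMod 2 → Submodule F V} (h : IsSlotConst 𝒰 a f) (hw : w.vec ∈ 𝒰 w.par)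
    (hw' : w.mom ≠ ⊤) : IsSlotConst 𝒰 (a + w.par) fun l => f (w :: l) :=
  fun l hl hm => by simpa [add_assoc] using h (w :: l) (by simp [hw, hl]) (by simp [hw', hm])

end Cons

theorem conv_slotSesq {Y Z : List (Arg F V) → Pol (Fin 1) F V} (hY : IsSlotSesq d Y)
    (hZ : IsSlotSesq d Z) : IsSlotSesq d fun l => conv l k Y Z := by
  intro l β v
  induction l generalizing k Y Z with
  | nil =>
    have h1 := hY [] β v
    have h2 := hZ [] β v
    simp only [List.nil_append] at h1 h2
    simp only [List.nil_append, conv, h1, h2, mul_smul_comm, smul_mul_assoc, smul_add,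
      smul_comm (sgn k β)]
  | cons w l ih =>
    simp only [List.cons_append, conv, ih hY (hZ.cons (w := w)), ih (hY.cons (w := w)) hZ,
      smul_add, smul_comm (sgn k w.par)]

theorem conv_slotDer (hV : IsDifferentialSuperalgebra 𝒱 d) {Y Z : List (Arg F V) → Pol (Fin 1) F V}
    (hY : IsSlotDer 𝒱 d Y) (hZ : IsSlotDer 𝒱 d Z) (hY' : IsSlotConst (parityShift 𝒱) a Y)
    (hZ' : IsSlotConst (parityShift 𝒱) (k + 1) Z) : IsSlotDer 𝒱 d fun l => conv l k Y Z := by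
  intro l γ δ b c hl hm hb hc
  induction l generalizing a k Y Z with
  | nil =>
    obtain ⟨y, -, hy⟩ := hY' [] hl hm
    obtain ⟨z, hz, hz'⟩ := hZ' [] hl hm
    rw [parSum_nil, add_zero, mem_parityShift] at hz
    have h1 := hY [] γ δ b c hl hm hb hc
    have h2 := hZ [] γ δ b c hl hm hb hc
    simp only [List.nil_append] at h1 h2
    simp only [List.nil_append, conv, h1, h2, hy, hz', map_add, map_zsmul, mul_add, add_mul,
      arrow_one_mul, arrow_mul_one hV 0 hc hz, arrow_mul_one hV 0 hb hz, mul_smul_comm,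
      smul_mul_assoc, smul_add, smul_smul, sgn_add_right, sgn_zero_right]
    match_scalars <;> grind [sgn_mul_self, sgn_comm]
  | cons w l ih =>
    simp only [hom_cons] at hl
    simp only [momSum_cons, ne_eq, WithTop.add_eq_top, not_or] at hm
    have hZc := hZ'.cons hl.1 hm.1
    rw [add_right_comm] at hZc
    have e1 := ih hY (hZ.cons hl.1 hm.1) hY' hZc hl.2 hm.2
    have e2 := ih (hY.cons hl.1 hm.1) hZ (hY'.cons hl.1 hm.1) hZ' hl.2 hm.2
    simp only [List.cons_append, conv, e1, e2, map_add, map_zsmul, smul_add, smul_smul]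
    match_scalars <;> ring

/-- The series of a family of maps with the variables of the formal arguments kept. -/
noncomputable def serSlot (X : Fam F V) (l : List (Arg F V)) : Pol (Fin 1) F V :=
  slotEval (fun i => (l.get i).mom) (X l.length fun i => (l.get i).vec)

theorem serSlot_ofFn (X : Fam F V) (e : Fin n → Arg F V) :
    serSlot X (List.ofFn e) = slotEval (fun i => (e i).mom) (X n fun i => (e i).vec) := by
  have : ∀ (l : List (Arg F V)) (n : ℕ) (e : Fin n → Arg F V), l = List.ofFn e →
      serSlot X l = slotEval (fun i => (e i).mom) (X n fun i => (e i).vec) := by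
    intro l n e h
    have hn : l.length = n := by simp [h]
    subst hn
    have : l.get = e := List.ofFn_injective ((List.ofFn_get l).trans h)
    rw [← this]; rfl
  exact this _ n e rfl

theorem momSum_add_finSum {ν T : F} (h : ν + momSum l = (T : WithTop F)) : ν + finSum l = T := by
  induction l generalizing ν with
  | nil => simpa using h
  | cons w l ih =>
    obtain ⟨μ, β, v⟩ := w
    induction μ using WithTop.recTopCoe with
    | top => simp at h
    | coe μ =>
      rw [momSum_cons, ← add_assoc, ← WithTop.coe_add] at h
      rw [finSum_cons, ← add_assoc]
      exact ih h

theorem topSum_eq_zero (h : momSum l ≠ ⊤) : topSum l = 0 := by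
  obtain ⟨T, hT⟩ := WithTop.ne_top_iff_exists.1 h
  have := topCount_add_topSum (ν := ((0 : F) : WithTop F)) (l := l) (T := T) (by rw [← hT]; simp)
  rw [topCount_coe, zero_add] at this
  exact this

theorem serSlot_of_ne_top (X : Fam F V) (h : momSum l ≠ ⊤) : serSlot X l = 1 ⊗ₜ[F] ser d ⊤ X l := by
  obtain ⟨n, e, rfl⟩ := exists_ofFn l
  have h0 := topSum_eq_zero h
  rw [topSum_ofFn] at h0
  rw [serSlot_ofFn, ser_ofFn, evC, if_pos (by rw [h0]; simp)]
  refine slotEval_of_ne_top (fun i => ?_) _ _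
  rw [← topCount_eq_zero]
  exact Finset.sum_eq_zero_iff.1 h0 i (Finset.mem_univ i)

theorem serSlot_isSlotConst (hV : IsDifferentialSuperalgebra 𝒱 d) (hX : IsHomFam 𝒱 a X) :
    IsSlotConst (parityShift 𝒱) a (serSlot X) :=
  fun l hl hm => ⟨_, hX.hasPar hV ⊤ l hl, serSlot_of_ne_top X hm⟩

theorem slotEval_sgn_smul (m : Fin n → WithTop F) (ε : ℤˣ) (P : Pol (Fin n) F V) :
    slotEval m (ε • P) = ε • slotEval m P := map_zsmul (slotEval m) (ε : ℤ) P

theorem serSlot_swap (hX : ∀ n, IsCoch 𝒱 d ⊤ (X n)) : IsSwap (parityShift 𝒱) ⊤ ⊤ (serSlot X) := by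
  intro l₁ e e' l₂ hl _
  obtain ⟨n, f, i, j, hij, rfl, rfl, h1, h2⟩ := exists_ofFn_swap l₁ e e' l₂
  rw [h1] at hl
  have h := (hX n).sym (Equiv.swap i j) (fun i => (f i).par) (fun i => (f i).vec) (hom_ofFn.1 hl)
  rw [mem_nullPol_top, sub_eq_zero] at h
  rw [h1, h2, serSlot_ofFn, serSlot_ofFn, h, permSign_swap _ _ _ hij,
    slotEval_sgn_smul, sgn_smul]
  congr 1
  exact slotEval_renameVars _ _ _

theorem serSlot_sesq (hX : ∀ n, IsCoch 𝒱 d ⊤ (X n)) : IsSlotSesq d (serSlot X) := by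
  intro l β v
  obtain ⟨n, e, i, -, -, h⟩ := exists_ofFn_update l ⟨⊤, β, v⟩ []
  have hs := (hX n).sesq (Function.update (fun j => (e j).vec) i v) i
  rw [mem_nullPol_top, Function.update_self, Function.update_idem, ← eq_neg_iff_add_eq_zero] at hs
  replace hs := hs.trans (neg_smul (MvPolynomial.X i : MvPolynomial (Fin n) F) _).symm
  rw [h, h, serSlot_ofFn, serSlot_ofFn, vec_update, vec_update, hs, slotEval_smul, mom_update,
    mom_update, map_neg, MvPolynomial.aeval_X, Function.update_self, slotVar_top]

theorem serSlot_der (hX : ∀ n, IsAs 𝒱 d ⊤ (X n)) : IsSlotDer 𝒱 d (serSlot X) := by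
  intro l γ δ b c hl hm hb hc
  obtain ⟨n, e, i, hi, hn, hu⟩ := exists_ofFn_update l ⟨⊤, γ + 1, b⟩ []
  have hI : Finset.Ioi i = ∅ := by
    ext j; simp only [Finset.mem_Ioi, Finset.notMem_empty, iff_false]; intro h'
    have := j.2; simp at hn; omega
  have hl' : Hom (parityShift 𝒱) (l ++ [⟨⊤, γ + 1, b⟩]) := by
    simp [hl, mem_parityShift, hb]
  rw [hu, hom_ofFn] at hl'
  have h := (hX n).leib i (fun j => (Function.update e i ⟨⊤, γ + 1, b⟩ j).par)
    (fun j => (Function.update e i ⟨⊤, γ + 1, b⟩ j).vec) hl' γ δ b c hb hc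
  rw [mem_nullPol_top, sub_eq_zero, hI, Finset.sum_empty, mul_zero, add_zero, uzpow_zero, one_smul,
    vec_update, Function.update_idem, Function.update_idem, Function.update_idem] at h
  have ht := topSum_eq_zero (l := l) hm
  have ht' : topSum (l ++ [⟨⊤, γ + 1, b⟩]) = 1 := by
    rw [topSum_append, topSum_cons, ht]; simp [topSum]
  rw [hu, topSum_ofFn] at ht'
  have hm' : ∀ j, j ≠ i → Function.update (fun k => (e k).mom) i ⊤ j ≠ ⊤ := by
    intro j hj
    rw [← topCount_eq_zero]
    have h2 := Finset.add_sum_erase Finset.univ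
      (fun j => topCount (Function.update e i ⟨⊤, γ + 1, b⟩ j).mom) (Finset.mem_univ i)
    rw [ht', Function.update_self, topCount_top] at h2
    have h3 := Finset.sum_eq_zero_iff.1 (Nat.add_left_cancel h2) j
      (Finset.mem_erase.2 ⟨hj, Finset.mem_univ j⟩)
    rwa [Function.update_of_ne hj] at h3 ⊢
  simp only [hu, serSlot_ofFn, vec_update, mom_update]
  rw [h, map_add, slotEval_sgn_smul]
  congr 1
  · exact slotEval_arrow (Function.update_self ..) hm' c _
  · rw [← sgn_smul]
    congr 1
    exact slotEval_arrow (Function.update_self ..) hm' b _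

/-- A family is determined to satisfy the symmetry, sesquilinearity and Leibniz conditions by its
series with one formal variable. -/
theorem isAs_of_slot [Infinite F] (hV : IsDifferentialSuperalgebra 𝒱 d)
    {g : List (Arg F V) → Pol (Fin 1) F V} (hg : ∀ l, Hom (parityShift 𝒱) l → serSlot Z l = g l)
    (hsw : IsSwap (parityShift 𝒱) ⊤ ⊤ g) (hsq : IsSlotSesq d g) (hder : IsSlotDer 𝒱 d g) (n : ℕ) :
    IsAs 𝒱 d ⊤ (Z n) := by
  refine isAs_top fun ν => isAs_of_null hV (Z := Z) (ν := ν) (g := fun l => if topSum l ≤ 1 then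
    evP d (fun _ => -Polynomial.C (ν + finSum l) - Polynomial.X) (g l) else 0)
    (fun l hl => ?_) ?_ (fun l β v T hl hv hT => ?_) ?_ n
  · convert zero_mem (nullVec d (ν + momSum l))
    rw [sub_eq_zero, ← hg l hl]
    obtain ⟨n, e, rfl⟩ := exists_ofFn l
    rw [ser_ofFn, evC, topCount_coe, zero_add, topSum_ofFn, serSlot_ofFn, evP_slotEval]
    simp [finSum, List.sum_ofFn, List.map_ofFn]
  · intro l₁ e e' l₂ hl _
    have h1 : topSum (l₁ ++ e' :: e :: l₂) = topSum (l₁ ++ e :: e' :: l₂) := by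
      simp only [topSum_append, topSum_cons]; omega
    have h2 : finSum (l₁ ++ e' :: e :: l₂) = finSum (l₁ ++ e :: e' :: l₂) := by
      simp only [finSum_append, finSum_cons]; ring
    simp only [h1, h2]
    split_ifs
    · rw [hsw l₁ e e' l₂ hl (by simp), map_zsmul]
    · simp
  · have ht : topSum l = 0 := by simpa using topCount_add_topSum hT
    have h1 : ∀ v, topSum (l ++ [(⟨⊤, β, v⟩ : Arg F V)]) ≤ 1 := fun v => by
      rw [topSum_append, topSum_cons, ht]; simp [topSum]
    have h2 : ∀ v, ν + finSum (l ++ [(⟨⊤, β, v⟩ : Arg F V)]) = T := fun v => by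
      simp [momSum_add_finSum hT]
    simp only [h1, h2, if_true]
    rw [hsq, evP_smul, map_neg, MvPolynomial.aeval_X, neg_sub, sub_neg_eq_add, map_add,
      LinearMap.add_apply, aeval_C_apply, Polynomial.aeval_X]
  · intro l γ δ b c T hl hb hc hT
    have hm : momSum l ≠ ⊤ := by
      intro h; rw [h] at hT; simp at hT
    have ht : topSum l = 0 := topSum_eq_zero hm
    have h1 : ∀ β v, topSum (l ++ [(⟨⊤, β, v⟩ : Arg F V)]) ≤ 1 := fun β v => by
      rw [topSum_append, topSum_cons, ht]; simp [topSum]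
    have h2 : ∀ β v, ν + finSum (l ++ [(⟨⊤, β, v⟩ : Arg F V)]) = T := fun β v => by
      simp [momSum_add_finSum hT]
    simp only [h1, h2, if_true]
    rw [hder l γ δ b c hl hm hb hc, map_add, map_zsmul, evP_arrow hV.d_mul 0 c rfl (by simp),
      evP_arrow hV.d_mul 0 b rfl (by simp)]

theorem conv_eq_shuf {B : Type*} [Ring B] [Algebra F B] (l : List (Arg F V)) (c : ZMod 2)
    (Y Z : List (Arg F V) → B) :
    conv l c Y Z = shuf l fun p q => sgn c (parSum p) • (Y p * Z q) := by
  induction l generalizing c Y Z with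
  | nil => simp [conv, shuf]
  | cons w l ih =>
    rw [conv, shuf, ih, ih, ← shuf_zsmul, add_comm]
    congr 1
    · refine shuf_congr fun p q _ => ?_
      rw [parSum_cons, sgn_add_right, smul_smul]
    · refine shuf_congr fun p q _ => ?_
      rw [sgn_add_left, smul_smul, mul_comm]

/-- The concatenation product of two families, the second one of parity `b`. -/
noncomputable def concatSum (b : ZMod 2) (X Y : Fam F V) (β : Fin n → ZMod 2) (v : Fin n → V) :
    Pol (Fin n) F V :=
  ∑ S : Finset (Fin n), (shuffleSign β S * (-1 : ℤˣ) ^ (b * ∑ j ∈ S, β j)) •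
    polyMul (renameVars (pick S) (X S.card (v ∘ pick S)))
      (renameVars (pick Sᶜ) (Y Sᶜ.card (v ∘ pick Sᶜ)))

/-- The concatenation product for fixed parities of the arguments, as a multilinear map. -/
noncomputable def concatMulti (b : ZMod 2) (X Y : Fam F V) (β : Fin n → ZMod 2) : Cochain F V n :=
  MultilinearMap.mk' (fun v => concatSum b X Y β v)
    (fun v j x y => by
      simp only [concatSum]
      rw [← Finset.sum_add_distrib]
      refine Finset.sum_congr rfl fun S _ => ?_
      rw [← smul_add]
      congr 1
      rcases update_comp_pick (α := V) S j with ⟨k, h⟩ | ⟨k, h⟩ <;>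
        simp only [(h _ _).1, (h _ _).2, MultilinearMap.map_update_add, map_add, polyMul, mul_add,
          add_mul])
    (fun v j c x => by
      simp only [concatSum]
      rw [Finset.smul_sum]
      refine Finset.sum_congr rfl fun S _ => ?_
      rw [smul_comm c]
      congr 1
      rcases update_comp_pick (α := V) S j with ⟨k, h⟩ | ⟨k, h⟩ <;>
        simp only [(h _ _).1, (h _ _).2, MultilinearMap.map_update_smul, map_smul, polyMul,
          mul_smul_comm, smul_mul_assoc])

variable (𝒱) in
/-- The concatenation product by families of parity `b`, bilinear in the two families. -/
noncomputable def concatLin (b : ZMod 2) (n : ℕ) : Fam F V →ₗ[F] Fam F V →ₗ[F] Cochain F V n :=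
  LinearMap.mk₂ F (fun X Y => homExt 𝒱 (concatMulti b X Y))
    (fun X X' Y => by
      rw [← map_add]; congr 1; ext β v
      simp only [concatMulti, concatSum, MultilinearMap.mk'_apply, Pi.add_apply, add_apply, map_add,
        polyMul, add_mul, smul_add, Finset.sum_add_distrib])
    (fun c X Y => by
      rw [← map_smul]; congr 1; ext β v
      simp only [concatMulti, concatSum, MultilinearMap.mk'_apply, Pi.smul_apply, smul_apply,
        map_smul, polyMul, smul_mul_assoc, smul_comm _ c, Finset.smul_sum])
    (fun X Y Y' => by
      rw [← map_add]; congr 1; ext β v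
      simp only [concatMulti, concatSum, MultilinearMap.mk'_apply, Pi.add_apply, add_apply, map_add,
        polyMul, mul_add, smul_add, Finset.sum_add_distrib])
    (fun c X Y => by
      rw [← map_smul]; congr 1; ext β v
      simp only [concatMulti, concatSum, MultilinearMap.mk'_apply, Pi.smul_apply, smul_apply,
        map_smul, polyMul, mul_smul_comm, smul_comm _ c, Finset.smul_sum])

variable (𝒱) in
/-- The concatenation product of families. -/
noncomputable def mulFam : Fam F V →ₗ[F] Fam F V →ₗ[F] Fam F V :=
  famBilin fun n => ∑ b, (concatLin 𝒱 b n).compl₂ (parProj 𝒱 (b + 1))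

theorem mulFam_apply (hY : IsHomFam 𝒱 (b + 1) Y) (hv : ∀ j, v j ∈ parityShift 𝒱 (β j)) :
    mulFam 𝒱 X Y n v = concatSum b X Y β v := by
  rw [mulFam, famBilin_apply, LinearMap.sum_apply, LinearMap.sum_apply, Finset.sum_eq_single b,
    LinearMap.compl₂_apply, hY.parProj]
  · exact homExt_apply _ hv
  · intro c _ hc
    rw [LinearMap.compl₂_apply, hY.parProj_of_ne fun h => hc (add_right_cancel h), map_zero]
  · simp

theorem serSlot_mulFam (hY : IsHomFam 𝒱 (b + 1) Y) (hl : Hom (parityShift 𝒱) l) :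
    serSlot (mulFam 𝒱 X Y) l = conv l b (serSlot X) (serSlot Y) := by
  obtain ⟨n, e, rfl⟩ := exists_ofFn l
  rw [serSlot_ofFn, mulFam_apply hY (hom_ofFn.1 hl), conv_eq_shuf, ← sum_shuffleSign, concatSum,
    map_sum]
  refine Finset.sum_congr rfl fun S _ => ?_
  have h2 : parSum (List.ofFn (e ∘ pick S)) = ∑ s ∈ S, (e s).par := by
    rw [parSum_ofFn]
    conv_rhs => rw [← S.map_orderEmbOfFin_univ rfl, Finset.sum_map]
    rfl
  rw [slotEval_sgn_smul, mul_smul, h2, ← sgn_smul]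
  congr 2
  rw [polyMul]
  refine (map_mul (slotEval _) _ _).trans ?_
  rw [slotEval_renameVars, slotEval_renameVars, serSlot_ofFn, serSlot_ofFn]
  rfl

theorem one_tmul_injective : Function.Injective
    fun x : V => ((1 : MvPolynomial (Fin 1) F) ⊗ₜ[F] x : Pol (Fin 1) F V) := by
  intro x y h
  have := congrArg (evP (0 : V →ₗ[F] V) fun _ => 0) h
  simpa using this

theorem ser_mulFam (hY : IsHomFam 𝒱 (b + 1) Y) (hl : Hom (parityShift 𝒱) l) (hm : momSum l ≠ ⊤) :
    ser d ⊤ (mulFam 𝒱 X Y) l = conv l b (ser d ⊤ X) (ser d ⊤ Y) := by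
  refine one_tmul_injective (F := F) ?_
  beta_reduce
  rw [← serSlot_of_ne_top _ hm, serSlot_mulFam hY hl, conv_eq_shuf, conv_eq_shuf]
  refine Eq.trans ?_ (shuf_map (TensorProduct.mk F (MvPolynomial (Fin 1) F) V 1).toAddMonoidHom l
    fun p q => sgn b (parSum p) • (ser d ⊤ X p * ser d ⊤ Y q)).symm
  refine shuf_congr fun p q hpq => ?_
  have h := momSum_of_perm hpq
  rw [momSum_append] at h
  rw [← h, ne_eq, WithTop.add_eq_top, not_or] at hm
  rw [serSlot_of_ne_top (d := d) _ hm.1, serSlot_of_ne_top (d := d) _ hm.2, Algebra.TensorProduct.tmul_mul_tmul,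
    one_mul]
  exact (map_zsmul (TensorProduct.mk F (MvPolynomial (Fin 1) F) V 1) _ _).symm

theorem isAs_mulFam [Infinite F] (hV : IsDifferentialSuperalgebra 𝒱 d) (hX : ∀ n, IsAs 𝒱 d ⊤ (X n))
    (hY : ∀ n, IsAs 𝒱 d ⊤ (Y n)) (n : ℕ) : IsAs 𝒱 d ⊤ (mulFam 𝒱 X Y n) := by
  rw [famBilin_sum (𝒱 := 𝒱)]
  refine IsAs.sum fun a _ => IsAs.sum fun b _ => ?_
  have hX₁ := parProj_isAs_top hV hX a
  have hY₁ := parProj_isAs_top hV hY b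
  have hX₂ := isHomFam_parProj (𝒱 := 𝒱) a X
  have hY₂ := isHomFam_parProj (𝒱 := 𝒱) b Y
  generalize parProj 𝒱 a X = X at *
  generalize parProj 𝒱 b Y = Y at *
  obtain ⟨b, rfl⟩ : ∃ c, b = c + 1 := ⟨b - 1, by ring⟩
  exact isAs_of_slot hV (fun l hl => serSlot_mulFam hY₂ hl)
    (conv_swap (serSlot_swap fun n => (hX₁ n).toIsCoch) (serSlot_swap fun n => (hY₁ n).toIsCoch))
    (conv_slotSesq (serSlot_sesq fun n => (hX₁ n).toIsCoch)
      (serSlot_sesq fun n => (hY₁ n).toIsCoch))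
    (conv_slotDer hV (serSlot_der hX₁) (serSlot_der hY₁) (serSlot_isSlotConst hV hX₂)
      (serSlot_isSlotConst hV hY₂)) n

theorem parProj_eq_zero (h : X n = 0) (a : ZMod 2) : parProj 𝒱 a X n = 0 :=
  eq_of_homogeneous (𝒱 := 𝒱) fun β v hv => by rw [parProj_apply a X hv, h]; simp

theorem boxLin_eq_zero {σ : Type*} {ν : Fin n → σ}
    {first : Finset (Fin n) → Polynomial (MvPolynomial σ F)}
    (h : ∀ k l, k + l = n + 1 → X k = 0 ∨ Y l = 0) : boxLin 𝒱 d ν first X Y = 0 :=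
  eq_of_homogeneous (𝒱 := 𝒱) fun β v hv => by
    rw [boxLin_apply _ _ _ _ hv]
    exact boxSum_eq_zero fun k l hkl => (h (l + 1) k (by omega)).symm

theorem superComm_eq_zero {M : Type*} [AddCommGroup M] [Module F M]
    {L R : Fam F V →ₗ[F] Fam F V →ₗ[F] M}
    (hL : ∀ {X Y : Fam F V}, (∀ k l, k + l = n + 1 → X k = 0 ∨ Y l = 0) → L X Y = 0)
    (hR : ∀ {X Y : Fam F V}, (∀ k l, k + l = n + 1 → X k = 0 ∨ Y l = 0) → R X Y = 0)
    (h : ∀ k l, k + l = n + 1 → X k = 0 ∨ Y l = 0) : superComm 𝒱 L R X Y = 0 := by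
  rw [superComm_apply]
  refine Finset.sum_eq_zero fun a _ => Finset.sum_eq_zero fun b _ => ?_
  have h' : ∀ k l, k + l = n + 1 → parProj 𝒱 a X k = 0 ∨ parProj 𝒱 b Y l = 0 := fun k l hkl =>
    (h k l hkl).imp (fun h => parProj_eq_zero h a) (fun h => parProj_eq_zero h b)
  rw [hL h', hR fun k l hkl => (h' l k (by omega)).symm, smul_zero, sub_zero]

theorem lieFam_eq_zero (h : ∀ k l, k + l = n + 1 → X k = 0 ∨ Y l = 0) :
    lieFam 𝒱 d X Y n = 0 := by
  rw [lieFam, famBilin_apply]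
  exact superComm_eq_zero (fun h => boxLin_eq_zero h) (fun h => boxLin_eq_zero h) h

theorem actFam_eq_zero (h : ∀ k l, k + l = n + 1 → X k = 0 ∨ Y l = 0) :
    actFam 𝒱 d X Y n = 0 := by
  rw [actFam, famBilin_apply]
  exact superComm_eq_zero (fun h => boxLin_eq_zero h) (fun h => boxLin_eq_zero h) h

theorem lambdaFam_eq_zero (h : ∀ k l, k + l = n + 1 → X k = 0 ∨ Y l = 0) :
    lambdaFam 𝒱 d n X Y = 0 :=
  superComm_eq_zero (fun h => boxLin_eq_zero h) (fun h => by
    rw [LinearMap.compr₂_apply, boxLin_eq_zero h, map_zero]) h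

theorem brCoeff_eq_zero (r : ℕ) (h : ∀ k l, k + l = n + 1 → X k = 0 ∨ Y l = 0) :
    brCoeff 𝒱 d r X Y n = 0 := by
  ext v
  rw [brCoeff_apply, lambdaFam_eq_zero h]
  simp

theorem mulFam_eq_zero (h : ∀ k l, k + l = n → X k = 0 ∨ Y l = 0) : mulFam 𝒱 X Y n = 0 := by
  rw [mulFam, famBilin_apply, LinearMap.sum_apply, LinearMap.sum_apply]
  refine Finset.sum_eq_zero fun b _ => eq_of_homogeneous (𝒱 := 𝒱) fun β v hv => ?_
  rw [LinearMap.compl₂_apply]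
  refine (homExt_apply _ hv).trans ?_
  change concatSum b X (parProj 𝒱 (b + 1) Y) β v = 0
  refine Finset.sum_eq_zero fun S _ => ?_
  rcases h _ _ ((Finset.card_add_card_compl S).trans (Fintype.card_fin n)) with h | h
  · simp [h, polyMul]
  · simp [parProj_eq_zero h, polyMul]

theorem IsDifferentialSuperalgebra.d_one (hV : IsDifferentialSuperalgebra 𝒱 d) : d 1 = 0 := by
  have := hV.d_mul 1 1
  simpa using this

theorem arrow_one (h : d 1 = 0) (i : Fin n) (P : Pol (Fin n) F V) : arrow d i 1 P = P := by
  have key : ∀ p : MvPolynomial (Fin n) F, arrowSubst d i 1 p = p ⊗ₜ 1 := by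
    intro p
    induction p using MvPolynomial.induction_on with
    | C a => rw [arrowSubst_C, TensorProduct.smul_tmul', MvPolynomial.smul_eq_C_mul, mul_one]
    | add p q hp hq => rw [arrowSubst_add, hp, hq, TensorProduct.add_tmul]
    | mul_X p j hp =>
      rw [arrowSubst_mul_X, hp, LinearMap.lTensor_tmul, h, TensorProduct.tmul_zero, ite_self,
        add_zero, TensorProduct.smul_tmul', smul_eq_mul, mul_comm]
  induction P using TensorProduct.induction_on with
  | zero => simp
  | tmul p x => rw [arrow_tmul, key, LinearMap.lTensor_tmul, LinearMap.mulLeft_apply, mul_one]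
  | add P Q hP hQ => rw [map_add, hP, hQ]

/-- A finitely generated differential superalgebra has finitely many homogeneous generators. -/
theorem IsFinitelyGenerated.exists_homogeneous (hV : IsDifferentialSuperalgebra 𝒱 d)
    (h : IsFinitelyGenerated d) : ∃ s : Finset V, (∀ g ∈ s, ∃ γ, g ∈ 𝒱 γ) ∧
      Algebra.adjoin F {a : V | ∃ g ∈ s, ∃ n : ℕ, a = (d ^ n) g} = ⊤ := by
  classical
  obtain ⟨s, hs⟩ := h
  refine ⟨s.biUnion fun g => Finset.univ.image fun γ => GradedAlgebra.proj 𝒱 γ g, ?_, ?_⟩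
  · simp only [Finset.mem_biUnion, Finset.mem_image, Finset.mem_univ, true_and]
    rintro _ ⟨g, -, γ, rfl⟩
    exact ⟨γ, SetLike.coe_mem _⟩
  · rw [eq_top_iff, ← hs]
    refine Algebra.adjoin_le ?_
    rintro _ ⟨g, hg, n, rfl⟩
    have hg' : g = ∑ β, piProj 𝒱 β g := (sum_piProj g).symm
    rw [hg', map_sum]
    refine sum_mem fun β _ => Algebra.subset_adjoin ⟨piProj 𝒱 β g, ?_, n, rfl⟩
    simp only [Finset.mem_biUnion, Finset.mem_image, Finset.mem_univ, true_and]
    exact ⟨g, hg, β + 1, rfl⟩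

/-- A map satisfying the Leibniz rules is determined by its values on generators. -/
theorem IsAs.eq_zero_of_generators (hV : IsDifferentialSuperalgebra 𝒱 d) {s : Finset V}
    (hs : ∀ g ∈ s, ∃ γ, g ∈ 𝒱 γ)
    (hs' : Algebra.adjoin F {a : V | ∃ g ∈ s, ∃ n : ℕ, a = (d ^ n) g} = ⊤) {X : Cochain F V n}
    (hX : IsAs 𝒱 d ⊤ X) (h : ∀ v : Fin n → V, (∀ j, v j ∈ s) → X v = 0) : X = 0 := by
  classical
  have key : ∀ (T : Finset (Fin n)) (β : Fin n → ZMod 2) (v : Fin n → V),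
      (∀ j, v j ∈ parityShift 𝒱 (β j)) → (∀ j, j ∉ T → v j ∈ s) → X v = 0 := by
    intro T
    induction T using Finset.induction_on with
    | empty => exact fun β v _ hv => h v fun j => hv j (by simp)
    | insert i T hi ih =>
      intro β v hv hvs
      have hgen : ∀ γ, ∀ g ∈ s, g ∈ 𝒱 γ → X (Function.update v i g) = 0 := by
        intro γ g hg hγ
        refine ih (Function.update β i (γ + 1)) _ (fun j => ?_) fun j hj => ?_
        · rcases eq_or_ne j i with rfl | hj
          · simpa [mem_parityShift] using hγ
          · simpa [hj] using hv j
        · rcases eq_or_ne j i with rfl | hj'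
          · simpa using hg
          · simpa [hj'] using hvs j (by simp [hj, hj'])
      have hd : ∀ u, X (Function.update v i u) = 0 → X (Function.update v i (d u)) = 0 := by
        intro u hu
        have := hX.sesq (Function.update v i u) i
        rwa [mem_nullPol_top, Function.update_self, Function.update_idem, hu, smul_zero,
          add_zero] at this
      have hl : ∀ γ δ b c, b ∈ 𝒱 γ → c ∈ 𝒱 δ → X (Function.update v i (b * c)) =
          (-1 : ℤˣ) ^ (δ * ∑ j ∈ Finset.Ioi i, β j) • arrow d i c (X (Function.update v i b)) +
            (-1 : ℤˣ) ^ (γ * (δ + ∑ j ∈ Finset.Ioi i, β j)) •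
              arrow d i b (X (Function.update v i c)) := fun γ δ b c hb hc => by
        have := hX.leib i β v hv γ δ b c hb hc
        rwa [mem_nullPol_top, sub_eq_zero] at this
      have h1 : X (Function.update v i 1) = 0 := by
        have := hl 0 0 1 1 SetLike.GradedOne.one_mem SetLike.GradedOne.one_mem
        simpa [arrow_one hV.d_one] using this
      have hspan : ∀ u, X (Function.update v i u) = 0 := by
        intro u
        have hu : u ∈ Algebra.adjoin F {a : V | ∃ g ∈ s, ∃ n : ℕ, a = (d ^ n) g} := by
          rw [hs']; trivial
        rw [← Subalgebra.mem_toSubmodule, Algebra.adjoin_eq_span] at hu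
        induction hu using Submodule.span_induction with
        | zero => simp
        | add x y _ _ hx hy => rw [MultilinearMap.map_update_add, hx, hy, add_zero]
        | smul c x _ hx => rw [MultilinearMap.map_update_smul, hx, smul_zero]
        | mem x hx =>
          suffices hx' : (∃ γ, x ∈ 𝒱 γ) ∧ X (Function.update v i x) = 0 from hx'.2
          induction hx using Submonoid.closure_induction with
          | one => exact ⟨⟨0, SetLike.GradedOne.one_mem⟩, h1⟩
          | mul x y _ _ hx hy =>
            obtain ⟨⟨γ, hγ⟩, hx⟩ := hx
            obtain ⟨⟨δ, hδ⟩, hy⟩ := hy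
            exact ⟨⟨γ + δ, SetLike.mul_mem_graded hγ hδ⟩, by rw [hl γ δ x y hγ hδ, hx, hy]; simp⟩
          | mem x hx =>
            obtain ⟨g, hg, k, rfl⟩ := hx
            obtain ⟨γ, hγ⟩ := hs g hg
            refine ⟨⟨γ, ?_⟩, ?_⟩
            · induction k with
              | zero => exact hγ
              | succ k ih => rw [pow_succ', Module.End.mul_apply]; exact hV.d_mem ih
            · induction k with
              | zero => exact hgen γ g hg hγ
              | succ k ih => rw [pow_succ', Module.End.mul_apply]; exact hd _ ih
      have := hspan (v i)
      rwa [Function.update_eq_self] at this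
  ext v
  rw [eq_zero_of_homogeneous (𝒱 := 𝒱) X (fun β v hv => key Finset.univ β v hv (by simp)) v]
  rfl

/-- The `λ`-bracket is polynomial in `λ`. -/
theorem exists_brCoeff_fam_eq_zero [Infinite F] (hV : IsDifferentialSuperalgebra 𝒱 d)
    (hfg : IsFinitelyGenerated d) (hX : ∀ n, IsAs 𝒱 d ⊤ (X n)) (hY : ∀ n, IsAs 𝒱 d ⊤ (Y n))
    (hX' : ∃ N, ∀ n, N ≤ n → X n = 0) (hY' : ∃ N, ∀ n, N ≤ n → Y n = 0) : ∃ R, ∀ r, R ≤ r →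
    brCoeff 𝒱 d r X Y = 0 := by
  classical
  obtain ⟨s, hs, hs'⟩ := hfg.exists_homogeneous hV
  obtain ⟨N, hN⟩ := hX'
  obtain ⟨M, hM⟩ := hY'
  choose R hR using fun (n : ℕ) (v : Fin n → V) => exists_brCoeff_eq_zero (𝒱 := 𝒱) (d := d) X Y v
  refine ⟨(Finset.range (N + M)).sup fun n =>
    (Fintype.piFinset fun _ : Fin n => s).sup fun v => R n v, fun r hr => ?_⟩
  funext n
  by_cases hn : n < N + M
  · refine (isAs_brCoeff hV hX hY r n).eq_zero_of_generators hV hs hs' fun v hv => hR n v r ?_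
    refine le_trans ?_ hr
    refine le_trans ?_ (Finset.le_sup (f := fun n =>
      (Fintype.piFinset fun _ : Fin n => s).sup fun v => R n v) (Finset.mem_range.2 hn))
    exact Finset.le_sup (f := fun v => R n v) (Fintype.mem_piFinset.2 hv)
  · refine brCoeff_eq_zero r fun k l hkl => ?_
    by_cases hk : N ≤ k
    · exact .inl (hN k hk)
    · exact .inr (hM l (by omega))

/-- The family of components of an element of `W̃^{∂,as}(ΠV)`. -/
noncomputable def famG : G 𝒱 d →ₗ[F] Fam F V where
  toFun X := X.comp
  map_add' _ _ := rfl
  map_smul' _ _ := rfl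

theorem famG_injective : Function.Injective (famG (𝒱 := 𝒱) (d := d)) := fun X Y h =>
  DFinsupp.ext fun n => Subtype.ext (congrFun h n)

theorem famG_isAs [Infinite F] (hV : IsDifferentialSuperalgebra 𝒱 d) (X : G 𝒱 d) (n : ℕ) :
    IsAs 𝒱 d ⊤ (famG X n) := (mem_WtAs_iff hV).1 (X n).2

theorem exists_famG_eq_zero (X : G 𝒱 d) : ∃ N, ∀ n, N ≤ n → famG X n = 0 :=
  exists_directSum_eq_zero _ X

theorem exists_famG [Infinite F] (hV : IsDifferentialSuperalgebra 𝒱 d) (hZ : ∀ n, IsAs 𝒱 d ⊤ (Z n))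
    (hZ' : ∃ N, ∀ n, N ≤ n → Z n = 0) : ∃ X : G 𝒱 d, famG X = Z := by
  obtain ⟨X, hX⟩ := exists_directSum (fun n => WtAs 𝒱 d n) (fun n => (mem_WtAs_iff hV).2 (hZ n)) hZ'
  exact ⟨X, funext hX⟩

theorem mem_barPar_iff {X : G 𝒱 d} : X ∈ G.barPar 𝒱 d a ↔ IsHomFam 𝒱 a (famG X) :=
  Iff.rfl

theorem mem_degG_iff {k : ℕ} {X : G 𝒱 d} : X ∈ G.deg 𝒱 d k ↔ ∀ n, n ≠ k → famG X n = 0 :=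
  mem_range_lof_iff _ X k

variable (F V) in
/-- The family of components of an element of `W^{∂,as}(ΠV)`. -/
noncomputable def compW : W 𝒱 d →ₗ[F] ∀ n, CochainQ n d where
  toFun X := X.comp
  map_add' _ _ := rfl
  map_smul' _ _ := rfl

theorem compW_injective : Function.Injective (compW F V (𝒱 := 𝒱) (d := d)) := fun X Y h =>
  DFinsupp.ext fun n => Subtype.ext (congrFun h n)

variable (d) in
/-- The quotient map of values of families. -/
noncomputable def famQ : Fam F V →ₗ[F] ∀ n, CochainQ n d where
  toFun Z n := (toQ d).compMultilinearMap (Z n)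
  map_add' X Y := by funext n; ext v; simp
  map_smul' c X := by funext n; ext v; simp

@[simp] theorem famQ_apply (Z : Fam F V) (v : Fin n → V) : famQ d Z n v = toQ d (Z n v) := rfl

theorem famQ_eq_iff : famQ d Z = famQ d Z' ↔ Z - Z' ∈ NullFam d ((0 : F) : WithTop F) := by
  constructor
  · intro h n v
    exact toQ_eq_iff.1 (congrArg (fun A : ∀ n, CochainQ n d => A n v) h)
  · intro h
    funext n
    ext v
    exact toQ_eq_iff.2 (h n v)

theorem exists_toQ_section (d : V →ₗ[F] V) (n : ℕ) :
    ∃ s : PolyQ n d →ₗ[F] Pol (Fin n) F V, toQ d ∘ₗ s = LinearMap.id :=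
  LinearMap.exists_rightInverse_of_surjective _ (LinearMap.range_eq_top.2 toQ_surjective)

/-- Representatives of the values of an element of `W^{∂,as}(ΠV)`, depending linearly on it. -/
noncomputable def repW : W 𝒱 d →ₗ[F] Fam F V where
  toFun X n := (exists_toQ_section d n).choose.compMultilinearMap (X.comp n)
  map_add' X Y := by
    funext n; ext v
    exact map_add (exists_toQ_section d n).choose (X.comp n v) (Y.comp n v)
  map_smul' c X := by
    funext n; ext v
    exact map_smul (exists_toQ_section d n).choose c (X.comp n v)

theorem isLift_repW (X : W 𝒱 d) : IsLift X (repW X) := fun n v =>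
  LinearMap.congr_fun (exists_toQ_section d n).choose_spec (X.comp n v)

theorem famQ_eq_of_isLift {X : W 𝒱 d} (h : IsLift X X') : famQ d X' = compW F V X := by
  funext n; ext v; exact h n v

theorem isAs_of_isLift (hV : IsDifferentialSuperalgebra 𝒱 d) {X : W 𝒱 d} (h : IsLift X X') (n : ℕ) :
    IsAs 𝒱 d ((0 : F) : WithTop F) (X' n) :=
  (mem_WQAs_iff hV (h n)).1 (X n).2

theorem sub_mem_of_isLift {X : W 𝒱 d} {X'' : Fam F V} (h : IsLift X X') (h' : IsLift X X'') : X' -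
    X'' ∈ NullFam d ((0 : F) : WithTop F) := by
  rw [← famQ_eq_iff, famQ_eq_of_isLift h, famQ_eq_of_isLift h']

theorem exists_repW_eq_zero (X : W 𝒱 d) : ∃ N, ∀ n, N ≤ n → repW X n = 0 := by
  obtain ⟨N, hN⟩ := exists_directSum_eq_zero _ X
  refine ⟨N, fun n hn => ?_⟩
  ext v
  change (exists_toQ_section d n).choose (X.comp n v) = 0
  rw [show X.comp n = 0 from hN n hn]
  simp

theorem exists_compW (hV : IsDifferentialSuperalgebra 𝒱 d)
    (hZ : ∀ n, IsAs 𝒱 d ((0 : F) : WithTop F) (Z n)) (hZ' : ∃ N, ∀ n, N ≤ n → Z n = 0) : ∃ X :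
    W 𝒱 d, compW F V X = famQ d Z := by
  obtain ⟨N, hN⟩ := hZ'
  obtain ⟨X, hX⟩ := exists_directSum (fun n => WQAs 𝒱 d n) (Z := famQ d Z)
    (fun n => (mem_WQAs_iff hV fun v => rfl).2 (hZ n)) ⟨N, fun n hn => by
      ext v; rw [famQ_apply, hN n hn]; simp⟩
  exact ⟨X, funext hX⟩

theorem mem_degW_iff {k : ℕ} {X : W 𝒱 d} : X ∈ W.deg 𝒱 d k ↔ ∀ n, n ≠ k → compW F V X n = 0 :=
  mem_range_lof_iff _ X k

theorem repW_eq_zero {X : W 𝒱 d} (h : compW F V X n = 0) : repW X n = 0 := by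
  ext v
  change (exists_toQ_section d n).choose (X.comp n v) = 0
  rw [show X.comp n = 0 from h]
  simp

theorem totalD_piProj (hV : IsDifferentialSuperalgebra 𝒱 d) (β : ZMod 2) (P : Pol (Fin n) F V) :
    totalD d ((piProj 𝒱 β).lTensor _ P) = (piProj 𝒱 β).lTensor _ (totalD d P) := by
  rw [totalD_apply, totalD_apply, map_add, lTensor_poly_smul, ← LinearMap.comp_apply,
    ← LinearMap.comp_apply, ← LinearMap.lTensor_comp, ← LinearMap.lTensor_comp]
  congr 3
  ext x
  exact (piProj_d hV β x).symm

theorem toQ_piProj_eq (hV : IsDifferentialSuperalgebra 𝒱 d) (β : ZMod 2) {Q : Pol (Fin n) F V}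
    (h : toQ d P = toQ d Q) : toQ d ((piProj 𝒱 β).lTensor _ P) = toQ d ((piProj 𝒱 β).lTensor _ Q)
    := by
  have := (Submodule.Quotient.eq _).1 h
  obtain ⟨A, hA⟩ := this
  refine (Submodule.Quotient.eq _).2 ⟨(piProj 𝒱 β).lTensor _ A, ?_⟩
  rw [totalD_piProj hV, hA, map_sub]

theorem famQ_parProj_eq (hV : IsDifferentialSuperalgebra 𝒱 d) (a : ZMod 2)
    (h : famQ d Z = famQ d Z') : famQ d (parProj 𝒱 a Z) = famQ d (parProj 𝒱 a Z') := by
  funext n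
  refine eq_of_homogeneous (𝒱 := 𝒱) fun β v hv => ?_
  rw [famQ_apply, famQ_apply, parProj_apply a Z hv, parProj_apply a Z' hv]
  exact toQ_piProj_eq hV _ (congrArg (fun A : ∀ n, CochainQ n d => A n v) h)

theorem mem_parW_iff {X : W 𝒱 d} (hV : IsDifferentialSuperalgebra 𝒱 d) (h : IsLift X X') : X ∈
    W.par 𝒱 d a ↔ IsLift X (parProj 𝒱 a X') := by
  constructor
  · intro hX n v
    have : (toQ d).compMultilinearMap (parProj 𝒱 a X' n) = X.comp n := by
      refine eq_of_homogeneous (𝒱 := 𝒱) fun β v hv => ?_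
      obtain ⟨P, hP, hP'⟩ := hX n β v hv
      change toQ d _ = _
      rw [parProj_apply a X' hv, ← hP', ← mem_polyPar_iff.1 hP]
      refine (toQ_piProj_eq hV _ ?_).trans (congrArg (toQ d) (congrArg _ (mem_polyPar_iff.1 hP)))
      rw [h n v, mem_polyPar_iff.1 hP, hP']
    exact congrArg (fun A => A v) this
  · intro hX n β v hv
    refine ⟨parProj 𝒱 a X' n v, ?_, hX n v⟩
    rw [parProj_apply a X' hv]
    exact lTensor_piProj_piProj _ _

variable (d) in
/-- The derivation `∂` on families. -/
noncomputable def transFam : Fam F V →ₗ[F] Fam F V where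
  toFun Z n := ((totalD d).restrictScalars F).compMultilinearMap (Z n)
  map_add' X Y := by funext n; ext v; simp
  map_smul' c X := by funext n; ext v; simp

@[simp] theorem transFam_apply (Z : Fam F V) (v : Fin n → V) :
    transFam d Z n v = totalD d (Z n v) := rfl

theorem isAs_transFam (hV : IsDifferentialSuperalgebra 𝒱 d) (hZ : ∀ n, IsAs 𝒱 d ⊤ (Z n)) (n : ℕ) :
    IsAs 𝒱 d ⊤ (transFam d Z n) where
  sesq v i := by
    have := (hZ n).sesq v i
    rw [mem_nullPol_top] at this ⊢
    rw [transFam_apply, transFam_apply, ← map_smul, ← map_add, this, map_zero]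
  sym σ β v hv := by
    have := (hZ n).sym σ β v hv
    rw [mem_nullPol_top, sub_eq_zero] at this ⊢
    rw [transFam_apply, transFam_apply, this, renameVars_totalD]
    exact map_zsmul (totalD d) _ _
  leib i β a ha γ δ b c hb hc := by
    have := (hZ n).leib i β a ha γ δ b c hb hc
    rw [mem_nullPol_top, sub_eq_zero] at this ⊢
    simp only [transFam_apply]
    rw [this, map_add, arrow_totalD hV.d_mul, arrow_totalD hV.d_mul]
    congr 1 <;> exact map_zsmul (totalD d) _ _

/-- The series of a family, as a linear map. -/
noncomputable def serLin (d : V →ₗ[F] V) (ν : WithTop F) : Fam F V →ₗ[F] (List (Arg F V) → V) where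
  toFun X := ser d ν X
  map_add' X Y := by
    funext l
    simp only [ser, evC, Pi.add_apply, add_apply, map_add]
    split_ifs <;> simp
  map_smul' c X := by
    funext l
    simp only [ser, evC, Pi.smul_apply, smul_apply, map_smul, RingHom.id_apply]
    split_ifs <;> simp

variable (𝒱) in
theorem mem_nullFam_iff [Infinite F] : Z ∈ NullFam d ν ↔ serLin d ν Z ∈ NullSer (parityShift 𝒱) d ν
    :=
  ⟨fun h _ _ => ser_mem_nullVec h, fun h => mem_nullFam 𝒱 h⟩

theorem smul_mem_nullPol (p : MvPolynomial (Fin n) F) (h : P ∈ nullPol d n ν) : p • P ∈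
    nullPol d n ν := by
  induction ν using WithTop.recTopCoe with
  | top => rw [mem_nullPol_top] at *; rw [h, smul_zero]
  | coe ν =>
    obtain ⟨Q, rfl⟩ := mem_nullPol_coe.1 h
    exact mem_nullPol_coe.2 ⟨p • Q, by rw [map_smul, smul_add, smul_comm ν]⟩

theorem isAs_of_mem_nullFam (hV : IsDifferentialSuperalgebra 𝒱 d) (hZ : Z ∈ NullFam d ν) (n : ℕ) :
    IsAs 𝒱 d ν (Z n) where
  sesq v i := add_mem (hZ n _) (smul_mem_nullPol _ (hZ n _))
  sym σ β v hv := sub_mem (hZ n _) (sgn_smul_mem _ (renameVars_mem_nullPol (hZ n _) σ))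
  leib i β a ha γ δ b c hb hc := sub_mem (hZ n _) (add_mem
    (sgn_smul_mem _ (arrow_mem_nullPol hV.d_mul i c (hZ n _)))
    (sgn_smul_mem _ (arrow_mem_nullPol hV.d_mul i b (hZ n _))))

theorem famQ_eq_zero_iff : famQ d Z = 0 ↔ Z ∈ NullFam d ((0 : F) : WithTop F) := by
  constructor
  · intro h n v
    refine mem_nullPol_zero.2 ?_
    exact congrArg (fun A : ∀ n, CochainQ n d => A n v) h
  · intro h
    funext n
    ext v
    exact mem_nullPol_zero.1 (h n v)

theorem parProj_mem_nullFam (hV : IsDifferentialSuperalgebra 𝒱 d) (a : ZMod 2)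
    (hZ : Z ∈ NullFam d ((0 : F) : WithTop F)) : parProj 𝒱 a Z ∈ NullFam d ((0 : F) : WithTop F)
    := by
  rw [← famQ_eq_zero_iff] at hZ ⊢
  have := famQ_parProj_eq hV a (hZ.trans (map_zero (famQ d)).symm)
  rwa [map_zero, map_zero] at this

theorem coe_zero_add (ν : WithTop F) : ((0 : F) : WithTop F) + ν = ν := by
  rw [WithTop.coe_zero, zero_add]

theorem fam_sub_eq_iff : X - Y = Z ↔ X = Z + Y := by
  constructor
  · rintro rfl
    funext n; ext v : 1
    exact (sub_add_cancel (X n v) (Y n v)).symm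
  · rintro rfl
    funext n; ext v : 1
    exact add_sub_cancel_right (Z n v) (Y n v)

theorem fam_sub_eq_zero : X - Y = 0 ↔ X = Y := by
  rw [fam_sub_eq_iff, zero_add]

theorem famBilin_sub_left (f : Fam F V →ₗ[F] Fam F V →ₗ[F] Fam F V) (X X' Y : Fam F V) :
    f (X - X') Y = f X Y - f X' Y := by
  rw [eq_comm, fam_sub_eq_iff, ← LinearMap.add_apply, ← map_add, ← fam_sub_eq_iff.1 rfl]

theorem famBilin_sub_right (f : Fam F V →ₗ[F] Fam F V →ₗ[F] Fam F V) (X Y Y' : Fam F V) :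
    f X (Y - Y') = f X Y - f X Y' := by
  rw [eq_comm, fam_sub_eq_iff, ← map_add, ← fam_sub_eq_iff.1 rfl]

section Bracket
variable [Infinite F] (hV : IsDifferentialSuperalgebra 𝒱 d)
include hV

theorem ser_lieFam_sub (hX : IsHomFam 𝒱 a X) (hY : IsHomFam 𝒱 b Y)
    (hX' : ∀ n, IsAs 𝒱 d ((0 : F) : WithTop F) (X n)) (hY' : ∀ n, IsAs 𝒱 d ((0 : F) : WithTop F)
    (Y n)) : serLin d ((0 : F) : WithTop F) (lieFam 𝒱 d X Y) -
    bracket ((0 : F) : WithTop F) a (serLin d ((0 : F) : WithTop F) X)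
    ((0 : F) : WithTop F) b (serLin d ((0 : F) : WithTop F) Y) ∈
    NullSer (parityShift 𝒱) d ((0 : F) : WithTop F) := fun _ hl =>
  ser_lieFam_mem hV hX hY (fun n => (hX' n).toIsCoch) (fun n => (hY' n).toIsCoch) hl

theorem ser_actFam_sub (hX : IsHomFam 𝒱 a X) (hY : IsHomFam 𝒱 b Y)
    (hX' : ∀ n, IsAs 𝒱 d ((0 : F) : WithTop F) (X n)) (hY' : ∀ n, IsAs 𝒱 d ν (Y n)) :
    serLin d ν (actFam 𝒱 d X Y) - bracket ((0 : F) : WithTop F) a (serLin d ((0 : F) : WithTop F) X)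
    ν b (serLin d ν Y) ∈ NullSer (parityShift 𝒱) d ν := fun _ hl =>
  ser_actFam_mem hV hX hY (fun n => (hX' n).toIsCoch) (fun n => (hY' n).toIsCoch) hl

theorem lieFam_mem_left (hZ : Z ∈ NullFam d ((0 : F) : WithTop F))
    (hY : ∀ n, IsAs 𝒱 d ((0 : F) : WithTop F) (Y n)) : lieFam 𝒱 d Z Y ∈
    NullFam d ((0 : F) : WithTop F) := by
  intro n v
  rw [famBilin_sum (𝒱 := 𝒱), MultilinearMap.sum_apply]
  refine sum_mem fun a _ => ?_
  rw [MultilinearMap.sum_apply]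
  refine sum_mem fun b _ => ?_
  revert n v
  change lieFam 𝒱 d _ _ ∈ NullFam d ((0 : F) : WithTop F)
  have h1 := parProj_mem_nullFam hV a hZ
  have h3 := isHomFam_parProj (𝒱 := 𝒱) b Y
  have h4 := fun n => (parProj_isAs hV hY b n)
  have h5 := ser_lieFam_sub hV (isHomFam_parProj (𝒱 := 𝒱) a Z) h3 (isAs_of_mem_nullFam hV h1) h4
  rw [mem_nullFam_iff 𝒱] at h1 ⊢
  have h6 := bracket_mem_left (a := a) h1 (h3.hasPar hV ((0 : F) : WithTop F))
    (isSeries_ser fun n => (h4 n).toIsCoch)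
  rw [coe_zero_add] at h6
  exact (sub_add_cancel (serLin d ((0 : F) : WithTop F) _) _) ▸ add_mem h5 h6

theorem actFam_eq_zero_of_nullFam (hZ : Z ∈ NullFam d ((0 : F) : WithTop F))
    (hY : ∀ n, IsAs 𝒱 d ⊤ (Y n)) : actFam 𝒱 d Z Y = 0 := by
  rw [← mem_nullFam_top (d := d)]
  intro n v
  rw [famBilin_sum (𝒱 := 𝒱), MultilinearMap.sum_apply]
  refine sum_mem fun a _ => ?_
  rw [MultilinearMap.sum_apply]
  refine sum_mem fun b _ => ?_
  revert n v
  change actFam 𝒱 d _ _ ∈ NullFam d ⊤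
  have h1 := parProj_mem_nullFam hV a hZ
  have h3 := isHomFam_parProj (𝒱 := 𝒱) b Y
  have h4 := fun n => (parProj_isAs_top hV hY b n)
  have h5 := ser_actFam_sub hV (isHomFam_parProj (𝒱 := 𝒱) a Z) h3 (isAs_of_mem_nullFam hV h1) h4
  rw [mem_nullFam_iff 𝒱] at h1 ⊢
  have h6 := bracket_mem_left (a := a) h1 (h3.hasPar hV ⊤)
    (isSeries_ser fun n => (h4 n).toIsCoch)
  rw [coe_zero_add] at h6
  exact (sub_add_cancel (serLin d ⊤ _) _) ▸ add_mem h5 h6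

end Bracket

theorem lieFam_skew (hX : IsHomFam 𝒱 a X) (hY : IsHomFam 𝒱 b Y) : lieFam 𝒱 d Y X =
    -(sgn a b • lieFam 𝒱 d X Y) := by
  funext n
  refine eq_of_homogeneous (𝒱 := 𝒱) fun β v hv => ?_
  change _ = -(sgn a b • lieFam 𝒱 d X Y n v)
  rw [lieFam_apply hX hY hv, lieFam_apply hY hX hv, sgn_smul, sgn_smul, sgn_comm b a, smul_sub,
    sgn_smul_sgn_smul]
  abel

theorem lieFam_mem_right [Infinite F] (hV : IsDifferentialSuperalgebra 𝒱 d)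
    (hZ : Z ∈ NullFam d ((0 : F) : WithTop F)) (hX : ∀ n, IsAs 𝒱 d ((0 : F) : WithTop F) (X n)) :
    lieFam 𝒱 d X Z ∈ NullFam d ((0 : F) : WithTop F) := by
  intro n v
  rw [famBilin_sum (𝒱 := 𝒱), MultilinearMap.sum_apply]
  refine sum_mem fun a _ => ?_
  rw [MultilinearMap.sum_apply]
  refine sum_mem fun b _ => ?_
  rw [lieFam_skew (isHomFam_parProj _ _) (isHomFam_parProj _ _)]
  exact neg_mem (zsmul_mem (lieFam_mem_left hV (parProj_mem_nullFam hV b hZ)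
    (fun n => parProj_isAs hV hX a n) n v) _)

variable (𝒱) in
/-- The box product `X □ Y` of families. -/
noncomputable def plainFam (d : V →ₗ[F] V) : Fam F V →ₗ[F] Fam F V →ₗ[F] Fam F V :=
  famBilin fun _ => boxLin 𝒱 d id fun S => ∑ j ∈ S, lam j

variable (𝒱) in
/-- The box product `X □^L Y` of families. -/
noncomputable def leftFam (d : V →ₗ[F] V) : Fam F V →ₗ[F] Fam F V →ₗ[F] Fam F V :=
  famBilin fun _ => boxLin 𝒱 d id fun S => -(∑ j ∈ Sᶜ, lam j) - del

theorem plainFam_apply (X Y : Fam F V) (hv : ∀ j, v j ∈ parityShift 𝒱 (β j)) :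
    plainFam 𝒱 d X Y n v = boxPlain d X Y β v :=
  boxLin_apply _ _ _ _ hv

theorem leftFam_apply (X Y : Fam F V) (hv : ∀ j, v j ∈ parityShift 𝒱 (β j)) : leftFam 𝒱 d X Y n v =
    boxLeft d X Y β v :=
  boxLin_apply _ _ _ _ hv

theorem ser_plainFam (hX : ∀ n, IsCoch 𝒱 d ν (X n)) (hl : Hom (parityShift 𝒱) l) :
    ser d ν (plainFam 𝒱 d X Y) l = insShuf d ν ((0 : F) : WithTop F) 0 X Y l := by
  obtain ⟨n, e, rfl⟩ := exists_ofFn l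
  rw [ser_ofFn, evC_eq_evPol, ← evPol_boxPlain hX, plainFam_apply _ _ (hom_ofFn.1 hl)]

theorem ser_leftFam_mem (hX : ∀ n, IsCoch 𝒱 d ((0 : F) : WithTop F) (X n))
    (hl : Hom (parityShift 𝒱) l) : ser d ν (leftFam 𝒱 d X Y) l -
    insShuf d ((0 : F) : WithTop F) ν 0 X Y l ∈ nullVec d (ν + momSum l) := by
  obtain ⟨n, e, rfl⟩ := exists_ofFn l
  rw [ser_ofFn, evC_eq_evPol, leftFam_apply _ _ (hom_ofFn.1 hl)]
  exact evPol_boxLeft_mem hX e 0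

theorem plainFam_sub_mem [Infinite F] {Y' : Fam F V} (hX : ∀ n, IsCoch 𝒱 d ν (X n))
    (hX' : ∀ n, IsCoch 𝒱 d ν (X' n)) (h : X - X' ∈ NullFam d ν)
    (h' : Y - Y' ∈ NullFam d ((0 : F) : WithTop F)) : plainFam 𝒱 d X Y - plainFam 𝒱 d X' Y' ∈
    NullFam d ν := by
  refine mem_nullFam 𝒱 fun l hl => ?_
  rw [ser_sub, ser_plainFam hX hl, ser_plainFam hX' hl]
  have h1 := insShuf_congr_left (νY := ((0 : F) : WithTop F)) (Y := Y) h 0 l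
  have h2 := insShuf_congr_right hX' h' 0 hl
  have := add_mem h1 h2
  rw [sub_add_sub_cancel] at this
  rwa [add_comm ν, coe_zero_add] at this

theorem leftFam_sub_mem [Infinite F] (hX : ∀ n, IsCoch 𝒱 d ((0 : F) : WithTop F) (X n))
    (hX' : ∀ n, IsCoch 𝒱 d ((0 : F) : WithTop F) (X' n))
    (h : X - X' ∈ NullFam d ((0 : F) : WithTop F)) : leftFam 𝒱 d X Y - leftFam 𝒱 d X' Y ∈
    NullFam d ν := by
  refine mem_nullFam 𝒱 fun l hl => ?_
  rw [ser_sub]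
  have h1 := insShuf_congr_left (νY := ν) (Y := Y) h 0 l
  rw [coe_zero_add] at h1
  have := add_mem (sub_mem (ser_leftFam_mem (ν := ν) (Y := Y) hX hl)
    (ser_leftFam_mem (ν := ν) (Y := Y) hX' hl)) h1
  convert this using 1
  abel

theorem conv_eq_zero {ν' : WithTop F} {Y Z : List (Arg F V) → V} (hY : ∀ l, ν + momSum l = ⊤ → Y l =
    0) (hZ : ∀ l, ν' + momSum l = ⊤ → Z l = 0) (h : ν + ν' + momSum l = ⊤) : conv l c Y Z = 0 := by
  induction l generalizing ν ν' c Y Z with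
  | nil =>
    simp only [momSum_nil, add_zero, WithTop.add_eq_top] at h
    rcases h with h | h
    · rw [conv, hY [] (by simp [h]), zero_mul]
    · rw [conv, hZ [] (by simp [h]), mul_zero]
  | cons w l ih =>
    rw [momSum_cons] at h
    rw [conv, ih hY (ν' := ν' + w.mom) (fun l hl => hZ _ (by rwa [momSum_cons, ← add_assoc]))
        (by rw [← h]; abel),
      ih (ν := ν + w.mom) (fun l hl => hY _ (by rwa [momSum_cons, ← add_assoc])) hZ
        (by rw [← h]; abel), smul_zero, add_zero]

/-- The bracket with a conformal derivation is a derivation of the concatenation product. -/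
theorem bracket_conv (hV : IsDifferentialSuperalgebra 𝒱 d) {ν : F} {X Y Z : List (Arg F V) → V}
    (hX : IsSeries (parityShift 𝒱) d ν X) (hX' : IsDer 𝒱 ν X) (hXp : HasPar (parityShift 𝒱) a X)
    (hY : HasPar (parityShift 𝒱) (b + 1) Y) (hZ : HasPar (parityShift 𝒱) (c + 1) Z)
    (hl : Hom (parityShift 𝒱) l) (h : momSum l ≠ ⊤) : bracket ν a X ⊤ (b + c + 1)
    (fun q => conv q c Y Z) l = conv l c (bracket ν a X ⊤ (b + 1) Y) Z +
    sgn a b • conv l (a + c) Y (bracket ν a X ⊤ (c + 1) Z) := by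
  have h1 : bracket (ν : WithTop F) a X ⊤ (b + 1) Y = fun q => ins q ⊤ (b + 1) Y X +
      (-sgn a (b + 1)) • ins q ν a X Y := by
    funext q; rw [bracket, neg_smul, sub_eq_add_neg]
  have h2 : bracket (ν : WithTop F) a X ⊤ (c + 1) Z = fun q => ins q ⊤ (c + 1) Z X +
      (-sgn a (c + 1)) • ins q ν a X Z := by
    funext q; rw [bracket, neg_smul, sub_eq_add_neg]
  rw [h1, h2, conv_add_left, conv_add_right, conv_zsmul_left, conv_zsmul_right, bracket,
    ins_conv_left hV hX hX' hXp hY hZ l hl h, ins_conv, add_comm c a]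
  simp only [smul_add, smul_sub, smul_smul, sgn_add_left, sgn_add_right]
  match_scalars <;> grind [sgn_mul_self, sgn_comm]

theorem ser_transFam_top (Z : Fam F V) (l : List (Arg F V)) :
    ser d ⊤ (transFam d Z) l = shiftD d 0 (ser d ⊤ Z) l := by
  obtain ⟨n, e, rfl⟩ := exists_ofFn l
  rw [shiftD, ser_ofFn, ser_ofFn, evC, evC]
  split_ifs with h
  · have h1 : ∀ j, topCount (e j).mom = 0 := by
      have : ∑ j, topCount (e j).mom = 0 := by
        have : topCount (⊤ : WithTop F) = 1 := by simp
        omega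
      exact fun j => Finset.sum_eq_zero_iff.1 this j (Finset.mem_univ j)
    simp only [tau_eq, h1, zero_smul, add_zero, transFam_apply]
    rw [evP_totalD, ← map_sum, map_add, LinearMap.add_apply, aeval_C_apply, Polynomial.aeval_X,
      add_comm, zero_add, finSum, List.map_ofFn, List.sum_ofFn]
    rfl
  · simp

/-- The family with the only nonzero component `1 ∈ V`. -/
noncomputable def unitFam : Fam F V
  | 0 => MultilinearMap.constOfIsEmpty F (fun _ : Fin 0 => V) (1 ⊗ₜ[F] (1 : V))
  | _ + 1 => 0

theorem isAs_unitFam (hV : IsDifferentialSuperalgebra 𝒱 d) (n : ℕ) :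
    IsAs 𝒱 d ⊤ (unitFam n : Cochain F V n) := by
  cases n with
  | zero => exact isAs_zero _
  | succ n => exact isAs_of_mem_nullFam (Z := 0) hV (zero_mem _) (n + 1)

theorem ser_unitFam_nil : ser d ⊤ (unitFam (F := F) (V := V)) [] = 1 := by
  rw [ser, evC, if_pos (by simp)]
  change evP d _ (1 ⊗ₜ[F] (1 : V)) = 1
  simp

theorem ser_unitFam_cons (w : Arg F V) (l : List (Arg F V)) :
    ser d ⊤ (unitFam (F := F) (V := V)) (w :: l) = 0 := by
  rw [ser, evC]
  split_ifs
  · exact map_zero _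
  · rfl

theorem isHomFam_unitFam : IsHomFam 𝒱 1 (unitFam (F := F) (V := V)) := by
  intro n β v hv
  cases n with
  | zero =>
    have h1 : (1 : V) ∈ parityShift 𝒱 1 := by
      change (1 : V) ∈ 𝒱 (1 + 1)
      rw [CharTwo.add_self_eq_zero]; exact SetLike.one_mem_graded 𝒱
    exact ⟨1 ⊗ₜ ⟨1, by simpa using h1⟩, rfl⟩
  | succ n => exact zero_mem _

end Families

section Operations

variable {F : Type*} [Field F] [Infinite F] {V : Type*} [Ring V] [Algebra F V]
  {𝒱 : ZMod 2 → Submodule F V} [GradedAlgebra 𝒱] {d : V →ₗ[F] V} {n : ℕ}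
variable {g : List (Arg F V) → V} {a c : ZMod 2} {X' Y' : Fam F V} {X Y : W 𝒱 d}

noncomputable local instance : AddCommMonoid (G 𝒱 d) :=
  inferInstanceAs (AddCommMonoid (DirectSum ℕ fun m => WtAs 𝒱 d m))
noncomputable local instance : Module F (G 𝒱 d) :=
  inferInstanceAs (Module F (DirectSum ℕ fun m => WtAs 𝒱 d m))
noncomputable local instance : AddCommMonoid (W 𝒱 d) :=
  inferInstanceAs (AddCommMonoid (DirectSum ℕ fun m => WQAs 𝒱 d m))
noncomputable local instance : Module F (W 𝒱 d) :=
  inferInstanceAs (Module F (DirectSum ℕ fun m => WQAs 𝒱 d m))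

theorem exists_translation (hV : IsDifferentialSuperalgebra 𝒱 d) :
    ∃ D : G 𝒱 d →ₗ[F] G 𝒱 d, ∀ X, famG (D X) = transFam d (famG X) :=
  exists_linear (transFam d ∘ₗ famG) famG famG_injective fun X =>
    exists_famG hV (isAs_transFam hV (famG_isAs hV X)) (by
      obtain ⟨N, hN⟩ := exists_famG_eq_zero X
      exact ⟨N, fun n hn => by ext v; simp [hN n hn]⟩)

theorem exists_mul (hV : IsDifferentialSuperalgebra 𝒱 d) :
    ∃ mul : G 𝒱 d →ₗ[F] G 𝒱 d →ₗ[F] G 𝒱 d,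
      ∀ X Y, famG (mul X Y) = mulFam 𝒱 (famG X) (famG Y) :=
  exists_bilin ((mulFam 𝒱).compl₁₂ famG famG) famG famG_injective fun X Y =>
    exists_famG hV (isAs_mulFam hV (famG_isAs hV X) (famG_isAs hV Y)) (by
      obtain ⟨N, hN⟩ := exists_famG_eq_zero X
      obtain ⟨M, hM⟩ := exists_famG_eq_zero Y
      refine ⟨N + M, fun n hn => mulFam_eq_zero fun k l hkl => ?_⟩
      by_cases hk : N ≤ k
      · exact .inl (hN k hk)
      · exact .inr (hM l (by omega)))

theorem exists_act (hV : IsDifferentialSuperalgebra 𝒱 d) :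
    ∃ act : W 𝒱 d →ₗ[F] G 𝒱 d →ₗ[F] G 𝒱 d,
      ∀ X Y, famG (act X Y) = actFam 𝒱 d (repW X) (famG Y) :=
  exists_bilin ((actFam 𝒱 d).compl₁₂ repW famG) famG famG_injective fun X Y =>
    exists_famG hV (isAs_actFam hV (isAs_of_isLift hV (isLift_repW X)) (famG_isAs hV Y)) (by
      obtain ⟨N, hN⟩ := exists_repW_eq_zero X
      obtain ⟨M, hM⟩ := exists_famG_eq_zero Y
      refine ⟨N + M, fun n hn => actFam_eq_zero fun k l hkl => ?_⟩
      by_cases hk : N ≤ k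
      · exact .inl (hN k hk)
      · exact .inr (hM l (by omega)))

theorem exists_lie (hV : IsDifferentialSuperalgebra 𝒱 d) :
    ∃ lie : W 𝒱 d →ₗ[F] W 𝒱 d →ₗ[F] W 𝒱 d,
      ∀ X Y, compW F V (lie X Y) = famQ d (lieFam 𝒱 d (repW X) (repW Y)) :=
  exists_bilin (((lieFam 𝒱 d).compl₁₂ repW repW).compr₂ (famQ d)) (compW F V) compW_injective
    fun X Y => exists_compW hV (isAs_lieFam hV (isAs_of_isLift hV (isLift_repW X))
      (isAs_of_isLift hV (isLift_repW Y))) (by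
      obtain ⟨N, hN⟩ := exists_repW_eq_zero X
      obtain ⟨M, hM⟩ := exists_repW_eq_zero Y
      refine ⟨N + M, fun n hn => lieFam_eq_zero fun k l hkl => ?_⟩
      by_cases hk : N ≤ k
      · exact .inl (hN k hk)
      · exact .inr (hM l (by omega)))

theorem exists_int (hV : IsDifferentialSuperalgebra 𝒱 d) :
    ∃ int : G 𝒱 d →ₗ[F] W 𝒱 d, ∀ X, compW F V (int X) = famQ d (famG X) :=
  exists_linear (famQ d ∘ₗ famG) (compW F V) compW_injective fun X =>
    exists_compW hV (fun n => (famG_isAs hV X n).of_top _) (exists_famG_eq_zero X)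

theorem exists_br (hV : IsDifferentialSuperalgebra 𝒱 d) (hfg : IsFinitelyGenerated d) :
    ∃ br : G 𝒱 d →ₗ[F] G 𝒱 d →ₗ[F] Pol (Fin 1) F (G 𝒱 d),
      ∀ X Y r, famG (polyCoeff r (br X Y)) = brCoeff 𝒱 d r (famG X) (famG Y) :=
  exists_bilin_poly (fun r => (brCoeff 𝒱 d r).compl₁₂ famG famG) famG famG_injective
    (fun r X Y => exists_famG hV (isAs_brCoeff hV (famG_isAs hV X) (famG_isAs hV Y) r) (by
      obtain ⟨N, hN⟩ := exists_famG_eq_zero X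
      obtain ⟨M, hM⟩ := exists_famG_eq_zero Y
      refine ⟨N + M, fun n hn => brCoeff_eq_zero r fun k l hkl => ?_⟩
      by_cases hk : N ≤ k
      · exact .inl (hN k hk)
      · exact .inr (hM l (by omega))))
    fun X Y => exists_brCoeff_fam_eq_zero hV hfg (famG_isAs hV X) (famG_isAs hV Y)
      (exists_famG_eq_zero X) (exists_famG_eq_zero Y)

/-- The operations on `G(V)` and `W^{∂,as}(ΠV)`, described on families. -/
structure Operations (𝒱 : ZMod 2 → Submodule F V) [GradedAlgebra 𝒱] (d : V →ₗ[F] V) where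
  D : G 𝒱 d →ₗ[F] G 𝒱 d
  mul : G 𝒱 d →ₗ[F] G 𝒱 d →ₗ[F] G 𝒱 d
  br : G 𝒱 d →ₗ[F] G 𝒱 d →ₗ[F] Pol (Fin 1) F (G 𝒱 d)
  lie : W 𝒱 d →ₗ[F] W 𝒱 d →ₗ[F] W 𝒱 d
  act : W 𝒱 d →ₗ[F] G 𝒱 d →ₗ[F] G 𝒱 d
  int : G 𝒱 d →ₗ[F] W 𝒱 d
  famG_D : ∀ X, famG (D X) = transFam d (famG X)
  famG_mul : ∀ X Y, famG (mul X Y) = mulFam 𝒱 (famG X) (famG Y)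
  famG_br : ∀ X Y r, famG (polyCoeff r (br X Y)) = brCoeff 𝒱 d r (famG X) (famG Y)
  compW_lie : ∀ X Y, compW F V (lie X Y) = famQ d (lieFam 𝒱 d (repW X) (repW Y))
  famG_act : ∀ X Y, famG (act X Y) = actFam 𝒱 d (repW X) (famG Y)
  compW_int : ∀ X, compW F V (int X) = famQ d (famG X)

theorem exists_operations (hV : IsDifferentialSuperalgebra 𝒱 d) (hfg : IsFinitelyGenerated d) :
    Nonempty (Operations 𝒱 d) := by
  obtain ⟨D, h1⟩ := exists_translation (𝒱 := 𝒱) hV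
  obtain ⟨mul, h2⟩ := exists_mul (𝒱 := 𝒱) hV
  obtain ⟨br, h3⟩ := exists_br (𝒱 := 𝒱) hV hfg
  obtain ⟨lie, h4⟩ := exists_lie (𝒱 := 𝒱) hV
  obtain ⟨act, h5⟩ := exists_act (𝒱 := 𝒱) hV
  obtain ⟨int, h6⟩ := exists_int (𝒱 := 𝒱) hV
  exact ⟨⟨D, mul, br, lie, act, int, h1, h2, h3, h4, h5, h6⟩⟩

theorem exists_homLift (hV : IsDifferentialSuperalgebra 𝒱 d) (hX : X ∈ W.par 𝒱 d a) : ∃ X',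
    IsLift X X' ∧ IsHomFam 𝒱 a X' :=
  ⟨_, (mem_parW_iff hV (isLift_repW X)).1 hX, isHomFam_parProj _ _⟩

theorem compW_eq_of_isLift (h : IsLift X X') (h' : IsLift Y X') : X = Y :=
  compW_injective (by rw [← famQ_eq_of_isLift h, ← famQ_eq_of_isLift h'])

theorem subst_subst_flip (P : Pol (Option (Fin n)) F V) :
    subst d (fun t : Option (Fin n) =>
        t.elim (-lam none - (∑ j, lam (some j)) - del) (fun j => lam (some j)))
      (subst d (fun t : Option (Fin n) =>
        t.elim (-lam none - (∑ j, lam (some j)) - del) (fun j => lam (some j))) P) = P := by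
  rw [← sub_eq_zero]
  refine eq_zero_of_evP (d := d) fun τ => ?_
  rw [map_sub, evP_subst, evP_subst, sub_eq_zero]
  congr 2
  funext s
  cases s with
  | none => simp; ring
  | some j => simp

theorem lambdaBracket_skew (a b : ZMod 2) (X Y : Fam F V) (β : Fin n → ZMod 2) (v : Fin n → V) :
    lambdaBracket d b a Y X β v = -((-1 : ℤˣ) ^ (a * b) • subst d
      (fun t : Option (Fin n) =>
        t.elim (-lam none - (∑ j, lam (some j)) - del) (fun j => lam (some j)))
      (lambdaBracket d a b X Y β v)) := by
  rw [lambdaBracket, lambdaBracket, map_sub, map_sgn_smul, subst_subst_flip, smul_sub, sgn_smul,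
    sgn_smul]
  simp only [sgn_smul]
  rw [sgn_smul_sgn_smul, sgn_comm b a]
  abel

theorem evP_polyValue {D : G 𝒱 d →ₗ[F] G 𝒱 d} (hD : ∀ X, famG (D X) = transFam d (famG X))
    (v : Fin n → V) (z : Pol (Fin 1) F (G 𝒱 d)) (τ : Fin n → F) (t c : F) :
    evP d (fun s : Option (Fin n) => s.elim
        (Polynomial.C t + Polynomial.C c * (Polynomial.C (∑ j, τ j) + Polynomial.X))
        fun j => Polynomial.C (τ j)) (G.polyValue v z) =
      evP d (fun j => Polynomial.C (τ j))
        (famG (evP D (fun _ => Polynomial.C t + Polynomial.C c * Polynomial.X) z) n v) := by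
  rw [G.polyValue, evP_extend (d := D) _ _ (fun s : Option (Fin n) => s.elim
    (Polynomial.C t + Polynomial.C c * Polynomial.X) fun j => Polynomial.C (τ j)),
    LinearMap.comp_apply, evP_renameVars, evP_renameVars]
  · rfl
  · intro s X
    simp only [LinearMap.comp_apply, evP_renameVars]
    cases s with
    | none =>
      simp only [Option.elim_none, Option.elim_some, map_add, map_mul, Polynomial.aeval_X,
        LinearMap.add_apply, Module.End.mul_apply, aeval_C_apply, map_smul]
      congr 2
      have : (G.value v) (D X) = totalD d (G.value v X) :=
        congrArg (fun A : Fam F V => A n v) (hD X)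
      rw [this, evP_totalD, ← map_sum]
      simp only [map_add, LinearMap.add_apply, Polynomial.aeval_X, aeval_C_apply, smul_add]
      rw [smul_comm c]
    | some j => simp only [Option.elim_some, aeval_C_apply, map_smul]

theorem evP_C_polyValue {D : G 𝒱 d →ₗ[F] G 𝒱 d} (hD : ∀ X, famG (D X) = transFam d (famG X))
    (v : Fin n → V) (z : Pol (Fin 1) F (G 𝒱 d)) (τ : Option (Fin n) → F) :
    evP d (fun s => Polynomial.C (τ s)) (G.polyValue v z) =
      evP d (fun j => Polynomial.C (τ (some j)))
        (famG (evP D (fun _ => Polynomial.C (τ none)) z) n v) := by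
  have := evP_polyValue hD v z (fun j => τ (some j)) (τ none) 0
  simp only [map_zero, zero_mul, add_zero] at this
  rw [← this]
  congr 2
  funext s
  cases s <;> rfl

theorem famG_eq_of_homogeneous {X Y : G 𝒱 d} (h : ∀ (n : ℕ) (β : Fin n → ZMod 2) (v : Fin n → V),
    (∀ j, v j ∈ parityShift 𝒱 (β j)) → famG X n v = famG Y n v) : X = Y :=
  famG_injective (funext fun n => eq_of_homogeneous (𝒱 := 𝒱) (h n))

theorem eq_of_polyValue {D : G 𝒱 d →ₗ[F] G 𝒱 d} (hD : ∀ X, famG (D X) = transFam d (famG X))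
    {z z' : Pol (Fin 1) F (G 𝒱 d)} (h : ∀ (n : ℕ) (β : Fin n → ZMod 2) (v : Fin n → V),
      (∀ j, v j ∈ parityShift 𝒱 (β j)) → G.polyValue v z = G.polyValue v z') : z = z' := by
  rw [← sub_eq_zero]
  refine eq_zero_of_evP (d := D) fun τ => ?_
  rw [map_sub, sub_eq_zero]
  refine famG_eq_of_homogeneous fun n β v hv => ?_
  rw [← sub_eq_zero]
  refine eq_zero_of_evP (d := d) fun σ => ?_
  have h1 := evP_C_polyValue hD v z (fun s => s.elim (τ 0) σ)
  have h2 := evP_C_polyValue hD v z' (fun s => s.elim (τ 0) σ)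
  rw [h n β v hv, h2] at h1
  simp only [Option.elim_none, Option.elim_some] at h1
  have h3 : τ = fun _ => τ 0 := funext fun i => congrArg τ (Subsingleton.elim i 0)
  rw [map_sub, sub_eq_zero, h3]
  exact h1.symm

theorem polyValue_subst {D : G 𝒱 d →ₗ[F] G 𝒱 d} (hD : ∀ X, famG (D X) = transFam d (famG X))
    (v : Fin n → V) (z : Pol (Fin 1) F (G 𝒱 d)) :
    G.polyValue v (subst D (fun _ => -lam 0 - del) z) = subst d
      (fun t : Option (Fin n) =>
        t.elim (-lam none - (∑ j, lam (some j)) - del) (fun j => lam (some j)))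
      (G.polyValue v z) := by
  rw [← sub_eq_zero]
  refine eq_zero_of_evP (d := d) fun τ => ?_
  rw [map_sub, sub_eq_zero, evP_C_polyValue hD, evP_subst, evP_subst]
  have := evP_polyValue hD v z (fun j => τ (some j)) (-τ none) (-1)
  refine Eq.trans (congrArg (fun f => evP d _ (famG (evP D f z) n v)) ?_)
    (this.symm.trans (congrArg (fun f => evP d f _) ?_))
  · funext s
    simp [sub_eq_add_neg]
  · funext s
    cases s with
    | none => simp; ring
    | some j => simp

theorem isHomFam_iff {X : Fam F V} : IsHomFam 𝒱 a X ↔ parProj 𝒱 a X = X :=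
  ⟨fun h => h.parProj, fun h => h ▸ isHomFam_parProj a X⟩

theorem exists_projG (hV : IsDifferentialSuperalgebra 𝒱 d) :
    ∃ π : ZMod 2 → G 𝒱 d →ₗ[F] G 𝒱 d, ∀ a X, famG (π a X) = parProj 𝒱 a (famG X) := by
  have := fun a => exists_linear (parProj 𝒱 a ∘ₗ famG) (famG (𝒱 := 𝒱) (d := d)) famG_injective
    fun X => exists_famG hV (parProj_isAs_top hV (famG_isAs hV X) a) (by
      obtain ⟨N, hN⟩ := exists_famG_eq_zero X
      exact ⟨N, fun n hn => parProj_eq_zero (hN n hn) a⟩)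
  choose π hπ using this
  exact ⟨π, hπ⟩

theorem exists_projW (hV : IsDifferentialSuperalgebra 𝒱 d) :
    ∃ π : ZMod 2 → W 𝒱 d →ₗ[F] W 𝒱 d,
      ∀ a X X', IsLift X X' → IsLift (π a X) (parProj 𝒱 a X') := by
  have := fun a => exists_linear (famQ d ∘ₗ parProj 𝒱 a ∘ₗ repW) (compW F V (𝒱 := 𝒱) (d := d))
    compW_injective
    fun X => exists_compW hV (parProj_isAs hV (isAs_of_isLift hV (isLift_repW X)) a) (by
      obtain ⟨N, hN⟩ := exists_repW_eq_zero X
      exact ⟨N, fun n hn => parProj_eq_zero (hN n hn) a⟩)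
  choose π hπ using this
  refine ⟨π, fun a X X' hX n v => ?_⟩
  have h1 := (hπ a X).trans (famQ_parProj_eq hV a (Z' := X')
    ((famQ_eq_of_isLift (isLift_repW X)).trans (famQ_eq_of_isLift hX).symm))
  exact (congrArg (fun A : ∀ n, CochainQ n d => A n v) h1).symm

theorem isInternal_barPar (hV : IsDifferentialSuperalgebra 𝒱 d) :
    DirectSum.IsInternal (G.barPar 𝒱 d) := by
  obtain ⟨π, hπ⟩ := exists_projG (𝒱 := 𝒱) hV
  refine isInternal_of_proj π (fun a X => ?_) (fun a X hX => famG_injective ?_)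
    (fun a b X hX hab => famG_injective ?_) fun X => ⟨Finset.univ, famG_injective ?_⟩
  · rw [mem_barPar_iff, hπ]; exact isHomFam_parProj _ _
  · rw [hπ, (mem_barPar_iff.1 hX).parProj]
  · rw [hπ, (mem_barPar_iff.1 hX).parProj_of_ne hab, map_zero]
  · rw [map_sum]; simp only [hπ]; exact sum_parProj _

theorem isInternal_par (hV : IsDifferentialSuperalgebra 𝒱 d) :
    DirectSum.IsInternal (G.par 𝒱 d) := by
  obtain ⟨π, hπ⟩ := exists_projG (𝒱 := 𝒱) hV
  refine isInternal_of_proj (fun a => π (a + 1)) (fun a X => ?_) (fun a X hX => famG_injective ?_)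
    (fun a b X hX hab => famG_injective ?_) fun X => ⟨Finset.univ, famG_injective ?_⟩
  · change IsHomFam 𝒱 (a + 1) (famG (π (a + 1) X))
    rw [hπ]; exact isHomFam_parProj _ _
  · rw [hπ]; exact IsHomFam.parProj hX
  · rw [hπ, map_zero]; exact IsHomFam.parProj_of_ne hX (by simpa using hab)
  · rw [map_sum]; simp only [hπ]
    exact (Equiv.sum_comp (Equiv.addRight (1 : ZMod 2)) fun a => parProj 𝒱 a (famG X)).trans
      (sum_parProj _)

theorem isInternal_parW (hV : IsDifferentialSuperalgebra 𝒱 d) :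
    DirectSum.IsInternal (W.par 𝒱 d) := by
  obtain ⟨π, hπ⟩ := exists_projW (𝒱 := 𝒱) hV
  refine isInternal_of_proj π (fun a X => ?_) (fun a X hX => ?_)
    (fun a b X hX hab => ?_) fun X => ⟨Finset.univ, ?_⟩
  · rw [mem_parW_iff hV (hπ a X _ (isLift_repW X)), (isHomFam_parProj _ _).parProj]
    exact hπ a X _ (isLift_repW X)
  · obtain ⟨X', h1, h2⟩ := exists_homLift hV hX
    have := hπ a X _ h1
    rw [h2.parProj] at this
    exact compW_eq_of_isLift this h1
  · obtain ⟨X', h1, h2⟩ := exists_homLift hV hX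
    have := hπ b X _ h1
    rw [h2.parProj_of_ne hab] at this
    exact compW_eq_of_isLift this fun n v => map_zero _
  · refine compW_injective ?_
    rw [map_sum, ← famQ_eq_of_isLift (isLift_repW X), ← sum_parProj (𝒱 := 𝒱) (repW X), map_sum]
    exact Finset.sum_congr rfl fun a _ => (famQ_eq_of_isLift (hπ a X _ (isLift_repW X))).symm

theorem isInternal_deg : DirectSum.IsInternal (G.deg 𝒱 d) := by
  refine isInternal_of_proj (fun k => DirectSum.lof F ℕ (fun m => WtAs 𝒱 d m) k ∘ₗ
    DirectSum.component F ℕ (fun m => WtAs 𝒱 d m) k) (fun k X => ⟨_, rfl⟩) ?_ ?_ fun X => ?_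
  · rintro k _ ⟨x, rfl⟩
    simp [DirectSum.component.lof_self]
  · rintro k l _ ⟨x, rfl⟩ hl
    simp [DirectSum.component.of, hl.symm]
  · classical
    exact ⟨DFinsupp.support X, DirectSum.sum_support_of X⟩

theorem isInternal_deg_par (hV : IsDifferentialSuperalgebra 𝒱 d) :
    DirectSum.IsInternal fun i : ℕ × ZMod 2 => G.deg 𝒱 d i.1 ⊓ G.par 𝒱 d i.2 := by
  obtain ⟨π, hπ⟩ := exists_projG (𝒱 := 𝒱) hV
  let ρ : ℕ → G 𝒱 d →ₗ[F] G 𝒱 d := fun k => DirectSum.lof F ℕ (fun m => WtAs 𝒱 d m) k ∘ₗ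
    DirectSum.component F ℕ (fun m => WtAs 𝒱 d m) k
  have hρ : ∀ k X, famG (ρ k X) = Pi.single k (famG X k) := by
    intro k X
    funext n
    rcases eq_or_ne n k with rfl | hn
    · rw [Pi.single_eq_same]
      exact congrArg Subtype.val (DirectSum.lof_apply F n _)
    · rw [Pi.single_eq_of_ne hn]
      exact mem_degG_iff.1 ⟨_, rfl⟩ n hn
  have hdeg : ∀ k X, X ∈ G.deg 𝒱 d k → ρ k X = X := fun k X hX => famG_injective (by
    rw [hρ]; funext n
    rcases eq_or_ne n k with rfl | hn
    · rw [Pi.single_eq_same]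
    · rw [Pi.single_eq_of_ne hn, mem_degG_iff.1 hX n hn])
  refine isInternal_of_proj (fun i => ρ i.1 ∘ₗ π (i.2 + 1)) (fun i X => ⟨⟨_, rfl⟩, fun m => ?_⟩)
    (fun i X hX => ?_) (fun i j X hX hij => ?_) fun X => ?_
  · change famG (ρ i.1 (π (i.2 + 1) X)) m ∈ _
    rw [hρ, hπ]
    rcases eq_or_ne m i.1 with rfl | hn
    · rw [Pi.single_eq_same]; exact isHomFam_parProj _ _ _
    · rw [Pi.single_eq_of_ne hn]; exact zero_mem _
  · have : π (i.2 + 1) X = X := famG_injective (by rw [hπ, (mem_barPar_iff.1 hX.2).parProj])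
    rw [LinearMap.comp_apply, this, hdeg _ _ hX.1]
  · rw [LinearMap.comp_apply]
    by_cases h2 : j.2 = i.2
    · have h1 : j.1 ≠ i.1 := fun h1 => hij (Prod.ext h1 h2)
      have : π (j.2 + 1) X = X := famG_injective (by rw [hπ, h2, (mem_barPar_iff.1 hX.2).parProj])
      refine famG_injective ?_
      rw [this, hρ, mem_degG_iff.1 hX.1 _ h1, map_zero, Pi.single_zero]
    · have : π (j.2 + 1) X = 0 := famG_injective (by
        rw [hπ, (mem_barPar_iff.1 hX.2).parProj_of_ne (by simpa using h2), map_zero])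
      rw [this, map_zero]
  · classical
    refine ⟨Finset.univ.biUnion fun a => (DFinsupp.support (π (a + 1) X)).image fun k => (k, a), ?_⟩
    rw [Finset.sum_biUnion]
    · have : ∀ a, ∑ i ∈ (DFinsupp.support (π (a + 1) X)).image fun k => (k, a),
          ρ i.1 (π (i.2 + 1) X) = π (a + 1) X := by
        intro a
        rw [Finset.sum_image fun _ _ _ _ h => (Prod.ext_iff.1 h).1]
        exact DirectSum.sum_support_of (π (a + 1) X)
      simp only [LinearMap.comp_apply, this]
      refine famG_injective ?_
      rw [map_sum]; simp only [hπ]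
      exact (Equiv.sum_comp (Equiv.addRight (1 : ZMod 2)) fun a => parProj 𝒱 a (famG X)).trans
        (sum_parProj _)
    · intro a _ b _ hab
      rw [Function.onFun, Finset.disjoint_left]
      intro i hi hi'
      obtain ⟨k, -, rfl⟩ := Finset.mem_image.1 hi
      obtain ⟨l, -, h⟩ := Finset.mem_image.1 hi'
      exact hab (Prod.ext_iff.1 h).2.symm

/-- The series of an element of `W̃^{∂,as}(ΠV)`, taken with total momentum `ν`. -/
noncomputable def serG (ν : WithTop F) : G 𝒱 d →ₗ[F] (List (Arg F V) → V) := serLin d ν ∘ₗ famG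

theorem serG_isAs (hV : IsDifferentialSuperalgebra 𝒱 d) (X : G 𝒱 d) (ν : WithTop F) (n : ℕ) :
    IsAs 𝒱 d ν (famG X n) := by
  induction ν using WithTop.recTopCoe with
  | top => exact famG_isAs hV X n
  | coe ν => exact (famG_isAs hV X n).of_top ν

theorem serG_isSeries (hV : IsDifferentialSuperalgebra 𝒱 d) (ν : WithTop F) (X : G 𝒱 d) :
    IsSeries (parityShift 𝒱) d ν (serG ν X) :=
  isSeries_ser fun n => (serG_isAs hV X ν n).toIsCoch

theorem serG_isDer (hV : IsDifferentialSuperalgebra 𝒱 d) (ν : F) (X : G 𝒱 d) :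
    IsDer 𝒱 ν (serG (ν : WithTop F) X) :=
  isDer_ser hV.d_mul fun n => serG_isAs hV X ν n

theorem serG_hasPar (hV : IsDifferentialSuperalgebra 𝒱 d) {X : G 𝒱 d} (hX : X ∈ G.barPar 𝒱 d a)
    (ν : WithTop F) : HasPar (parityShift 𝒱) a (serG ν X) :=
  (mem_barPar_iff.1 hX).hasPar hV ν

theorem serG_top_eq_zero (X : G 𝒱 d) {l : List (Arg F V)} (h : momSum l = ⊤) : serG ⊤ X l = 0 := by
  refine ser_eq_zero ?_
  have := one_le_topSum (ν := ((0 : F) : WithTop F)) (l := l) (by rw [coe_zero_add, h])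
  rw [topCount_coe] at this
  have h1 : topCount (⊤ : WithTop F) = 1 := by simp
  omega

/-- Elements of `W̃^{∂,as}(ΠV)` are determined by their series. -/
theorem serG_ext {X Y : G 𝒱 d}
    (h : ∀ l, Hom (parityShift 𝒱) l → momSum l ≠ ⊤ → serG ⊤ X l = serG ⊤ Y l) : X = Y := by
  rw [← sub_eq_zero]
  refine famG_injective ?_
  rw [map_zero, ← mem_nullFam_top (d := d), mem_nullFam_iff 𝒱]
  change serG ⊤ (X - Y) ∈ _
  intro l hl
  rw [WithTop.top_add, mem_nullVec_top, map_sub, Pi.sub_apply, sub_eq_zero]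
  by_cases hm : momSum l = ⊤
  · rw [serG_top_eq_zero X hm, serG_top_eq_zero Y hm]
  · exact h l hl hm

theorem nullSer_top_iff {f : List (Arg F V) → V} : f ∈ NullSer (parityShift 𝒱) d ⊤ ↔
    ∀ l, Hom (parityShift 𝒱) l → f l = 0 := by
  refine forall₂_congr fun l _ => ?_
  rw [WithTop.top_add, mem_nullVec_top]

theorem parProj_sub_mem (hV : IsDifferentialSuperalgebra 𝒱 d) {ν : WithTop F} {Z : Fam F V}
    (hg : HasPar (parityShift 𝒱) c g) (h : serLin d ν Z - g ∈ NullSer (parityShift 𝒱) d ν) : Z -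
    parProj 𝒱 c Z ∈ NullFam d ν :=
  sub_parProj_mem_nullFam hV hg h

theorem mem_barPar_of_serG (hV : IsDifferentialSuperalgebra 𝒱 d) {Z : G 𝒱 d}
    (hg : HasPar (parityShift 𝒱) c g) (h : ∀ l, Hom (parityShift 𝒱) l → serG ⊤ Z l = g l) : Z ∈
    G.barPar 𝒱 d c := by
  have := parProj_sub_mem (ν := ⊤) (Z := famG Z) hV hg
    (nullSer_top_iff.2 fun l hl => sub_eq_zero.2 (h l hl))
  rw [mem_nullFam_top, fam_sub_eq_zero] at this
  rw [mem_barPar_iff, isHomFam_iff]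
  exact this.symm

theorem eq_of_lift (hX : IsLift X X') (hY : IsLift Y Y')
    (h : serLin d ((0 : F) : WithTop F) X' - serLin d ((0 : F) : WithTop F) Y' ∈
    NullSer (parityShift 𝒱) d ((0 : F) : WithTop F)) : X = Y := by
  refine compW_injective ?_
  rw [← famQ_eq_of_isLift hX, ← famQ_eq_of_isLift hY, famQ_eq_iff, mem_nullFam_iff 𝒱]
  have h1 : serLin d ((0 : F) : WithTop F) (X' - Y') = serLin d ((0 : F) : WithTop F) X' -
    serLin d ((0 : F) : WithTop F) Y' := funext fun l => ser_sub _ _ _ l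
  exact h1 ▸ h

theorem IsLift.sub_zsmul (hX : IsLift X X') (hY : IsLift Y Y') (k : ℤ) :
    IsLift (X - k • Y) (X' - k • Y') := fun n v => by
  let f : W 𝒱 d →ₗ[F] PolyQ n d := ⟨⟨fun X => X.comp n v, fun _ _ => rfl⟩, fun _ _ => rfl⟩
  have h1 : (X - k • Y).comp n v = X.comp n v - k • Y.comp n v := by
    change f (X - k • Y) = f X - k • f Y
    rw [map_sub, map_zsmul]
  rw [h1, ← hX n v, ← hY n v]
  change toQ d (X' n v - k • Y' n v) = _
  rw [map_sub, map_zsmul]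

theorem serLin_sub_zsmul (ν : WithTop F) (X Y : Fam F V) (k : ℤ) :
    serLin d ν (X - k • Y) = serLin d ν X - k • serLin d ν Y := by
  funext l
  change ser d ν (X - k • Y) l = ser d ν X l - k • ser d ν Y l
  rw [ser_sub]
  congr 1
  have h1 : ∀ v, (k • Y) l.length v = k • Y l.length v := fun _ => rfl
  simp only [ser, evC, h1, map_zsmul]
  split_ifs <;> simp

/-- The series of a family, taken with total momentum `0`. -/
noncomputable def serZ (d : V →ₗ[F] V) : Fam F V →ₗ[F] (List (Arg F V) → V) :=
  serLin d ((0 : F) : WithTop F)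

theorem exists_totalD_section (d : V →ₗ[F] V) (n : ℕ) : ∃ s : Pol (Fin n) F V →ₗ[F] Pol (Fin n) F V,
    ∀ P, toQ d P = 0 → totalD d (s P) = P := by
  obtain ⟨s, hs⟩ := exists_rangeSection ((totalD (σ := Fin n) d).restrictScalars F)
  exact ⟨s, fun P hP => hs P ((Submodule.Quotient.mk_eq_zero _).1 hP)⟩

theorem isAs_of_totalD (hV : IsDifferentialSuperalgebra 𝒱 d) {Z : Cochain F V (n + 1)}
    {X : Cochain F V (n + 1)} (hX : IsAs 𝒱 d ⊤ X) (h : ∀ v, totalD d (Z v) = X v) : IsAs 𝒱 d ⊤ Z where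
  sesq v i := by
    have := hX.sesq v i
    rw [mem_nullPol_top] at this ⊢
    refine totalD_injective (d := d) ?_
    rw [map_add, map_smul, h, h, this, map_zero]
  sym σ β v hv := by
    have := hX.sym σ β v hv
    rw [mem_nullPol_top, sub_eq_zero] at this ⊢
    refine totalD_injective (d := d) ?_
    rw [h, this, ← h, renameVars_totalD]
    exact (map_zsmul (totalD d) _ _).symm
  leib i β a ha γ δ b c hb hc := by
    have := hX.leib i β a ha γ δ b c hb hc
    rw [mem_nullPol_top, sub_eq_zero] at this ⊢
    refine totalD_injective (d := d) ?_
    rw [h, this, ← h, ← h, map_add, arrow_totalD hV.d_mul, arrow_totalD hV.d_mul]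
    congr 1 <;> exact (map_zsmul (totalD d) _ _).symm

namespace Operations

variable (h : Operations 𝒱 d) (hV : IsDifferentialSuperalgebra 𝒱 d)
variable {a b c : ZMod 2} {w' x' y' z' : Fam F V} {w x y z : W 𝒱 d} {X Y Z : G 𝒱 d}

theorem exists_famG_br (X Y : G 𝒱 d) : ∃ R, (∀ r, R ≤ r → brCoeff 𝒱 d r (famG X) (famG Y) = 0) ∧
    ∀ t : F, famG (evP h.D (fun _ => Polynomial.C t) (h.br X Y)) =
      ∑ r ∈ Finset.range R, t ^ r • brCoeff 𝒱 d r (famG X) (famG Y) := by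
  obtain ⟨R, h1, h2⟩ := exists_polyCoeff_eq_zero (D := h.D) (h.br X Y)
  refine ⟨R, fun r hr => by rw [← h.famG_br, h1 r hr, map_zero], fun t => ?_⟩
  rw [h2 t R le_rfl, map_sum]
  simp only [map_smul, h.famG_br]

theorem isLambdaBracket : IsLambdaBracket h.br := by
  intro a b X Y hX hY m β v hv
  obtain ⟨R, h1, h2⟩ := h.exists_famG_br X Y
  change _ = lambdaBracket d a b (famG X) (famG Y) β v
  rw [← lambdaFam_apply (X := famG X) (Y := famG Y) hX hY hv, ← sub_eq_zero]
  refine eq_zero_of_evP (d := d) fun τ => ?_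
  have h3 : ∀ r, R ≤ r → lambdaCoeff r (lambdaFam 𝒱 d m (famG X) (famG Y) v) = 0 := fun r hr => by
    rw [← brCoeff_apply, h1 r hr]; rfl
  have h4 := sum_evP_lambdaCoeff (d := d) (τ none) (fun j => Polynomial.C (τ (some j))) _ h3
  rw [map_sub, sub_eq_zero, evP_C_polyValue h.famG_D, h2]
  refine Eq.trans ?_ (h4.trans (congrArg (fun f => evP d f _) ?_))
  · rw [Finset.sum_apply, MultilinearMap.sum_apply, map_sum]
    refine Finset.sum_congr rfl fun r _ => ?_
    rw [← brCoeff_apply]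
    exact map_smul (evP d fun j => Polynomial.C (τ (some j))) _ _
  · funext s
    cases s <;> rfl

theorem br_skew (hX : X ∈ G.barPar 𝒱 d a) (hY : Y ∈ G.barPar 𝒱 d b) : h.br Y X =
    -((-1 : ℤˣ) ^ (a * b) • subst h.D (fun _ => -lam 0 - del) (h.br X Y)) := by
  refine eq_of_polyValue h.famG_D fun n β v hv => ?_
  have h1 := h.isLambdaBracket a b X Y hX hY n β v hv
  have h2 := h.isLambdaBracket b a Y X hY hX n β v hv
  rw [h2, show Y.comp = famG Y from rfl, show X.comp = famG X from rfl, lambdaBracket_skew]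
  change _ = lambdaBracket d a b (famG X) (famG Y) β v at h1
  rw [← h1, ← polyValue_subst h.famG_D]
  have h3 : ∀ z : Pol (Fin 1) F (G 𝒱 d), G.polyValue v (-((-1 : ℤˣ) ^ (a * b) • z)) =
      -((-1 : ℤˣ) ^ (a * b) • G.polyValue v z) := by
    intro z
    let f : Pol (Fin 1) F (G 𝒱 d) →ₗ[F] Pol (Option (Fin n)) F V :=
      extend (renameVars some ∘ₗ G.value v) ∘ₗ renameVars fun _ => none
    change f _ = -(_ • f z)
    rw [map_neg, map_sgn_smul]
  rw [h3]

theorem ser_br_sub (hV : IsDifferentialSuperalgebra 𝒱 d) (hX : X ∈ G.barPar 𝒱 d a)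
    (hY : Y ∈ G.barPar 𝒱 d b) (t : F) (ν : WithTop F) :
    serLin d (t + ν) (famG (evP h.D (fun _ => Polynomial.C t) (h.br X Y))) -
    bracket (t : WithTop F) a (serLin d t (famG X)) ν b (serLin d ν (famG Y)) ∈
    NullSer (parityShift 𝒱) d (t + ν) := by
  intro l hl
  obtain ⟨n, e, rfl⟩ := exists_ofFn l
  obtain ⟨R, h1, h2⟩ := h.exists_famG_br X Y
  have h3 := sum_ser_brCoeff_mem (X := famG X) (Y := famG Y) hV hX hY (t := t) (ν := ν)
    (fun n => ((famG_isAs hV X n).of_top _).toIsCoch)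
    (fun n => (by
      induction ν using WithTop.recTopCoe with
      | top => exact (famG_isAs hV Y n).toIsCoch
      | coe ν => exact ((famG_isAs hV Y n).of_top _).toIsCoch)) hl (R := R)
    (fun r hr => by rw [h1 r hr]; rfl)
  convert h3 using 1
  rw [h2, map_sum, Pi.sub_apply, Finset.sum_apply]
  congr 1
  refine Finset.sum_congr rfl fun r _ => ?_
  rw [map_smul, Pi.smul_apply]
  exact congrArg _ (ser_ofFn _ _ _)

theorem isTranslation : IsTranslation h.D := fun X n v =>
  congrArg (fun A : Fam F V => A n v) (h.famG_D X)

theorem isIntegral : IsIntegral h.int := fun X n v =>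
  congrArg (fun A : ∀ n, CochainQ n d => A n v) (h.compW_int X)

theorem isConcatenation : IsConcatenation h.mul := fun b X Y hY m β a ha =>
  (congrArg (fun A : Fam F V => A m a) (h.famG_mul X Y)).trans (mulFam_apply hY ha)

include hV

theorem isLift_lie {X Y : W 𝒱 d} {X' Y' : Fam F V} (hX : IsLift X X') (hY : IsLift Y Y') :
    IsLift (h.lie X Y) (lieFam 𝒱 d X' Y') := by
  have h1 := lieFam_mem_left hV (sub_mem_of_isLift (isLift_repW X) hX)
    (isAs_of_isLift hV (isLift_repW Y))
  have h2 := lieFam_mem_right hV (sub_mem_of_isLift (isLift_repW Y) hY) (isAs_of_isLift hV hX)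
  rw [famBilin_sub_left, ← famQ_eq_iff] at h1
  rw [famBilin_sub_right, ← famQ_eq_iff] at h2
  intro n v
  have := (h.compW_lie X Y).trans (h1.trans h2)
  exact (congrArg (fun A : ∀ n, CochainQ n d => A n v) this).symm

theorem famG_act_of_isLift {X : W 𝒱 d} {X' : Fam F V} (hX : IsLift X X') (Y : G 𝒱 d) :
    famG (h.act X Y) = actFam 𝒱 d X' (famG Y) := by
  rw [h.famG_act, ← fam_sub_eq_zero]
  have h1 := actFam_eq_zero_of_nullFam hV (sub_mem_of_isLift (isLift_repW X) hX) (famG_isAs hV Y)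
  rwa [famBilin_sub_left] at h1

theorem isLieBracket : IsLieBracket h.lie := by
  intro a b X Y hX hY X' Y' hX' hY' m β v hv
  obtain ⟨X₁, hX₁, hX₂⟩ := exists_homLift hV hX
  obtain ⟨Y₁, hY₁, hY₂⟩ := exists_homLift hV hY
  have hs := fun {X : W 𝒱 d} {X' : Fam F V} (h : IsLift X X') n => (isAs_of_isLift hV h n).toIsCoch
  rw [← h.isLift_lie hV hX₁ hY₁, lieFam_apply hX₂ hY₂ hv, toQ_eq_iff,
    ← plainFam_apply _ _ hv, ← plainFam_apply _ _ hv, ← plainFam_apply _ _ hv,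
    ← plainFam_apply _ _ hv]
  have h1 := plainFam_sub_mem (𝒱 := 𝒱) (hs hX₁) (hs hX') (sub_mem_of_isLift hX₁ hX')
    (sub_mem_of_isLift hY₁ hY') m v
  have h2 := plainFam_sub_mem (𝒱 := 𝒱) (hs hY₁) (hs hY') (sub_mem_of_isLift hY₁ hY')
    (sub_mem_of_isLift hX₁ hX') m v
  have := sub_mem h1 (sgn_smul_mem ((-1 : ℤˣ) ^ (a * b)) h2)
  convert this using 1
  simp only [Pi.sub_apply, MultilinearMap.sub_apply, smul_sub]
  abel

theorem isAction : IsAction h.act := by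
  intro a b X Y hX hY X' hX' m β v hv
  obtain ⟨X₁, hX₁, hX₂⟩ := exists_homLift hV hX
  have hs := fun {X : W 𝒱 d} {X' : Fam F V} (h : IsLift X X') n => (isAs_of_isLift hV h n).toIsCoch
  have hY' := fun n => (famG_isAs hV Y n).toIsCoch
  refine (congrArg (fun A : Fam F V => A m v) (h.famG_act_of_isLift hV hX₁ Y)).trans ?_
  change actFam 𝒱 d X₁ (famG Y) m v = boxLeft d X' (famG Y) β v - _ • boxPlain d (famG Y) X' β v
  rw [actFam_apply (Y := famG Y) hX₂ hY hv, ← plainFam_apply _ _ hv, ← plainFam_apply _ _ hv,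
    ← leftFam_apply _ _ hv, ← leftFam_apply _ _ hv, ← sub_eq_zero]
  have h1 := leftFam_sub_mem (𝒱 := 𝒱) (Y := famG Y) (ν := ⊤) (hs hX₁) (hs hX')
    (sub_mem_of_isLift hX₁ hX')
  have h2 := plainFam_sub_mem (𝒱 := 𝒱) hY' hY' (mem_nullFam_top.2 (fam_sub_eq_zero.2 rfl))
    (sub_mem_of_isLift hX₁ hX')
  rw [mem_nullFam_top, fam_sub_eq_zero] at h1 h2
  rw [h1, h2, sub_self]

omit hV

theorem serG_D (X : G 𝒱 d) : serG ⊤ (h.D X) = shiftD d 0 (serG ⊤ X) := by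
  funext l
  rw [serG, LinearMap.comp_apply, h.famG_D]
  exact ser_transFam_top _ l

theorem serG_D_add_mem (t : F) (X : G 𝒱 d) :
    serG (t : WithTop F) (h.D X) + t • serG (t : WithTop F) X ∈ NullSer (parityShift 𝒱) d t := by
  have h1 : famG (h.D X + t • X) ∈ NullFam d (t : WithTop F) := fun n v =>
    mem_nullPol_coe.2 ⟨famG X n v, by
      rw [map_add, h.famG_D, map_smul]; rfl⟩
  rw [mem_nullFam_iff 𝒱] at h1
  rw [← map_smul, ← map_add]
  exact h1

theorem serG_mul (X : G 𝒱 d) (hY : Y ∈ G.barPar 𝒱 d (c + 1)) {l : List (Arg F V)}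
    (hl : Hom (parityShift 𝒱) l) : serG ⊤ (h.mul X Y) l = conv l c (serG ⊤ X) (serG ⊤ Y) := by
  by_cases hm : momSum l = ⊤
  · rw [serG_top_eq_zero _ hm, conv_eq_zero (ν := ((0 : F) : WithTop F))
      (ν' := ((0 : F) : WithTop F))]
    · intro l hl; rw [coe_zero_add] at hl; exact serG_top_eq_zero _ hl
    · intro l hl; rw [coe_zero_add] at hl; exact serG_top_eq_zero _ hl
    · rw [hm, WithTop.add_top]
  · rw [serG, LinearMap.comp_apply, h.famG_mul]
    exact ser_mulFam (mem_barPar_iff.1 hY) hl hm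

include hV

theorem serG_brAt (hX : X ∈ G.barPar 𝒱 d a) (hY : Y ∈ G.barPar 𝒱 d b) (t : F) (ν : WithTop F) :
    serG ((t : WithTop F) + ν) (brAt h.D h.br t X Y) -
        bracket (t : WithTop F) a (serG (t : WithTop F) X) ν b (serG ν Y) ∈
      NullSer (parityShift 𝒱) d ((t : WithTop F) + ν) := h.ser_br_sub hV hX hY t ν

theorem serG_top_brAt (hX : X ∈ G.barPar 𝒱 d a) (hY : Y ∈ G.barPar 𝒱 d b) (t : F)
    {l : List (Arg F V)} (hl : Hom (parityShift 𝒱) l) :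
    serG ⊤ (brAt h.D h.br t X Y) l = bracket (t : WithTop F) a (serG t X) ⊤ b (serG ⊤ Y) l := by
  have := h.serG_brAt hV hX hY t ⊤
  rw [WithTop.add_top, nullSer_top_iff] at this
  exact sub_eq_zero.1 (this l hl)

theorem brAt_mem (hX : X ∈ G.barPar 𝒱 d a) (hY : Y ∈ G.barPar 𝒱 d b) (t : F) :
    brAt h.D h.br t X Y ∈ G.barPar 𝒱 d (a + b) :=
  mem_barPar_of_serG hV ((serG_hasPar hV hX t).bracket (serG_hasPar hV hY ⊤))
    fun _ hl => h.serG_top_brAt hV hX hY t hl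

theorem mul_mem (hX : X ∈ G.barPar 𝒱 d (b + 1)) (hY : Y ∈ G.barPar 𝒱 d (c + 1)) :
    h.mul X Y ∈ G.barPar 𝒱 d (b + c + 1) :=
  mem_barPar_of_serG hV ((serG_hasPar hV hX ⊤).conv (serG_hasPar hV hY ⊤))
    fun _ hl => h.serG_mul X hY hl

theorem D_mem (hX : X ∈ G.barPar 𝒱 d a) : h.D X ∈ G.barPar 𝒱 d a :=
  mem_barPar_of_serG hV (g := shiftD d 0 (serG ⊤ X)) (fun l hl => by
      have h1 := serG_hasPar hV hX ⊤ l hl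
      exact add_mem (hV.d_mem h1) (Submodule.smul_mem _ _ h1))
    fun l _ => by rw [h.serG_D]

omit hV in
theorem D_mul (hV : IsDifferentialSuperalgebra 𝒱 d) (hY : Y ∈ G.barPar 𝒱 d (c + 1)) :
    h.D (h.mul X Y) = h.mul (h.D X) Y + h.mul X (h.D Y) := by
  refine serG_ext fun l hl hm => ?_
  rw [map_add, Pi.add_apply, h.serG_D, h.serG_mul _ hY hl, h.serG_mul _ (h.D_mem hV hY) hl,
    h.serG_D, h.serG_D, ← conv_shiftD hV.d_mul, add_zero, shiftD, shiftD, h.serG_mul _ hY hl]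

theorem mul_assoc (hY : Y ∈ G.barPar 𝒱 d (b + 1)) (hZ : Z ∈ G.barPar 𝒱 d (c + 1)) :
    h.mul (h.mul X Y) Z = h.mul X (h.mul Y Z) := by
  refine serG_ext fun l hl hm => ?_
  rw [h.serG_mul _ hZ hl, h.serG_mul _ (h.mul_mem hV hY hZ) hl,
    conv_congr hl (fun l hl => h.serG_mul X hY hl) fun _ _ => rfl,
    conv_congr (Z := serG ⊤ (h.mul Y Z)) hl (fun _ _ => rfl) fun l hl => h.serG_mul Y hZ hl,
    conv_assoc]

theorem mul_comm (hX : X ∈ G.barPar 𝒱 d (a + 1)) (hY : Y ∈ G.barPar 𝒱 d (b + 1)) :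
    h.mul Y X = sgn a b • h.mul X Y := by
  refine serG_ext fun l hl hm => ?_
  rw [map_zsmul, Pi.smul_apply, h.serG_mul _ hX hl, h.serG_mul _ hY hl]
  exact conv_comm hV (serG_hasPar hV hX ⊤) (serG_hasPar hV hY ⊤) l hl

theorem brAt_D_left (hX : X ∈ G.barPar 𝒱 d a) (hY : Y ∈ G.barPar 𝒱 d b) (t : F) :
    brAt h.D h.br t (h.D X) Y = -(t • brAt h.D h.br t X Y) := by
  refine serG_ext fun l hl hm => ?_
  rw [map_neg, map_smul, Pi.neg_apply, Pi.smul_apply, h.serG_top_brAt hV (h.D_mem hV hX) hY t hl,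
    h.serG_top_brAt hV hX hY t hl,
    bracket_congr_left (X' := fun p => -(t • serG (t : WithTop F) X p)) (mem_nullSer.1 (by
      have := h.serG_D_add_mem t X
      rw [← sub_neg_eq_add] at this
      exact this)) (serG_hasPar hV hY ⊤)
      (serG_isSeries hV ⊤ Y) l hl (by simp), bracket, bracket, ins_neg_smul_right,
    ins_neg_smul_left (serG_isSeries hV ⊤ Y).toIsLin]
  module

theorem brAt_D_right (hX : X ∈ G.barPar 𝒱 d a) (hY : Y ∈ G.barPar 𝒱 d b) (t : F) :
    brAt h.D h.br t X (h.D Y) = t • brAt h.D h.br t X Y + h.D (brAt h.D h.br t X Y) := by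
  refine serG_ext fun l hl hm => ?_
  rw [map_add, map_smul, Pi.add_apply, Pi.smul_apply, h.serG_D, shiftD,
    h.serG_top_brAt hV hX (h.D_mem hV hY) t hl, h.serG_top_brAt hV hX hY t hl, h.serG_D,
    bracket_shiftD (serG_isSeries hV t X) l hl hm, shiftD]
  module

theorem brAt_jacobi (hX : X ∈ G.barPar 𝒱 d a) (hY : Y ∈ G.barPar 𝒱 d b) (hZ : Z ∈ G.barPar 𝒱 d c)
    (x y : F) : brAt h.D h.br x X (brAt h.D h.br y Y Z) - sgn a b • brAt h.D h.br y Y (brAt h.D h.br x X Z) =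
      brAt h.D h.br (x + y) (brAt h.D h.br x X Y) Z := by
  have key : ∀ {a b : ZMod 2} {X Y : G 𝒱 d}, X ∈ G.barPar 𝒱 d a → Y ∈ G.barPar 𝒱 d b → ∀ t : F,
      IsNull (parityShift 𝒱) d ⊤ fun p => serG ⊤ (brAt h.D h.br t X Y) p -
        bracket (t : WithTop F) a (serG (t : WithTop F) X) ⊤ b (serG ⊤ Y) p :=
    fun hX hY t => mem_nullSer.1 (nullSer_top_iff.2 fun l hl =>
      sub_eq_zero.2 (h.serG_top_brAt hV hX hY t hl))
  refine serG_ext fun l hl hm => ?_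
  rw [map_sub, map_zsmul, Pi.sub_apply, Pi.smul_apply,
    h.serG_top_brAt hV hX (h.brAt_mem hV hY hZ y) x hl,
    h.serG_top_brAt hV hY (h.brAt_mem hV hX hZ x) y hl,
    h.serG_top_brAt hV (h.brAt_mem hV hX hY x) hZ (x + y) hl,
    bracket_congr_right (key hY hZ y) (serG_hasPar hV hX x) (serG_isSeries hV x X) l hl (by simp),
    bracket_congr_right (key hX hZ x) (serG_hasPar hV hY y) (serG_isSeries hV y Y) l hl (by simp)]
  have h1 := h.serG_brAt hV hX hY x y
  rw [WithTop.coe_add, bracket_congr_left (mem_nullSer.1 h1) (serG_hasPar hV hZ ⊤)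
    (serG_isSeries hV ⊤ Z) l hl (by simp)]
  have h2 := bracket_jacobi (serG_hasPar hV hX x) (serG_hasPar hV hY y) (serG_hasPar hV hZ ⊤)
    (serG_isSeries hV x X) (serG_isSeries hV y Y) (serG_isSeries hV ⊤ Z) l hl (by simp)
  rw [WithTop.add_top, WithTop.add_top] at h2
  exact h2

theorem brAt_mul (hX : X ∈ G.barPar 𝒱 d a) (hY : Y ∈ G.barPar 𝒱 d (b + 1))
    (hZ : Z ∈ G.barPar 𝒱 d (c + 1)) (t : F) : brAt h.D h.br t X (h.mul Y Z) =
      h.mul (brAt h.D h.br t X Y) Z + sgn a b • h.mul Y (brAt h.D h.br t X Z) := by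
  refine serG_ext fun l hl hm => ?_
  have h1 := h.brAt_mem hV hX hZ t
  rw [← add_assoc] at h1
  rw [map_add, map_zsmul, Pi.add_apply, Pi.smul_apply,
    h.serG_top_brAt hV hX (h.mul_mem hV hY hZ) t hl, h.serG_mul _ hZ hl, h.serG_mul _ h1 hl,
    conv_congr hl (fun l hl => h.serG_top_brAt hV hX hY t hl) fun _ _ => rfl,
    conv_congr (Z := serG ⊤ (brAt h.D h.br t X Z)) hl (fun _ _ => rfl)
      fun l hl => h.serG_top_brAt hV hX hZ t hl,
    bracket_congr_right (Y' := fun q => conv q c (serG ⊤ Y) (serG ⊤ Z))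
      (mem_nullSer.1 (nullSer_top_iff.2 fun l hl => sub_eq_zero.2 (h.serG_mul _ hZ hl)))
      (serG_hasPar hV hX t) (serG_isSeries hV t X) l hl (by simp)]
  exact bracket_conv hV (serG_isSeries hV t X) (serG_isDer hV t X) (serG_hasPar hV hX t)
    (serG_hasPar hV hY ⊤) (serG_hasPar hV hZ ⊤) hl hm

include hV

theorem _root_.UniversalPVA.IsLift.isSeries (hw : IsLift w w') :
    IsSeries (parityShift 𝒱) d ((0 : F) : WithTop F) (serZ d w') :=
  isSeries_ser fun n => (isAs_of_isLift hV hw n).toIsCoch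

theorem _root_.UniversalPVA.IsHomFam.hasPar_serZ (hw : IsHomFam 𝒱 a w') :
    HasPar (parityShift 𝒱) a (serZ d w') := hw.hasPar hV _

theorem serG_act (hw : IsLift w w') (hw' : IsHomFam 𝒱 a w') (hY : Y ∈ G.barPar 𝒱 d b)
    (ν : WithTop F) : serG ν (h.act w Y) - bracket ((0 : F) : WithTop F) a (serZ d w') ν b (serG ν Y) ∈
      NullSer (parityShift 𝒱) d ν := by
  have := ser_actFam_sub hV hw' (mem_barPar_iff.1 hY) (isAs_of_isLift hV hw)
    (fun n => serG_isAs hV Y ν n)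
  rwa [← h.famG_act_of_isLift hV hw Y] at this

theorem serG_top_act (hw : IsLift w w') (hw' : IsHomFam 𝒱 a w') (hY : Y ∈ G.barPar 𝒱 d b)
    {l : List (Arg F V)} (hl : Hom (parityShift 𝒱) l) :
    serG ⊤ (h.act w Y) l = bracket ((0 : F) : WithTop F) a (serZ d w') ⊤ b (serG ⊤ Y) l :=
  sub_eq_zero.1 (nullSer_top_iff.1 (h.serG_act hV hw hw' hY ⊤) l hl)

theorem act_mem (hw : w ∈ W.par 𝒱 d a) (hY : Y ∈ G.barPar 𝒱 d b) :
    h.act w Y ∈ G.barPar 𝒱 d (a + b) := by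
  obtain ⟨w', h1, h2⟩ := exists_homLift hV hw
  exact mem_barPar_of_serG hV ((h2.hasPar_serZ hV).bracket (serG_hasPar hV hY ⊤))
    fun _ hl => h.serG_top_act hV h1 h2 hY hl

theorem act_D (hw : w ∈ W.par 𝒱 d a) (hY : Y ∈ G.barPar 𝒱 d b) : h.act w (h.D Y) = h.D (h.act w Y) := by
  obtain ⟨w', h1, h2⟩ := exists_homLift hV hw
  refine serG_ext fun l hl hm => ?_
  rw [h.serG_top_act hV h1 h2 (h.D_mem hV hY) hl, h.serG_D, h.serG_D, shiftD,
    h.serG_top_act hV h1 h2 hY hl, bracket_shiftD (h1.isSeries hV) l hl hm, shiftD]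

theorem act_mul (hw : w ∈ W.par 𝒱 d a) (hY : Y ∈ G.barPar 𝒱 d (b + 1))
    (hZ : Z ∈ G.barPar 𝒱 d (c + 1)) :
    h.act w (h.mul Y Z) = h.mul (h.act w Y) Z + sgn a b • h.mul Y (h.act w Z) := by
  obtain ⟨w', h1, h2⟩ := exists_homLift hV hw
  refine serG_ext fun l hl hm => ?_
  have h3 := h.act_mem hV hw hZ
  rw [← add_assoc] at h3
  rw [map_add, map_zsmul, Pi.add_apply, Pi.smul_apply,
    h.serG_top_act hV h1 h2 (h.mul_mem hV hY hZ) hl, h.serG_mul _ hZ hl, h.serG_mul _ h3 hl,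
    conv_congr hl (fun l hl => h.serG_top_act hV h1 h2 hY hl) fun _ _ => rfl,
    conv_congr (Z := serG ⊤ (h.act w Z)) hl (fun _ _ => rfl)
      fun l hl => h.serG_top_act hV h1 h2 hZ hl,
    bracket_congr_right (Y' := fun q => conv q c (serG ⊤ Y) (serG ⊤ Z))
      (mem_nullSer.1 (nullSer_top_iff.2 fun l hl => sub_eq_zero.2 (h.serG_mul _ hZ hl)))
      (h2.hasPar_serZ hV) (h1.isSeries hV) l hl (by simp)]
  exact bracket_conv hV (h1.isSeries hV) (isDer_ser hV.d_mul (isAs_of_isLift hV h1))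
    (h2.hasPar_serZ hV) (serG_hasPar hV hY ⊤) (serG_hasPar hV hZ ⊤) hl hm

theorem act_brAt (hw : w ∈ W.par 𝒱 d a) (hY : Y ∈ G.barPar 𝒱 d b) (hZ : Z ∈ G.barPar 𝒱 d c)
    (t : F) : h.act w (brAt h.D h.br t Y Z) =
      brAt h.D h.br t (h.act w Y) Z + sgn a b • brAt h.D h.br t Y (h.act w Z) := by
  obtain ⟨w', h1, h2⟩ := exists_homLift hV hw
  refine serG_ext fun l hl hm => ?_
  have k1 := h.serG_act hV h1 h2 hY t
  have k2 := h.serG_act hV h1 h2 hZ ⊤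
  have k3 := h.serG_brAt hV hY hZ t ⊤
  rw [WithTop.add_top] at k3
  rw [map_add, map_zsmul, Pi.add_apply, Pi.smul_apply,
    h.serG_top_act hV h1 h2 (h.brAt_mem hV hY hZ t) hl,
    h.serG_top_brAt hV (h.act_mem hV hw hY) hZ t hl,
    h.serG_top_brAt hV hY (h.act_mem hV hw hZ) t hl,
    bracket_congr_right (mem_nullSer.1 k3) (h2.hasPar_serZ hV) (h1.isSeries hV) l hl (by simp),
    bracket_congr_right (mem_nullSer.1 k2) (serG_hasPar hV hY t) (serG_isSeries hV t Y) l hl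
      (by simp),
    bracket_congr_left (mem_nullSer.1 k1) (serG_hasPar hV hZ ⊤) (serG_isSeries hV ⊤ Z) l hl
      (by simp)]
  have k4 := bracket_jacobi (h2.hasPar_serZ hV) (serG_hasPar hV hY t) (serG_hasPar hV hZ ⊤)
    (h1.isSeries hV) (serG_isSeries hV t Y) (serG_isSeries hV ⊤ Z) l hl (by simp)
  rw [WithTop.add_top, coe_zero_add, coe_zero_add] at k4
  exact sub_eq_iff_eq_add.1 k4

theorem exists_homLift_lie (hx : IsLift x x') (hx' : IsHomFam 𝒱 a x') (hy : IsLift y y')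
    (hy' : IsHomFam 𝒱 b y') : ∃ z', IsLift (h.lie x y) z' ∧ IsHomFam 𝒱 (a + b) z' ∧
      serZ d z' - bracket ((0 : F) : WithTop F) a (serZ d x') ((0 : F) : WithTop F) b (serZ d y') ∈
        NullSer (parityShift 𝒱) d ((0 : F) : WithTop F) := by
  have h1 := h.isLift_lie hV hx hy
  have h2 := ser_lieFam_sub hV hx' hy' (isAs_of_isLift hV hx) (isAs_of_isLift hV hy)
  have h3 := parProj_sub_mem hV ((hx'.hasPar_serZ hV).bracket (hy'.hasPar_serZ hV)) h2
  have h4 := famQ_eq_iff.2 h3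
  refine ⟨parProj 𝒱 (a + b) (lieFam 𝒱 d x' y'), fun n v => ?_, isHomFam_parProj _ _, ?_⟩
  · rw [← h1 n v]
    exact (congrArg (fun A : ∀ n, CochainQ n d => A n v) h4).symm
  · rw [mem_nullFam_iff 𝒱] at h3
    have h5 : serLin d ((0 : F) : WithTop F)
        (lieFam 𝒱 d x' y' - parProj 𝒱 (a + b) (lieFam 𝒱 d x' y')) =
        serZ d (lieFam 𝒱 d x' y') - serZ d (parProj 𝒱 (a + b) (lieFam 𝒱 d x' y')) :=
      funext fun l => ser_sub _ _ _ l
    rw [h5] at h3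
    exact sub_mem_of_sub_left h2 h3

theorem lie_mem (hx : x ∈ W.par 𝒱 d a) (hy : y ∈ W.par 𝒱 d b) : h.lie x y ∈ W.par 𝒱 d (a + b) := by
  obtain ⟨x', h1, h2⟩ := exists_homLift hV hx
  obtain ⟨y', h3, h4⟩ := exists_homLift hV hy
  obtain ⟨z', h5, h6, -⟩ := h.exists_homLift_lie hV h1 h2 h3 h4
  rw [mem_parW_iff hV h5, h6.parProj]
  exact h5

theorem lie_skew (hx : x ∈ W.par 𝒱 d a) (hy : y ∈ W.par 𝒱 d b) :
    h.lie y x = -(sgn a b • h.lie x y) := by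
  obtain ⟨x', h1, h2⟩ := exists_homLift hV hx
  obtain ⟨y', h3, h4⟩ := exists_homLift hV hy
  rw [← zero_sub]
  refine compW_eq_of_isLift (h.isLift_lie hV h3 h1) fun n v => ?_
  have := IsLift.sub_zsmul (X := (0 : W 𝒱 d)) (X' := 0) (fun _ _ => map_zero _)
    (h.isLift_lie hV h1 h3) (sgn a b) n v
  rw [← this, lieFam_skew h2 h4]
  exact congrArg (toQ d) (zero_sub (sgn a b • lieFam 𝒱 d x' y' n v)).symm

theorem act_lie (hx : x ∈ W.par 𝒱 d a) (hy : y ∈ W.par 𝒱 d b) (hZ : Z ∈ G.barPar 𝒱 d c) :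
    h.act (h.lie x y) Z = h.act x (h.act y Z) - sgn a b • h.act y (h.act x Z) := by
  obtain ⟨x', h1, h2⟩ := exists_homLift hV hx
  obtain ⟨y', h3, h4⟩ := exists_homLift hV hy
  obtain ⟨z', h5, h6, h7⟩ := h.exists_homLift_lie hV h1 h2 h3 h4
  refine serG_ext fun l hl hm => ?_
  rw [map_sub, map_zsmul, Pi.sub_apply, Pi.smul_apply, h.serG_top_act hV h5 h6 hZ hl,
    h.serG_top_act hV h1 h2 (h.act_mem hV hy hZ) hl,
    h.serG_top_act hV h3 h4 (h.act_mem hV hx hZ) hl,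
    bracket_congr_left (mem_nullSer.1 h7) (serG_hasPar hV hZ ⊤) (serG_isSeries hV ⊤ Z) l hl
      (by simp),
    bracket_congr_right (mem_nullSer.1 (h.serG_act hV h3 h4 hZ ⊤)) (h2.hasPar_serZ hV)
      (h1.isSeries hV) l hl (by simp),
    bracket_congr_right (mem_nullSer.1 (h.serG_act hV h1 h2 hZ ⊤)) (h4.hasPar_serZ hV)
      (h3.isSeries hV) l hl (by simp)]
  have k4 := bracket_jacobi (h2.hasPar_serZ hV) (h4.hasPar_serZ hV) (serG_hasPar hV hZ ⊤)
    (h1.isSeries hV) (h3.isSeries hV) (serG_isSeries hV ⊤ Z) l hl (by simp)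
  simp only [coe_zero_add] at k4
  exact k4.symm

theorem exists_lift_lie_lie (hx : IsLift x x') (hx' : IsHomFam 𝒱 a x') (hy : IsLift y y')
    (hy' : IsHomFam 𝒱 b y') (hz : IsLift z z') (hz' : IsHomFam 𝒱 c z') : ∃ t,
    IsLift (h.lie x (h.lie y z)) t ∧ serZ d t - bracket ((0 : F) : WithTop F) a (serZ d x')
    ((0 : F) : WithTop F) (b + c) (bracket ((0 : F) : WithTop F) b (serZ d y')
    ((0 : F) : WithTop F) c (serZ d z')) ∈ NullSer (parityShift 𝒱) d ((0 : F) : WithTop F) := by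
  obtain ⟨p, p1, p2, p3⟩ := h.exists_homLift_lie hV hy hy' hz hz'
  obtain ⟨q, q1, -, q3⟩ := h.exists_homLift_lie hV hx hx' p1 p2
  have e := bracket_sub_mem_right (b := b + c) p3 (hx'.hasPar_serZ hV) (hx.isSeries hV)
  rw [coe_zero_add] at e
  exact ⟨q, q1, (sub_add_sub_cancel (serZ d q) _ _) ▸ add_mem q3 e⟩

theorem exists_lift_lie_lie' (hx : IsLift x x') (hx' : IsHomFam 𝒱 a x') (hy : IsLift y y')
    (hy' : IsHomFam 𝒱 b y') (hz : IsLift z z') (hz' : IsHomFam 𝒱 c z') : ∃ t,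
    IsLift (h.lie (h.lie x y) z) t ∧ serZ d t - bracket ((0 : F) : WithTop F) (a + b)
    (bracket ((0 : F) : WithTop F) a (serZ d x') ((0 : F) : WithTop F) b (serZ d y'))
    ((0 : F) : WithTop F) c (serZ d z') ∈ NullSer (parityShift 𝒱) d ((0 : F) : WithTop F) := by
  obtain ⟨p, p1, p2, p3⟩ := h.exists_homLift_lie hV hx hx' hy hy'
  obtain ⟨q, q1, -, q3⟩ := h.exists_homLift_lie hV p1 p2 hz hz'
  have e := bracket_sub_mem_left (a := a + b) p3 (hz'.hasPar_serZ hV) (hz.isSeries hV)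
  rw [coe_zero_add] at e
  exact ⟨q, q1, (sub_add_sub_cancel (serZ d q) _ _) ▸ add_mem q3 e⟩

set_option maxHeartbeats 1000000
theorem lie_jacobi (hx : x ∈ W.par 𝒱 d a) (hy : y ∈ W.par 𝒱 d b) (hz : z ∈ W.par 𝒱 d c) :
    h.lie x (h.lie y z) - sgn a b • h.lie y (h.lie x z) = h.lie (h.lie x y) z := by
  obtain ⟨x', x1, x2⟩ := exists_homLift hV hx
  obtain ⟨y', y1, y2⟩ := exists_homLift hV hy
  obtain ⟨z', z1, z2⟩ := exists_homLift hV hz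
  obtain ⟨p, p1, p2⟩ := h.exists_lift_lie_lie hV x1 x2 y1 y2 z1 z2
  obtain ⟨q, q1, q2⟩ := h.exists_lift_lie_lie hV y1 y2 x1 x2 z1 z2
  obtain ⟨r, r1, r2⟩ := h.exists_lift_lie_lie' hV x1 x2 y1 y2 z1 z2
  refine eq_of_lift (p1.sub_zsmul q1 _) r1 ?_
  rw [serLin_sub_zsmul]
  have e := mem_nullSer.2 (bracket_jacobi_isNull (x2.hasPar_serZ hV) (y2.hasPar_serZ hV)
    (z2.hasPar_serZ hV) (x1.isSeries hV) (y1.isSeries hV) (z1.isSeries hV))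
  simp only [coe_zero_add] at e
  exact sub_zsmul_sub_mem p2 q2 r2 e

set_option maxHeartbeats 200000

omit hV
theorem isLift_int (X : G 𝒱 d) : IsLift (h.int X) (famG X) := fun n v =>
  (congrArg (fun A : ∀ n, CochainQ n d => A n v) (h.compW_int X)).symm

include hV
theorem int_act (hw : w ∈ W.par 𝒱 d a) (hY : Y ∈ G.barPar 𝒱 d b) :
    h.int (h.act w Y) = h.lie w (h.int Y) := by
  obtain ⟨w', h1, h2⟩ := exists_homLift hV hw
  refine eq_of_lift (h.isLift_int _) (h.isLift_lie hV h1 (h.isLift_int Y)) ?_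
  exact sub_mem_of_sub_right (h.serG_act hV h1 h2 hY ((0 : F) : WithTop F))
    (ser_lieFam_sub hV h2 (mem_barPar_iff.1 hY) (isAs_of_isLift hV h1)
      (isAs_of_isLift hV (h.isLift_int Y)))

theorem int_brAt (hX : X ∈ G.barPar 𝒱 d a) (hY : Y ∈ G.barPar 𝒱 d b) :
    h.int (brAt h.D h.br 0 X Y) = h.lie (h.int X) (h.int Y) := by
  refine eq_of_lift (h.isLift_int _) (h.isLift_lie hV (h.isLift_int X) (h.isLift_int Y)) ?_
  have h1 := h.serG_brAt hV hX hY 0 ((0 : F) : WithTop F)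
  rw [coe_zero_add] at h1
  exact sub_mem_of_sub_right h1
    (ser_lieFam_sub hV (mem_barPar_iff.1 hX) (mem_barPar_iff.1 hY)
      (isAs_of_isLift hV (h.isLift_int X)) (isAs_of_isLift hV (h.isLift_int Y)))

theorem int_mem (hX : X ∈ G.barPar 𝒱 d a) : h.int X ∈ W.par 𝒱 d a := by
  rw [mem_parW_iff hV (h.isLift_int X), (mem_barPar_iff.1 hX).parProj]
  exact h.isLift_int X

omit hV
theorem int_deg {k : ℕ} (hX : X ∈ G.deg 𝒱 d k) : h.int X ∈ W.deg 𝒱 d k := mem_degW_iff.2 fun n hn => by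
  ext v
  exact (h.isLift_int X n v).symm.trans (by rw [mem_degG_iff.1 hX n hn]; exact map_zero _)

theorem _root_.UniversalPVA.parityShift_par : parityShift (G.par 𝒱 d) = G.barPar 𝒱 d :=
  funext fun a => congrArg (G.barPar 𝒱 d) (by rw [add_assoc, CharTwo.add_self_eq_zero, add_zero])

include hV

theorem exists_unit : ∃ e ∈ G.par 𝒱 d 0, ∀ X, h.mul e X = X ∧ h.mul X e = X := by
  obtain ⟨e, he⟩ := exists_famG (𝒱 := 𝒱) hV (isAs_unitFam hV)
    ⟨1, fun n hn => by cases n with | zero => omega | succ n => rfl⟩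
  have he' : e ∈ G.barPar 𝒱 d (0 + 1) := by
    rw [mem_barPar_iff, he, zero_add]; exact isHomFam_unitFam
  have h1 : serG ⊤ e [] = 1 := by rw [serG, LinearMap.comp_apply, he]; exact ser_unitFam_nil
  have h2 : ∀ w l, serG ⊤ e (w :: l) = 0 := fun w l => by
    rw [serG, LinearMap.comp_apply, he]; exact ser_unitFam_cons w l
  refine ⟨e, he', fun X => ⟨?_, ?_⟩⟩
  · refine LinearMap.congr_fun (f := h.mul e) (g := LinearMap.id)
      (linearMap_eq_of_internal (isInternal_par hV) fun a Y hY => serG_ext fun l hl _ => ?_) X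
    rw [h.serG_mul _ hY hl, conv_unit_left _ _ _ _ h2, h1, one_mul]; rfl
  · refine serG_ext fun l hl _ => ?_
    rw [h.serG_mul _ he' hl, conv_unit_right _ _ _ h2, h1, mul_one]

theorem isLieConformalSuperalgebra :
    IsLieConformalSuperalgebra (G.barPar 𝒱 d) h.D h.br := by
  obtain ⟨π, hπ⟩ := exists_projG (𝒱 := 𝒱) hV
  refine isLieConformalSuperalgebra_of_values (isInternal_barPar hV) π (fun a X => ?_)
    (fun a X hX => famG_injective ?_) (h.D_mem hV) (h.brAt_mem hV) (h.brAt_D_left hV)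
    (h.brAt_D_right hV) h.br_skew (h.brAt_jacobi hV)
  · rw [mem_barPar_iff, hπ]; exact isHomFam_parProj _ _
  · rw [hπ, (mem_barPar_iff.1 hX).parProj]

theorem isOddPVA : IsOddPVA (G.par 𝒱 d) h.D h.mul h.br where
  isInternal := isInternal_par hV
  mul_mem hX hY := h.mul_mem hV hX hY
  mul_comm hX hY := (h.mul_comm hV hX hY).trans (sgn_smul _ _ _).symm
  mul_assoc X Y Z := bilin_eq_of_internal (isInternal_par hV) (isInternal_par hV)
    (f := h.mul.comp (h.mul X)) (g := h.mul.compr₂ (h.mul X))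
    (fun b c Y hY Z hZ => h.mul_assoc hV hY hZ) Y Z
  unital := h.exists_unit hV
  D_mem hX := h.D_mem hV hX
  D_mul X Y := LinearMap.congr_fun (f := h.D ∘ₗ h.mul X) (g := h.mul (h.D X) + h.mul X ∘ₗ h.D)
    (linearMap_eq_of_internal (isInternal_par hV) fun c Y hY => h.D_mul hV hY) Y
  lieConformal := by rw [parityShift_par]; exact h.isLieConformalSuperalgebra hV
  leibniz {α β X Y} hX hY Z := ext_evP (D := h.D) fun t => by
    simp only [sgn_smul, map_add, map_zsmul, evP_extend_C (d := h.D), LinearMap.comp_apply,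
      TensorProduct.mk_apply, evP_tmul, map_one, Module.End.one_apply, LinearMap.flip_apply]
    exact LinearMap.congr_fun (f := brAt h.D h.br t X ∘ₗ h.mul Y)
      (g := h.mul (brAt h.D h.br t X Y) + sgn (α + 1) β • (h.mul Y ∘ₗ brAt h.D h.br t X))
      (linearMap_eq_of_internal (isInternal_par hV) fun c Z hZ => h.brAt_mul hV hX hY hZ t) Z

theorem isZPlusGraded : IsZPlusGraded (G.par 𝒱 d) (G.deg 𝒱 d) h.D h.mul h.br where
  isInternal := isInternal_deg
  isInternal_par := isInternal_deg_par hV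
  D_mem {k X} hX := mem_degG_iff.2 fun n hn => by
    rw [h.famG_D]; ext v; rw [transFam_apply, mem_degG_iff.1 hX n hn]; exact map_zero _
  mul_mem {k l X Y} hX hY := mem_degG_iff.2 fun n hn => by
    rw [h.famG_mul]
    refine mulFam_eq_zero fun i j hij => ?_
    by_cases hi : i = k
    · exact .inr (mem_degG_iff.1 hY _ (by omega))
    · exact .inl (mem_degG_iff.1 hX _ hi)
  br_mem {k l n X Y} hn hX hY := mem_range_lTensor fun r => mem_degG_iff.2 fun m hm => by
    rw [h.famG_br]
    refine brCoeff_eq_zero r fun i j hij => ?_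
    by_cases hi : i = k
    · exact .inr (mem_degG_iff.1 hY _ (by omega))
    · exact .inl (mem_degG_iff.1 hX _ hi)
  br_zero {X Y} hX hY := eq_zero_of_polyCoeff fun r => famG_injective <| by
    rw [h.famG_br, map_zero]
    funext n
    refine brCoeff_eq_zero r fun i j hij => ?_
    by_cases hi : i = 0
    · exact .inr (mem_degG_iff.1 hY _ (by omega))
    · exact .inl (mem_degG_iff.1 hX _ hi)

omit hV in
theorem act_deg {k l m : ℕ} (hx : x ∈ W.deg 𝒱 d k) (hY : Y ∈ G.deg 𝒱 d l) (hm : m + 1 ≠ k + l) :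
    famG (h.act x Y) m = 0 := by
  rw [h.famG_act]
  refine actFam_eq_zero fun i j hij => ?_
  by_cases hi : i = k
  · exact .inr (mem_degG_iff.1 hY _ (by omega))
  · exact .inl (repW_eq_zero (mem_degW_iff.1 hx _ hi))

theorem isLieSuperalgebra : IsLieSuperalgebra (W.par 𝒱 d) h.lie where
  isInternal := isInternal_parW hV
  mem := h.lie_mem hV
  skew hx hy := by rw [sgn_smul]; exact h.lie_skew hV hx hy
  jacobi hx hy hz := by rw [sgn_smul]; exact h.lie_jacobi hV hx hy hz

omit hV

theorem int_D (X : G 𝒱 d) : h.int (h.D X) = 0 := by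
  refine compW_injective ?_
  rw [h.compW_int, h.famG_D, map_zero]
  funext n
  ext v
  exact (Submodule.Quotient.mk_eq_zero _).2 ⟨_, rfl⟩

include hV

theorem exists_D_eq (hX : h.int X = 0) : ∃ Y, h.D Y = X := by
  choose s hs using exists_totalD_section d
  have h1 : ∀ n v, totalD d (s n (famG X n v)) = famG X n v := fun n v =>
    hs n _ ((h.isLift_int X n v).trans (by rw [hX]; rfl))
  obtain ⟨Y, hY⟩ := exists_famG (𝒱 := 𝒱) (Z := fun n => (s n).compMultilinearMap (famG X n)) hV
    (fun n => by
      cases n with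
      | zero => exact isAs_zero _
      | succ n => exact isAs_of_totalD hV (famG_isAs hV X _) (h1 _))
    (by
      obtain ⟨N, hN⟩ := exists_famG_eq_zero X
      exact ⟨N, fun n hn => by ext v; simp [hN n hn]⟩)
  refine ⟨Y, famG_injective ?_⟩
  rw [h.famG_D, hY]
  funext n
  ext v
  exact h1 n v

theorem act_D' (x : W 𝒱 d) (Y : G 𝒱 d) : h.act x (h.D Y) = h.D (h.act x Y) :=
  (bilin_map_eq_of_internal (isInternal_parW hV) (isInternal_barPar hV) (u := LinearMap.id)
    (fun a b x hx Y hY => (h.act_D hV hx hY).symm) x Y).symm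

theorem int_act' (x : W 𝒱 d) (Y : G 𝒱 d) : h.int (h.act x Y) = h.lie x (h.int Y) :=
  bilin_map_eq_of_internal (isInternal_parW hV) (isInternal_barPar hV) (u := LinearMap.id)
    (fun a b x hx Y hY => h.int_act hV hx hY) x Y

theorem int_brAt' (X Y : G 𝒱 d) : h.int (brAt h.D h.br 0 X Y) = h.lie (h.int X) (h.int Y) :=
  bilin_map_eq_of_internal (isInternal_barPar hV) (isInternal_barPar hV)
    (fun a b X hX Y hY => h.int_brAt hV hX hY) X Y

theorem brAt_D_left' (X Y : G 𝒱 d) : brAt h.D h.br 0 (h.D X) Y = 0 :=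
  bilin_eq_of_internal (isInternal_barPar hV) (isInternal_barPar hV)
    (f := brAt h.D h.br 0 ∘ₗ h.D) (g := 0)
    (fun a b X hX Y hY => (h.brAt_D_left hV hX hY 0).trans (by rw [zero_smul, neg_zero]; rfl)) X Y

theorem brAt_D_right' (X Y : G 𝒱 d) : brAt h.D h.br 0 X (h.D Y) = h.D (brAt h.D h.br 0 X Y) :=
  bilin_eq_of_internal (isInternal_barPar hV) (isInternal_barPar hV)
    (f := (brAt h.D h.br 0).compl₂ h.D) (g := (brAt h.D h.br 0).compr₂ h.D)
    (fun a b X hX Y hY => (h.brAt_D_right hV hX hY 0).trans (by rw [zero_smul, zero_add]; rfl)) X Y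

theorem act_mul' (hx : x ∈ W.par 𝒱 d a) (hY : Y ∈ G.par 𝒱 d b) (Z : G 𝒱 d) : h.act x (h.mul Y Z) =
    h.mul (h.act x Y) Z + sgn a b • h.mul Y (h.act x Z) :=
  LinearMap.congr_fun (f := h.act x ∘ₗ h.mul Y)
    (g := h.mul (h.act x Y) + sgn a b • (h.mul Y ∘ₗ h.act x))
    (linearMap_eq_of_internal (isInternal_par hV) fun c Z hZ => h.act_mul hV hx hY hZ) Z

theorem act_lie' (hx : x ∈ W.par 𝒱 d a) (hy : y ∈ W.par 𝒱 d b) (Z : G 𝒱 d) : h.act (h.lie x y) Z =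
    h.act x (h.act y Z) - sgn a b • h.act y (h.act x Z) :=
  LinearMap.congr_fun (f := h.act (h.lie x y))
    (g := h.act x ∘ₗ h.act y - sgn a b • (h.act y ∘ₗ h.act x))
    (linearMap_eq_of_internal (isInternal_barPar hV) fun c Z hZ => h.act_lie hV hx hy hZ) Z

theorem act_br (hx : x ∈ W.par 𝒱 d a) (hY : Y ∈ G.barPar 𝒱 d b) (Z : G 𝒱 d) :
    (h.act x).lTensor (MvPolynomial (Fin 1) F) (h.br Y Z) = h.br (h.act x Y) Z +
    sgn a b • h.br Y (h.act x Z) := ext_evP (D := h.D) fun t => by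
  rw [map_add, map_zsmul]
  exact (evP_lTensor (d := h.D) (h.act x) (fun _ => t) _).trans
    (LinearMap.congr_fun (f := h.act x ∘ₗ brAt h.D h.br t Y)
      (g := brAt h.D h.br t (h.act x Y) + sgn a b • (brAt h.D h.br t Y ∘ₗ h.act x))
      (linearMap_eq_of_internal (isInternal_barPar hV) fun c Z hZ => h.act_brAt hV hx hY hZ t) Z)

omit hV in
theorem act_mem_deg {k l n : ℕ} (hn : k + l = n + 1) (hx : x ∈ W.deg 𝒱 d k) (hY : Y ∈ G.deg 𝒱 d l) :
    h.act x Y ∈ G.deg 𝒱 d n :=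
  mem_degG_iff.2 fun m hm => h.act_deg hx hY (by omega)

omit hV in
theorem act_eq_zero (hx : x ∈ W.deg 𝒱 d 0) (hY : Y ∈ G.deg 𝒱 d 0) : h.act x Y = 0 :=
  famG_injective (funext fun m => h.act_deg hx hY (by omega))

theorem isLieSuperalgebra_quotient
    {f : (G 𝒱 d ⧸ LinearMap.range h.D) →ₗ[F] (G 𝒱 d ⧸ LinearMap.range h.D) →ₗ[F]
      (G 𝒱 d ⧸ LinearMap.range h.D)}
    (hf : ∀ X Y : G 𝒱 d, f (Submodule.Quotient.mk X) (Submodule.Quotient.mk Y) =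
      Submodule.Quotient.mk (brAt h.D h.br 0 X Y)) :
    IsLieSuperalgebra (fun α => (G.barPar 𝒱 d α).map (LinearMap.range h.D).mkQ) f where
  isInternal := by
    obtain ⟨π, hπ⟩ := exists_projG (𝒱 := 𝒱) hV
    have h2 : ∀ a X, X ∈ G.barPar 𝒱 d a → π a X = X := fun a X hX => famG_injective (by
      rw [hπ, (mem_barPar_iff.1 hX).parProj])
    have h3 : ∀ a b X, X ∈ G.barPar 𝒱 d a → b ≠ a → π b X = 0 := fun a b X hX hb =>
      famG_injective (by rw [hπ, (mem_barPar_iff.1 hX).parProj_of_ne hb, map_zero])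
    have h5 : ∀ a, π a ∘ₗ h.D = h.D ∘ₗ π a := fun a =>
      linearMap_eq_of_internal (isInternal_barPar hV) fun b X hX => by
        rw [LinearMap.comp_apply, LinearMap.comp_apply]
        by_cases hb : a = b
        · subst hb; rw [h2 _ _ hX, h2 _ _ (h.D_mem hV hX)]
        · rw [h3 _ _ _ hX hb, h3 _ _ _ (h.D_mem hV hX) hb, map_zero]
    refine isInternal_quotient π (fun a X => ?_) h2 h3 (fun X => famG_injective ?_) ?_
    · rw [mem_barPar_iff, hπ]; exact isHomFam_parProj _ _
    · rw [map_sum, Finset.sum_congr rfl fun a _ => hπ a X]; exact sum_parProj _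
    · rintro a _ ⟨X, rfl⟩
      exact ⟨π a X, (LinearMap.congr_fun (h5 a) X).symm⟩
  mem := by
    rintro a b _ _ ⟨X, hX, rfl⟩ ⟨Y, hY, rfl⟩
    exact ⟨_, h.brAt_mem hV hX hY 0, (hf X Y).symm⟩
  skew := by
    rintro a b _ _ ⟨X, hX, rfl⟩ ⟨Y, hY, rfl⟩
    rw [sgn_smul]
    refine (hf Y X).trans (.trans ?_ (congrArg (fun z => -(sgn a b • z)) (hf X Y).symm))
    change (LinearMap.range h.D).mkQ _ = -(sgn a b • (LinearMap.range h.D).mkQ _)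
    rw [← map_zsmul, ← map_neg]
    refine (Submodule.Quotient.eq _).2 ?_
    have h1 : brAt h.D h.br 0 Y X = -(sgn a b • evP h.D
        (fun _ => -Polynomial.C 0 - Polynomial.X) (h.br X Y)) := by
      rw [brAt, LinearMap.compr₂_apply, h.br_skew hX hY, sgn_smul, map_neg, map_zsmul, evP_subst]
      simp only [map_sub, map_neg, bindP_lam, bindP_del]
    obtain ⟨u, hu⟩ := evP_sub_eq (d := h.D) (τ := fun _ : Fin 1 => Polynomial.C (0 : F))
      (τ' := fun _ => -Polynomial.C 0 - Polynomial.X) (q := Polynomial.X)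
      (fun _ => Ideal.mem_span_singleton.2 ⟨1, by simp⟩) (h.br X Y)
    rw [Polynomial.aeval_X] at hu
    refine ⟨sgn a b • u, ?_⟩
    rw [map_zsmul, ← hu, h1, smul_sub]
    exact (neg_sub_neg _ _).symm
  jacobi := by
    rintro a b c _ _ _ ⟨X, hX, rfl⟩ ⟨Y, hY, rfl⟩ ⟨Z, hZ, rfl⟩
    have := congrArg (LinearMap.range h.D).mkQ (h.brAt_jacobi hV hX hY hZ 0 0)
    rw [map_sub, map_zsmul, zero_add] at this
    simp only [sgn_smul, Submodule.mkQ_apply, hf] at this ⊢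
    exact this

theorem exists_quotient :
    ∃ (f : (G 𝒱 d ⧸ LinearMap.range h.D) →ₗ[F] (G 𝒱 d ⧸ LinearMap.range h.D) →ₗ[F]
          (G 𝒱 d ⧸ LinearMap.range h.D))
        (g : (G 𝒱 d ⧸ LinearMap.range h.D) →ₗ[F] W 𝒱 d),
      (∀ X Y : G 𝒱 d, f (Submodule.Quotient.mk X) (Submodule.Quotient.mk Y) =
        Submodule.Quotient.mk (atZero (h.br X Y))) ∧
      IsLieSuperalgebra (fun α => (G.barPar 𝒱 d α).map (LinearMap.range h.D).mkQ) f ∧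
      (∀ X : G 𝒱 d, g (Submodule.Quotient.mk X) = h.int X) ∧
      (∀ x y, g (f x y) = h.lie (g x) (g y)) ∧ Function.Injective g := by
  obtain ⟨f, hf⟩ := exists_bilin_quotient (I := LinearMap.range h.D) (brAt h.D h.br 0)
    (by
      rintro _ ⟨X, rfl⟩ Y
      rw [h.brAt_D_left' hV]; exact zero_mem _)
    (by
      rintro X _ ⟨Y, rfl⟩
      exact ⟨_, (h.brAt_D_right' hV X Y).symm⟩)
  have hg : LinearMap.range h.D ≤ LinearMap.ker h.int := by
    rintro _ ⟨X, rfl⟩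
    exact h.int_D X
  refine ⟨f, (LinearMap.range h.D).liftQ h.int hg, fun X Y => ?_, h.isLieSuperalgebra_quotient hV hf,
    fun X => rfl, fun x y => ?_, ?_⟩
  · rw [hf, atZero_eq (D := h.D)]; rfl
  · obtain ⟨X, rfl⟩ := (LinearMap.range h.D).mkQ_surjective x
    obtain ⟨Y, rfl⟩ := (LinearMap.range h.D).mkQ_surjective y
    exact (congrArg _ (hf X Y)).trans (h.int_brAt' hV X Y)
  · refine (injective_iff_map_eq_zero _).2 fun x hx => ?_
    obtain ⟨X, rfl⟩ := (LinearMap.range h.D).mkQ_surjective x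
    exact (Submodule.Quotient.mk_eq_zero _).2 (h.exists_D_eq hV hx)

end Operations

end Operations

end UniversalPVA

open UniversalPVA in
theorem mainTheorem9 {F : Type*} [Field F] [CharZero F] {V : Type*} [Ring V] [Algebra F V]
    (𝒱 : ZMod 2 → Submodule F V) [GradedAlgebra 𝒱] (d : V →ₗ[F] V)
    (hV : IsDifferentialSuperalgebra 𝒱 d) (hfg : IsFinitelyGenerated d) :
    -- the operations are well defined by their formulas
    ∃ (D : G 𝒱 d →ₗ[F] G 𝒱 d)
      (mul : G 𝒱 d →ₗ[F] G 𝒱 d →ₗ[F] G 𝒱 d)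
      (br : G 𝒱 d →ₗ[F] G 𝒱 d →ₗ[F] Pol (Fin 1) F (G 𝒱 d))
      (lie : W 𝒱 d →ₗ[F] W 𝒱 d →ₗ[F] W 𝒱 d)
      (act : W 𝒱 d →ₗ[F] G 𝒱 d →ₗ[F] G 𝒱 d)
      (int : G 𝒱 d →ₗ[F] W 𝒱 d),
      IsTranslation D ∧ IsConcatenation mul ∧ IsLambdaBracket br ∧
      IsLieBracket lie ∧ IsAction act ∧ IsIntegral int ∧
      -- (a)
      IsOddPVA (G.par 𝒱 d) D mul br ∧
      IsZPlusGraded (G.par 𝒱 d) (G.deg 𝒱 d) D mul br ∧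
      -- (b)
      IsLieSuperalgebra (W.par 𝒱 d) lie ∧
      (∀ (a b : ZMod 2) (X : W 𝒱 d) (Y : G 𝒱 d), X ∈ W.par 𝒱 d a → Y ∈ G.barPar 𝒱 d b →
        act X Y ∈ G.barPar 𝒱 d (a + b)) ∧
      (∀ (k l n : ℕ) (X : W 𝒱 d) (Y : G 𝒱 d), k + l = n + 1 → X ∈ W.deg 𝒱 d k →
        Y ∈ G.deg 𝒱 d l → act X Y ∈ G.deg 𝒱 d n) ∧
      (∀ (X : W 𝒱 d) (Y : G 𝒱 d), X ∈ W.deg 𝒱 d 0 → Y ∈ G.deg 𝒱 d 0 → act X Y = 0) ∧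
      (∀ (a b : ZMod 2) (X Y : W 𝒱 d), X ∈ W.par 𝒱 d a → Y ∈ W.par 𝒱 d b → ∀ Z : G 𝒱 d,
        act (lie X Y) Z = act X (act Y Z) - (-1 : ℤˣ) ^ (a * b) • act Y (act X Z)) ∧
      (∀ (X : W 𝒱 d) (Y : G 𝒱 d), act X (D Y) = D (act X Y)) ∧
      (∀ (a b : ZMod 2) (X : W 𝒱 d) (Y : G 𝒱 d), X ∈ W.par 𝒱 d a → Y ∈ G.par 𝒱 d b →
        ∀ Z : G 𝒱 d,
          act X (mul Y Z) = mul (act X Y) Z + (-1 : ℤˣ) ^ (a * b) • mul Y (act X Z)) ∧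
      (∀ (a b : ZMod 2) (X : W 𝒱 d) (Y : G 𝒱 d), X ∈ W.par 𝒱 d a → Y ∈ G.barPar 𝒱 d b →
        ∀ Z : G 𝒱 d,
          (act X).lTensor (MvPolynomial (Fin 1) F) (br Y Z) =
            br (act X Y) Z + (-1 : ℤˣ) ^ (a * b) • br Y (act X Z)) ∧
      -- (c)
      (∀ (a : ZMod 2) (Y : G 𝒱 d), Y ∈ G.barPar 𝒱 d a → int Y ∈ W.par 𝒱 d a) ∧
      (∀ (k : ℕ) (Y : G 𝒱 d), Y ∈ G.deg 𝒱 d k → int Y ∈ W.deg 𝒱 d k) ∧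
      (∀ (X : W 𝒱 d) (Y : G 𝒱 d), int (act X Y) = lie X (int Y)) ∧
      ∃ (lieQ : (G 𝒱 d ⧸ LinearMap.range D) →ₗ[F] (G 𝒱 d ⧸ LinearMap.range D) →ₗ[F]
            (G 𝒱 d ⧸ LinearMap.range D))
          (intQ : (G 𝒱 d ⧸ LinearMap.range D) →ₗ[F] W 𝒱 d),
        (∀ X Y : G 𝒱 d, lieQ (Submodule.Quotient.mk X) (Submodule.Quotient.mk Y) =
          Submodule.Quotient.mk (atZero (br X Y))) ∧
        IsLieSuperalgebra (fun α => (G.barPar 𝒱 d α).map (LinearMap.range D).mkQ) lieQ ∧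
        (∀ X : G 𝒱 d, intQ (Submodule.Quotient.mk X) = int X) ∧
        (∀ x y, intQ (lieQ x y) = lie (intQ x) (intQ y)) ∧
        Function.Injective intQ := by
  obtain ⟨h⟩ := exists_operations hV hfg
  refine ⟨h.D, h.mul, h.br, h.lie, h.act, h.int, h.isTranslation, h.isConcatenation,
    h.isLambdaBracket, h.isLieBracket hV, h.isAction hV, h.isIntegral, h.isOddPVA hV,
    h.isZPlusGraded hV, h.isLieSuperalgebra hV, fun a b X Y hX hY => h.act_mem hV hX hY,
    fun k l n X Y hn hX hY => h.act_mem_deg hn hX hY, fun X Y hX hY => h.act_eq_zero hX hY,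
    fun a b X Y hX hY Z => ?_, h.act_D' hV, fun a b X Y hX hY Z => ?_, fun a b X Y hX hY Z => ?_,
    fun a Y hY => h.int_mem hV hY, fun k Y hY => h.int_deg hY, h.int_act' hV, h.exists_quotient hV⟩
  · rw [sgn_smul]; exact h.act_lie' hV hX hY Z
  · rw [sgn_smul]; exact h.act_mul' hV hX hY Z
  · rw [sgn_smul]; exact h.act_br hV hX hY Z
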